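/- **Setting.** Let $n\ge 0$ and let $\Phi_0$ be a strictly plurisubharmonic real quadratic form on $\mathbb C^n$. For a real $C^1$ function $\Phi$ put $\xi_\Phi(x)=\frac2i\frac{\partial\Phi}{\partial x}(x)$ and $\Lambda_{\Phi}=\{(x,\xi_\Phi(x)):x\in\mathbb C^n\}\subset\mathbb C^{2n}$, and for $0<h\le1$ let $H_\Phi=\mathrm{Hol}(\mathbb C^n)\cap L^2(\mathbb C^n,e^{-2\Phi/h}L(dx))$, where $L(dx)$ is Lebesgue measure; $(\cdot,\cdot)_{H_\Phi}$ and $\|\cdot\|_{H_\Phi}$ denote the scalar product (linear in the first argument) and the norm of $L^2(\mathbb C^n,e^{-2\Phi/h}L(dx))$. For $s>1$, $\mathcal G^s_b(\mathbb R^d)$ is the set of complex-valued $u\in C^\infty(\mathbb R^d)$ such that for some $C>0$, $|\partial^\alpha u(x)|\le C^{1+|\alpha|}\alpha!^s$ for all $\alpha\in\mathbb N^d$, $x\in\mathbb R^d$. We write $\mathcal G^s_b(\mathbb C^{m})=\mathcal G^s_b(\mathbb R^{2m})$, and $\mathcal G^s_b(\Lambda_{\Phi_0})$ is defined by identifying $\Lambda_{\Phi_0}$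 with $\mathbb C^n$ through $(x,\xi)\mapsto x$. For $a\in\mathcal G^s_b(\Lambda_{\Phi_0})$, $a^w=a^w(x,hD_x)$ denotes the bounded linear operator on $H_{\Phi_0}$ that is given by $$a^wu(x)=\frac1{(2\pi h)^n}\iint_{\Gamma(x)}e^{\frac ih(x-y)\cdot\theta}\,a\Big(\frac{x+y}2,\theta\Big)u(y)\,dy\wedge d\theta,\qquad \Gamma(x):\ \theta=\xi_{\Phi_0}\Big(\frac{x+y}2\Big),\ y\in\mathbb C^n,$$ for all $u\in\mathrm{Hol}(\mathbb C^n)$ with $u=\mathcal O_{h,N}(1)\langle x\rangle^{-N}e^{\Phi_0/h}$ for every $N$. The contour is oriented so that $dy\wedge d\theta$ is a positive multiple of Lebesgue measure in $y$. An almost holomorphic extension of $a$ is a function $\widetilde a\in\mathcal G^s_b(\mathbb C^{2n})$ with $\widetilde a=a$ on $\Lambda_{\Phi_0}$, such that $\bar\partial\widetilde a$ vanishes to infinite order on $\Lambda_{\Phi_0}$, that is, $|\bar\partial\widetilde a(\rho)|\le C_N\,\mathrm{dist}(\rho,\Lambda_{\Phi_0})^N$ for all $\rho\in\mathbb C^{2n}$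 and $N\in\mathbb N$, and such that $\mathrm{supp}\,\widetilde a\subset\Lambda_{\Phi_0}+B_{\mathbb C^{2n}}(0,C_0)$ for some $C_0>0$. **Proposition.** Let $s>1$ and $a\in\mathcal G^s_b(\Lambda_{\Phi_0})$. For every $h\in(0,1]$ the operator $a^w$ on $H_{\Phi_0}$ exists and is unique. Moreover, there is a constant $C>0$, depending only on $n,\Phi_0,s,a$, such that for every almost holomorphic extension $\widetilde a$ of $a$ there is a constant $K>0$, depending only on $n,\Phi_0,s,a,\widetilde a$, for which the following holds. Let $h\in(0,1]$ and let $\Phi_1\in C^{1,1}(\mathbb C^n;\mathbb R)$ (possibly depending on $h$) satisfy $$\|\nabla^k(\Phi_1-\Phi_0)\|_{L^\infty(\mathbb C^n)}\le C^{-1}h^{1-\frac1s},\qquad k=0,1,2 .$$ Then $H_{\Phi_1}=H_{\Phi_0}$ as linear spaces, and for all $\psi\in W^{1,\infty}(\mathbb C^n)$ and all $u,v\in H_{\Phi_1}$, $$\Big|(\psi\,a^wu,v)_{H_{\Phi_1}}-\int_{\mathbb C^n}\psi(x)\,\widetilde a(x,\xi_{\Phi_1}(x))\,u(x)\overline{v(x)}\,e^{-2\Phi_1(x)/h}\,L(dx)\Big|\le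 K\,h\,\big(\|\psi\|_{L^\infty}+\|\nabla\psi\|_{L^\infty}\big)\,\|u\|_{H_{\Phi_1}}\|v\|_{H_{\Phi_1}} .$$ -/

import Mathlib

open MeasureTheory
open scoped ContDiff

noncomputable section

/-- The space `ℂⁿ`, with its Lebesgue measure `volume`. It carries the maximum norm; every norm
bound below is up to a constant, so the choice of the norm does not matter. -/
abbrev Cn (n : ℕ) : Type := Fin n → ℂ

/-- `∂f/∂x_j = (1/2) (∂_{Re x_j} - i ∂_{Im x_j}) f`. -/
def wirtinger {n : ℕ} (j : Fin n) (f : Cn n → ℂ) (x : Cn n) : ℂ :=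
  (1 / 2) * (fderiv ℝ f x (Pi.single j 1) - Complex.I * fderiv ℝ f x (Pi.single j Complex.I))

/-- `∂f/∂x̄_j = (1/2) (∂_{Re x_j} + i ∂_{Im x_j}) f`. -/
def wirtingerBar {n : ℕ} (j : Fin n) (f : Cn n → ℂ) (x : Cn n) : ℂ :=
  (1 / 2) * (fderiv ℝ f x (Pi.single j 1) + Complex.I * fderiv ℝ f x (Pi.single j Complex.I))

/-- The complex Hessian `(∂²Φ / ∂x_j ∂x̄_k)_{j,k}` of a real function. -/
def leviMatrix {n : ℕ} (Φ : Cn n → ℝ) (x : Cn n) : Matrix (Fin n) (Fin n) ℂ :=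
  Matrix.of fun j k => wirtinger j (wirtingerBar k fun z => (Φ z : ℂ)) x

open scoped ComplexOrder in
/-- Strict plurisubharmonicity of a (twice differentiable) function. -/
def StrictlyPlurisubharmonic {n : ℕ} (Φ : Cn n → ℝ) : Prop :=
  ∀ x, (leviMatrix Φ x).PosDef

/-- `ξ_Φ(x) = (2/i) ∂Φ/∂x (x)`. -/
def xi {n : ℕ} (Φ : Cn n → ℝ) (x : Cn n) : Cn n :=
  fun j => (2 / Complex.I) * wirtinger j (fun z => (Φ z : ℂ)) x

/-- `Λ_Φ = {(x, (2/i) ∂Φ/∂x (x)) : x ∈ ℂⁿ} ⊆ ℂ²ⁿ`. -/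
def Lambda {n : ℕ} (Φ : Cn n → ℝ) : Set (Cn n × Cn n) :=
  Set.range fun x => (x, xi Φ x)

/-- The point of `Λ_Φ` over `x`: the inverse of the projection `Λ_Φ → ℂⁿ`. -/
def toLambda {n : ℕ} (Φ : Cn n → ℝ) (x : Cn n) : Lambda Φ :=
  ⟨(x, xi Φ x), x, rfl⟩

/-- The bounded Gevrey class of order `s` on a real vector space: smooth functions all of whose
derivatives of order `k` are bounded by `C ^ (1 + k) * k! ^ s`. Since `α! ≤ k! ≤ d ^ k * α!` for a
multi-index `α` of length `k` in `d` variables, this is the class given by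
`|∂^α u| ≤ C ^ (1 + |α|) * α! ^ s` for all multi-indices `α`. -/
def GevreyBounded {V : Type*} [NormedAddCommGroup V] [NormedSpace ℝ V] (s : ℝ) (u : V → ℂ) :
    Prop :=
  ContDiff ℝ ∞ u ∧
    ∃ C : ℝ, 0 < C ∧ ∀ (k : ℕ) (x : V), ‖iteratedFDeriv ℝ k u x‖ ≤ C ^ (1 + k) * (Nat.factorial k : ℝ) ^ s

/-- The class of bounded Gevrey functions on `Λ_Φ`, which is identified with `ℂⁿ ≅ ℝ²ⁿ` by the
projection `(x, ξ) ↦ x`. -/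
def GevreyBoundedOnLambda {n : ℕ} (s : ℝ) {Φ : Cn n → ℝ} (a : Lambda Φ → ℂ) : Prop :=
  GevreyBounded s fun x => a (toLambda Φ x)

/-- The `(0,1)`-form `∂̄f` at `ρ`, evaluated on the vector `w`: the antilinear part of `df`. -/
def dbar {V : Type*} [NormedAddCommGroup V] [NormedSpace ℂ V] (f : V → ℂ) (ρ w : V) : ℂ :=
  (1 / 2) * (fderiv ℝ f ρ w + Complex.I * fderiv ℝ f ρ (Complex.I • w))

/-- `aT` is an almost holomorphic extension, in the bounded Gevrey class of order `s` on `ℂ²ⁿ`, of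
the function `a` on `Λ_Φ`: it equals `a` on `Λ_Φ`, and `∂̄aT` vanishes to infinite order on `Λ_Φ`.
It is supported in a tubular neighbourhood `Λ_Φ + B(0, C₀)`. -/
structure IsAlmostHolomorphicExtension {n : ℕ} (s : ℝ) {Φ : Cn n → ℝ} (a : Lambda Φ → ℂ)
    (aT : Cn n × Cn n → ℂ) : Prop where
  gevrey : GevreyBounded s aT
  extends_symbol : ∀ ρ : Lambda Φ, aT ρ = a ρ
  dbar_flat : ∀ N : ℕ, ∃ C : ℝ, ∀ ρ w : Cn n × Cn n,
    ‖dbar aT ρ w‖ ≤ C * Metric.infDist ρ (Lambda Φ) ^ N * ‖w‖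
  support_tube : ∃ C₀ : ℝ, 0 < C₀ ∧ tsupport aT ⊆ Metric.thickening C₀ (Lambda Φ)

/-- `H_Φ(ℂⁿ) = Hol(ℂⁿ) ∩ L²(ℂⁿ, e^{-2Φ/h} L(dx))`. -/
def bargmannSpace {n : ℕ} (Φ : Cn n → ℝ) (h : ℝ) : Submodule ℂ (Cn n → ℂ) where
  carrier := {u | Differentiable ℂ u ∧
    MemLp (fun x => (Real.exp (-Φ x / h) : ℂ) * u x) 2 volume}
  zero_mem' := by
    refine ⟨differentiable_const 0, ?_⟩
    simp
  add_mem' := by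
    rintro u v ⟨hu, hu'⟩ ⟨hv, hv'⟩
    refine ⟨hu.add hv, ?_⟩
    have := hu'.add hv'
    refine this.congr_norm (this.aestronglyMeasurable.congr ?_) ?_ <;>
      exact Filter.Eventually.of_forall fun x => by simp [mul_add]
  smul_mem' := by
    rintro c u ⟨hu, hu'⟩
    refine ⟨hu.const_smul c, ?_⟩
    have := hu'.const_mul c
    refine this.congr_norm (this.aestronglyMeasurable.congr ?_) ?_ <;>
      exact Filter.Eventually.of_forall fun x => by simp [mul_left_comm]

/-- The scalar product `∫ f ḡ e^{-2Φ/h} L(dx)` of `L²(ℂⁿ, e^{-2Φ/h} L(dx))`. -/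
def weightedInner {n : ℕ} (Φ : Cn n → ℝ) (h : ℝ) (f g : Cn n → ℂ) : ℂ :=
  ∫ x, f x * starRingEnd ℂ (g x) * (Real.exp (-2 * Φ x / h) : ℂ)

/-- The norm of `L²(ℂⁿ, e^{-2Φ/h} L(dx))`. -/
def weightedNorm {n : ℕ} (Φ : Cn n → ℝ) (h : ℝ) (f : Cn n → ℂ) : ℝ :=
  Real.sqrt (∫ x, ‖f x‖ ^ 2 * Real.exp (-2 * Φ x / h))

/-- `u = O_{h,N}(1) ⟨x⟩^{-N} e^{Φ/h}` for all `N`. -/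
def RapidlyDecaying {n : ℕ} (Φ : Cn n → ℝ) (h : ℝ) (u : Cn n → ℂ) : Prop :=
  ∀ N : ℕ, ∃ C : ℝ, ∀ x, (1 + ‖x‖) ^ N * ‖u x‖ ≤ C * Real.exp (Φ x / h)

/-- The Weyl quantization
`(2πh)^{-n} ∬_{Γ(x)} e^{i(x-y)·θ/h} a((x+y)/2, θ) u(y) dy ∧ dθ`,
where `Γ(x)` is the contour `θ = (2/i) ∂Φ/∂x ((x+y)/2)`, `y ∈ ℂⁿ`, written as an integral in `y`.
As `∂θ_j/∂ȳ_k = (1/i) ∂²Φ/∂x_j∂x̄_k ((x+y)/2)`, the form `dy ∧ dθ` is, on the contour,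
`2^n det(∂²Φ/∂x∂x̄) L(dy)`, the contour being oriented so that this is positive. -/
def weylIntegral {n : ℕ} (Φ : Cn n → ℝ) (a : Lambda Φ → ℂ) (h : ℝ) (u : Cn n → ℂ) (x : Cn n) : ℂ :=
  (1 / (2 * (Real.pi : ℂ) * h) ^ n) *
    ∫ y, let m : Cn n := (1 / 2 : ℂ) • (x + y)
      Complex.exp (Complex.I / h * ∑ j, (x j - y j) * xi Φ m j) * a (toLambda Φ m) * u y *
        (2 ^ n * (leviMatrix Φ m).det)

/-- `A` is the operator `a^w(x, hD_x)` on `H_Φ(ℂⁿ)`: the bounded linear operator which is given by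
the Weyl quantization integral on the rapidly decaying elements. -/
def IsWeylQuantization {n : ℕ} (Φ : Cn n → ℝ) (a : Lambda Φ → ℂ) (h : ℝ)
    (A : bargmannSpace Φ h →ₗ[ℂ] bargmannSpace Φ h) : Prop :=
  (∃ M : ℝ, ∀ u, weightedNorm Φ h (A u) ≤ M * weightedNorm Φ h u) ∧
    ∀ u : bargmannSpace Φ h, RapidlyDecaying Φ h u → ∀ x, (A u : Cn n → ℂ) x = weylIntegral Φ a h u x

/-- `Φ₁` is a `C^{1,1}` function with `‖∇^k(Φ₁ - Φ₀)‖_{L^∞} ≤ ε` for `k = 0, 1, 2`. For `k = 2` this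
bounds the Lipschitz constant of the gradient, which is the `L^∞` norm of the (almost everywhere
defined) Hessian. -/
structure IsC11Perturbation {n : ℕ} (Φ₀ Φ₁ : Cn n → ℝ) (ε : ℝ) : Prop where
  contDiff : ContDiff ℝ 1 Φ₁
  lipschitz_gradient : ∃ L, LipschitzWith L (fderiv ℝ Φ₁)
  bound_zero : ∀ x, |Φ₁ x - Φ₀ x| ≤ ε
  bound_one : ∀ x, ‖fderiv ℝ (fun z => Φ₁ z - Φ₀ z) x‖ ≤ ε
  bound_two : ∀ x y,
    ‖fderiv ℝ (fun z => Φ₁ z - Φ₀ z) x - fderiv ℝ (fun z => Φ₁ z - Φ₀ z) y‖ ≤ ε * ‖x - y‖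

/-- `G` is the weak (distributional) gradient of `ψ`. -/
def HasWeakGradient {n : ℕ} (ψ : Cn n → ℂ) (G : Cn n → Cn n →L[ℝ] ℂ) : Prop :=
  ∀ f : Cn n → ℝ, ContDiff ℝ ∞ f → HasCompactSupport f → ∀ w : Cn n,
    ∫ x, ψ x * (fderiv ℝ f x w : ℂ) = -∫ x, (f x : ℂ) * G x w

/-- `ψ ∈ W^{1,∞}(ℂⁿ)`, with weak gradient `∇ψ = G`. -/
structure MemW1Infty {n : ℕ} (ψ : Cn n → ℂ) (G : Cn n → Cn n →L[ℝ] ℂ) : Prop where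
  bounded : MemLp ψ ⊤ volume
  bounded_gradient : MemLp G ⊤ volume
  weak_gradient : HasWeakGradient ψ G

/-- `‖ψ‖_{L^∞} + ‖∇ψ‖_{L^∞}`, for `∇ψ = G`. -/
def w1InftyNorm {n : ℕ} (ψ : Cn n → ℂ) (G : Cn n → Cn n →L[ℝ] ℂ) : ℝ :=
  (eLpNorm ψ ⊤ volume).toReal + (eLpNorm G ⊤ volume).toReal

end

open MeasureTheory
open scoped ContDiff

noncomputable section

open Complex Filter Topology
open scoped ComplexConjugate

/-! Write Φ₀(x) = H(x,x) + Re Q(x,x) with H a positive hermitian form and Q complex bilinear, and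
put B(z,x) = H(z,x) + Q(z,x), which is the derivative ∂Φ₀(x) applied to z. After the substitution y
= x - z the Weyl integral is a superposition, with weights α(x - z/2), of the magnetic translations
`QData.tr`. Each of these translates |u| e^{-Φ₀/h} exactly, because Re(2B(z,x) - B(z,z)) = Φ₀(x) -
Φ₀(x - z) (`QData.wt_sub`).

For general u in the Bargmann space the Weyl integral need not converge absolutely, so the symbol is
first cut into Gaussian wave packets w = (p,ζ) (`QData.exists_amp_inversion`). The Gevrey hypothesis
makes their amplitudes O(e^{-N(p) - c|ζ|^{1/s}}), where N(p) = H(p,p) (`QData.exists_amp_bound`).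
For a single packet the z-integral is a Gaussian integral of a holomorphic function, and the mean
value property evaluates it at one complex shift z = (h/2)(p - iζ) (`QData.gauss_packet`). Thus a^w
becomes `QData.op`, an absolutely convergent superposition of translations of size O(h(|p| + |ζ|)),
bounded by Young's inequality. It agrees with the Weyl integral on rapidly decaying functions
(`QData.op_eq_weyl`). These are dense, by dilations that leave the pluriharmonic part of the weight
alone, and point evaluations are continuous; hence existence and uniqueness.

Now perturb the weight by φ with ε of order h^{1-1/s}. In a scalar product against v, the
translation by z is joined to the identity by the translations by tz. Since v̄ is antiholomorphic,
the t-derivative of the integrand is, up to an explicit integrating factor, its holomorphic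
derivative along -z. Integrating by parts moves this derivative onto the Lipschitz coefficients and
costs O(|z|) = O(h) (`QData.norm_integral_homJ_sub_le`). What remains is multiplication by
e^{-∂φ(x)·(p - iζ)} up to O(h). The exponential losses are of size e^{2ε(|p|+|ζ|)} if |ζ| ≤ 1/h and
e^{2ε/h} if |ζ| > 1/h, and the Gevrey decay absorbs both exactly because ε ≤ (c/4) h^{1-1/s}
(`QData.growth_le`, `QData.damp_mul_exp_le`). High frequencies gain a factor h from 1 ≤ h|ζ|.

So a^w acts in scalar products like the function `QData.sym`, the superposition of amp(x,w)
e^{-∂φ(x)·(p - iζ)} over |ζ| ≤ 1/h. To compare it with ã on Λ_{Φ₁}, follow the vertical segment from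
Λ_{Φ₀} to Λ_{Φ₁}. On Λ_{Φ₀} the vertical derivatives of ã are forced by the Cauchy–Riemann
equations, which hold to all orders there, and they equal the moments of the wave packet
decomposition (`QData.dirD_eq_mom`). Hence the Taylor coefficients of ã and of the symbol agree up
to the discarded high frequencies. The Taylor remainders of order N are O(ε^N) = O(h) as soon as (1
- 1/s)N ≥ 1 (`QData.exists_norm_sym_sub_le`). Only this comparison involves ã, so the smallness
constant C comes from a alone.

Finally ψ in W^{1,∞} is approximated almost everywhere by compactly supported Lipschitz functions
without increasing the bounds (`exists_lipschitz_approx`). -/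

/-- The data of a strictly plurisubharmonic quadratic form `x ↦ H(x, x) + Re Q(x, x)`: a positive
definite hermitian form `H` and a symmetric complex bilinear form `Q`, with the constant `vol`
by which the Gaussian integrals of `H` are normalised. -/
structure QData (n : ℕ) where
  H : Cn n →ₗ[ℂ] Cn n →ₗ⋆[ℂ] ℂ
  Q : Cn n →ₗ[ℂ] Cn n →ₗ[ℂ] ℂ
  herm : ∀ x y, H y x = conj (H x y)
  symm : ∀ x y, Q y x = Q x y
  pos : ∀ x, x ≠ 0 → 0 < (H x x).re
  vol : ℝ
  vol_pos : 0 < vol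
  integral_gauss : ∀ t : ℝ, 0 < t →
    ∫ z : Cn n, Real.exp (-(t * (H z z).re)) = Real.pi ^ n / (t ^ n * vol)

/-! ### Algebra and bounds of the forms H and Q. -/

namespace QData

variable {n : ℕ} (D : QData n)

/-- The squared norm given by `H`. -/
def N (x : Cn n) : ℝ := (D.H x x).re

/-- The quadratic weight. -/
def wt (x : Cn n) : ℝ := D.N x + (D.Q x x).re

/-- The polar form `B(z, x) = ∑ z_j ∂_jΦ(x)` of the weight. -/
def B (z x : Cn n) : ℂ := D.H z x + D.Q z x

lemma H_self (x : Cn n) : D.H x x = (D.N x : ℂ) := by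
  have h := D.herm x x
  apply Complex.ext
  · simp [N]
  · have := congrArg Complex.im h
    simp only [conj_im] at this
    simp only [ofReal_im]
    linarith

lemma H_re_comm (x y : Cn n) : (D.H y x).re = (D.H x y).re := by
  rw [D.herm x y]; simp

lemma N_zero : D.N 0 = 0 := by simp [N]

lemma N_nonneg (x : Cn n) : 0 ≤ D.N x := by
  rcases eq_or_ne x 0 with rfl | hx
  · simp [N]
  · exact (D.pos x hx).le

lemma N_add (x y : Cn n) : D.N (x + y) = D.N x + 2 * (D.H x y).re + D.N y := by
  have := D.H_re_comm x y
  simp only [N, map_add, LinearMap.add_apply, add_re]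
  linarith

lemma N_smul (c : ℂ) (x : Cn n) : D.N (c • x) = ‖c‖ ^ 2 * D.N x := by
  have : D.H (c • x) (c • x) = (‖c‖ ^ 2 * D.N x : ℝ) := by
    simp only [map_smulₛₗ, LinearMap.smul_apply, smul_eq_mul, RingHom.id_apply]
    rw [H_self, ← mul_assoc, mul_comm (conj c), Complex.mul_conj, Complex.normSq_eq_norm_sq]
    push_cast; ring
  rw [N, this, ofReal_re]

lemma N_neg (x : Cn n) : D.N (-x) = D.N x := by
  simpa using D.N_smul (-1) x

lemma N_sub (x y : Cn n) : D.N (x - y) = D.N x - 2 * (D.H x y).re + D.N y := by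
  rw [sub_eq_add_neg, N_add, N_neg]
  simp; ring

/-- Positivity of N on the vector √a x + (t/√a) y, taken at t = 1 and t = -1. -/
lemma two_re_le (x y : Cn n) {a : ℝ} (ha : 0 < a) :
    2 * |(D.H x y).re| ≤ a * D.N x + a⁻¹ * D.N y := by
  have key : ∀ t : ℝ, 0 ≤ a * D.N x + 2 * t * (D.H x y).re + t ^ 2 * a⁻¹ * D.N y := by
    intro t
    have h := D.N_nonneg (((Real.sqrt a : ℝ) : ℂ) • x + ((t / Real.sqrt a : ℝ) : ℂ) • y)
    rw [N_add, N_smul, N_smul] at h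
    simp only [map_smulₛₗ, LinearMap.smul_apply, smul_eq_mul, RingHom.id_apply, conj_ofReal,
      re_ofReal_mul, norm_real, Real.norm_eq_abs, sq_abs, Real.sq_sqrt ha.le, div_pow] at h
    have hs : Real.sqrt a ≠ 0 := (Real.sqrt_pos.2 ha).ne'
    have e : t / Real.sqrt a * (Real.sqrt a * (D.H x y).re) = t * (D.H x y).re := by
      field_simp
    rw [e] at h
    have e2 : t ^ 2 / a * D.N y = t ^ 2 * a⁻¹ * D.N y := by ring
    linarith
  have h1 := key 1
  have h2 := key (-1)
  rcases abs_cases (D.H x y).re with ⟨h, _⟩ | ⟨h, _⟩ <;> rw [h] <;> nlinarith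

lemma H_eq_sum (x y : Cn n) :
    D.H x y = ∑ j, ∑ k, x j * conj (y k) * D.H (Pi.single j 1) (Pi.single k 1) := by
  have hx : x = ∑ j, x j • (Pi.single j (1 : ℂ) : Cn n) := by
    ext i; simp [Finset.sum_apply, Pi.single_apply]
  have hy : y = ∑ j, y j • (Pi.single j (1 : ℂ) : Cn n) := by
    ext i; simp [Finset.sum_apply, Pi.single_apply]
  conv_lhs => rw [hx, hy]
  simp only [map_sum, LinearMap.sum_apply, map_smulₛₗ, LinearMap.smul_apply, smul_eq_mul,
    RingHom.id_apply, Finset.mul_sum]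
  rw [Finset.sum_comm]
  exact Finset.sum_congr rfl fun j _ => Finset.sum_congr rfl fun k _ => by ring

lemma Q_eq_sum (x y : Cn n) :
    D.Q x y = ∑ j, ∑ k, x j * y k * D.Q (Pi.single j 1) (Pi.single k 1) := by
  have hx : x = ∑ j, x j • (Pi.single j (1 : ℂ) : Cn n) := by
    ext i; simp [Finset.sum_apply, Pi.single_apply]
  have hy : y = ∑ j, y j • (Pi.single j (1 : ℂ) : Cn n) := by
    ext i; simp [Finset.sum_apply, Pi.single_apply]
  conv_lhs => rw [hx, hy]
  simp only [map_sum, LinearMap.sum_apply, map_smulₛₗ, LinearMap.smul_apply, smul_eq_mul,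
    RingHom.id_apply, Finset.mul_sum]
  rw [Finset.sum_comm]
  exact Finset.sum_congr rfl fun j _ => Finset.sum_congr rfl fun k _ => by ring

@[fun_prop]
lemma continuous_H {X : Type*} [TopologicalSpace X] {f g : X → Cn n} (hf : Continuous f)
    (hg : Continuous g) : Continuous fun x => D.H (f x) (g x) := by
  rw [show (fun x => D.H (f x) (g x)) = _ from funext fun x => D.H_eq_sum (f x) (g x)]
  fun_prop

@[fun_prop]
lemma continuous_Q {X : Type*} [TopologicalSpace X] {f g : X → Cn n} (hf : Continuous f)
    (hg : Continuous g) : Continuous fun x => D.Q (f x) (g x) := by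
  rw [show (fun x => D.Q (f x) (g x)) = _ from funext fun x => D.Q_eq_sum (f x) (g x)]
  fun_prop

@[fun_prop]
lemma continuous_N {X : Type*} [TopologicalSpace X] {f : X → Cn n} (hf : Continuous f) :
    Continuous fun x => D.N (f x) := by
  unfold N
  fun_prop

@[fun_prop]
lemma continuous_B {X : Type*} [TopologicalSpace X] {f g : X → Cn n} (hf : Continuous f)
    (hg : Continuous g) : Continuous fun x => D.B (f x) (g x) := by
  unfold B
  fun_prop

@[fun_prop]
lemma continuous_wt {X : Type*} [TopologicalSpace X] {f : X → Cn n} (hf : Continuous f) :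
    Continuous fun x => D.wt (f x) := by
  unfold wt
  fun_prop

lemma exists_upper : ∃ C : ℝ, 0 < C ∧ ∀ x y, ‖D.H x y‖ ≤ C * ‖x‖ * ‖y‖ := by
  refine ⟨(∑ j, ∑ k, ‖D.H (Pi.single j 1) (Pi.single k 1)‖) + 1, by positivity, fun x y => ?_⟩
  rw [D.H_eq_sum]
  have h1 : ‖∑ j, ∑ k, x j * conj (y k) * D.H (Pi.single j 1) (Pi.single k 1)‖ ≤
      ∑ j, ∑ k, ‖x‖ * ‖y‖ * ‖D.H (Pi.single j 1) (Pi.single k 1)‖ := by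
    refine (norm_sum_le _ _).trans (Finset.sum_le_sum fun j _ => (norm_sum_le _ _).trans
      (Finset.sum_le_sum fun k _ => ?_))
    rw [norm_mul, norm_mul, RCLike.norm_conj]
    gcongr
    · exact norm_le_pi_norm x j
    · exact norm_le_pi_norm y k
  simp_rw [← Finset.mul_sum] at h1
  nlinarith [norm_nonneg x, norm_nonneg y, mul_nonneg (norm_nonneg x) (norm_nonneg y)]

lemma exists_lower : ∃ c : ℝ, 0 < c ∧ ∀ x, c * ‖x‖ ^ 2 ≤ D.N x := by
  by_cases hne : (Metric.sphere (0 : Cn n) 1).Nonempty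
  · obtain ⟨x₀, hx₀, hmin⟩ := (isCompact_sphere (0 : Cn n) 1).exists_isMinOn hne
      (D.continuous_N continuous_id).continuousOn
    have hx₀' : x₀ ≠ 0 := by
      rintro rfl; simp at hx₀
    refine ⟨D.N x₀, D.pos x₀ hx₀', fun x => ?_⟩
    rcases eq_or_ne x 0 with rfl | hx
    · simp [N_zero]
    have hx' : 0 < ‖x‖ := norm_pos_iff.2 hx
    have := hmin (show ((‖x‖⁻¹ : ℝ) : ℂ) • x ∈ Metric.sphere (0 : Cn n) 1 by
      simp [norm_smul, hx'.ne'])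
    simp only [Set.mem_ofPred_eq, id] at this
    rw [N_smul, norm_real, norm_inv, norm_norm] at this
    calc D.N x₀ * ‖x‖ ^ 2 ≤ (‖x‖⁻¹ ^ 2 * D.N x) * ‖x‖ ^ 2 := by gcongr
      _ = D.N x := by field_simp
  -- The unit sphere is empty only for n = 0, where every vector is zero.
  · refine ⟨1, one_pos, fun x => ?_⟩
    rcases eq_or_ne x 0 with rfl | hx
    · simp [N_zero]
    · exact absurd ⟨((‖x‖⁻¹ : ℝ) : ℂ) • x, by simp [norm_smul, hx]⟩ hne

/-- A lower bound of the form `H`. -/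
def lo : ℝ := D.exists_lower.choose
lemma lo_pos : 0 < D.lo := D.exists_lower.choose_spec.1
lemma lo_le (x : Cn n) : D.lo * ‖x‖ ^ 2 ≤ D.N x := D.exists_lower.choose_spec.2 x

/-- An upper bound of the form `H`. -/
def up : ℝ := D.exists_upper.choose
lemma up_pos : 0 < D.up := D.exists_upper.choose_spec.1
lemma norm_H_le (x y : Cn n) : ‖D.H x y‖ ≤ D.up * ‖x‖ * ‖y‖ := D.exists_upper.choose_spec.2 x y
lemma N_le (x : Cn n) : D.N x ≤ D.up * ‖x‖ ^ 2 := by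
  have := D.norm_H_le x x
  rw [H_self, norm_real, Real.norm_eq_abs] at this
  nlinarith [le_abs_self (D.N x)]

/-- The identity behind the magnetic translations: the exponent 2B(z,x) - B(z,z) is holomorphic in x
up to the terms that its real part needs to compensate the change of the weight exactly. It makes
`tr` an isometry for e^{-Φ₀/h}. -/
lemma wt_sub (x z : Cn n) :
    D.wt x - D.wt (x - z) = (2 * D.B z x - D.B z z).re := by
  have h1 := D.N_sub x z
  have h2 := D.H_re_comm z x
  have h3 := D.symm x z
  simp only [wt, B]
  rw [h1, H_self]
  simp only [map_sub, LinearMap.sub_apply, h3, sub_re, add_re, mul_re, re_ofNat, im_ofNat,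
    ofReal_re, zero_mul, sub_zero]
  rw [← h2]; ring

end QData

/-! ### Integrability of stretched exponentials and the Cauchy–Schwarz inequality. -/

/-- The quotient of the two sides is continuous on [0, ∞) and tends to 0 at infinity, hence is
bounded. -/
lemma exists_exp_neg_rpow_le {c r d : ℝ} (hc : 0 < c) (hr : 0 < r) (hd0 : 0 ≤ d) :
    ∃ M : ℝ, ∀ t : ℝ, 0 ≤ t → Real.exp (-(c * t ^ r)) ≤ M * (1 + t) ^ (-d) := by
  have hcont : Continuous fun t : ℝ => (1 + |t|) ^ d * Real.exp (-(c * |t| ^ r)) := by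
    refine Continuous.mul ?_ ?_
    · exact Continuous.rpow_const (by fun_prop) fun t => Or.inr hd0
    · exact Real.continuous_exp.comp (((continuous_abs.rpow_const
        fun t => Or.inr hr.le).const_mul c).neg)
  have hlim : Tendsto (fun t : ℝ => (1 + |t|) ^ d * Real.exp (-(c * |t| ^ r))) atTop (𝓝 0) := by
    have h1 : Tendsto (fun t : ℝ => t ^ (d / r) * Real.exp (-c * t)) atTop (𝓝 0) :=
      tendsto_rpow_mul_exp_neg_mul_atTop_nhds_zero _ _ hc
    have h2 := (h1.comp (tendsto_rpow_atTop hr)).const_mul ((2 : ℝ) ^ d)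
    rw [mul_zero] at h2
    refine squeeze_zero' (Eventually.of_forall fun t => by positivity) ?_ h2
    filter_upwards [eventually_ge_atTop 1] with t ht
    have ht0 : (0 : ℝ) ≤ t := by linarith
    rw [abs_of_nonneg ht0]
    simp only [Function.comp]
    rw [← Real.rpow_mul ht0, mul_div_cancel₀ _ hr.ne', ← mul_assoc,
      ← Real.mul_rpow (by norm_num) ht0, neg_mul]
    gcongr
    linarith
  obtain ⟨T, hT⟩ := (hlim.eventually (gt_mem_nhds (zero_lt_one))).exists_forall_of_atTop
  obtain ⟨M, hM⟩ := (isCompact_Icc (a := (0 : ℝ)) (b := T)).exists_bound_of_continuousOn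
    hcont.continuousOn
  refine ⟨max M 1, fun t ht => ?_⟩
  have hpos : 0 < (1 + t) ^ d := by positivity
  rw [Real.rpow_neg (by positivity), ← div_eq_mul_inv, le_div_iff₀ hpos, mul_comm]
  rcases le_total t T with h | h
  · have := hM t ⟨ht, h⟩
    rw [Real.norm_eq_abs, abs_of_nonneg ht] at this
    exact (le_abs_self _).trans (this.trans (le_max_left _ _))
  · have := hT t h
    rw [abs_of_nonneg ht] at this
    exact this.le.trans (le_max_right _ _)

/-- Stretched exponentials are integrable. -/
lemma integrable_exp_neg_rpow {E : Type*} [NormedAddCommGroup E] [NormedSpace ℝ E]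
    [FiniteDimensional ℝ E] [MeasurableSpace E] [BorelSpace E] {μ : Measure E} [μ.IsAddHaarMeasure]
    {c r : ℝ} (hc : 0 < c) (hr : 0 < r) :
    Integrable (fun x : E => Real.exp (-(c * ‖x‖ ^ r))) μ := by
  set d : ℝ := Module.finrank ℝ E + 1
  have hd : (Module.finrank ℝ E : ℝ) < d := by simp [d]
  have hd0 : 0 ≤ d := by positivity
  obtain ⟨M, hM⟩ := exists_exp_neg_rpow_le hc hr hd0
  refine ((integrable_one_add_norm (μ := μ) hd).const_mul M).mono' ?_
    (Eventually.of_forall fun x => ?_)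
  · have : Continuous fun x : E => Real.exp (-(c * ‖x‖ ^ r)) :=
      Real.continuous_exp.comp (((continuous_norm.rpow_const fun t => Or.inr hr.le).const_mul c).neg)
    exact this.aestronglyMeasurable
  · rw [Real.norm_eq_abs, Real.abs_exp]
    exact hM _ (norm_nonneg _)

namespace QData

variable {n : ℕ} (D : QData n)

lemma integrable_gauss {t : ℝ} (ht : 0 < t) :
    Integrable fun z : Cn n => Real.exp (-(t * D.N z)) := by
  refine (integrable_exp_neg_rpow (μ := volume) (mul_pos ht D.lo_pos) two_pos).mono' ?_
    (Eventually.of_forall fun x => ?_)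
  · exact Continuous.aestronglyMeasurable (by fun_prop)
  · rw [Real.norm_eq_abs, Real.abs_exp, Real.rpow_two]
    have := mul_le_mul_of_nonneg_left (D.lo_le x) ht.le
    exact Real.exp_le_exp.2 (by linarith)

end QData

/-- The Cauchy-Schwarz inequality for nonnegative functions with integrable squares. -/
lemma integral_mul_le_sqrt {X : Type*} [MeasurableSpace X] {μ : Measure X} {f g : X → ℝ}
    (hf : AEStronglyMeasurable f μ) (hg : AEStronglyMeasurable g μ) (hf0 : ∀ x, 0 ≤ f x)
    (hg0 : ∀ x, 0 ≤ g x) (hf2 : Integrable (fun x => f x ^ 2) μ)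
    (hg2 : Integrable (fun x => g x ^ 2) μ) :
    Integrable (fun x => f x * g x) μ ∧
      ∫ x, f x * g x ∂μ ≤ Real.sqrt (∫ x, f x ^ 2 ∂μ) * Real.sqrt (∫ x, g x ^ 2 ∂μ) := by
  have mf : MemLp f 2 μ := (memLp_two_iff_integrable_sq hf).2 hf2
  have mg : MemLp g 2 μ := (memLp_two_iff_integrable_sq hg).2 hg2
  refine ⟨mf.integrable_mul mg, ?_⟩
  have e : ENNReal.ofReal 2 = 2 := by simp
  have := integral_mul_le_Lp_mul_Lq_of_nonneg (μ := μ) Real.HolderConjugate.two_two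
    (Eventually.of_forall hf0) (Eventually.of_forall hg0) (by rwa [e]) (by rwa [e])
  simpa [Real.sqrt_eq_rpow] using this

/-! ### Gaussian mean value formulas and point evaluations on the Bargmann space. -/

lemma measurePreserving_smul_of_norm_eq_one {n : ℕ} {c : ℂ} (hc : ‖c‖ = 1) :
    MeasurePreserving (fun z : Cn n => c • z) := by
  have h : MeasurePreserving (fun z : ℂ => c * z) := by
    have := (rotation (⟨c, by simpa [Submonoid.unitSphere] using hc⟩ : Circle)).measurePreserving
    exact this
  exact measurePreserving_pi (fun _ : Fin n => volume) (fun _ => volume) fun _ => h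

namespace QData

variable {n : ℕ} (D : QData n)

/-- The Gaussian and Lebesgue measure are invariant under z ↦ e^{iθ}z. Averaging over θ replaces
F(z) by F(0), by the mean value property of ζ ↦ F(ζz) on the unit circle, and `integral_gauss`
supplies the mass. -/
lemma integral_gauss_mul_of_differentiable {t : ℝ} (ht : 0 < t) {F : Cn n → ℂ}
    (hF : Differentiable ℂ F) (hi : Integrable fun z => (Real.exp (-(t * D.N z)) : ℂ) * F z) :
    ∫ z, (Real.exp (-(t * D.N z)) : ℂ) * F z = (Real.pi ^ n / (t ^ n * D.vol) : ℝ) * F 0 := by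
  set g : Cn n → ℂ := fun z => (Real.exp (-(t * D.N z)) : ℂ) * F z with hg
  have hgc : Continuous g := by
    have := hF.continuous
    fun_prop
  have hmp : ∀ θ : ℝ, MeasurePreserving (fun z : Cn n => circleMap 0 1 θ • z) := fun θ =>
    measurePreserving_smul_of_norm_eq_one (by simp)
  have hgθ : ∀ (θ : ℝ) z, g (circleMap 0 1 θ • z) =
      (Real.exp (-(t * D.N z)) : ℂ) * F (circleMap 0 1 θ • z) := by
    intro θ z
    simp [hg, N_smul]
  have hrot : ∀ θ : ℝ, ∫ z, g (circleMap 0 1 θ • z) = ∫ z, g z := fun θ =>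
    (hmp θ).integral_comp (Homeomorph.smulOfNeZero (circleMap 0 1 θ) (by
      simp [circleMap])).measurableEmbedding g
  have hgi : ∀ θ : ℝ, Integrable fun z => g (circleMap 0 1 θ • z) := fun θ =>
    ((hmp θ).integrable_comp hgc.aestronglyMeasurable).2 hi
  have hprod : Integrable (fun p : ℝ × Cn n => g (circleMap 0 1 p.1 • p.2))
      ((volume.restrict (Set.Ioc 0 (2 * Real.pi))).prod volume) := by
    have hc : Continuous fun p : ℝ × Cn n => g (circleMap 0 1 p.1 • p.2) := by
      have := continuous_circleMap 0 1
      exact hgc.comp (((this.comp continuous_fst)).smul continuous_snd)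
    refine (integrable_prod_iff hc.aestronglyMeasurable).2 ⟨Eventually.of_forall hgi, ?_⟩
    have : ∀ θ : ℝ, ∫ z, ‖g (circleMap 0 1 θ • z)‖ = ∫ z, ‖g z‖ := fun θ =>
      (hmp θ).integral_comp (Homeomorph.smulOfNeZero (circleMap 0 1 θ) (by
        simp [circleMap])).measurableEmbedding fun z => ‖g z‖
    simp only [this]
    exact integrable_const _
  have hmean : ∀ z : Cn n, ∫ θ in Set.Ioc 0 (2 * Real.pi), F (circleMap 0 1 θ • z) =
      2 * Real.pi * F 0 := by
    intro z
    have hd : Differentiable ℂ fun ζ : ℂ => F (ζ • z) :=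
      hF.comp (differentiable_id.smul_const z)
    have := DiffContOnCl.circleAverage (f := fun ζ : ℂ => F (ζ • z)) (c := 0) (R := 1)
      hd.diffContOnCl
    rw [Real.circleAverage_def, intervalIntegral.integral_of_le (by positivity), zero_smul] at this
    rw [← this, real_smul]
    push_cast
    rw [← mul_assoc, mul_inv_cancel₀, one_mul]
    simp [Real.pi_ne_zero]
  have h1 : ∫ θ in Set.Ioc 0 (2 * Real.pi), ∫ z, g (circleMap 0 1 θ • z) =
      2 * Real.pi * ∫ z, g z := by
    simp only [hrot]
    rw [setIntegral_const]
    simp [Real.pi_pos.le]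
  rw [integral_integral_swap hprod] at h1
  have h2 : ∫ z, ∫ θ in Set.Ioc 0 (2 * Real.pi), g (circleMap 0 1 θ • z) =
      2 * Real.pi * ((Real.pi ^ n / (t ^ n * D.vol) : ℝ) * F 0) := by
    simp only [hgθ]
    simp_rw [integral_const_mul, hmean]
    rw [integral_mul_const, integral_complex_ofReal]
    have := D.integral_gauss t ht
    rw [show (∫ z, Real.exp (-(t * D.N z))) = _ from this]
    ring
  rw [h2] at h1
  have hpi : (2 * Real.pi : ℂ) ≠ 0 := by simp [Real.pi_ne_zero]
  exact (mul_left_cancel₀ hpi h1).symm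

/-- The Gaussian mean value formula for entire functions. -/
lemma integral_gauss_linear_mul {t : ℝ} (ht : 0 < t) (w : Cn n) {F : Cn n → ℂ}
    (hF : Differentiable ℂ F)
    (hi : Integrable fun z => cexp (-(t * D.N z) + D.H w z) * F z) :
    ∫ z, cexp (-(t * D.N z) + D.H w z) * F z =
      (Real.pi ^ n / (t ^ n * D.vol) : ℝ) * F ((t⁻¹ : ℂ) • w) := by
  set v : Cn n := (t⁻¹ : ℂ) • w with hv
  have htc : (t : ℂ) ≠ 0 := by exact_mod_cast ht.ne'
  have hw : w = (t : ℂ) • v := by rw [hv, smul_smul, mul_inv_cancel₀ htc, one_smul]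
  -- Completing the square: the shift by v = w/t cancels H(w, ·) against the part of N(z + v) that
  -- is antiholomorphic in z, and the cross term H(z,v) that is left is holomorphic in z and
  -- vanishes at 0.
  have hkey : ∀ z, cexp (-(t * D.N (z + v)) + D.H w (z + v)) * F (z + v) =
      (Real.exp (-(t * D.N z)) : ℂ) * (cexp (-(t * D.H z v)) * F (z + v)) := by
    intro z
    rw [← mul_assoc, ofReal_exp, ← Complex.exp_add]
    congr 2
    rw [hw]
    simp only [ofReal_neg, ofReal_mul, ← H_self, map_add, map_smulₛₗ, LinearMap.add_apply,
      LinearMap.smul_apply, smul_eq_mul, RingHom.id_apply]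
    ring
  have hd : Differentiable ℂ fun z => cexp (-(t * D.H z v)) * F (z + v) := by
    have h1 : Differentiable ℂ fun z : Cn n => D.H z v :=
      (LinearMap.toContinuousLinearMap ((D.H.flip) v)).differentiable
    have h2 : Differentiable ℂ fun z : Cn n => F (z + v) :=
      hF.comp (differentiable_id.add_const v)
    exact (((h1.const_mul _).neg).cexp).mul h2
  have := D.integral_gauss_mul_of_differentiable ht hd (by
    simp only [← hkey]
    exact hi.comp_add_right v)
  simp only [← hkey] at this
  rw [integral_add_right_eq_self (fun z => cexp (-(t * D.N z) + D.H w z) * F z) v] at this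
  rw [this]
  simp

lemma differentiable_B_left (x : Cn n) : Differentiable ℂ fun z => D.B z x :=
  ((LinearMap.toContinuousLinearMap (D.H.flip x)).differentiable).add
    ((LinearMap.toContinuousLinearMap (D.Q.flip x)).differentiable)

lemma differentiable_H_left (x : Cn n) : Differentiable ℂ fun z => D.H z x :=
  (LinearMap.toContinuousLinearMap (D.H.flip x)).differentiable

lemma differentiable_Q_diag : Differentiable ℂ fun z => D.Q z z := by
  rw [show (fun z => D.Q z z) = _ from funext fun z => D.Q_eq_sum z z]
  fun_prop

/-- The magnetic translation by `z`. -/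
def tr (h : ℝ) (z : Cn n) (u : Cn n → ℂ) (x : Cn n) : ℂ :=
  cexp ((2 * D.B z x - D.B z z) / h) * u (x - z)

lemma norm_tr (h : ℝ) (z : Cn n) (u : Cn n → ℂ) (x : Cn n) :
    ‖D.tr h z u x‖ = Real.exp ((D.wt x - D.wt (x - z)) / h) * ‖u (x - z)‖ := by
  rw [tr, norm_mul, norm_exp, wt_sub, div_ofReal_re]

/-- Square integrability in the weighted space. -/
def SqInt (Φ : Cn n → ℝ) (h : ℝ) (u : Cn n → ℂ) : Prop :=
  Integrable fun x => ‖u x‖ ^ 2 * Real.exp (-2 * Φ x / h)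

lemma exp_sq (a h : ℝ) : Real.exp (-2 * a / h) = Real.exp (-a / h) ^ 2 := by
  rw [← Real.exp_nat_mul]; congr 1; push_cast; ring

/-- The pointwise estimate of the elements of the Bargmann space. -/
lemma exists_pointwise_bound {h : ℝ} (hh : 0 < h) : ∃ C : ℝ, 0 < C ∧
    ∀ u : Cn n → ℂ, Differentiable ℂ u → SqInt D.wt h u →
      ∀ x, ‖u x‖ ≤ C * weightedNorm D.wt h u * Real.exp (D.wt x / h) := by
  set κ : ℝ := Real.pi ^ n / ((2 / h) ^ n * D.vol) with hκ
  have hκ0 : 0 < κ := by have := D.vol_pos; have := Real.pi_pos; positivity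
  set S : ℝ := Real.sqrt (∫ z, Real.exp (-(h⁻¹ * D.N z)) ^ 2)
  refine ⟨κ⁻¹ * (S + 1), by positivity, fun u hu hu2 x => ?_⟩
  -- The factor e^{-N(z)/h} of the translation is pulled out and a second one is added. This leaves
  -- a holomorphic F with value u(x) at 0, while the added Gaussian serves as one factor in the
  -- Cauchy–Schwarz inequality.
  set F : Cn n → ℂ := fun z => cexp ((2 * D.B z x - D.Q z z) / h) * u (x - z) with hFdef
  have hF : Differentiable ℂ F := by
    refine Differentiable.mul ?_ (hu.comp (differentiable_id.const_sub x))
    refine Differentiable.cexp ?_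
    simp only [div_eq_mul_inv]
    exact (((D.differentiable_B_left x).const_mul 2).sub D.differentiable_Q_diag).mul_const _
  have hu_c := hu.continuous
  set f : Cn n → ℝ := fun z => Real.exp (-(h⁻¹ * D.N z))
  set g : Cn n → ℝ := fun z => ‖u (x - z)‖ * Real.exp (-D.wt (x - z) / h)
  have hnorm : ∀ z, ‖(Real.exp (-(2 / h * D.N z)) : ℂ) * F z‖ =
      f z * g z * Real.exp (D.wt x / h) := by
    intro z
    have e1 : (Real.exp (-(2 / h * D.N z)) : ℂ) * F z =
        (Real.exp (-(h⁻¹ * D.N z)) : ℂ) * D.tr h z u x := by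
      simp only [hFdef, tr, B, H_self]
      rw [← mul_assoc, ← mul_assoc, ofReal_exp, ofReal_exp, ← Complex.exp_add, ← Complex.exp_add]
      congr 2
      push_cast; ring
    rw [e1, norm_mul, norm_tr, norm_real, Real.norm_eq_abs, Real.abs_exp, sub_div, sub_eq_add_neg,
      Real.exp_add]
    simp only [f, g, neg_div]; ring
  have hfc : Continuous f := by fun_prop
  have hgc : Continuous g := by fun_prop
  have hf2 : Integrable fun z => f z ^ 2 := by
    have : (fun z => f z ^ 2) = fun z => Real.exp (-(2 * h⁻¹ * D.N z)) := by
      ext z; simp only [f]; rw [← Real.exp_nat_mul]; congr 1; push_cast; ring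
    rw [this]
    exact D.integrable_gauss (by positivity)
  have hg2e : (fun z => g z ^ 2) = fun z =>
      (fun y => ‖u y‖ ^ 2 * Real.exp (-2 * D.wt y / h)) (x - z) := by
    ext z; simp only [g]; rw [mul_pow, ← exp_sq]
  have hg2 : Integrable fun z => g z ^ 2 := by
    rw [hg2e]
    exact hu2.comp_sub_left x
  obtain ⟨hfg, hcs⟩ := integral_mul_le_sqrt (μ := volume) hfc.aestronglyMeasurable
    hgc.aestronglyMeasurable (fun z => (Real.exp_pos _).le) (fun z => by positivity) hf2 hg2
  have hi : Integrable fun z => (Real.exp (-(2 / h * D.N z)) : ℂ) * F z := by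
    refine (hfg.mul_const (Real.exp (D.wt x / h))).mono' ?_
      (Eventually.of_forall fun z => (hnorm z).le)
    have := hF.continuous
    exact Continuous.aestronglyMeasurable (by fun_prop)
  have hmv := D.integral_gauss_mul_of_differentiable (t := 2 / h) (by positivity) hF hi
  have hF0 : F 0 = u x := by simp [hFdef, B]
  have h1 : κ * ‖u x‖ ≤ S * weightedNorm D.wt h u * Real.exp (D.wt x / h) := by
    calc κ * ‖u x‖ = ‖∫ z, (Real.exp (-(2 / h * D.N z)) : ℂ) * F z‖ := by
          rw [hmv, hF0, norm_mul, norm_real, Real.norm_eq_abs, abs_of_pos hκ0]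
      _ ≤ ∫ z, f z * g z * Real.exp (D.wt x / h) := by
          refine (norm_integral_le_integral_norm _).trans (le_of_eq ?_)
          simp only [hnorm]
      _ = (∫ z, f z * g z) * Real.exp (D.wt x / h) := integral_mul_const _ _
      _ ≤ _ := by
          gcongr
          refine hcs.trans (le_of_eq ?_)
          rw [hg2e, integral_sub_left_eq_self
            (fun y => ‖u y‖ ^ 2 * Real.exp (-2 * D.wt y / h)) volume x]
          rfl
  have hw : 0 ≤ weightedNorm D.wt h u := Real.sqrt_nonneg _
  calc ‖u x‖ = κ⁻¹ * (κ * ‖u x‖) := by field_simp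
    _ ≤ κ⁻¹ * (S * weightedNorm D.wt h u * Real.exp (D.wt x / h)) := by gcongr
    _ ≤ κ⁻¹ * ((S + 1) * weightedNorm D.wt h u * Real.exp (D.wt x / h)) := by gcongr; linarith
    _ = _ := by ring

end QData

/-! ### Directional derivatives and the decay of windowed Fourier transforms of Gevrey functions. -/

section DirectionalDerivative

variable {E : Type*} [NormedAddCommGroup E] [NormedSpace ℝ E]

/-- The iterated derivative in the direction `e`. -/
def dirD (e : E) : ℕ → (E → ℂ) → E → ℂ
  | 0, f => f
  | k + 1, f => fun x => fderiv ℝ (dirD e k f) x e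

lemma contDiff_dirD {f : E → ℂ} (hf : ContDiff ℝ ∞ f) (e : E) (k : ℕ) :
    ContDiff ℝ ∞ (dirD e k f) := by
  induction k with
  | zero => exact hf
  | succ k ih => exact (ih.fderiv_right (m := ∞) (by simp)).clm_apply contDiff_const

lemma dirD_eq_iteratedFDeriv {f : E → ℂ} (hf : ContDiff ℝ ∞ f) (e : E) (k : ℕ) (x : E) :
    dirD e k f x = iteratedFDeriv ℝ k f x fun _ => e := by
  induction k generalizing x with
  | zero => simp [dirD]
  | succ k ih =>
    rw [iteratedFDeriv_succ_apply_left, dirD, show dirD e k f = _ from funext ih]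
    have hd : DifferentiableAt ℝ (iteratedFDeriv ℝ k f) x :=
      (hf.differentiable_iteratedFDeriv (m := k) (by exact_mod_cast WithTop.coe_lt_top _)) x
    have := (ContinuousMultilinearMap.apply ℝ (fun _ : Fin k => E) ℂ (fun _ => e)).hasFDerivAt.comp x
      hd.hasFDerivAt
    have h2 := this.fderiv
    simp only [Function.comp_def, ContinuousMultilinearMap.apply_apply] at h2
    exact congrArg (fun L : E →L[ℝ] ℂ => L e) h2

lemma norm_dirD_le {f : E → ℂ} (hf : ContDiff ℝ ∞ f) (e : E) (k : ℕ) (x : E) :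
    ‖dirD e k f x‖ ≤ ‖iteratedFDeriv ℝ k f x‖ * ‖e‖ ^ k := by
  rw [dirD_eq_iteratedFDeriv hf]
  simpa using (iteratedFDeriv ℝ k f x).le_opNorm fun _ => e

lemma hasDerivAt_dirD {f : E → ℂ} (hf : ContDiff ℝ ∞ f) (e : E) (k : ℕ) (x : E) (r : ℝ) :
    HasDerivAt (fun r : ℝ => dirD e k f (x + r • e)) (dirD e (k + 1) f (x + r • e)) r := by
  have h1 : HasDerivAt (fun r : ℝ => x + r • e) e r := by
    simpa using ((hasDerivAt_id r).smul_const e).const_add x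
  have h2 := ((contDiff_dirD hf e k).differentiable (by simp)) (x + r • e)
  exact h2.hasFDerivAt.comp_hasDerivAt r h1

lemma iteratedDeriv_line {f : E → ℂ} (hf : ContDiff ℝ ∞ f) (e : E) (k : ℕ) (x : E) (r : ℝ) :
    iteratedDeriv k (fun r : ℝ => f (x + r • e)) r = dirD e k f (x + r • e) := by
  induction k generalizing r with
  | zero => simp [dirD]
  | succ k ih =>
    rw [iteratedDeriv_succ, show iteratedDeriv k (fun r : ℝ => f (x + r • e)) = _ from funext ih]
    exact (hasDerivAt_dirD hf e k x r).deriv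

lemma iteratedDeriv_ofReal {G : ℂ → ℂ} (hG : Differentiable ℂ G) (k : ℕ) (r : ℝ) :
    iteratedDeriv k (fun r : ℝ => G r) r = iteratedDeriv k G r := by
  induction k generalizing r with
  | zero => simp
  | succ k ih =>
    rw [iteratedDeriv_succ, show iteratedDeriv k (fun r : ℝ => G r) = _ from funext ih,
      iteratedDeriv_succ]
    have hd : Differentiable ℂ (iteratedDeriv k G) :=
      (hG.contDiff (n := ⊤)).differentiable_iteratedDeriv k (by exact_mod_cast WithTop.coe_lt_top _)
    exact (hd (r : ℂ)).hasDerivAt.comp_ofReal.deriv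

end DirectionalDerivative

/-- Factorial estimates of all orders give a stretched exponential estimate. -/
lemma le_exp_of_forall_mul_pow_le {s X A ρ : ℝ} (hs : 1 < s) (hX : 0 ≤ X) (hA : 0 ≤ A)
    (hρ : 0 ≤ ρ) (h : ∀ N : ℕ, X * ρ ^ N ≤ A * (N.factorial : ℝ) ^ s) :
    X ≤ A * 2 ^ s * Real.exp (-(s / 2 * ρ ^ (1 / s))) := by
  have hs0 : 0 < s := by linarith
  have hs1 : 0 < 1 / s := by positivity
  set x := X ^ (1 / s)
  set r := ρ ^ (1 / s)
  set a := A ^ (1 / s)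
  have hr : 0 ≤ r := Real.rpow_nonneg hρ _
  -- Taking roots of order s turns N!^s into N!. With ρ^{1/s} halved, the resulting bounds sum over
  -- N to an exponential series on the left and a geometric series on the right; the power s is
  -- restored afterwards.
  have key : ∀ N : ℕ, x * ((r / 2) ^ N / N.factorial) ≤ a * (1 / 2) ^ N := by
    intro N
    have h1 := Real.rpow_le_rpow (by positivity) (h N) hs1.le
    rw [Real.mul_rpow hX (by positivity), Real.mul_rpow hA (by positivity), ← Real.rpow_mul
      (by positivity), mul_one_div_cancel hs0.ne', Real.rpow_one, ← Real.rpow_natCast,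
      ← Real.rpow_mul hρ, mul_comm (N : ℝ), Real.rpow_mul hρ, Real.rpow_natCast] at h1
    have hf : (0 : ℝ) < N.factorial := by positivity
    rw [div_pow, div_div, mul_div_assoc', div_le_iff₀ (by positivity)]
    calc x * r ^ N ≤ a * N.factorial := h1
      _ = a * (1 / 2) ^ N * (2 ^ N * N.factorial) := by
        rw [div_pow, one_pow]; field_simp
  have hsum : x * Real.exp (r / 2) ≤ a * 2 := by
    have s1 : HasSum (fun N : ℕ => x * ((r / 2) ^ N / N.factorial)) (x * Real.exp (r / 2)) := by
      have := NormedSpace.expSeries_div_hasSum_exp (r / 2)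
      rw [← Real.exp_eq_exp_ℝ] at this
      exact this.mul_left x
    have s2 : HasSum (fun N : ℕ => a * (1 / 2 : ℝ) ^ N) (a * 2) := hasSum_geometric_two.mul_left a
    exact hasSum_le key s1 s2
  have h2 := Real.rpow_le_rpow (by positivity) hsum hs0.le
  rw [Real.mul_rpow (by positivity) (by positivity), Real.mul_rpow (by positivity) (by positivity),
    ← Real.rpow_mul hX, ← Real.rpow_mul hA, one_div_mul_cancel hs0.ne', Real.rpow_one,
    Real.rpow_one, ← Real.exp_mul] at h2
  rw [Real.exp_neg, ← div_eq_mul_inv, le_div_iff₀ (Real.exp_pos _)]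
  rw [show s / 2 * r = r / 2 * s by ring]
  exact h2

namespace QData

variable {n : ℕ} (D : QData n)

lemma contDiff_N : ContDiff ℝ ∞ D.N := by
  have : D.N = fun z => (∑ j, ∑ k, z j * conjCLE (z k) *
      D.H (Pi.single j 1) (Pi.single k 1)).re := by
    ext z; rw [N, D.H_eq_sum]; rfl
  rw [this]
  refine reCLM.contDiff.comp (ContDiff.sum fun j _ => ContDiff.sum fun k _ => ?_)
  refine ContDiff.mul (ContDiff.mul (by fun_prop) ?_) contDiff_const
  exact conjCLE.toContinuousLinearMap.contDiff.comp (by fun_prop)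

/-- Cauchy's estimate on the unit circle for the entire extension G of the Gaussian along the line.
For |τ| = 1 the cross term is at most N(t + p)/2 + 2N(e), so half of the Gaussian survives at the
cost of e^{3N(e)}. -/
lemma norm_dirD_gauss_le (p e t : Cn n) (he : ‖e‖ = 1) (k : ℕ) :
    ‖iteratedDeriv k (fun r : ℝ => (Real.exp (-D.N (t + r • e + p)) : ℂ)) 0‖ ≤
      k.factorial * (Real.exp (3 * D.up) * Real.exp (-(1 / 2 * D.N (t + p)))) := by
  set G : ℂ → ℂ := fun τ => cexp (-(D.N (t + p) + 2 * (D.H (t + p) e).re * τ + D.N e * τ ^ 2))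
  have hG : Differentiable ℂ G := by fun_prop
  have hN : D.N e ≤ D.up := by simpa [he] using D.N_le e
  have e1 : (fun r : ℝ => (Real.exp (-D.N (t + r • e + p)) : ℂ)) = fun r : ℝ => G r := by
    ext r
    have : t + r • e + p = (t + p) + (r : ℂ) • e := by
      rw [show (r : ℂ) • e = r • e from by ext i; simp]; abel
    rw [this, N_add, N_smul, D.H_re_comm]
    simp only [G, map_smul, LinearMap.smul_apply, smul_eq_mul, re_ofReal_mul, norm_real,
      Real.norm_eq_abs, sq_abs, D.H_re_comm (t + p) e]
    push_cast; ring_nf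
  rw [e1, iteratedDeriv_ofReal hG, ofReal_zero]
  have := norm_iteratedDeriv_le_of_forall_mem_sphere_norm_le (c := 0) (R := 1) (f := G)
    (C := Real.exp (3 * D.up) * Real.exp (-(1 / 2 * D.N (t + p)))) k one_pos hG.diffContOnCl ?_
  · simpa using this
  intro τ hτ
  have hτ1 : ‖τ‖ = 1 := by simpa using hτ
  rw [norm_exp, ← Real.exp_add]
  apply Real.exp_le_exp.2
  have h1 : (D.N e * τ ^ 2 : ℂ).re ≥ -D.N e := by
    have := neg_abs_le ((D.N e * τ ^ 2 : ℂ).re)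
    have h2 := abs_re_le_norm (D.N e * τ ^ 2 : ℂ)
    rw [norm_mul, norm_pow, hτ1, norm_real, Real.norm_eq_abs, abs_of_nonneg (D.N_nonneg e)] at h2
    linarith
  have h2 : (2 * (D.H (t + p) e).re * τ : ℂ).re ≥ -(2 * |(D.H (t + p) e).re|) := by
    have := neg_abs_le ((2 * (D.H (t + p) e).re * τ : ℂ).re)
    have h2 := abs_re_le_norm (2 * (D.H (t + p) e).re * τ : ℂ)
    rw [norm_mul, norm_mul, hτ1, norm_real, Real.norm_eq_abs] at h2
    simp only [RCLike.norm_ofNat] at h2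
    linarith
  have h3 := D.two_re_le (t + p) e (a := 1 / 2) (by norm_num)
  simp only [neg_re, add_re, ofReal_re]
  rw [show ((1 : ℝ) / 2)⁻¹ = 2 by norm_num] at h3
  linarith

/-- Decay of the windowed Fourier transform of a Gevrey function. -/
lemma oscillatory_decay {s C : ℝ} (hs : 1 < s) (hC : 1 ≤ C) :
    ∃ c C' : ℝ, 0 < c ∧ 0 < C' ∧ ∀ (b : Cn n → ℂ) (M : ℝ), ContDiff ℝ ∞ b → 0 ≤ M →
      (∀ (k : ℕ) x, ‖iteratedFDeriv ℝ k b x‖ ≤ M * C ^ k * (k.factorial : ℝ) ^ s) →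
      ∀ p ζ : Cn n, ‖∫ t, b t * (Real.exp (-D.N (t + p)) : ℂ) *
        cexp (-(2 * (D.H t ζ).re) * I)‖ ≤ M * C' * Real.exp (-(c * ‖ζ‖ ^ (1 / s))) := by
  have hs0 : 0 < s := by linarith
  set E := Real.exp (3 * D.up)
  set Gi := ∫ t : Cn n, Real.exp (-(1 / 2 * D.N t))
  have hGi : 0 ≤ Gi := integral_nonneg fun t => (Real.exp_pos _).le
  have hlo := D.lo_pos
  refine ⟨s / 2 * (D.lo / C) ^ (1 / s), E * (Gi + 1) * 2 ^ s, by positivity, by positivity,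
    fun b M hb hM hbd p ζ => ?_⟩
  set f : Cn n → ℂ := fun t => b t * (Real.exp (-D.N (t + p)) : ℂ) with hfdef
  set g : Cn n → ℂ := fun t => cexp (-(2 * (D.H t ζ).re) * I) with hgdef
  have hgauss : ContDiff ℝ ∞ fun t => (Real.exp (-D.N (t + p)) : ℂ) :=
    ofRealCLM.contDiff.comp ((D.contDiff_N.comp (contDiff_id.add contDiff_const)).neg.exp)
  have hf : ContDiff ℝ ∞ f := hb.mul hgauss
  have hgc : Continuous g := by fun_prop
  have hgn : ∀ t, ‖g t‖ = 1 := fun t => by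
    simp only [hgdef]
    rw [show (-(2 * (D.H t ζ).re) * I : ℂ) = ((-(2 * (D.H t ζ).re) : ℝ) : ℂ) * I by push_cast; ring]
    exact norm_exp_ofReal_mul_I _
  have hgd : ∀ t e, HasFDerivAt g (fderiv ℝ g t) t ∧
      fderiv ℝ g t e = -(2 * (D.H e ζ).re) * I * g t := by
    intro t e
    let ℓ : Cn n →ₗ[ℝ] ℂ :=
          { toFun := fun t => (-(2 * (D.H t ζ).re) * I : ℂ)
            map_add' := fun x y => by
              simp only [map_add, LinearMap.add_apply, add_re]; push_cast; ring
            map_smul' := fun r x => by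
              have : r • x = (r : ℂ) • x := by ext i; simp
              rw [this]
              simp only [map_smul, LinearMap.smul_apply, smul_eq_mul, re_ofReal_mul,
                RingHom.id_apply, real_smul]; push_cast; ring }
    have hlin : HasFDerivAt (fun t => (-(2 * (D.H t ζ).re) * I : ℂ))
        (LinearMap.toContinuousLinearMap ℓ) t := (LinearMap.toContinuousLinearMap ℓ).hasFDerivAt
    have h2 := hlin.cexp
    refine ⟨h2.differentiableAt.hasFDerivAt, ?_⟩
    rw [h2.fderiv]
    simp only [smul_apply, smul_eq_mul, hgdef]
    rw [mul_comm]; rfl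
  have hgdiff : Differentiable ℝ g := fun t => (hgd t 0).1.differentiableAt
  have hGint : Integrable fun t : Cn n => Real.exp (-(1 / 2 * D.N (t + p))) :=
    (D.integrable_gauss (t := 1 / 2) (by norm_num)).comp_add_right p
  have hbound : ∀ e : Cn n, ‖e‖ = 1 → ∀ (k : ℕ) t, ‖dirD e k f t‖ ≤
      M * E * (2 * C) ^ k * (k.factorial : ℝ) ^ s * Real.exp (-(1 / 2 * D.N (t + p))) := by
    intro e he k t
    have h1 := iteratedDeriv_line hf e k t 0
    rw [zero_smul, add_zero] at h1
    have hbl : ContDiff ℝ ∞ fun r : ℝ => b (t + r • e) := by fun_prop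
    have hgl : ContDiff ℝ ∞ fun r : ℝ => (Real.exp (-D.N (t + r • e + p)) : ℂ) :=
      hgauss.comp (by fun_prop : ContDiff ℝ ∞ fun r : ℝ => t + r • e)
    rw [← h1, ← norm_iteratedFDeriv_eq_norm_iteratedDeriv]
    refine (norm_iteratedFDeriv_mul_le hbl hgl 0 (n := k)
      (by exact_mod_cast le_top)).trans ?_
    have hterm : ∀ i ∈ Finset.range (k + 1), (k.choose i : ℝ) *
        ‖iteratedFDeriv ℝ i (fun r : ℝ => b (t + r • e)) 0‖ *
        ‖iteratedFDeriv ℝ (k - i) (fun r : ℝ => (Real.exp (-D.N (t + r • e + p)) : ℂ)) 0‖ ≤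
        (k.choose i : ℝ) * (M * E * C ^ k * (k.factorial : ℝ) ^ s *
          Real.exp (-(1 / 2 * D.N (t + p)))) := by
      intro i hi
      have hik : i ≤ k := Nat.lt_succ_iff.1 (Finset.mem_range.1 hi)
      rw [mul_assoc]
      refine mul_le_mul_of_nonneg_left ?_ (by positivity)
      rw [norm_iteratedFDeriv_eq_norm_iteratedDeriv, norm_iteratedFDeriv_eq_norm_iteratedDeriv,
        iteratedDeriv_line hb]
      have hA : ‖dirD e i b (t + (0 : ℝ) • e)‖ ≤ M * C ^ i * (i.factorial : ℝ) ^ s := by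
        refine (norm_dirD_le hb e i _).trans ?_
        rw [he, one_pow, mul_one]
        exact hbd _ _
      have hB := D.norm_dirD_gauss_le p e t he (k - i)
      -- The Gaussian contributes one factorial only, which is dominated by its power s since s > 1;
      -- so the product stays in the Gevrey class of b.
      have hfac : (i.factorial : ℝ) ^ s * ((k - i).factorial : ℝ) ≤ (k.factorial : ℝ) ^ s := by
        have h1 : (1 : ℝ) ≤ ((k - i).factorial : ℝ) := by
          exact_mod_cast Nat.factorial_pos _
        calc (i.factorial : ℝ) ^ s * ((k - i).factorial : ℝ)
            ≤ (i.factorial : ℝ) ^ s * ((k - i).factorial : ℝ) ^ s := by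
              gcongr
              exact Real.self_le_rpow_of_one_le h1 hs.le
          _ = ((i.factorial * (k - i).factorial : ℕ) : ℝ) ^ s := by
              rw [← Real.mul_rpow (by positivity) (by positivity)]; push_cast; rfl
          _ ≤ (k.factorial : ℝ) ^ s := by
              refine Real.rpow_le_rpow (by positivity) ?_ hs0.le
              exact_mod_cast Nat.le_of_dvd (Nat.factorial_pos _)
                (Nat.factorial_mul_factorial_dvd_factorial hik)
      calc _ ≤ (M * C ^ i * (i.factorial : ℝ) ^ s) *
            ((k - i).factorial * (E * Real.exp (-(1 / 2 * D.N (t + p))))) := by gcongr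
        _ = M * E * C ^ i * ((i.factorial : ℝ) ^ s * (k - i).factorial) *
            Real.exp (-(1 / 2 * D.N (t + p))) := by ring
        _ ≤ M * E * C ^ k * (k.factorial : ℝ) ^ s * Real.exp (-(1 / 2 * D.N (t + p))) := by
            gcongr
    refine (Finset.sum_le_sum hterm).trans (le_of_eq ?_)
    rw [← Finset.sum_mul, ← Nat.cast_sum, Nat.sum_range_choose]
    push_cast; ring
  have hint : ∀ e : Cn n, ‖e‖ = 1 → ∀ (k : ℕ) (g' : Cn n → ℂ) (c' : ℝ), Continuous g' →
      (∀ t, ‖g' t‖ ≤ c') → Integrable fun t => dirD e k f t * g' t := by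
    intro e he k g' c' hg' hn
    refine ((hGint.const_mul (M * E * (2 * C) ^ k * (k.factorial : ℝ) ^ s)).mul_const c').mono'
      ((contDiff_dirD hf e k).continuous.mul hg').aestronglyMeasurable
      (Eventually.of_forall fun t => ?_)
    rw [norm_mul]
    exact mul_le_mul (hbound e he k t) (hn t) (norm_nonneg _) (by positivity)
  -- The phase is an eigenfunction of every directional derivative, so each integration by parts
  -- produces the factor 2i Re H(e,ζ).
  have hparts : ∀ e : Cn n, ‖e‖ = 1 → ∀ k : ℕ, ∫ t, dirD e (k + 1) f t * g t =
      (2 * (D.H e ζ).re) * I * ∫ t, dirD e k f t * g t := by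
    intro e he k
    have hfd : (fun t => fderiv ℝ g t e) = fun t => -(2 * (D.H e ζ).re) * I * g t :=
      funext fun t => (hgd t e).2
    have hg'c : Continuous fun t => fderiv ℝ g t e := by rw [hfd]; fun_prop
    have := integral_mul_fderiv_eq_neg_fderiv_mul_of_integrable (μ := volume) (f := dirD e k f)
      (g := g) (v := e) (hint e he (k + 1) g 1 hgc fun t => (hgn t).le)
      (hint e he k _ (‖(-(2 * (D.H e ζ).re) * I : ℂ)‖) hg'c fun t => by
        rw [(hgd t e).2, norm_mul, hgn, mul_one])
      (hint e he k g 1 hgc fun t => (hgn t).le)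
      (fun t _ => ((contDiff_dirD hf e k).differentiable (by simp)) t) (fun t _ => hgdiff t)
    rw [neg_eq_iff_eq_neg.symm] at this
    rw [show (fun t => dirD e (k + 1) f t * g t) = fun t => fderiv ℝ (dirD e k f) t e * g t from rfl,
      ← this, ← integral_const_mul, ← integral_neg]
    congr 1; ext t
    rw [(hgd t e).2]; ring
  have hpow : ∀ e : Cn n, ‖e‖ = 1 → ∀ k : ℕ, ∫ t, dirD e k f t * g t =
      ((2 * (D.H e ζ).re) * I) ^ k * ∫ t, f t * g t := by
    intro e he k
    induction k with
    | zero => simp [dirD]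
    | succ k ih => rw [hparts e he, ih, pow_succ]; ring
  have hest : ∀ e : Cn n, ‖e‖ = 1 → ∀ k : ℕ, ‖∫ t, f t * g t‖ * |2 * (D.H e ζ).re| ^ k ≤
      M * E * (2 * C) ^ k * (k.factorial : ℝ) ^ s * Gi := by
    intro e he k
    have h1 : ‖∫ t, dirD e k f t * g t‖ ≤ ∫ t, M * E * (2 * C) ^ k * (k.factorial : ℝ) ^ s *
        Real.exp (-(1 / 2 * D.N (t + p))) := by
      refine norm_integral_le_of_norm_le (hGint.const_mul _) (Eventually.of_forall fun t => ?_)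
      rw [norm_mul, hgn, mul_one]
      exact hbound e he k t
    rw [hpow e he k, integral_const_mul,
      integral_add_right_eq_self (fun t => Real.exp (-(1 / 2 * D.N t))) p, norm_mul, norm_pow,
      mul_comm] at h1
    convert h1 using 3
    simp
  have hfin : ∀ N : ℕ, ‖∫ t, f t * g t‖ * (D.lo / C * ‖ζ‖) ^ N ≤
      M * E * (Gi + 1) * (N.factorial : ℝ) ^ s := by
    intro N
    -- At ζ = 0 there is no distinguished direction; only N = 0 carries information, and it is the
    -- trivial bound by the mass of the Gaussian.
    rcases eq_or_ne ζ 0 with rfl | hζ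
    · rcases Nat.eq_zero_or_pos N with rfl | hN
      · have h1 : ‖∫ t, f t * g t‖ ≤ ∫ t, M * E * Real.exp (-(1 / 2 * D.N (t + p))) := by
          refine norm_integral_le_of_norm_le (hGint.const_mul _) (Eventually.of_forall fun t => ?_)
          rw [norm_mul, hgn, mul_one]
          have hb0 := hbd 0 t
          simp only [norm_iteratedFDeriv_zero, pow_zero, mul_one, Nat.factorial_zero,
            Nat.cast_one, Real.one_rpow] at hb0
          simp only [hfdef, norm_mul, norm_real, Real.norm_eq_abs, Real.abs_exp]
          have hE1 : 1 ≤ E := Real.one_le_exp (by have := D.up_pos; positivity)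
          have : Real.exp (-D.N (t + p)) ≤ Real.exp (-(1 / 2 * D.N (t + p))) := by
            apply Real.exp_le_exp.2; linarith [D.N_nonneg (t + p)]
          calc ‖b t‖ * Real.exp (-D.N (t + p)) ≤ M * Real.exp (-(1 / 2 * D.N (t + p))) := by gcongr
            _ = M * 1 * Real.exp (-(1 / 2 * D.N (t + p))) := by ring
            _ ≤ _ := by gcongr
        rw [integral_const_mul,
          integral_add_right_eq_self (fun t => Real.exp (-(1 / 2 * D.N t))) p] at h1
        simp only [norm_zero, mul_zero, pow_zero, mul_one, Nat.factorial_zero, Nat.cast_one,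
          Real.one_rpow]
        refine h1.trans ?_
        gcongr
        linarith
      · simp only [norm_zero, mul_zero, zero_pow hN.ne']
        positivity
    · have hζ0 : 0 < ‖ζ‖ := norm_pos_iff.2 hζ
      -- In the direction of ζ the phase oscillates fastest: 2 Re H(e,ζ) = 2N(ζ)/|ζ| ≥ 2 `D.lo` |ζ|.
      -- This is the source of the constant `D.lo` / C.
      set e : Cn n := ((‖ζ‖⁻¹ : ℝ) : ℂ) • ζ
      have he : ‖e‖ = 1 := by simp [e, norm_smul, hζ0.ne']
      have h1 := hest e he N
      have h2 : |2 * (D.H e ζ).re| = 2 * (‖ζ‖⁻¹ * D.N ζ) := by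
        simp only [e, map_smul, LinearMap.smul_apply, smul_eq_mul, re_ofReal_mul]
        rw [abs_of_nonneg]
        · rfl
        · have := D.N_nonneg ζ
          have h : (D.H ζ ζ).re = D.N ζ := rfl
          rw [h]; positivity
      have h3 : 2 * (D.lo * ‖ζ‖) ≤ 2 * (‖ζ‖⁻¹ * D.N ζ) := by
        have := D.lo_le ζ
        refine mul_le_mul_of_nonneg_left ?_ two_pos.le
        calc D.lo * ‖ζ‖ = ‖ζ‖⁻¹ * (D.lo * ‖ζ‖ ^ 2) := by field_simp
          _ ≤ _ := by gcongr
      rw [h2] at h1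
      have h4 : ‖∫ t, f t * g t‖ * (2 * (D.lo * ‖ζ‖)) ^ N ≤
          M * E * (2 * C) ^ N * (N.factorial : ℝ) ^ s * Gi :=
        le_trans (by gcongr) h1
      have hC0 : 0 < C := by linarith
      have h5 : (2 * (D.lo * ‖ζ‖)) ^ N = (2 * C) ^ N * (D.lo / C * ‖ζ‖) ^ N := by
        rw [← mul_pow]; congr 1; field_simp
      rw [h5] at h4
      have h6 : (0 : ℝ) < (2 * C) ^ N := by positivity
      refine le_of_mul_le_mul_left ?_ h6
      calc (2 * C) ^ N * (‖∫ t, f t * g t‖ * (D.lo / C * ‖ζ‖) ^ N)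
          = ‖∫ t, f t * g t‖ * ((2 * C) ^ N * (D.lo / C * ‖ζ‖) ^ N) := by ring
        _ ≤ M * E * (2 * C) ^ N * (N.factorial : ℝ) ^ s * Gi := h4
        _ ≤ M * E * (2 * C) ^ N * (N.factorial : ℝ) ^ s * (Gi + 1) := by gcongr; linarith
        _ = _ := by ring
  have := le_exp_of_forall_mul_pow_le hs (norm_nonneg _) (by positivity) (by positivity) hfin
  refine this.trans (le_of_eq ?_)
  rw [Real.mul_rpow (by positivity) (norm_nonneg _)]
  ring_nf

end QData

/-! ### Fourier inversion and the wave packet decomposition. -/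

/-- Uniqueness of Haar measure. The value of the constant is irrelevant later, so no determinant is
computed. -/
lemma exists_integral_comp_equiv {E F : Type*} [NormedAddCommGroup E] [NormedSpace ℝ E]
    [FiniteDimensional ℝ E] [MeasurableSpace E] [BorelSpace E]
    [NormedAddCommGroup F] [NormedSpace ℝ F] [FiniteDimensional ℝ F] [MeasurableSpace F]
    [BorelSpace F] (μ : Measure E) [μ.IsAddHaarMeasure] (ν : Measure F) [ν.IsAddHaarMeasure]
    (L : E ≃L[ℝ] F) : ∃ c : ℝ, 0 < c ∧ (∀ g : F → ℂ, ∫ y, g (L y) ∂μ = c * ∫ x, g x ∂ν) ∧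
      ∀ g : F → ℂ, Integrable g ν → Integrable (fun y => g (L y)) μ := by
  have hm : (μ.map L).IsAddHaarMeasure := L.isAddHaarMeasure_map μ
  have he : μ.map L = (μ.map L).addHaarScalarFactor ν • ν :=
    Measure.isAddLeftInvariant_eq_smul _ _
  have hpos : 0 < (μ.map L).addHaarScalarFactor ν :=
    Measure.addHaarScalarFactor_pos_of_isAddHaarMeasure _ _
  have hme : MeasurableEmbedding L := L.toHomeomorph.measurableEmbedding
  refine ⟨(μ.map L).addHaarScalarFactor ν, by exact_mod_cast hpos, fun g => ?_, fun g hg => ?_⟩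
  · rw [← hme.integral_map]
    conv_lhs => rw [he]
    rw [integral_smul_nnreal_measure]
    rfl
  · have h1 : Integrable g (μ.map L) := by
      rw [he]
      exact hg.smul_measure_nnreal
    exact (hme.integrable_map_iff).1 h1

namespace QData

variable {n : ℕ} (D : QData n)

/-- The Fourier transform with respect to the real scalar product `2 Re H`. -/
def hat (f : Cn n → ℂ) (ζ : Cn n) : ℂ := ∫ t, f t * cexp (-(2 * (D.H t ζ).re) * I)

open scoped FourierTransform RealInnerProductSpace in
/-- Fourier inversion. -/
lemma exists_fourier_inversion : ∃ c : ℝ, 0 < c ∧ ∀ f : Cn n → ℂ, Continuous f → Integrable f →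
    Integrable (D.hat f) → ∀ m, f m = c * ∫ ζ, D.hat f ζ * cexp (2 * (D.H m ζ).re * I) := by
  let E := EuclideanSpace ℝ (Fin (Module.finrank ℝ (Cn n)))
  let T : E ≃L[ℝ] Cn n := toEuclidean.symm
  let b := EuclideanSpace.basisFun (Fin (Module.finrank ℝ (Cn n))) ℝ
  have hsmul : ∀ (r : ℝ) (x : Cn n), r • x = (r : ℂ) • x := fun r x => by ext i; simp
  -- The Riesz representative of y ↦ Re H(Ty,ζ)/π: it turns the Euclidean phase 2π⟨·,·⟩ into 2 Re H,
  -- and it is injective because H is positive definite.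
  let S₀ : Cn n →ₗ[ℝ] E :=
    { toFun := fun ζ => ∑ i, ((D.H (T (b i)) ζ).re / Real.pi) • b i
      map_add' := fun x y => by
        simp only [map_add, add_re, add_div, add_smul, Finset.sum_add_distrib]
      map_smul' := fun r x => by
        simp only [hsmul, map_smulₛₗ, conj_ofReal, smul_eq_mul, re_ofReal_mul, RingHom.id_apply,
          mul_div_assoc, Finset.smul_sum, smul_smul] }
  have hS₀ : ∀ ζ y, ⟪S₀ ζ, y⟫ = (D.H (T y) ζ).re / Real.pi := by
    intro ζ y
    have h1 : ⟪S₀ ζ, y⟫ = ∑ i, ((D.H (T (b i)) ζ).re / Real.pi) * ⟪b i, y⟫ := by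
      simp only [S₀, LinearMap.coe_mk, AddHom.coe_mk]
      rw [sum_inner]
      exact Finset.sum_congr rfl fun i _ => real_inner_smul_left _ _ _
    have h2 : T y = ∑ i, ((⟪b i, y⟫ : ℝ) : ℂ) • T (b i) := by
      conv_lhs => rw [← b.sum_repr' y, map_sum]
      exact Finset.sum_congr rfl fun i _ => by rw [map_smul, hsmul]
    rw [h1, h2]
    simp only [map_sum, LinearMap.sum_apply, map_smul, LinearMap.smul_apply, smul_eq_mul,
      re_sum, re_ofReal_mul, Finset.sum_div]
    exact Finset.sum_congr rfl fun i _ => by ring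
  have hinj : Function.Injective S₀ := by
    rw [injective_iff_map_eq_zero]
    intro ζ h
    have := hS₀ ζ (T.symm ζ)
    rw [h, inner_zero_left, T.apply_symm_apply] at this
    by_contra hne
    have h2 := D.pos ζ hne
    have h3 := div_pos h2 Real.pi_pos
    linarith
  let S : Cn n ≃L[ℝ] E :=
    (LinearMap.linearEquivOfInjective S₀ hinj (by simp [E])).toContinuousLinearEquiv
  have hS : ∀ ζ y, ⟪S ζ, y⟫ = (D.H (T y) ζ).re / Real.pi := hS₀
  obtain ⟨cT, hcT, hT, hT'⟩ := exists_integral_comp_equiv (volume : Measure E)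
    (volume : Measure (Cn n)) T
  obtain ⟨cS, hcS, hSi, -⟩ := exists_integral_comp_equiv (volume : Measure (Cn n))
    (volume : Measure E) S
  obtain ⟨-, -, -, hS'⟩ := exists_integral_comp_equiv (volume : Measure E)
    (volume : Measure (Cn n)) S.symm
  refine ⟨cT / cS, by positivity, fun f hf hfi hhat m => ?_⟩
  have hpi : (Real.pi : ℝ) ≠ 0 := Real.pi_ne_zero
  have hF : ∀ ζ, 𝓕 (fun y => f (T y)) (S ζ) = cT * D.hat f ζ := by
    intro ζ
    rw [Real.fourier_eq', hat, ← hT]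
    congr 1; ext y
    rw [smul_eq_mul, mul_comm, real_inner_comm, hS]
    congr 3
    field_simp
    push_cast; ring
  have hFi : Integrable (𝓕 (fun y => f (T y))) := by
    have := hS' _ (hhat.const_mul (cT : ℂ))
    refine this.congr (Eventually.of_forall fun η => ?_)
    simp only [← hF, ContinuousLinearEquiv.apply_symm_apply]
  have hinv := congrFun (Continuous.fourierInv_fourier_eq (hf.comp T.continuous)
    (hT' f hfi) hFi) (T.symm m)
  simp only [Function.comp_def, T.apply_symm_apply] at hinv
  rw [← hinv, Real.fourierInv_eq']
  have h2 := hSi fun η => cexp (((2 * Real.pi * ⟪η, T.symm m⟫ : ℝ) : ℂ) * I) •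
    𝓕 (fun y => f (T y)) η
  have h3 : (∫ ζ, cexp (((2 * Real.pi * ⟪S ζ, T.symm m⟫ : ℝ) : ℂ) * I) •
      𝓕 (fun y => f (T y)) (S ζ)) = cT * ∫ ζ, D.hat f ζ * cexp (2 * (D.H m ζ).re * I) := by
    rw [← integral_const_mul]
    congr 1; ext ζ
    rw [hF, hS, T.apply_symm_apply, smul_eq_mul]
    rw [show 2 * Real.pi * ((D.H m ζ).re / Real.pi) = 2 * (D.H m ζ).re by field_simp]
    push_cast; ring
  have hcS' : (cS : ℂ) ≠ 0 := by exact_mod_cast hcS.ne'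
  have h4 : ∀ X Y Z : ℂ, Y = cS * Z → Y = cT * X → Z = (cT / cS : ℝ) * X := by
    intro X Y Z h h'
    push_cast
    rw [div_mul_eq_mul_div, ← h', h]
    field_simp
  exact h4 _ _ _ h2 h3

/-- The short time Fourier transform with Gaussian window. -/
def stft (α : Cn n → ℂ) (k ζ : Cn n) : ℂ :=
  ∫ m, α (m + k) * (Real.exp (-D.N m) : ℂ) * cexp (-(2 * (D.H (m + k) ζ).re) * I)

/-- The amplitude of the wave packet decomposition. -/
def amp (α : Cn n → ℂ) (y : Cn n) (w : Cn n × Cn n) : ℂ :=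
  D.stft α (y - w.1) w.2 * cexp (2 * (D.H y w.2).re * I) * (Real.exp (-D.N w.1) : ℂ)

lemma norm_cexp_two_re (x y : Cn n) : ‖cexp (2 * (D.H x y).re * I)‖ = 1 := by
  rw [show (2 * (D.H x y).re * I : ℂ) = ((2 * (D.H x y).re : ℝ) : ℂ) * I by push_cast; ring]
  exact norm_exp_ofReal_mul_I _

lemma norm_cexp_neg_two_re (x y : Cn n) : ‖cexp (-(2 * (D.H x y).re) * I)‖ = 1 := by
  rw [show (-(2 * (D.H x y).re) * I : ℂ) = ((-(2 * (D.H x y).re) : ℝ) : ℂ) * I by push_cast; ring]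
  exact norm_exp_ofReal_mul_I _

lemma continuous_stft {X : Type*} [TopologicalSpace X] [FirstCountableTopology X] {α : Cn n → ℂ}
    (hα : Continuous α) {M : ℝ} (hM : ∀ x, ‖α x‖ ≤ M) {f g : X → Cn n} (hf : Continuous f)
    (hg : Continuous g) : Continuous fun x => D.stft α (f x) (g x) := by
  unfold stft
  refine continuous_of_dominated (bound := fun m => M * Real.exp (-(1 * D.N m)))
    (fun p => Continuous.aestronglyMeasurable (by fun_prop)) (fun p => Eventually.of_forall
      fun m => ?_) ((D.integrable_gauss one_pos).const_mul _)
    (Eventually.of_forall fun m => by fun_prop)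
  rw [norm_mul, norm_mul, norm_cexp_neg_two_re, mul_one, norm_real, Real.norm_eq_abs,
    Real.abs_exp, one_mul]
  gcongr
  exact hM _

/-- Centring the integral at y cancels the two phases in y. The amplitude becomes a windowed Fourier
transform of the translate α(· + y), so that `oscillatory_decay` applies to α(· + y) and, for the
Lipschitz bound, to differences of translates. -/
lemma amp_eq (α : Cn n → ℂ) (y : Cn n) (w : Cn n × Cn n) :
    D.amp α y w = (∫ t, α (t + y) * (Real.exp (-D.N (t + w.1)) : ℂ) *
      cexp (-(2 * (D.H t w.2).re) * I)) * (Real.exp (-D.N w.1) : ℂ) := by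
  rw [amp, stft]
  congr 1
  rw [← integral_mul_const, ← integral_add_right_eq_self _ w.1]
  congr 1; ext t
  rw [show t + w.1 + (y - w.1) = t + y by abel, mul_assoc _ (cexp _) (cexp _), ← Complex.exp_add]
  congr 2
  simp only [map_add, LinearMap.add_apply, add_re]
  push_cast; ring

lemma stft_eq_hat (α : Cn n → ℂ) (k ζ : Cn n) :
    D.stft α k ζ = D.hat (fun t => α t * (Real.exp (-D.N (t - k)) : ℂ)) ζ := by
  rw [stft, hat]
  conv_rhs => rw [← integral_add_right_eq_self _ k]
  congr 1; ext t
  rw [add_sub_cancel_right]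

/-- The weight `e^{-N(p)} e^{-c|ζ|^{1/s}}` by which amplitudes are estimated. -/
def damp (s c : ℝ) (w : Cn n × Cn n) : ℝ :=
  Real.exp (-D.N w.1) * Real.exp (-(c * ‖w.2‖ ^ (1 / s)))

/-- The estimates of the amplitude of a bounded Gevrey function. -/
lemma exists_amp_bound {s : ℝ} (hs : 1 < s) {α : Cn n → ℂ} (hα : GevreyBounded s α) :
    ∃ c K : ℝ, 0 < c ∧ 0 < K ∧ (∀ y w, ‖D.amp α y w‖ ≤ K * D.damp s c w) ∧
      (∀ y y' w, ‖D.amp α y w - D.amp α y' w‖ ≤ K * D.damp s c w * ‖y - y'‖) ∧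
      ∀ k ζ, ‖D.stft α k ζ‖ ≤ K * Real.exp (-(c * ‖ζ‖ ^ (1 / s))) := by
  obtain ⟨hsm, C, hC, hb⟩ := hα
  have hs0 : 0 < s := by linarith
  -- The Lipschitz bound uses one more derivative than the size bound; the loss (k+1)!^s ≤ (2^s)^k
  -- k!^s is absorbed by the factor 2^s.
  set C₁ := max C 1 * 2 ^ s
  have h2s : (1 : ℝ) ≤ 2 ^ s := Real.one_le_rpow (by norm_num) hs0.le
  have hC1 : 1 ≤ C₁ := one_le_mul_of_one_le_of_one_le (le_max_right _ _) h2s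
  have hCC1 : C ≤ C₁ := (le_max_left C 1).trans (le_mul_of_one_le_right (by positivity) h2s)
  obtain ⟨c, C', hc, hC', hdec⟩ := D.oscillatory_decay (s := s) (C := C₁) hs hC1
  have htr : ∀ (k : ℕ) (y x : Cn n), iteratedFDeriv ℝ k (fun t => α (t + y)) x =
      iteratedFDeriv ℝ k α (x + y) := fun k y x => iteratedFDeriv_comp_add_right k y x
  have hsmt : ∀ y : Cn n, ContDiff ℝ ∞ fun t => α (t + y) := fun y => by fun_prop
  have hb1 : ∀ y : Cn n, ∀ (k : ℕ) x, ‖iteratedFDeriv ℝ k (fun t => α (t + y)) x‖ ≤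
      C * C₁ ^ k * (k.factorial : ℝ) ^ s := by
    intro y k x
    rw [htr]
    refine (hb k _).trans ?_
    rw [pow_add, pow_one]
    gcongr
  have hb2 : ∀ y y' : Cn n, ∀ (k : ℕ) x,
      ‖iteratedFDeriv ℝ k (fun t => α (t + y) - α (t + y')) x‖ ≤
      C ^ 2 * ‖y - y'‖ * C₁ ^ k * (k.factorial : ℝ) ^ s := by
    intro y y' k x
    rw [fun_iteratedFDeriv_sub_apply ((hsmt y).contDiffAt.of_le (by exact_mod_cast le_top))
      ((hsmt y').contDiffAt.of_le (by exact_mod_cast le_top)), htr, htr]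
    have hlip := (convex_univ (𝕜 := ℝ) (E := Cn n)).norm_image_sub_le_of_norm_fderiv_le (𝕜 := ℝ)
      (f := iteratedFDeriv ℝ k α)
      (C := C ^ (1 + (k + 1)) * ((k + 1).factorial : ℝ) ^ s) (x := x + y') (y := x + y)
      (fun z _ => (hsm.differentiable_iteratedFDeriv (m := k)
        (by exact_mod_cast WithTop.coe_lt_top _)) z)
      (fun z _ => by rw [norm_fderiv_iteratedFDeriv]; exact hb (k + 1) z)
      (Set.mem_univ _) (Set.mem_univ _)
    refine hlip.trans ?_
    rw [add_sub_add_left_eq_sub]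
    have h1 : ((k + 1).factorial : ℝ) ^ s ≤ (2 ^ s) ^ k * (k.factorial : ℝ) ^ s := by
      rw [← Real.rpow_natCast, ← Real.rpow_mul (by norm_num), mul_comm s, Real.rpow_mul (by norm_num),
        Real.rpow_natCast, ← Real.mul_rpow (by positivity) (by positivity)]
      refine Real.rpow_le_rpow (by positivity) ?_ hs0.le
      have : k + 1 ≤ 2 ^ k := Nat.lt_two_pow_self
      rw [Nat.factorial_succ]
      push_cast
      have h' : (k + 1 : ℝ) ≤ 2 ^ k := by exact_mod_cast this
      gcongr
    calc C ^ (1 + (k + 1)) * ((k + 1).factorial : ℝ) ^ s * ‖y - y'‖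
        ≤ C ^ (1 + (k + 1)) * ((2 ^ s) ^ k * (k.factorial : ℝ) ^ s) * ‖y - y'‖ := by gcongr
      _ = C ^ 2 * ‖y - y'‖ * (C ^ k * (2 ^ s) ^ k) * (k.factorial : ℝ) ^ s := by ring
      _ ≤ C ^ 2 * ‖y - y'‖ * C₁ ^ k * (k.factorial : ℝ) ^ s := by
        rw [← mul_pow]
        have h3 : (C * 2 ^ s) ^ k ≤ C₁ ^ k := pow_le_pow_left₀ (by positivity)
          (mul_le_mul_of_nonneg_right (le_max_left _ _) (by positivity)) k
        gcongr
  have hint : ∀ y p ζ : Cn n, Integrable fun t => α (t + y) * (Real.exp (-D.N (t + p)) : ℂ) *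
      cexp (-(2 * (D.H t ζ).re) * I) := by
    intro y p ζ
    have hc := hsm.continuous
    refine ((((D.integrable_gauss one_pos).comp_add_right p)).const_mul C).mono'
      (Continuous.aestronglyMeasurable (by fun_prop)) (Eventually.of_forall fun t => ?_)
    rw [norm_mul, norm_mul, norm_cexp_neg_two_re, mul_one, norm_real, Real.norm_eq_abs,
      Real.abs_exp, one_mul]
    gcongr
    simpa using hb 0 (t + y)
  have hA : ∀ y w, ‖D.amp α y w‖ ≤ C * C' * D.damp s c w := by
    intro y w
    rw [amp_eq, norm_mul, norm_real, Real.norm_eq_abs, Real.abs_exp, damp]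
    calc _ ≤ C * C' * Real.exp (-(c * ‖w.2‖ ^ (1 / s))) * Real.exp (-D.N w.1) := by
          gcongr
          exact hdec _ C (hsmt y) hC.le (hb1 y) w.1 w.2
      _ = _ := by ring
  have hdpos : ∀ w, 0 ≤ D.damp s c w := fun w => by unfold damp; positivity
  refine ⟨c, C * C' + C ^ 2 * C', hc, by positivity, fun y w => (hA y w).trans ?_,
    fun y y' w => ?_, fun k ζ => ?_⟩
  · have := hdpos w
    gcongr
    simp only [le_add_iff_nonneg_right]; positivity
  · have h0 := hdec (fun t => α (t + y) - α (t + y')) (C ^ 2 * ‖y - y'‖)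
      ((hsmt y).sub (hsmt y')) (by positivity) (hb2 y y') w.1 w.2
    have he : D.amp α y w - D.amp α y' w = (∫ t, (α (t + y) - α (t + y')) *
        (Real.exp (-D.N (t + w.1)) : ℂ) * cexp (-(2 * (D.H t w.2).re) * I)) *
        (Real.exp (-D.N w.1) : ℂ) := by
      rw [amp_eq, amp_eq, ← sub_mul, ← integral_sub (hint _ _ _) (hint _ _ _)]
      congr 2; ext t; ring
    rw [he, norm_mul, norm_real, Real.norm_eq_abs, Real.abs_exp]
    have := hdpos w
    calc _ ≤ C ^ 2 * ‖y - y'‖ * C' * Real.exp (-(c * ‖w.2‖ ^ (1 / s))) * Real.exp (-D.N w.1) := by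
          gcongr
      _ = C ^ 2 * C' * D.damp s c w * ‖y - y'‖ := by unfold damp; ring
      _ ≤ _ := by
          gcongr
          simp only [le_add_iff_nonneg_left]; positivity
  -- At p = 0 and y = k the window factor and the phase have modulus 1, so the amplitude has the
  -- size of the transform itself.
  · have h0 := hA k (0, ζ)
    rw [amp, norm_mul, norm_mul, norm_cexp_two_re] at h0
    simp only [damp, sub_zero, N_zero, neg_zero, Real.exp_zero, ofReal_one, norm_one, mul_one,
      one_mul] at h0
    refine h0.trans ?_
    gcongr
    simp only [le_add_iff_nonneg_right]; positivity

lemma integrable_damp {s c : ℝ} (hs : 1 < s) (hc : 0 < c) : Integrable (D.damp s c) := by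
  have h1 := D.integrable_gauss one_pos
  simp only [one_mul] at h1
  exact h1.mul_prod (integrable_exp_neg_rpow (μ := (volume : Measure (Cn n))) hc
    (r := 1 / s) (by positivity))

lemma damp_nonneg (s c : ℝ) (w : Cn n × Cn n) : 0 ≤ D.damp s c w := by unfold damp; positivity

lemma continuous_amp {X : Type*} [TopologicalSpace X] [FirstCountableTopology X] {α : Cn n → ℂ}
    (hα : Continuous α) {M : ℝ} (hM : ∀ x, ‖α x‖ ≤ M) {f : X → Cn n} {g : X → Cn n × Cn n}
    (hf : Continuous f) (hg : Continuous g) : Continuous fun x => D.amp α (f x) (g x) := by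
  unfold amp
  have := D.continuous_stft hα hM (f := fun x => f x - (g x).1) (g := fun x => (g x).2)
    (by fun_prop) (by fun_prop)
  fun_prop

/-- The wave packet decomposition of a bounded Gevrey function. -/
lemma exists_amp_inversion : ∃ c₂ : ℝ, 0 < c₂ ∧ ∀ (s : ℝ) (α : Cn n → ℂ), 1 < s →
    GevreyBounded s α → ∀ y, α y = c₂ * ∫ w, D.amp α y w := by
  obtain ⟨c₁, hc₁, hinv⟩ := D.exists_fourier_inversion
  -- The window is used twice, in the transform centred at y - p and in the synthesis; κ is the
  -- integral of its square.
  set κ : ℝ := ∫ p : Cn n, Real.exp (-(2 * D.N p))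
  have hκ : 0 < κ := by
    have := D.integral_gauss 2 two_pos
    have h2 : κ = Real.pi ^ n / (2 ^ n * D.vol) := this
    rw [h2]
    have := D.vol_pos; have := Real.pi_pos; positivity
  refine ⟨c₁ / κ, by positivity, fun s α hs hα y => ?_⟩
  obtain ⟨c, K, hc, hK, hamp, -, hst⟩ := D.exists_amp_bound hs hα
  obtain ⟨hsm, C, hC, hb⟩ := hα
  have hcont := hsm.continuous
  have hM : ∀ x, ‖α x‖ ≤ C := fun x => by simpa using hb 0 x
  -- For fixed p, this is Fourier inversion at y of α times the window centred at y - p.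
  have hp : ∀ p : Cn n, α y * (Real.exp (-(2 * D.N p)) : ℂ) =
      c₁ * ∫ ζ, D.amp α y (p, ζ) := by
    intro p
    have h1 := hinv (fun t => α t * (Real.exp (-D.N (t - (y - p))) : ℂ)) (by fun_prop) ?_ ?_ y
    · simp only [← stft_eq_hat, sub_sub_cancel] at h1
      simp only [amp]
      rw [integral_mul_const, ← mul_assoc, ← h1, mul_assoc, ← ofReal_mul, ← Real.exp_add]
      congr 3; ring
    · refine ((((D.integrable_gauss one_pos).comp_sub_right (y - p))).const_mul C).mono'
        (Continuous.aestronglyMeasurable (by fun_prop)) (Eventually.of_forall fun t => ?_)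
      rw [norm_mul, norm_real, Real.norm_eq_abs, Real.abs_exp, one_mul]
      gcongr
      exact hM t
    · rw [show D.hat (fun t => α t * (Real.exp (-D.N (t - (y - p))) : ℂ)) =
        fun ζ => D.stft α (y - p) ζ from funext fun ζ => (D.stft_eq_hat α (y - p) ζ).symm]
      refine ((integrable_exp_neg_rpow (μ := (volume : Measure (Cn n))) hc
        (r := 1 / s) (by positivity)).const_mul K).mono'
        (Continuous.aestronglyMeasurable ?_) (Eventually.of_forall fun ζ => hst _ ζ)
      exact D.continuous_stft hcont hM continuous_const continuous_id
  have hint : Integrable (fun w => D.amp α y w) := by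
    refine ((D.integrable_damp hs hc).const_mul K).mono' (Continuous.aestronglyMeasurable ?_)
      (Eventually.of_forall fun w => hamp y w)
    exact D.continuous_amp hcont hM continuous_const continuous_id
  have h2 : ∫ w, D.amp α y w = ∫ p, ∫ ζ, D.amp α y (p, ζ) := integral_prod _ hint
  have hc₁' : (c₁ : ℂ) ≠ 0 := by exact_mod_cast hc₁.ne'
  have hκ' : (κ : ℂ) ≠ 0 := by exact_mod_cast hκ.ne'
  have h3 : c₁ * ∫ w, D.amp α y w = α y * κ := by
    rw [h2, ← integral_const_mul, ← integral_complex_ofReal, ← integral_const_mul]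
    simp only [hp]
  push_cast
  rw [div_mul_eq_mul_div, h3]
  field_simp

end QData

/-! ### Parameter integrals: affine changes of variables, holomorphy, Young's inequality. -/

lemma finrank_real_Cn (n : ℕ) : Module.finrank ℝ (Cn n) = 2 * n := by
  rw [Module.finrank_pi_fintype]
  simp [Complex.finrank_real_complex, mul_comm]

/-- An affine change of the first variable, depending on the second one. -/
lemma integral_comp_affine_fst {n : ℕ} {G : Cn n × Cn n → ℂ} (hG : Continuous G)
    (hGi : Integrable G) {a : Cn n → Cn n} (ha : Continuous a) {R : ℝ} (hR : 0 < R) :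
    Integrable (fun w : Cn n × Cn n => G (a w.2 - R • w.1, w.2)) ∧
      ∫ w : Cn n × Cn n, G (a w.2 - R • w.1, w.2) = ((R ^ (2 * n))⁻¹ : ℝ) * ∫ w, G w := by
  have hsub : ∀ (F : Cn n → ℂ) (b : Cn n), ∫ p : Cn n, F (b - R • p) =
      ((R ^ (2 * n))⁻¹ : ℝ) * ∫ p, F p := by
    intro F b
    rw [Measure.integral_comp_smul volume (fun p => F (b - p)) R, integral_sub_left_eq_self,
      finrank_real_Cn, abs_of_pos (by positivity), real_smul]
  have hsubR : ∀ (F : Cn n → ℝ) (b : Cn n), ∫ p : Cn n, F (b - R • p) =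
      ((R ^ (2 * n))⁻¹ : ℝ) * ∫ p, F p := by
    intro F b
    rw [Measure.integral_comp_smul volume (fun p => F (b - p)) R, integral_sub_left_eq_self,
      finrank_real_Cn, abs_of_pos (by positivity), smul_eq_mul]
  have hGi' : Integrable G ((volume : Measure (Cn n)).prod volume) := hGi
  have hc : Continuous fun w : Cn n × Cn n => G (a w.2 - R • w.1, w.2) := by fun_prop
  have hi : Integrable (fun w : Cn n × Cn n => G (a w.2 - R • w.1, w.2))
      ((volume : Measure (Cn n)).prod volume) := by
    rw [integrable_prod_iff' hc.aestronglyMeasurable]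
    rw [integrable_prod_iff' hG.aestronglyMeasurable] at hGi'
    refine ⟨hGi'.1.mono fun y hy => ?_, ?_⟩
    · exact ((integrable_comp_smul_iff volume (fun p => G (a y - p, y)) hR.ne').2
        (hy.comp_sub_left (a y)))
    · simp only [fun y => hsubR (fun p => ‖G (p, y)‖) (a y)]
      exact hGi'.2.const_mul _
  refine ⟨hi, ?_⟩
  have e1 : ∫ w : Cn n × Cn n, G (a w.2 - R • w.1, w.2) =
      ∫ y, ∫ p, G (a y - R • p, y) := integral_prod_symm _ hi
  have e2 : ∫ w : Cn n × Cn n, G w = ∫ y, ∫ p, G (p, y) := integral_prod_symm _ hGi'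
  rw [e1, e2, ← integral_const_mul]
  congr 1; ext y
  exact hsub (fun p => G (p, y)) (a y)

/-- Integrals of holomorphic functions depending on a parameter are holomorphic. -/
lemma differentiable_integral_of_dominated {n : ℕ} {Ω : Type*} [MeasurableSpace Ω]
    [TopologicalSpace Ω] [OpensMeasurableSpace Ω] [SecondCountableTopology Ω] {μ : Measure Ω}
    {F : Cn n → Ω → ℂ} (hc : Continuous (Function.uncurry F))
    (hd : ∀ w, Differentiable ℂ fun x => F x w)
    (hb : ∀ x₀, ∃ b : Ω → ℝ, Integrable b μ ∧ ∀ x ∈ Metric.ball x₀ 1, ∀ w, ‖F x w‖ ≤ b w) :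
    Differentiable ℂ fun x => ∫ w, F x w ∂μ := by
  intro x₀
  obtain ⟨b, hbi, hb⟩ := hb x₀
  have hFm : ∀ x, AEStronglyMeasurable (F x) μ := fun x =>
    (hc.comp (Continuous.prodMk continuous_const continuous_id)).aestronglyMeasurable
  -- Cauchy's estimate on the disc of radius 1/(2|v|): from x in the ball of radius 1/4 the point x
  -- + ζv stays within distance 3/4 of x₀, where the majorant b is available.
  have hcauchy : ∀ w, ∀ x ∈ Metric.ball x₀ (1 / 4), ‖fderiv ℂ (fun x => F x w) x‖ ≤ 2 * b w := by
    intro w x hx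
    have hb0 : 0 ≤ b w := (norm_nonneg _).trans (hb x₀ (Metric.mem_ball_self one_pos) w)
    refine ContinuousLinearMap.opNorm_le_bound _ (by positivity) fun v => ?_
    rcases eq_or_ne v 0 with rfl | hv
    · simp
    have hv0 : 0 < ‖v‖ := norm_pos_iff.2 hv
    have hdl : Differentiable ℂ fun ζ : ℂ => F (x + ζ • v) w :=
      (hd w).comp ((differentiable_id.smul_const v).const_add x)
    have h1 := norm_deriv_le_of_forall_mem_sphere_norm_le (f := fun ζ : ℂ => F (x + ζ • v) w)
      (c := 0) (R := 1 / (2 * ‖v‖)) (C := b w) (by positivity) hdl.diffContOnCl fun ζ hζ => by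
        apply hb
        have hζ' : ‖ζ‖ = 1 / (2 * ‖v‖) := by simpa using hζ
        rw [Metric.mem_ball, dist_eq_norm] at hx ⊢
        calc ‖x + ζ • v - x₀‖ ≤ ‖x - x₀‖ + ‖ζ • v‖ := by
              rw [add_sub_right_comm]; exact norm_add_le _ _
          _ < 1 / 4 + 1 / 2 := by
              rw [norm_smul, hζ']
              have : 1 / (2 * ‖v‖) * ‖v‖ = 1 / 2 := by field_simp
              linarith
          _ < 1 := by norm_num
    have h2 : HasDerivAt (fun ζ : ℂ => F (x + ζ • v) w) (fderiv ℂ (fun x => F x w) x v) 0 := by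
      have h3 : HasDerivAt (fun ζ : ℂ => x + ζ • v) v 0 := by
        simpa using ((hasDerivAt_id (0 : ℂ)).smul_const v).const_add x
      have h4 : HasFDerivAt (fun x => F x w) (fderiv ℂ (fun x => F x w) x) (x + (0 : ℂ) • v) := by
        rw [zero_smul, add_zero]; exact (hd w x).hasFDerivAt
      exact h4.comp_hasDerivAt 0 h3
    rw [h2.deriv] at h1
    refine h1.trans (le_of_eq ?_)
    field_simp
  have hmeas : Measurable fun w => fderiv ℂ (fun x => F x w) x₀ := by
    have h1 := measurable_fderiv_with_param ℂ (f := fun w x => F x w)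
      (by exact hc.comp continuous_swap)
    exact h1.comp (measurable_id.prodMk measurable_const)
  exact (hasFDerivAt_integral_of_dominated_of_fderiv_le (𝕜 := ℂ)
    (F' := fun x w => fderiv ℂ (fun x => F x w) x) (bound := fun w => 2 * b w)
    (Metric.ball_mem_nhds x₀ (by norm_num : (0 : ℝ) < 1 / 4)) (Eventually.of_forall hFm)
    (hbi.mono' (hFm x₀) (Eventually.of_forall fun w => hb x₀ (Metric.mem_ball_self one_pos) w))
    hmeas.stronglyMeasurable.aestronglyMeasurable
    (Eventually.of_forall fun w x hx => hcauchy w x hx) (hbi.const_mul 2)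
    (Eventually.of_forall fun w x _ => (hd w x).hasFDerivAt)).differentiableAt

/-- Young's inequality for superpositions of translations. -/
lemma integrable_sq_integral_translates {n : ℕ} {Ω : Type*} [MeasurableSpace Ω]
    [TopologicalSpace Ω] [OpensMeasurableSpace Ω] [SecondCountableTopology Ω] {μ : Measure Ω}
    [SigmaFinite μ] {k : Ω → ℝ} {U : Cn n → ℝ} {z : Ω → Cn n} (hk : Continuous k)
    (hU : Continuous U) (hz : Continuous z) (hk0 : ∀ w, 0 ≤ k w) (hU0 : ∀ x, 0 ≤ U x)
    (hki : Integrable k μ) (hU2 : Integrable fun x => U x ^ 2) {M : ℝ} (hM : ∀ x, U x ≤ M) :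
    Integrable (fun x => (∫ w, k w * U (x - z w) ∂μ) ^ 2) ∧
      ∫ x, (∫ w, k w * U (x - z w) ∂μ) ^ 2 ≤ (∫ w, k w ∂μ) ^ 2 * ∫ x, U x ^ 2 := by
  have hM0 : 0 ≤ M := (hU0 0).trans (hM 0)
  have hc2 : Continuous fun q : Cn n × Ω => k q.2 * U (q.1 - z q.2) ^ 2 := by fun_prop
  have hprod : Integrable (fun q : Cn n × Ω => k q.2 * U (q.1 - z q.2) ^ 2)
      ((volume : Measure (Cn n)).prod μ) := by
    rw [integrable_prod_iff' hc2.aestronglyMeasurable]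
    refine ⟨Eventually.of_forall fun w => (hU2.comp_sub_right (z w)).const_mul (k w), ?_⟩
    have : ∀ w, ∫ x, ‖k w * U (x - z w) ^ 2‖ = k w * ∫ x, U x ^ 2 := by
      intro w
      simp only [norm_mul, Real.norm_eq_abs, abs_of_nonneg (hk0 w), abs_pow, sq_abs]
      rw [integral_const_mul, integral_sub_right_eq_self (fun x => U x ^ 2)]
    simp only [this]
    exact hki.mul_const _
  have hi1 : ∀ x, Integrable (fun w => k w * U (x - z w)) μ := fun x =>
    (hki.mul_const M).mono' (Continuous.aestronglyMeasurable (by fun_prop))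
      (Eventually.of_forall fun w => by
        rw [Real.norm_eq_abs, abs_of_nonneg (mul_nonneg (hk0 w) (hU0 _))]
        exact mul_le_mul_of_nonneg_left (hM _) (hk0 w))
  have hi2 : ∀ x, Integrable (fun w => k w * U (x - z w) ^ 2) μ := fun x =>
    (hki.mul_const (M ^ 2)).mono' (Continuous.aestronglyMeasurable (by fun_prop))
      (Eventually.of_forall fun w => by
        rw [Real.norm_eq_abs, abs_of_nonneg (mul_nonneg (hk0 w) (by positivity))]
        exact mul_le_mul_of_nonneg_left (pow_le_pow_left₀ (hU0 _) (hM _) 2) (hk0 w))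
  have hpt : ∀ x, (∫ w, k w * U (x - z w) ∂μ) ^ 2 ≤
      (∫ w, k w ∂μ) * ∫ w, k w * U (x - z w) ^ 2 ∂μ := by
    intro x
    -- Cauchy–Schwarz for the measure k dμ, with k split as √k · √k.
    have h := (integral_mul_le_sqrt (μ := μ) (f := fun w => Real.sqrt (k w))
      (g := fun w => Real.sqrt (k w) * U (x - z w))
      (Continuous.aestronglyMeasurable (by fun_prop)) (Continuous.aestronglyMeasurable
        (by fun_prop)) (fun w => Real.sqrt_nonneg _)
      (fun w => mul_nonneg (Real.sqrt_nonneg _) (hU0 _))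
      (by simpa only [Real.sq_sqrt (hk0 _)] using hki)
      (by simpa only [mul_pow, Real.sq_sqrt (hk0 _)] using hi2 x)).2
    simp only [mul_pow, Real.sq_sqrt (hk0 _), ← mul_assoc, Real.mul_self_sqrt (hk0 _)] at h
    have h0 : 0 ≤ ∫ w, k w * U (x - z w) ∂μ :=
      integral_nonneg fun w => mul_nonneg (hk0 w) (hU0 _)
    calc _ ≤ (Real.sqrt (∫ w, k w ∂μ) * Real.sqrt (∫ w, k w * U (x - z w) ^ 2 ∂μ)) ^ 2 := by
          gcongr
      _ = _ := by
          rw [mul_pow, Real.sq_sqrt (integral_nonneg hk0),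
            Real.sq_sqrt (integral_nonneg fun w => mul_nonneg (hk0 w) (by positivity))]
  have hdom : Integrable fun x => (∫ w, k w ∂μ) * ∫ w, k w * U (x - z w) ^ 2 ∂μ :=
    hprod.integral_prod_left.const_mul _
  have hcont : Continuous fun x => (∫ w, k w * U (x - z w) ∂μ) ^ 2 := by
    refine Continuous.pow ?_ 2
    refine continuous_of_dominated (bound := fun w => k w * M)
      (fun x => (hi1 x).aestronglyMeasurable) (fun x => Eventually.of_forall fun w => ?_)
      (hki.mul_const M) (Eventually.of_forall fun w => by fun_prop)
    rw [Real.norm_eq_abs, abs_of_nonneg (mul_nonneg (hk0 w) (hU0 _))]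
    exact mul_le_mul_of_nonneg_left (hM _) (hk0 w)
  have hint : Integrable fun x => (∫ w, k w * U (x - z w) ∂μ) ^ 2 :=
    hdom.mono' hcont.aestronglyMeasurable (Eventually.of_forall fun x => by
      rw [Real.norm_eq_abs, abs_of_nonneg (sq_nonneg _)]; exact hpt x)
  refine ⟨hint, (integral_mono hint hdom hpt).trans (le_of_eq ?_)⟩
  rw [integral_const_mul, integral_integral_swap hprod]
  have hs : ∀ w, ∫ x, U (x - z w) ^ 2 = ∫ x, U x ^ 2 := fun w =>
    integral_sub_right_eq_self (fun x => U x ^ 2) (z w)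
  simp only [integral_const_mul, hs]
  rw [integral_mul_const]; ring

/-! ### The quantization as a superposition of magnetic translations. -/

namespace QData

variable {n : ℕ} (D : QData n)

/-- The complex translation vector of a wave packet. -/
def zsh (h : ℝ) (w : Cn n × Cn n) : Cn n := ((h / 2 : ℝ) : ℂ) • (w.1 - I • w.2)

@[fun_prop]
lemma continuous_zsh {X : Type*} [TopologicalSpace X] (h : ℝ) {f : X → Cn n × Cn n}
    (hf : Continuous f) : Continuous fun x => zsh h (f x) := by
  unfold zsh; fun_prop

/-- The normalisation constant of the wave packet decomposition. -/
def c₂ : ℝ := D.exists_amp_inversion.choose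

lemma c₂_pos : 0 < D.c₂ := D.exists_amp_inversion.choose_spec.1

lemma amp_inversion {s : ℝ} {α : Cn n → ℂ} (hs : 1 < s) (hα : GevreyBounded s α) (y : Cn n) :
    α y = D.c₂ * ∫ w, D.amp α y w := D.exists_amp_inversion.choose_spec.2 s α hs hα y

/-- The integrand of the operator. -/
def opInt (α : Cn n → ℂ) (h : ℝ) (u : Cn n → ℂ) (x : Cn n) (w : Cn n × Cn n) : ℂ :=
  D.amp α (x - (1 / 2 : ℂ) • zsh h w) w * D.tr h (zsh h w) u x

/-- The quantization of `α`, as a superposition of magnetic translations. -/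
def op (α : Cn n → ℂ) (h : ℝ) (u : Cn n → ℂ) (x : Cn n) : ℂ :=
  ((D.c₂ * (1 + h / 4) ^ n : ℝ) : ℂ) * ∫ w, D.opInt α h u x w

/-- The Weyl quantization of `α`. -/
def weyl (α : Cn n → ℂ) (h : ℝ) (u : Cn n → ℂ) (x : Cn n) : ℂ :=
  ((D.vol / (Real.pi * h) ^ n : ℝ) : ℂ) * ∫ z, α (x - (1 / 2 : ℂ) • z) * D.tr h z u x

/-- The change of variables from the centre `k` of a wave packet. -/
def centre (h : ℝ) (x : Cn n) (q : Cn n × Cn n) : Cn n × Cn n :=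
  (((1 + h / 4)⁻¹ : ℝ) • (x + ((h / 4 : ℝ) * I : ℂ) • q.2) - ((1 + h / 4)⁻¹ : ℝ) • q.1, q.2)

@[fun_prop]
lemma continuous_tr {X : Type*} [TopologicalSpace X] (h : ℝ) {u : Cn n → ℂ} (hu : Continuous u)
    {f g : X → Cn n} (hf : Continuous f) (hg : Continuous g) :
    Continuous fun x => D.tr h (f x) u (g x) := by
  unfold tr; fun_prop

@[fun_prop]
lemma continuous_centre {X : Type*} [TopologicalSpace X] (h : ℝ) {f : X → Cn n}
    {g : X → Cn n × Cn n} (hf : Continuous f) (hg : Continuous g) :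
    Continuous fun x => centre h (f x) (g x) := by
  unfold centre; fun_prop

lemma continuous_opInt {X : Type*} [TopologicalSpace X] [FirstCountableTopology X] {α : Cn n → ℂ}
    (hα : Continuous α) {M : ℝ} (hM : ∀ x, ‖α x‖ ≤ M) (h : ℝ) {u : Cn n → ℂ} (hu : Continuous u)
    {f : X → Cn n} {g : X → Cn n × Cn n} (hf : Continuous f) (hg : Continuous g) :
    Continuous fun x => D.opInt α h u (f x) (g x) := by
  unfold opInt
  have := D.continuous_amp hα hM (f := fun x => f x - (1 / 2 : ℂ) • zsh h (g x)) (g := g)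
    (by fun_prop) hg
  fun_prop

lemma re_smul_eq (r : ℝ) (x : Cn n) : r • x = (r : ℂ) • x := by ext i; simp

/-- The centre of a wave packet is the midpoint of the translation minus the first variable. -/
lemma midpoint_centre {h : ℝ} (hh : 0 < h) (x : Cn n) (q : Cn n × Cn n) :
    x - (1 / 2 : ℂ) • zsh h (centre h x q) - (centre h x q).1 = q.1 := by
  have h1 : (4 + h : ℂ) ≠ 0 := by
    have : (0 : ℝ) < 4 + h := by positivity
    exact_mod_cast this.ne'
  have h2 : (1 + h / 4 : ℂ) ≠ 0 := by
    have : (0 : ℝ) < 1 + h / 4 := by positivity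
    exact_mod_cast this.ne'
  ext i
  simp only [zsh, centre, re_smul_eq, Pi.sub_apply, Pi.smul_apply, Pi.add_apply, smul_eq_mul]
  push_cast
  field_simp
  ring

/-- Once the centre k = q.1 and the frequency are frozen, the antiholomorphic parts of the packet
and of the translation cancel: the exponent retains only H(·,q.2), H(·,q.1) and Q terms in arguments
that are affine and holomorphic in x. The transform α ↦ stft no longer depends on x. -/
lemma opInt_centre {h : ℝ} (hh : 0 < h) (α u : Cn n → ℂ) (x : Cn n) (q : Cn n × Cn n) :
    D.opInt α h u x (centre h x q) = D.stft α q.1 q.2 *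
      cexp (I * D.H (x - (1 / 2 : ℂ) • zsh h (centre h x q)) q.2 + D.H (centre h x q).1 q.1 +
        (2 * D.Q (zsh h (centre h x q)) x - D.Q (zsh h (centre h x q)) (zsh h (centre h x q))) / h) *
      u (x - zsh h (centre h x q)) := by
  have hm := midpoint_centre hh x q
  set w := centre h x q
  have hq : q.2 = w.2 := rfl
  rw [opInt, amp, hm, ← hq, tr, ← mul_assoc, mul_assoc (D.stft α q.1 q.2),
    mul_assoc (D.stft α q.1 q.2), ofReal_exp, ← Complex.exp_add, ← Complex.exp_add]
  congr 3
  have hhc : (h : ℂ) ≠ 0 := by exact_mod_cast hh.ne'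
  have e1 : (2 * (D.H (x - (1 / 2 : ℂ) • zsh h w) q.2).re : ℂ) =
      D.H (x - (1 / 2 : ℂ) • zsh h w) q.2 + D.H q.2 (x - (1 / 2 : ℂ) • zsh h w) := by
    rw [D.herm (x - (1 / 2 : ℂ) • zsh h w) q.2, Complex.add_conj]; push_cast; ring
  rw [e1, ← hm, ofReal_neg, ← H_self]
  simp only [B, zsh, hq, map_sub, map_smulₛₗ, map_add, LinearMap.sub_apply, LinearMap.smul_apply,
    smul_eq_mul, RingHom.id_apply, conj_ofReal, map_div₀, map_one, map_ofNat, conj_I]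
  push_cast
  field_simp
  ring_nf

lemma norm_opInt_le {s c K : ℝ} {α : Cn n → ℂ} (hK : ∀ y w, ‖D.amp α y w‖ ≤ K * D.damp s c w)
    (h : ℝ) (u : Cn n → ℂ) (x : Cn n) (w : Cn n × Cn n) :
    ‖D.opInt α h u x w‖ ≤ K * D.damp s c w *
      (Real.exp (D.wt x / h) *
        (‖u (x - zsh h w)‖ * Real.exp (-D.wt (x - zsh h w) / h))) := by
  have h0 : Real.exp ((D.wt x - D.wt (x - zsh h w)) / h) =
      Real.exp (D.wt x / h) * Real.exp (-(D.wt (x - zsh h w) / h)) := by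
    rw [← Real.exp_add]; congr 1; ring
  rw [opInt, norm_mul, norm_tr, h0, neg_div]
  have h1 := hK (x - (1 / 2 : ℂ) • zsh h w) w
  calc _ ≤ K * D.damp s c w * (Real.exp (D.wt x / h) * Real.exp (-(D.wt (x - zsh h w) / h)) *
        ‖u (x - zsh h w)‖) := by gcongr
    _ = _ := by ring

section

variable {s c K M h : ℝ} {α u : Cn n → ℂ}

/-- The pointwise bound of the normalised function `|u| e^{-Φ/h}`. -/
lemma exists_bound_normalised (hh : 0 < h) (hu : Differentiable ℂ u) (hu2 : SqInt D.wt h u) :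
    ∃ C : ℝ, 0 ≤ C ∧ ∀ x, ‖u x‖ * Real.exp (-D.wt x / h) ≤ C := by
  obtain ⟨C, hC, hb⟩ := D.exists_pointwise_bound hh
  refine ⟨C * weightedNorm D.wt h u, mul_nonneg hC.le (Real.sqrt_nonneg _), fun x => ?_⟩
  rw [neg_div, Real.exp_neg, ← div_eq_mul_inv, div_le_iff₀ (Real.exp_pos _)]
  exact hb u hu hu2 x

lemma integrable_opInt (hα : Continuous α) (hM : ∀ x, ‖α x‖ ≤ M) (hs : 1 < s) (hc : 0 < c)
    (hK0 : 0 ≤ K)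
    (hK : ∀ y w, ‖D.amp α y w‖ ≤ K * D.damp s c w) (hh : 0 < h) (hu : Differentiable ℂ u)
    (hu2 : SqInt D.wt h u) (x : Cn n) : Integrable fun w => D.opInt α h u x w := by
  obtain ⟨C, hC, hb⟩ := D.exists_bound_normalised hh hu hu2
  refine (((D.integrable_damp hs hc).const_mul K).mul_const (Real.exp (D.wt x / h) * C)).mono'
    (D.continuous_opInt hα hM h hu.continuous continuous_const continuous_id).aestronglyMeasurable
    (Eventually.of_forall fun w => ?_)
  refine (D.norm_opInt_le hK h u x w).trans ?_
  have := D.damp_nonneg s c w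
  gcongr
  exact hb _

lemma integral_opInt_centre (hα : Continuous α) (hM : ∀ x, ‖α x‖ ≤ M) (hs : 1 < s) (hc : 0 < c)
    (hK0 : 0 ≤ K)
    (hK : ∀ y w, ‖D.amp α y w‖ ≤ K * D.damp s c w) (hh : 0 < h) (hu : Differentiable ℂ u)
    (hu2 : SqInt D.wt h u) (x : Cn n) :
    ∫ q, D.opInt α h u x (centre h x q) = ((1 + h / 4) ^ (2 * n) : ℝ) *
      ∫ w, D.opInt α h u x w := by
  have hR : 0 < (1 + h / 4)⁻¹ := by positivity
  have := (integral_comp_affine_fst (G := fun w => D.opInt α h u x w)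
    (D.continuous_opInt hα hM h hu.continuous continuous_const continuous_id)
    (D.integrable_opInt hα hM hs hc hK0 hK hh hu hu2 x)
    (a := fun ζ => ((1 + h / 4)⁻¹ : ℝ) • (x + ((h / 4 : ℝ) * I : ℂ) • ζ)) (by fun_prop) hR).2
  rw [inv_pow, inv_inv] at this
  exact this

/-- The Jacobian of the change of centre in real dimension 2n is (1 + h/4)^{2n}, which turns the
normalisation (1 + h/4)^n into its inverse. In this form the integrand is holomorphic in x. -/
lemma op_eq_centre (hα : Continuous α) (hM : ∀ x, ‖α x‖ ≤ M) (hs : 1 < s) (hc : 0 < c)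
    (hK0 : 0 ≤ K)
    (hK : ∀ y w, ‖D.amp α y w‖ ≤ K * D.damp s c w) (hh : 0 < h) (hu : Differentiable ℂ u)
    (hu2 : SqInt D.wt h u) (x : Cn n) :
    D.op α h u x = ((D.c₂ * ((1 + h / 4) ^ n)⁻¹ : ℝ) : ℂ) *
      ∫ q, D.opInt α h u x (centre h x q) := by
  rw [D.integral_opInt_centre hα hM hs hc hK0 hK hh hu hu2, op, ← mul_assoc, ← ofReal_mul]
  congr 2
  have : (1 + h / 4) ^ n ≠ 0 := by positivity
  rw [pow_mul']
  field_simp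

lemma _root_.Differentiable.H_left {f : Cn n → Cn n} (hf : Differentiable ℂ f) (y : Cn n) :
    Differentiable ℂ fun x => D.H (f x) y := (D.differentiable_H_left y).comp hf

lemma _root_.Differentiable.Q_diag {f g : Cn n → Cn n} (hf : Differentiable ℂ f)
    (hg : Differentiable ℂ g) : Differentiable ℂ fun x => D.Q (f x) (g x) := by
  rw [show (fun x => D.Q (f x) (g x)) = _ from funext fun x => D.Q_eq_sum (f x) (g x)]
  have h1 : ∀ j, Differentiable ℂ fun x => f x j := fun j => (differentiable_pi.1 hf) j
  have h2 : ∀ j, Differentiable ℂ fun x => g x j := fun j => (differentiable_pi.1 hg) j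
  fun_prop

lemma differentiable_centre_fst (q : Cn n × Cn n) :
    Differentiable ℂ fun x => (centre h x q).1 := by
  have h1 : ∀ (c : ℂ) (a b : Cn n), Differentiable ℂ fun x => c • (x + a) - b := fun c a b =>
    ((differentiable_id.add_const a).const_smul c).sub_const b
  simp only [centre, re_smul_eq]
  exact h1 _ _ _

lemma differentiable_zsh_centre (q : Cn n × Cn n) :
    Differentiable ℂ fun x => zsh h (centre h x q) :=
  ((differentiable_centre_fst q).sub_const (I • q.2)).const_smul ((h / 2 : ℝ) : ℂ)

lemma differentiable_opInt_centre (hh : 0 < h) (hu : Differentiable ℂ u) (q : Cn n × Cn n) :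
    Differentiable ℂ fun x => D.opInt α h u x (centre h x q) := by
  have hz := differentiable_zsh_centre (h := h) q
  have hp := differentiable_centre_fst (h := h) q
  have hx : Differentiable ℂ fun x : Cn n => x := differentiable_id
  have hexp : Differentiable ℂ fun x : Cn n =>
      I * D.H (x - (1 / 2 : ℂ) • zsh h (centre h x q)) q.2 + D.H (centre h x q).1 q.1 +
        (2 * D.Q (zsh h (centre h x q)) x - D.Q (zsh h (centre h x q)) (zsh h (centre h x q))) / h := by
    have h1 := (hx.sub (hz.const_smul (1 / 2 : ℂ))).H_left D q.2
    have h2 := hp.H_left D q.1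
    have h3 := hz.Q_diag D hx
    have h4 := hz.Q_diag D hz
    simp only [div_eq_mul_inv]
    exact ((h1.const_mul I).add h2).add (((h3.const_mul 2).sub h4).mul_const _)
  have h1 := (hexp.cexp.const_mul (D.stft α q.1 q.2)).mul (hu.comp (hx.sub hz))
  rw [show (fun x => D.opInt α h u x (centre h x q)) = _ from
    funext fun x => D.opInt_centre hh α u x q]
  exact h1

lemma integrable_half_damp_centre (hs : 1 < s) (hc : 0 < c) (hh : 0 < h) (x : Cn n) :
    Integrable fun q : Cn n × Cn n => Real.exp (-(1 / 2 * D.N (centre h x q).1)) *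
      Real.exp (-(c * ‖q.2‖ ^ (1 / s))) := by
  have hR : 0 < (1 + h / 4)⁻¹ := by positivity
  set f : Cn n × Cn n → ℝ := fun w => Real.exp (-(1 / 2 * D.N w.1)) *
    Real.exp (-(c * ‖w.2‖ ^ (1 / s)))
  have hfc : Continuous f := by
    have : Continuous fun w : Cn n × Cn n => ‖w.2‖ ^ (1 / s) :=
      (continuous_norm.comp continuous_snd).rpow_const fun w => Or.inr (by positivity)
    fun_prop
  have hfi : Integrable f := Integrable.mul_prod (D.integrable_gauss (t := 1 / 2) (by norm_num))
    (integrable_exp_neg_rpow (μ := (volume : Measure (Cn n))) hc (r := 1 / s) (by positivity))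
  have h2 := (integral_comp_affine_fst (G := fun w => (f w : ℂ)) (by fun_prop) hfi.ofReal
    (a := fun ζ => ((1 + h / 4)⁻¹ : ℝ) • (x + ((h / 4 : ℝ) * I : ℂ) • ζ)) (by fun_prop) hR).1
  exact (h2.re.congr (Eventually.of_forall fun q => rfl))

/-- Moving x by at most 1 moves the first component of the centre variable by at most 1, so half of
the Gaussian at x₀ is a majorant on a whole ball, as differentiation under the integral requires. -/
lemma damp_centre_le (hh : 0 < h) {x x₀ : Cn n} (hx : ‖x - x₀‖ ≤ 1) (q : Cn n × Cn n) :
    D.damp s c (centre h x q) ≤ Real.exp D.up * (Real.exp (-(1 / 2 * D.N (centre h x₀ q).1)) *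
      Real.exp (-(c * ‖q.2‖ ^ (1 / s)))) := by
  have hR : 0 < (1 + h / 4)⁻¹ := by positivity
  have hR1 : (1 + h / 4)⁻¹ ≤ 1 := inv_le_one_of_one_le₀ (by linarith)
  rw [damp, ← mul_assoc, ← Real.exp_add D.up]
  refine mul_le_mul_of_nonneg_right (Real.exp_le_exp.2 ?_) (Real.exp_pos _).le
  set p := (centre h x q).1
  set p₀ := (centre h x₀ q).1
  have e3 : p - p₀ = (((1 + h / 4)⁻¹ : ℝ) : ℂ) • (x - x₀) := by
    simp only [p, p₀, centre, re_smul_eq]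
    module
  have e4 : D.N (p - p₀) ≤ D.up := by
    rw [e3, N_smul, norm_real, Real.norm_eq_abs, abs_of_pos hR]
    have := D.N_le (x - x₀)
    have h3 : ‖x - x₀‖ ^ 2 ≤ 1 := by nlinarith [norm_nonneg (x - x₀)]
    have h4 : D.N (x - x₀) ≤ D.up := by nlinarith [D.up_pos]
    have h5 : ((1 + h / 4)⁻¹) ^ 2 ≤ 1 := by nlinarith
    nlinarith [D.N_nonneg (x - x₀)]
  have e6 := D.N_sub p (p - p₀)
  rw [sub_sub_cancel] at e6
  have e9 : D.N p₀ ≤ 2 * D.N p + 2 * D.N (p - p₀) := by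
    have h1 := D.two_re_le p (p - p₀) (a := 1) one_pos
    have h2 := neg_abs_le ((D.H p (p - p₀)).re)
    rw [inv_one, one_mul, one_mul] at h1
    linarith
  linarith

lemma differentiable_op (hα : Continuous α) (hM : ∀ x, ‖α x‖ ≤ M) (hs : 1 < s) (hc : 0 < c)
    (hK0 : 0 ≤ K)
    (hK : ∀ y w, ‖D.amp α y w‖ ≤ K * D.damp s c w) (hh : 0 < h) (hu : Differentiable ℂ u)
    (hu2 : SqInt D.wt h u) : Differentiable ℂ (D.op α h u) := by
  rw [show D.op α h u = _ from funext fun x => D.op_eq_centre hα hM hs hc hK0 hK hh hu hu2 x]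
  refine Differentiable.const_mul ?_ _
  obtain ⟨C, hC, hb⟩ := D.exists_bound_normalised hh hu hu2
  have hcc : Continuous (Function.uncurry fun (x : Cn n) (q : Cn n × Cn n) =>
      D.opInt α h u x (centre h x q)) :=
    D.continuous_opInt hα hM h hu.continuous (f := fun r : Cn n × (Cn n × Cn n) => r.1)
      (g := fun r => centre h r.1 r.2) continuous_fst (by fun_prop)
  refine differentiable_integral_of_dominated hcc
    (fun q => D.differentiable_opInt_centre hh hu q) fun x₀ => ?_
  have hwc : Continuous fun x => Real.exp (D.wt x / h) := by fun_prop
  obtain ⟨E, hE⟩ := (isCompact_closedBall x₀ 1).exists_bound_of_continuousOn hwc.continuousOn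
  refine ⟨_, (((D.integrable_half_damp_centre hs hc hh x₀).const_mul
    (Real.exp D.up)).const_mul K).mul_const (E * C), fun x hx q => ?_⟩
  refine (D.norm_opInt_le hK h u x _).trans ?_
  have hE' := hE x (Metric.ball_subset_closedBall hx)
  rw [Real.norm_eq_abs, Real.abs_exp] at hE'
  have hxx : ‖x - x₀‖ ≤ 1 := by
    rw [← dist_eq_norm]; exact (Metric.mem_ball.1 hx).le
  have hE0 : 0 ≤ E := (Real.exp_pos _).le.trans hE'
  have h1 := mul_le_mul_of_nonneg_left (D.damp_centre_le (s := s) (c := c) hh hxx q) hK0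
  have h0 := mul_nonneg hK0 (D.damp_nonneg s c (centre h x q))
  exact mul_le_mul h1 (mul_le_mul hE' (hb _) (by positivity) hE0) (by positivity)
    (h0.trans h1)

end

end QData

/-! ### Boundedness on the Bargmann space and agreement with the Weyl integral. -/

namespace QData

variable {n : ℕ} (D : QData n)

section

variable {s c K M h : ℝ} {α u : Cn n → ℂ}

/-- Boundedness of the operator on the Bargmann space. -/
lemma exists_op_bound (hα : Continuous α) (hM : ∀ x, ‖α x‖ ≤ M) (hs : 1 < s) (hc : 0 < c)
    (hK0 : 0 ≤ K)
    (hK : ∀ y w, ‖D.amp α y w‖ ≤ K * D.damp s c w) (hh : 0 < h) :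
    ∃ L : ℝ, ∀ u, Differentiable ℂ u → SqInt D.wt h u →
      SqInt D.wt h (D.op α h u) ∧ weightedNorm D.wt h (D.op α h u) ≤ L * weightedNorm D.wt h u := by
  set κ := D.c₂ * (1 + h / 4) ^ n
  have hκ : 0 < κ := mul_pos D.c₂_pos (by positivity)
  have hdc : Continuous (D.damp s c) := by
    unfold damp
    have : Continuous fun w : Cn n × Cn n => ‖w.2‖ ^ (1 / s) :=
      (continuous_norm.comp continuous_snd).rpow_const fun w => Or.inr (by positivity)
    fun_prop
  set S := ∫ w, K * D.damp s c w
  have hS : 0 ≤ S := integral_nonneg fun w => mul_nonneg hK0 (D.damp_nonneg s c w)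
  refine ⟨κ * S, fun u hu hu2 => ?_⟩
  obtain ⟨C, hC, hb⟩ := D.exists_bound_normalised hh hu hu2
  have huc := hu.continuous
  set U : Cn n → ℝ := fun x => ‖u x‖ * Real.exp (-D.wt x / h)
  have hU2 : (fun x => U x ^ 2) = fun x => ‖u x‖ ^ 2 * Real.exp (-2 * D.wt x / h) := by
    ext x; simp only [U]; rw [mul_pow, ← exp_sq]
  obtain ⟨y1, y2⟩ := integrable_sq_integral_translates (μ := volume)
    (k := fun w => K * D.damp s c w) (U := U) (z := fun w => zsh h w) (by fun_prop) (by fun_prop)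
    (by fun_prop) (fun w => mul_nonneg hK0 (D.damp_nonneg s c w)) (fun x => by positivity)
    ((D.integrable_damp hs hc).const_mul K) (by rw [hU2]; exact hu2) hb
  -- After multiplication by e^{-Φ₀/h} the magnetic translations bound the operator by ordinary
  -- translates of U, with kernel K · damp; Young's inequality then applies.
  have hpt : ∀ x, ‖D.op α h u x‖ ^ 2 * Real.exp (-2 * D.wt x / h) ≤
      κ ^ 2 * (∫ w, K * D.damp s c w * U (x - zsh h w)) ^ 2 := by
    intro x
    rw [exp_sq, ← mul_pow, ← mul_pow]
    refine pow_le_pow_left₀ (by positivity) ?_ 2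
    rw [op, norm_mul, norm_real, Real.norm_eq_abs, abs_of_pos hκ, mul_assoc]
    gcongr
    have h1 : ‖∫ w, D.opInt α h u x w‖ ≤ ∫ w, Real.exp (D.wt x / h) *
        (K * D.damp s c w * U (x - zsh h w)) := by
      refine norm_integral_le_of_norm_le ?_ (Eventually.of_forall fun w =>
        (D.norm_opInt_le hK h u x w).trans (le_of_eq (by simp only [U]; ring)))
      refine Integrable.const_mul ?_ _
      refine (((D.integrable_damp hs hc).const_mul K).mul_const C).mono'
        (Continuous.aestronglyMeasurable (by fun_prop)) (Eventually.of_forall fun w => ?_)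
      have h0 := mul_nonneg hK0 (D.damp_nonneg s c w)
      rw [Real.norm_eq_abs, abs_of_nonneg (mul_nonneg h0 (by positivity))]
      exact mul_le_mul_of_nonneg_left (hb _) h0
    rw [integral_const_mul] at h1
    calc _ ≤ Real.exp (D.wt x / h) * (∫ w, K * D.damp s c w * U (x - zsh h w)) *
          Real.exp (-D.wt x / h) := by gcongr
      _ = (∫ w, K * D.damp s c w * U (x - zsh h w)) *
          (Real.exp (D.wt x / h) * Real.exp (-D.wt x / h)) := by ring
      _ = _ := by rw [← Real.exp_add, neg_div, add_neg_cancel, Real.exp_zero, mul_one]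
  have hopc := (D.differentiable_op hα hM hs hc hK0 hK hh hu hu2).continuous
  have hsq : SqInt D.wt h (D.op α h u) := by
    refine (y1.const_mul (κ ^ 2)).mono' (Continuous.aestronglyMeasurable (by fun_prop))
      (Eventually.of_forall fun x => ?_)
    rw [Real.norm_eq_abs, abs_of_nonneg (by positivity)]
    exact hpt x
  refine ⟨hsq, ?_⟩
  have h2 : ∫ x, ‖D.op α h u x‖ ^ 2 * Real.exp (-2 * D.wt x / h) ≤
      (κ * S) ^ 2 * ∫ x, ‖u x‖ ^ 2 * Real.exp (-2 * D.wt x / h) := by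
    refine (integral_mono hsq (y1.const_mul (κ ^ 2)) hpt).trans ?_
    rw [integral_const_mul, mul_pow κ S, mul_assoc, ← hU2]
    exact mul_le_mul_of_nonneg_left y2 (sq_nonneg κ)
  unfold weightedNorm
  refine (Real.sqrt_le_sqrt h2).trans (le_of_eq ?_)
  rw [Real.sqrt_mul (by positivity), Real.sqrt_sq (by positivity)]

/-- Rapidly decaying functions are integrable after normalisation. -/
lemma integrable_of_rapidlyDecaying (hu : Continuous u) (hr : RapidlyDecaying D.wt h u) :
    Integrable fun x => ‖u x‖ * Real.exp (-D.wt x / h) := by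
  obtain ⟨C, hC⟩ := hr (2 * n + 1)
  have hfr : (Module.finrank ℝ (Cn n) : ℝ) < ((2 * n + 1 : ℕ) : ℝ) := by
    rw [finrank_real_Cn]; push_cast; linarith
  refine ((integrable_one_add_norm (μ := (volume : Measure (Cn n))) hfr).const_mul C).mono'
    (Continuous.aestronglyMeasurable (by fun_prop)) (Eventually.of_forall fun x => ?_)
  rw [Real.norm_eq_abs, abs_of_nonneg (by positivity), Real.rpow_neg (by positivity),
    Real.rpow_natCast, neg_div, Real.exp_neg, ← div_eq_mul_inv, ← div_eq_mul_inv,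
    div_le_div_iff₀ (Real.exp_pos _) (by positivity), mul_comm]
  exact hC x

/-- With the centre and the frequency fixed, packet times translation is e^{-tN(z) + H(w,z)} with w
= (κ - iζ)/2, times a function holomorphic in z. The Gaussian mean value formula evaluates the
latter at z = w/t, and this point is exactly the shift `zsh` of the packet: the shift of size h is
not a stationary phase approximation but an identity. -/
lemma gauss_packet (hh : 0 < h) (hu : Differentiable ℂ u) (x : Cn n) (q : Cn n × Cn n)
    (hi : Integrable fun z => D.tr h z u x) :
    ∫ z, D.amp α (x - (1 / 2 : ℂ) • z) (x - (1 / 2 : ℂ) • z - q.1, q.2) * D.tr h z u x =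
      (Real.pi ^ n / ((1 / 4 + 1 / h) ^ n * D.vol) : ℝ) * D.opInt α h u x (centre h x q) := by
  obtain ⟨k, ζ⟩ := q
  simp only
  set κ := x - k
  -- 1/4 comes from the window e^{-N(κ - z/2)} and 1/h from e^{-N(z)/h} in the translation.
  set t : ℝ := 1 / 4 + 1 / h
  have ht : 0 < t := by positivity
  have hhc : (h : ℂ) ≠ 0 := by exact_mod_cast hh.ne'
  set F : Cn n → ℂ := fun z => D.stft α k ζ * cexp (I * D.H x ζ + I * D.H ζ x - D.H κ κ) *
    cexp (-(1 / 2 * I * D.H z ζ) + 1 / 2 * D.H z κ + (2 * D.B z x - D.Q z z) * (h : ℂ)⁻¹) *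
      u (x - z) with hF
  have hFd : Differentiable ℂ F := by
    refine Differentiable.mul (Differentiable.const_mul (Differentiable.cexp ?_) _)
      (hu.comp (differentiable_id.const_sub x))
    exact ((((D.differentiable_H_left ζ).const_mul _).neg).add
      ((D.differentiable_H_left κ).const_mul _)).add
      ((((D.differentiable_B_left x).const_mul 2).sub D.differentiable_Q_diag).mul_const _)
  have hkey : ∀ z, D.amp α (x - (1 / 2 : ℂ) • z) (x - (1 / 2 : ℂ) • z - k, ζ) * D.tr h z u x =
      cexp (-(t * D.N z) + D.H ((1 / 2 : ℂ) • (κ - I • ζ)) z) * F z := by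
    intro z
    have e1 : (2 * (D.H (x - (1 / 2 : ℂ) • z) ζ).re : ℂ) =
        D.H (x - (1 / 2 : ℂ) • z) ζ + D.H ζ (x - (1 / 2 : ℂ) • z) := by
      rw [D.herm (x - (1 / 2 : ℂ) • z) ζ, Complex.add_conj]; push_cast; ring
    rw [amp, tr, hF]
    simp only [sub_sub_cancel]
    rw [e1, ofReal_exp, ofReal_neg, ← H_self, ← H_self,
      show x - (1 / 2 : ℂ) • z - k = κ - (1 / 2 : ℂ) • z by simp only [κ]; abel]
    have : ∀ S a b c d e f U : ℂ, a + b + c = d + e + f →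
        S * cexp a * cexp b * (cexp c * U) = cexp d * (S * cexp e * cexp f * U) := by
      intro S a b c d e f U habc
      calc S * cexp a * cexp b * (cexp c * U) = S * (cexp a * cexp b * cexp c) * U := by ring
        _ = S * (cexp d * cexp e * cexp f) * U := by
          rw [← Complex.exp_add, ← Complex.exp_add, habc, Complex.exp_add, Complex.exp_add]
        _ = _ := by ring
    apply this
    simp only [B, t, map_sub, map_smulₛₗ, LinearMap.sub_apply, LinearMap.smul_apply,
      smul_eq_mul, RingHom.id_apply, map_div₀, map_one, map_ofNat]
    push_cast
    field_simp
    ring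
  have hint : Integrable fun z => cexp (-(t * D.N z) + D.H ((1 / 2 : ℂ) • (κ - I • ζ)) z) * F z := by
    simp only [← hkey]
    refine (hi.norm.const_mul ‖D.stft α k ζ‖).mono' ?_ (Eventually.of_forall fun z => ?_)
    · simp only [hkey]
      have := hFd.continuous
      exact Continuous.aestronglyMeasurable (by fun_prop)
    · rw [norm_mul, amp, norm_mul, norm_mul, norm_cexp_two_re, sub_sub_cancel, mul_one, norm_real,
        Real.norm_eq_abs, Real.abs_exp]
      have h1 : Real.exp (-D.N (x - (1 / 2 : ℂ) • z - k)) ≤ 1 :=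
        Real.exp_le_one_iff.2 (by have := D.N_nonneg (x - (1 / 2 : ℂ) • z - k); linarith)
      gcongr
      exact mul_le_of_le_one_right (norm_nonneg _) h1
  simp only [hkey]
  rw [D.integral_gauss_linear_mul ht _ hFd hint, D.opInt_centre hh]
  congr 1
  have hpk : (centre h x (k, ζ)).1 = (((1 + h / 4)⁻¹ : ℝ) : ℂ) • (κ + ((h / 4 : ℝ) * I : ℂ) • ζ) := by
    simp only [centre, re_smul_eq, κ]; module
  have h14 : (1 + h / 4 : ℂ) ≠ 0 := by
    have : (0 : ℝ) < 1 + h / 4 := by positivity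
    exact_mod_cast this.ne'
  have h4 : (4 + h : ℂ) ≠ 0 := by
    have : (0 : ℝ) < 4 + h := by positivity
    exact_mod_cast this.ne'
  have hz : ((t : ℂ)⁻¹) • ((1 / 2 : ℂ) • (κ - I • ζ)) = zsh h (centre h x (k, ζ)) := by
    rw [zsh, hpk]
    have ht' : (t : ℂ) = (1 + h / 4) / h := by simp only [t]; push_cast; field_simp; ring
    rw [ht']
    ext i
    simp only [centre, Pi.sub_apply, Pi.smul_apply, Pi.add_apply, smul_eq_mul]
    push_cast
    field_simp
    ring
  rw [hz]
  set z := zsh h (centre h x (k, ζ)) with hzdef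
  set p := (centre h x (k, ζ)).1
  have hzp : z = ((h / 2 : ℝ) : ℂ) • (p - I • ζ) := rfl
  -- The evaluation point is self-consistent: p is the midpoint minus the centre, and z is the shift
  -- determined by p and ζ.
  have hkp : p = κ - (1 / 2 : ℂ) • z := by
    have h1 : x - (1 / 2 : ℂ) • z - p = k := midpoint_centre hh x (k, ζ)
    have h2 : k = x - κ := by simp only [κ]; abel
    have h3 : p = x - (1 / 2 : ℂ) • z - k := by rw [← h1]; abel
    rw [h3, h2]; abel
  have hk : k = x - κ := by simp only [κ]; abel
  rw [hF]
  simp only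
  congr 1
  rw [mul_assoc, ← Complex.exp_add]
  congr 2
  rw [H_self]
  have e3 : (2 : ℂ) * D.H z x * (h : ℂ)⁻¹ = D.H p x - I * D.H ζ x := by
    rw [hzp]
    simp only [map_sub, map_smul, LinearMap.sub_apply, LinearMap.smul_apply, smul_eq_mul]
    push_cast; field_simp
  have e4 : D.H p κ = D.H κ κ - 1 / 2 * D.H z κ := by
    conv_lhs => rw [hkp]
    simp only [map_sub, map_smul, LinearMap.sub_apply, LinearMap.smul_apply, smul_eq_mul]
  have e5 : D.H p k = D.H p x - D.H p κ := by
    conv_lhs => rw [hk]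
    simp only [map_sub]
  rw [e5, e4, ← H_self, B]
  simp only [map_sub, map_smul, LinearMap.sub_apply, LinearMap.smul_apply, smul_eq_mul]
  linear_combination e3

lemma measurePreserving_reflect_fst (y : Cn n) :
    MeasurePreserving (fun q : Cn n × Cn n => (y - q.1, q.2)) :=
  (Measure.measurePreserving_sub_left volume y).prod (MeasurePreserving.id volume)

lemma integral_reflect_fst {E : Type*} [NormedAddCommGroup E] [NormedSpace ℝ E]
    (F : Cn n × Cn n → E) (y : Cn n) : ∫ q : Cn n × Cn n, F (y - q.1, q.2) = ∫ w, F w :=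
  (measurePreserving_reflect_fst y).integral_comp
    ((Homeomorph.subLeft y).prodCongr (Homeomorph.refl _)).measurableEmbedding F

lemma continuous_packet (hα : Continuous α) (hM : ∀ x, ‖α x‖ ≤ M) (x : Cn n) :
    Continuous fun r : Cn n × (Cn n × Cn n) =>
      D.amp α (x - (1 / 2 : ℂ) • r.1) (x - (1 / 2 : ℂ) • r.1 - r.2.1, r.2.2) :=
  D.continuous_amp hα hM
    (f := fun r : Cn n × (Cn n × Cn n) => x - (1 / 2 : ℂ) • r.1)
    (g := fun r => (x - (1 / 2 : ℂ) • r.1 - r.2.1, r.2.2)) (by fun_prop) (by fun_prop)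

/-- Tonelli: the inner integral of the majorant does not depend on the centre y z of the reflection,
so the iterated integral factors. -/
lemma _root_.integrable_of_le_reflect_fst {F : Cn n × (Cn n × Cn n) → ℂ} (hF : Continuous F)
    {d : Cn n × Cn n → ℝ} (hd : Integrable d) {y : Cn n → Cn n} {g : Cn n → ℝ} (hg : Integrable g)
    (hle : ∀ z q, ‖F (z, q)‖ ≤ d (y z - q.1, q.2) * g z) :
    Integrable F ((volume : Measure (Cn n)).prod volume) := by
  have hdm : ∀ z, Integrable fun q : Cn n × Cn n => d (y z - q.1, q.2) * g z := fun z =>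
    ((measurePreserving_reflect_fst (y z)).integrable_comp_of_integrable hd).mul_const _
  have hfz : ∀ z, Continuous fun q => F (z, q) := fun z =>
    hF.comp (Continuous.prodMk (continuous_const (y := z)) continuous_id)
  rw [integrable_prod_iff hF.aestronglyMeasurable]
  refine ⟨Eventually.of_forall fun z => (hdm z).mono' (hfz z).aestronglyMeasurable
    (Eventually.of_forall fun q => hle z q), ?_⟩
  refine (hg.const_mul (∫ w, d w)).mono'
    (hF.norm.aestronglyMeasurable.integral_prod_right') (Eventually.of_forall fun z => ?_)
  rw [Real.norm_eq_abs, abs_of_nonneg (integral_nonneg fun q => norm_nonneg _)]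
  refine (integral_mono_of_nonneg (Eventually.of_forall fun q => norm_nonneg _) (hdm z)
    (Eventually.of_forall fun q => hle z q)).trans (le_of_eq ?_)
  rw [integral_mul_const, integral_reflect_fst d (y z)]

lemma integrable_packet (hα : Continuous α) (hM : ∀ x, ‖α x‖ ≤ M) (hs : 1 < s) (hc : 0 < c)
    (hK : ∀ y w, ‖D.amp α y w‖ ≤ K * D.damp s c w) (x : Cn n)
    {g : Cn n → ℂ} (hg : Continuous g) (hgi : Integrable g) :
    Integrable (Function.uncurry fun (z : Cn n) (q : Cn n × Cn n) =>
      D.amp α (x - (1 / 2 : ℂ) • z) (x - (1 / 2 : ℂ) • z - q.1, q.2) * g z)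
      ((volume : Measure (Cn n)).prod volume) := by
  have hfc : Continuous fun r : Cn n × (Cn n × Cn n) =>
      D.amp α (x - (1 / 2 : ℂ) • r.1) (x - (1 / 2 : ℂ) • r.1 - r.2.1, r.2.2) * g r.1 :=
    (D.continuous_packet hα hM x).mul (hg.comp continuous_fst)
  refine integrable_of_le_reflect_fst hfc ((D.integrable_damp hs hc).const_mul K)
    (y := fun z => x - (1 / 2 : ℂ) • z) hgi.norm fun z q => ?_
  rw [Function.uncurry_apply_pair, norm_mul]
  exact mul_le_mul_of_nonneg_right (hK _ _) (norm_nonneg _)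

/-- The operator is given by the Weyl quantization on the rapidly decaying functions. -/
lemma op_eq_weyl (hαG : GevreyBounded s α) (hs : 1 < s) (hh : 0 < h) (hu : Differentiable ℂ u)
    (hu2 : SqInt D.wt h u) (hr : RapidlyDecaying D.wt h u) (x : Cn n) :
    D.op α h u x = D.weyl α h u x := by
  obtain ⟨c, K, hc, hK0, hK, -, hst⟩ := D.exists_amp_bound hs hαG
  have hα : Continuous α := hαG.1.continuous
  obtain ⟨M, hM⟩ : ∃ M, ∀ x, ‖α x‖ ≤ M := by
    obtain ⟨-, C, -, hb⟩ := hαG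
    exact ⟨_, fun x => by simpa using hb 0 x⟩
  have huc := hu.continuous
  have htr : Integrable fun z => D.tr h z u x := by
    refine (((D.integrable_of_rapidlyDecaying huc hr).comp_sub_left x).const_mul
      (Real.exp (D.wt x / h))).mono' (Continuous.aestronglyMeasurable (by fun_prop))
      (Eventually.of_forall fun z => ?_)
    have h0 : Real.exp ((D.wt x - D.wt (x - z)) / h) =
        Real.exp (D.wt x / h) * Real.exp (-D.wt (x - z) / h) := by
      rw [← Real.exp_add]; congr 1; ring
    rw [norm_tr, h0]
    exact le_of_eq (by ring)
  -- Packets are parametrized by their centre y - p, so that the centre does not move when z is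
  -- integrated.
  have hinv : ∀ y, α y = D.c₂ * ∫ q : Cn n × Cn n, D.amp α y (y - q.1, q.2) := fun y => by
    rw [D.amp_inversion hs hαG y, integral_reflect_fst (fun w => D.amp α y w) y]
  have hprod := D.integrable_packet hα hM hs hc hK x (g := fun z => D.tr h z u x)
    (by fun_prop) htr
  have h1 : ∫ z, α (x - (1 / 2 : ℂ) • z) * D.tr h z u x = D.c₂ * ∫ z, ∫ q : Cn n × Cn n,
      D.amp α (x - (1 / 2 : ℂ) • z) (x - (1 / 2 : ℂ) • z - q.1, q.2) * D.tr h z u x := by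
    rw [← integral_const_mul]
    congr 1; ext z
    rw [hinv (x - (1 / 2 : ℂ) • z), integral_mul_const]
    ring
  rw [weyl, h1, integral_integral_swap hprod, D.op_eq_centre hα hM hs hc hK0.le hK hh hu hu2]
  simp only [fun q => D.gauss_packet (α := α) hh hu x q htr]
  rw [integral_const_mul, ← mul_assoc, ← mul_assoc]
  congr 1
  rw [← ofReal_mul, ← ofReal_mul]
  congr 1
  have hv := D.vol_pos.ne'
  have hpi := Real.pi_ne_zero
  -- This turns the Gaussian constant π^n / (t^n vol), times the Weyl prefactor vol/(πh)^n, into (1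
  -- + h/4)^{-n}.
  have e1 : (1 / 4 + 1 / h) = (1 + h / 4) / h := by field_simp; ring
  have h14 : (1 + h / 4) ^ n ≠ 0 := by positivity
  rw [e1, div_pow, mul_pow]
  field_simp

end

end QData

/-! ### Integration by parts against Lipschitz functions and small perturbations of the weight. -/

section Analysis

variable {n : ℕ}

lemma hasDerivAt_integral_of_compact {G G' : ℝ → Cn n → ℂ} {S : Set (Cn n)} (hS : IsCompact S)
    (hG : Continuous (Function.uncurry G)) (hG' : Continuous (Function.uncurry G'))
    (hGS : ∀ t, ∀ x ∉ S, G t x = 0) (hGS' : ∀ t, ∀ x ∉ S, G' t x = 0)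
    (hd : ∀ t x, HasDerivAt (fun t => G t x) (G' t x) t) (t₀ : ℝ) :
    HasDerivAt (fun t => ∫ x, G t x) (∫ x, G' t₀ x) t₀ := by
  have hc : ∀ t, Continuous (G t) := fun t =>
    hG.comp (Continuous.prodMk (continuous_const (y := t)) continuous_id)
  have hc' : ∀ t, Continuous (G' t) := fun t =>
    hG'.comp (Continuous.prodMk (continuous_const (y := t)) continuous_id)
  obtain ⟨M, hM⟩ := ((isCompact_closedBall t₀ 1).prod hS).exists_bound_of_continuousOn
    hG'.continuousOn
  have hb : Integrable (S.indicator fun _ => M) :=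
    (integrable_indicator_iff hS.measurableSet).2 (integrableOn_const hS.measure_lt_top.ne)
  refine (hasDerivAt_integral_of_dominated_loc_of_deriv_le (F := G) (F' := G')
    (bound := S.indicator fun _ => M) (Metric.ball_mem_nhds t₀ one_pos)
    (Eventually.of_forall fun t => (hc t).aestronglyMeasurable)
    ((hc t₀).integrable_of_hasCompactSupport (HasCompactSupport.intro hS (hGS t₀)))
    (hc' t₀).aestronglyMeasurable (Eventually.of_forall fun x t ht => ?_) hb
    (Eventually.of_forall fun x t _ => hd t x)).2
  by_cases hx : x ∈ S
  · rw [Set.indicator_of_mem hx]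
    exact hM (t, x) ⟨Metric.ball_subset_closedBall ht, hx⟩
  · rw [Set.indicator_of_notMem hx, hGS' t x hx, norm_zero]

/-- Integration by parts against a Lipschitz function. -/
lemma norm_integral_mul_fderiv_le {F J : Cn n → ℂ} {L : ℝ} (hL : ∀ x y, ‖F x - F y‖ ≤ L * ‖x - y‖)
    (hFc : Continuous F) (hFs : HasCompactSupport F) (hJ : ContDiff ℝ 1 J) (hJi : Integrable J)
    (e : Cn n) : ‖∫ x, F x * fderiv ℝ J x e‖ ≤ L * ‖e‖ * ∫ x, ‖J x‖ := by
  have hJ' : Continuous (fderiv ℝ J) := hJ.continuous_fderiv one_ne_zero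
  have hJc := hJ.continuous
  have hF0 : ∀ x ∉ tsupport F, F x = 0 := fun x hx => image_eq_zero_of_notMem_tsupport hx
  -- The integral is the derivative at t = 0 of ∫ F(x) J(x + te) dx. Translating the variable puts
  -- the shift on F, where the Lipschitz bound suffices and no derivative of F is needed.
  have hder := hasDerivAt_integral_of_compact (G := fun t x => F x * J (x + t • e))
    (G' := fun t x => F x * fderiv ℝ J (x + t • e) e) hFs.isCompact
    (by simp only [Function.uncurry_def]; fun_prop)
    (by
      simp only [Function.uncurry_def]
      have : Continuous fun r : ℝ × Cn n => fderiv ℝ J (r.2 + r.1 • e) := hJ'.comp (by fun_prop)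
      exact (hFc.comp continuous_snd).mul (this.clm_apply continuous_const))
    (fun t x hx => by simp [hF0 x hx]) (fun t x hx => by simp [hF0 x hx])
    (fun t x => by
      have h1 : HasDerivAt (fun r : ℝ => x + r • e) e t := by
        simpa using ((hasDerivAt_id t).smul_const e).const_add x
      have h2 := (hJ.differentiable one_ne_zero) (x + t • e)
      exact (h2.hasFDerivAt.comp_hasDerivAt t h1).const_mul _) 0
  simp only [zero_smul, add_zero] at hder
  have hI : 0 ≤ ∫ x, ‖J x‖ := integral_nonneg fun x => norm_nonneg (J x)
  have hL0 : 0 ≤ L * ‖e‖ := by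
    have := (norm_nonneg _).trans (hL e 0)
    simpa using this
  refine hder.le_of_lip' (mul_nonneg hL0 hI) (Eventually.of_forall fun t => ?_)
  have hsh : ∀ t : ℝ, ∫ x, F x * J (x + t • e) = ∫ x, F (x - t • e) * J x := fun t => by
    rw [← integral_sub_right_eq_self (fun x => F x * J (x + t • e)) (t • e)]
    simp only [sub_add_cancel]
  have hint : ∀ t : ℝ, Integrable fun x => F (x - t • e) * J x := fun t => by
    refine (Continuous.integrable_of_hasCompactSupport (by fun_prop) ?_)
    exact HasCompactSupport.mul_right (hFs.comp_homeomorph (Homeomorph.subRight (t • e)))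
  have h0 := hint 0
  have e0 := hsh 0
  simp only [zero_smul, add_zero, sub_zero] at h0 e0
  rw [hsh t, zero_smul ℝ e]
  simp only [add_zero]
  rw [← integral_sub (hint t) h0, sub_zero, ← integral_const_mul, ← integral_mul_const]
  refine norm_integral_le_of_norm_le ((hJi.norm.const_mul _).mul_const _)
    (Eventually.of_forall fun x => ?_)
  rw [← sub_mul, norm_mul]
  have := hL (x - t • e) x
  rw [show x - t • e - x = -(t • e) by abel, norm_neg, norm_smul] at this
  calc _ ≤ L * (‖t‖ * ‖e‖) * ‖J x‖ := by gcongr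
    _ = _ := by ring

/-- The mean value inequality on the convex half plane Re z ≤ m. -/
lemma norm_cexp_sub_cexp_le {a b : ℂ} {m : ℝ} (ha : a.re ≤ m) (hb : b.re ≤ m) :
    ‖cexp a - cexp b‖ ≤ Real.exp m * ‖a - b‖ := by
  have hconv : Convex ℝ {z : ℂ | z.re ≤ m} := convex_halfSpace_re_le m
  refine hconv.norm_image_sub_le_of_norm_hasDerivWithin_le (f := cexp) (f' := cexp)
    (fun z _ => (Complex.hasDerivAt_exp z).hasDerivWithinAt) (fun z hz => ?_) hb ha
  rw [norm_exp]
  exact Real.exp_le_exp.2 hz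

end Analysis

/-- The derivative `∑ z_j ∂φ/∂x_j` of a real function. -/
def del {n : ℕ} (φ : Cn n → ℝ) (x z : Cn n) : ℂ :=
  (1 / 2) * (fderiv ℝ φ x z - I * fderiv ℝ φ x (I • z))

/-- A small perturbation of a weight. -/
structure SmallPert {n : ℕ} (φ : Cn n → ℝ) (ε : ℝ) : Prop where
  contDiff : ContDiff ℝ 1 φ
  bound_zero : ∀ x, |φ x| ≤ ε
  bound_one : ∀ x, ‖fderiv ℝ φ x‖ ≤ ε
  bound_two : ∀ x y, ‖fderiv ℝ φ x - fderiv ℝ φ y‖ ≤ ε * ‖x - y‖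

namespace SmallPert

variable {n : ℕ} {φ : Cn n → ℝ} {ε : ℝ}

lemma nonneg (P : SmallPert φ ε) : 0 ≤ ε := (abs_nonneg _).trans (P.bound_zero 0)

lemma norm_del_le (P : SmallPert φ ε) (x z : Cn n) : ‖del φ x z‖ ≤ ε * ‖z‖ := by
  have h1 : ∀ y, ‖(fderiv ℝ φ x y : ℂ)‖ ≤ ε * ‖y‖ := fun y => by
    rw [norm_real]
    exact ((fderiv ℝ φ x).le_opNorm y).trans (by gcongr; exact P.bound_one x)
  have h2 := h1 z
  have h3 := h1 (I • z)
  rw [norm_smul, norm_I, one_mul] at h3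
  rw [del, norm_mul]
  have h4 := norm_sub_le (fderiv ℝ φ x z : ℂ) (I * fderiv ℝ φ x (I • z))
  rw [norm_mul I, norm_I, one_mul] at h4
  have h5 : ‖(1 / 2 : ℂ)‖ = 1 / 2 := by norm_num
  rw [h5]
  linarith

lemma norm_del_sub_le (P : SmallPert φ ε) (x y z : Cn n) : ‖del φ x z - del φ y z‖ ≤ ε * ‖x - y‖ * ‖z‖ := by
  have h1 : ∀ v, ‖(fderiv ℝ φ x v - fderiv ℝ φ y v : ℂ)‖ ≤ ε * ‖x - y‖ * ‖v‖ := fun v => by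
    rw [← ofReal_sub, norm_real, ← _root_.sub_apply]
    exact ((fderiv ℝ φ x - fderiv ℝ φ y).le_opNorm v).trans (by gcongr; exact P.bound_two x y)
  have h2 := h1 z
  have h3 := h1 (I • z)
  rw [norm_smul, norm_I, one_mul] at h3
  have e : del φ x z - del φ y z = (1 / 2) * ((fderiv ℝ φ x z - fderiv ℝ φ y z : ℂ) -
      I * (fderiv ℝ φ x (I • z) - fderiv ℝ φ y (I • z) : ℂ)) := by
    simp only [del]; ring
  rw [e, norm_mul]
  have h4 := norm_sub_le (fderiv ℝ φ x z - fderiv ℝ φ y z : ℂ)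
    (I * (fderiv ℝ φ x (I • z) - fderiv ℝ φ y (I • z) : ℂ))
  rw [norm_mul I, norm_I, one_mul] at h4
  have h5 : ‖(1 / 2 : ℂ)‖ = 1 / 2 := by norm_num
  rw [h5]
  linarith

lemma continuous_del (P : SmallPert φ ε) {X : Type*} [TopologicalSpace X] {f g : X → Cn n} (hf : Continuous f)
    (hg : Continuous g) : Continuous fun x => del φ (f x) (g x) := by
  have h1 : Continuous fun x => fderiv ℝ φ (f x) := (P.contDiff.continuous_fderiv one_ne_zero).comp hf
  have h2 := h1.clm_apply hg
  have h3 := h1.clm_apply (hg.const_smul I)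
  unfold del
  fun_prop

lemma abs_sub_le (P : SmallPert φ ε) (x y : Cn n) : |φ x - φ y| ≤ ε * ‖x - y‖ := by
  have := convex_univ.norm_image_sub_le_of_norm_fderiv_le (𝕜 := ℝ) (f := φ) (C := ε)
    (fun x _ => (P.contDiff.differentiable one_ne_zero) x) (fun x _ => P.bound_one x)
    (Set.mem_univ y) (Set.mem_univ x)
  simpa [Real.norm_eq_abs] using this

end SmallPert

lemma del_real_smul {n : ℕ} (φ : Cn n → ℝ) (x z : Cn n) (r : ℝ) :
    del φ x ((r : ℂ) • z) = r * del φ x z := by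
  have h1 : ((r : ℂ) • z) = r • z := by ext i; simp
  have h2 : I • (r • z) = r • (I • z) := by rw [smul_comm]
  simp only [del, h1, h2, map_smul, smul_eq_mul]
  push_cast; ring

/-! ### Continuous differentiability of holomorphic functions of several variables. -/

section Holomorphic

variable {n : ℕ}

lemma hasDerivAt_line {u : Cn n → ℂ} (hu : Differentiable ℂ u) (x y : Cn n) :
    HasDerivAt (fun ζ : ℂ => u (x + ζ • y)) (fderiv ℂ u x y) 0 := by
  have h3 : HasDerivAt (fun ζ : ℂ => x + ζ • y) y 0 := by
    simpa using ((hasDerivAt_id (0 : ℂ)).smul_const y).const_add x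
  have h4 : HasFDerivAt u (fderiv ℂ u x) (x + (0 : ℂ) • y) := by
    rw [zero_smul, add_zero]; exact (hu x).hasFDerivAt
  exact h4.comp_hasDerivAt 0 h3

/-- Holomorphic functions of several variables are continuously differentiable. -/
lemma contDiff_of_differentiable {u : Cn n → ℂ} (hu : Differentiable ℂ u) : ContDiff ℂ 1 u := by
  rw [contDiff_one_iff_fderiv]
  refine ⟨hu, continuous_clm_apply.2 fun y => ?_⟩
  -- Cauchy's formula writes the derivative as a circle integral of u, which depends continuously on
  -- x.
  have h : ∀ x, fderiv ℂ u x y = cderiv 1 (fun ζ : ℂ => u (x + ζ • y)) 0 := by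
    intro x
    have hd : Differentiable ℂ fun ζ : ℂ => u (x + ζ • y) :=
      hu.comp ((differentiable_id.smul_const y).const_add x)
    rw [cderiv_eq_deriv isOpen_univ hd.differentiableOn one_pos (Set.subset_univ _),
      (hasDerivAt_line hu x y).deriv]
  simp only [h, cderiv, circleIntegral]
  have huc := hu.continuous
  have hne : ∀ p : Cn n × ℝ, circleMap 0 1 p.2 - 0 ≠ 0 := fun p => by
    simp [circleMap]
  have h1 : Continuous fun p : Cn n × ℝ => circleMap 0 1 p.2 :=
    (continuous_circleMap 0 1).comp continuous_snd
  have h2 : Continuous fun p : Cn n × ℝ => ((circleMap 0 1 p.2 - 0) ^ 2)⁻¹ :=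
    ((h1.sub continuous_const).pow 2).inv₀ fun p => pow_ne_zero _ (hne p)
  have h3 : Continuous fun p : Cn n × ℝ => u (p.1 + circleMap 0 1 p.2 • y) :=
    huc.comp (continuous_fst.add (h1.smul continuous_const))
  have h4 : Continuous (Function.uncurry fun (x : Cn n) (θ : ℝ) => deriv (circleMap 0 1) θ •
      ((circleMap 0 1 θ - 0) ^ 2)⁻¹ • u (x + circleMap 0 1 θ • y)) := by
    simp only [Function.uncurry_def, deriv_circleMap]
    exact (h1.mul continuous_const).smul (h2.smul h3)
  have h5 : Continuous fun x : Cn n => ∫ θ in (0 : ℝ)..2 * Real.pi, deriv (circleMap 0 1) θ •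
      ((circleMap 0 1 θ - 0) ^ 2)⁻¹ • u (x + circleMap 0 1 θ • y) :=
    intervalIntegral.continuous_parametric_intervalIntegral_of_continuous' h4 0 (2 * Real.pi)
  exact h5.const_smul ((2 * Real.pi * I : ℂ)⁻¹)

end Holomorphic

/-! ### Interpolation between a magnetic translation and a multiplication. -/

namespace QData

variable {n : ℕ} (D : QData n)

/-- The exponent of the interpolating integrand. -/
def homE (h : ℝ) (φ : Cn n → ℝ) (z : Cn n) (t : ℝ) (x : Cn n) : ℂ :=
  (2 * t * D.B z x - t ^ 2 * D.B z z - 2 * (D.wt x + φ x)) / h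

/-- The interpolating integrand between `u v̄ e^{-2Φ/h}` and its translate. -/
def homJ (h : ℝ) (φ : Cn n → ℝ) (u v : Cn n → ℂ) (z : Cn n) (t : ℝ) (x : Cn n) : ℂ :=
  cexp (D.homE h φ z t x) * u (x - (t : ℂ) • z) * conj (v x)

/-- The integrating factor of the interpolation. -/
def homK (h : ℝ) (φ : Cn n → ℝ) (z : Cn n) (t : ℝ) (x : Cn n) : ℂ :=
  cexp (-((1 - t) * 2 / h * del φ x z) - (1 - t ^ 2) * D.N z / h)

variable {h ε : ℝ} {φ : Cn n → ℝ} {u v : Cn n → ℂ}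

lemma contDiff_B_right (z : Cn n) : ContDiff ℝ ∞ fun x => D.B z x := by
  have : (fun x => D.B z x) = fun x => (∑ j, ∑ k, z j * conjCLE (x k) *
      D.H (Pi.single j 1) (Pi.single k 1)) + ∑ j, ∑ k, z j * x k *
      D.Q (Pi.single j 1) (Pi.single k 1) := by
    ext x; rw [B, D.H_eq_sum, D.Q_eq_sum]; rfl
  rw [this]
  refine ContDiff.add (ContDiff.sum fun j _ => ContDiff.sum fun k _ => ?_) (by fun_prop)
  refine ContDiff.mul (ContDiff.mul contDiff_const ?_) contDiff_const
  exact conjCLE.contDiff.comp (by fun_prop)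

lemma contDiff_wt : ContDiff ℝ ∞ D.wt := by
  have : D.wt = fun x => D.N x + (D.Q x x).re := rfl
  rw [this]
  refine D.contDiff_N.add (reCLM.contDiff.comp ?_)
  rw [show (fun z => D.Q z z) = _ from funext fun z => D.Q_eq_sum z z]
  fun_prop

lemma wt_add_smul (x y : Cn n) (r : ℝ) :
    D.wt (x + (r : ℂ) • y) = D.wt x + 2 * r * (D.B y x).re + r ^ 2 * D.wt y := by
  have h1 := D.H_re_comm y x
  have h2 := D.symm x y
  simp only [wt, N_add, N_smul, B, map_add, LinearMap.add_apply, map_smulₛₗ, LinearMap.smul_apply,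
    smul_eq_mul, RingHom.id_apply, conj_ofReal, re_ofReal_mul, add_re, h2, norm_real,
    Real.norm_eq_abs, sq_abs, h1]
  ring

lemma fderiv_wt (x y : Cn n) : fderiv ℝ D.wt x y = 2 * (D.B y x).re := by
  have h1 : HasDerivAt (fun r : ℝ => x + (r : ℂ) • y) y 0 := by
    have h := ((hasDerivAt_id (0 : ℝ)).smul_const y).const_add x
    simp only [id, one_smul, ← re_smul_eq] at h ⊢
    exact h
  have h2 : HasFDerivAt D.wt (fderiv ℝ D.wt x) (x + ((0 : ℝ) : ℂ) • y) := by
    rw [ofReal_zero, zero_smul, add_zero]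
    exact ((D.contDiff_wt.differentiable (by simp)) x).hasFDerivAt
  have h3 := h2.comp_hasDerivAt (0 : ℝ) h1
  have h4 : HasDerivAt (fun r : ℝ => D.wt x + 2 * r * (D.B y x).re + r ^ 2 * D.wt y)
      (2 * (D.B y x).re) 0 := by
    have := (((hasDerivAt_id (0 : ℝ)).const_mul 2).mul_const (D.B y x).re).const_add (D.wt x)
    have h5 := this.add (((hasDerivAt_id (0 : ℝ)).pow 2).mul_const (D.wt y))
    exact h5.congr_deriv (by simp)
  have h6 : (D.wt ∘ fun r : ℝ => x + (r : ℂ) • y) =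
      fun r : ℝ => D.wt x + 2 * r * (D.B y x).re + r ^ 2 * D.wt y := by
    ext r; exact D.wt_add_smul x y r
  rw [h6] at h3
  exact h3.unique h4

lemma del_wt (x z : Cn n) : del D.wt x z = D.B z x := by
  have h1 : D.B (I • z) x = I * D.B z x := by
    simp only [B, map_smul, LinearMap.smul_apply, smul_eq_mul]; ring
  rw [del, fderiv_wt, fderiv_wt, h1, I_mul_re]
  apply Complex.ext <;> simp

lemma contDiff_homE (hφ : ContDiff ℝ 1 φ) (z : Cn n) (t : ℝ) : ContDiff ℝ 1 (D.homE h φ z t) := by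
  have h1 : ContDiff ℝ 1 fun x => D.B z x := (D.contDiff_B_right z).of_le (by simp)
  have h2 : ContDiff ℝ 1 D.wt := D.contDiff_wt.of_le (by simp)
  have h3 : ContDiff ℝ 1 fun x => ((D.wt x + φ x : ℝ) : ℂ) := ofRealCLM.contDiff.comp (h2.add hφ)
  unfold homE
  simp only [div_eq_mul_inv, ← ofReal_add]
  exact (((contDiff_const.mul h1).sub contDiff_const).sub (contDiff_const.mul h3)).mul contDiff_const

lemma contDiff_homJ (hφ : ContDiff ℝ 1 φ) (hu : Differentiable ℂ u) (hv : Differentiable ℂ v)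
    (z : Cn n) (t : ℝ) : ContDiff ℝ 1 (D.homJ h φ u v z t) := by
  have h1 : ContDiff ℝ 1 u := (contDiff_of_differentiable hu).restrict_scalars ℝ
  have h2 : ContDiff ℝ 1 v := (contDiff_of_differentiable hv).restrict_scalars ℝ
  have h3 : ContDiff ℝ 1 fun x => cexp (D.homE h φ z t x) := (D.contDiff_homE hφ z t).cexp
  exact (h3.mul (h1.comp (contDiff_id.sub contDiff_const))).mul (conjCLE.contDiff.comp h2)

lemma fderiv_homE (hφ : ContDiff ℝ 1 φ) (z : Cn n) (t : ℝ) (x y : Cn n) :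
    fderiv ℝ (D.homE h φ z t) x y =
      (2 * t * D.B z y - 2 * (2 * (D.B y x).re + fderiv ℝ φ x y)) / h := by
  have h1 : HasFDerivAt (fun x => D.B z x) (fderiv ℝ (fun x => D.B z x) x) x :=
    ((D.contDiff_B_right z).differentiable (by simp) x).hasFDerivAt
  have h1' : fderiv ℝ (fun x => D.B z x) x y = D.B z y := by
    have h3 : HasDerivAt (fun r : ℝ => x + r • y) y 0 := by
      simpa using ((hasDerivAt_id (0 : ℝ)).smul_const y).const_add x
    have h4 : HasFDerivAt (fun x => D.B z x) (fderiv ℝ (fun x => D.B z x) x) (x + (0 : ℝ) • y) := by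
      rw [zero_smul, add_zero]; exact h1
    have h5 := h4.comp_hasDerivAt (0 : ℝ) h3
    have h6 : ((fun x => D.B z x) ∘ fun r : ℝ => x + r • y) =
        fun r : ℝ => D.B z x + (r : ℂ) * D.B z y := by
      ext r
      simp only [Function.comp, B, re_smul_eq, map_add, map_smulₛₗ, smul_eq_mul, RingHom.id_apply,
        conj_ofReal]
      ring
    rw [h6] at h5
    have h7 := ((hasDerivAt_id (0 : ℝ)).ofReal_comp.mul_const (D.B z y)).const_add (D.B z x)
    simp only [ofReal_one, one_mul, id] at h7
    exact h5.unique h7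
  have h2 : HasFDerivAt D.wt (fderiv ℝ D.wt x) x :=
    (D.contDiff_wt.differentiable (by simp) x).hasFDerivAt
  have h3 : HasFDerivAt φ (fderiv ℝ φ x) x := (hφ.differentiable one_ne_zero x).hasFDerivAt
  have h4 : HasFDerivAt (fun x => ((D.wt x + φ x : ℝ) : ℂ))
      (ofRealCLM.comp (fderiv ℝ D.wt x + fderiv ℝ φ x)) x :=
    ofRealCLM.hasFDerivAt.comp x (h2.add h3)
  have h5 := (((h1.const_mul (2 * t : ℂ)).sub_const ((t : ℂ) ^ 2 * D.B z z)).sub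
    (h4.const_mul (2 : ℂ))).mul_const ((h : ℂ)⁻¹)
  have h6 : D.homE h φ z t = fun x => (2 * t * D.B z x - t ^ 2 * D.B z z -
      2 * ((D.wt x + φ x : ℝ) : ℂ)) * (h : ℂ)⁻¹ := by
    ext x; rw [homE, div_eq_mul_inv, ofReal_add]
  have h7 : HasFDerivAt (D.homE h φ z t) _ x := h6 ▸ h5
  rw [h7.fderiv]
  simp [h1', fderiv_wt]
  ring

/-- The derivative of the interpolating integrand in the direction `y`. -/
lemma fderiv_homJ (hφ : ContDiff ℝ 1 φ) (hu : Differentiable ℂ u) (hv : Differentiable ℂ v)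
    (z : Cn n) (t : ℝ) (x y : Cn n) : fderiv ℝ (D.homJ h φ u v z t) x y =
      (2 * t * D.B z y - 2 * (2 * (D.B y x).re + fderiv ℝ φ x y)) / h * D.homJ h φ u v z t x +
      cexp (D.homE h φ z t x) * fderiv ℂ u (x - (t : ℂ) • z) y * conj (v x) +
      cexp (D.homE h φ z t x) * u (x - (t : ℂ) • z) * conj (fderiv ℂ v x y) := by
  have h1 : HasFDerivAt (D.homE h φ z t) (fderiv ℝ (D.homE h φ z t) x) x :=
    ((D.contDiff_homE hφ z t).differentiable one_ne_zero x).hasFDerivAt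
  have hs : HasFDerivAt (fun x => x - (t : ℂ) • z) (ContinuousLinearMap.id ℝ (Cn n)) x :=
    (hasFDerivAt_id x).sub_const _
  have h2 : HasFDerivAt (fun x => u (x - (t : ℂ) • z)) _ x :=
    ((hu (x - (t : ℂ) • z)).hasFDerivAt.restrictScalars ℝ).comp x hs
  have h3 : HasFDerivAt (fun x => conj (v x))
      ((conjCLE : ℂ →L[ℝ] ℂ).comp ((fderiv ℂ v x).restrictScalars ℝ)) x :=
    (conjCLE : ℂ →L[ℝ] ℂ).hasFDerivAt.comp x ((hv x).hasFDerivAt.restrictScalars ℝ)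
  have h4 : HasFDerivAt (D.homJ h φ u v z t) _ x := (h1.cexp.mul h2).mul h3
  rw [h4.fderiv]
  simp [D.fderiv_homE hφ, homJ]
  ring

/-- The integrand is transported by the vector field `-z·∂`, up to a factor. -/
lemma hasDerivAt_homJ (hu : Differentiable ℂ u) (z : Cn n) (t : ℝ) (x : Cn n) :
    HasDerivAt (fun t => D.homJ h φ u v z t x)
      ((2 * D.B z x - 2 * t * D.B z z) / h * D.homJ h φ u v z t x -
        cexp (D.homE h φ z t x) * fderiv ℂ u (x - (t : ℂ) • z) z * conj (v x)) t := by
  have h0 : HasDerivAt (fun t : ℝ => (t : ℂ)) 1 t := (hasDerivAt_id t).ofReal_comp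
  have h1 : HasDerivAt (fun t => D.homE h φ z t x) ((2 * D.B z x - 2 * t * D.B z z) / h) t := by
    have := ((((h0.const_mul 2).mul_const (D.B z x)).sub ((h0.pow 2).mul_const
      (D.B z z))).sub_const (2 * (D.wt x + φ x : ℂ))).div_const (h : ℂ)
    refine HasDerivAt.congr_deriv this ?_
    simp
  have h2 : HasDerivAt (fun t : ℝ => u (x - (t : ℂ) • z)) (-(fderiv ℂ u (x - (t : ℂ) • z) z)) t := by
    have h3 : HasDerivAt (fun t : ℝ => x - (t : ℂ) • z) (-z) t := by
      have := (h0.smul_const z).const_sub x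
      simpa using this
    have h4 := ((hu (x - (t : ℂ) • z)).hasFDerivAt.restrictScalars ℝ).comp_hasDerivAt t h3
    exact h4.congr_deriv (by simp)
  have h3 := (h1.cexp.mul h2).mul_const (conj (v x))
  refine HasDerivAt.congr_deriv h3 ?_
  simp only [homJ]; ring

/-- The holomorphic derivative `z·∂` of the interpolating integrand. -/
lemma del_homJ (hφ : ContDiff ℝ 1 φ) (hu : Differentiable ℂ u) (hv : Differentiable ℂ v)
    (z : Cn n) (t : ℝ) (x : Cn n) : (1 / 2 : ℂ) * (fderiv ℝ (D.homJ h φ u v z t) x z -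
        I * fderiv ℝ (D.homJ h φ u v z t) x (I • z)) =
      (2 * t * D.Q z z - 2 * (D.B z x + del φ x z)) / h * D.homJ h φ u v z t x +
      cexp (D.homE h φ z t x) * fderiv ℂ u (x - (t : ℂ) • z) z * conj (v x) := by
  have hB : D.B (I • z) x = I * D.B z x := by
    simp only [B, map_smul, LinearMap.smul_apply, smul_eq_mul]; ring
  have hB2 : D.B z (I • z) = -I * D.H z z + I * D.Q z z := by
    simp only [B, map_smulₛₗ, smul_eq_mul, RingHom.id_apply, conj_I]
  have hB3 : (((D.B z x).re : ℂ) - I * ((I * D.B z x).re : ℂ)) = D.B z x := by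
    rw [I_mul_re]; apply Complex.ext <;> simp
  rw [D.fderiv_homJ hφ hu hv, D.fderiv_homJ hφ hu hv, hB, hB2, del]
  have hB4 : D.B z z = D.H z z + D.Q z z := rfl
  rw [hB4]
  simp only [map_smul, smul_eq_mul, map_mul, conj_I]
  ring_nf
  simp only [I_sq]
  linear_combination (-(2 / h) * D.homJ h φ u v z t x) * hB3

/-- Adding `hasDerivAt_homJ` and `del_homJ` cancels the derivatives of u, and v̄ is not seen by ∂.
What is left of ∂_t J + z·∂J is the factor -(2 ∂φ·z + 2tN(z))/h times J, which is exactly what the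
integrating factor K removes. -/
lemma hasDerivAt_homK_mul_homJ (hφ : ContDiff ℝ 1 φ) (hu : Differentiable ℂ u)
    (hv : Differentiable ℂ v) (z : Cn n) (t : ℝ) (x : Cn n) :
    HasDerivAt (fun t => D.homK h φ z t x * D.homJ h φ u v z t x)
      (-(D.homK h φ z t x * ((1 / 2 : ℂ) * (fderiv ℝ (D.homJ h φ u v z t) x z -
        I * fderiv ℝ (D.homJ h φ u v z t) x (I • z))))) t := by
  have h0 : HasDerivAt (fun t : ℝ => (t : ℂ)) 1 t := (hasDerivAt_id t).ofReal_comp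
  have h1 : HasDerivAt (fun t => D.homK h φ z t x)
      (D.homK h φ z t x * ((2 * del φ x z + 2 * t * D.N z) / h)) t := by
    have h2 := ((((h0.const_sub 1).mul_const 2).div_const (h : ℂ)).mul_const (del φ x z)).neg
    have h3 := ((((h0.pow 2).const_sub 1).mul_const (D.N z : ℂ)).div_const (h : ℂ))
    refine HasDerivAt.congr_deriv (h2.sub h3).cexp ?_
    simp only [homK, Pi.sub_apply, Pi.neg_apply]
    simp
    ring_nf
  refine HasDerivAt.congr_deriv (h1.mul (D.hasDerivAt_homJ hu z t x)) ?_
  rw [D.del_homJ hφ hu hv, ← H_self]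
  simp only [B]
  ring

end QData

lemma norm_integral_mul_del_le {n : ℕ} {F J : Cn n → ℂ} {L : ℝ} (hL : ∀ x y, ‖F x - F y‖ ≤ L * ‖x - y‖)
    (hFc : Continuous F) (hFs : HasCompactSupport F) (hJ : ContDiff ℝ 1 J) (hJi : Integrable J)
    (z : Cn n) : ‖∫ x, F x * ((1 / 2 : ℂ) * (fderiv ℝ J x z - I * fderiv ℝ J x (I • z)))‖ ≤
      L * ‖z‖ * ∫ x, ‖J x‖ := by
  have hint : ∀ y : Cn n, Integrable fun x => F x * fderiv ℝ J x y := fun y =>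
    (hFc.mul ((hJ.continuous_fderiv one_ne_zero).clm_apply
      (continuous_const (y := y)))).integrable_of_hasCompactSupport hFs.mul_right
  have e : ∀ x, F x * ((1 / 2 : ℂ) * (fderiv ℝ J x z - I * fderiv ℝ J x (I • z))) =
      (1 / 2 : ℂ) * (F x * fderiv ℝ J x z) - (I / 2) * (F x * fderiv ℝ J x (I • z)) :=
    fun x => by ring
  simp only [e]
  rw [integral_sub ((hint z).const_mul _) ((hint (I • z)).const_mul _), integral_const_mul,
    integral_const_mul]
  have l1 := norm_integral_mul_fderiv_le hL hFc hFs hJ hJi z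
  have l2 := norm_integral_mul_fderiv_le hL hFc hFs hJ hJi (I • z)
  rw [norm_smul, norm_I, one_mul] at l2
  refine (norm_sub_le _ _).trans ?_
  rw [norm_mul, norm_mul, norm_div, norm_div, norm_one, norm_I, RCLike.norm_ofNat]
  linarith

namespace QData

variable {n : ℕ} (D : QData n) {h ε : ℝ} {φ : Cn n → ℝ} {u v : Cn n → ℂ}

/-- The quadratic weight is transported exactly. In terms of the perturbed weight the only defect is
the increment of φ along tz, which is O(ε|z|), or O(ε) if the gradient is not used. -/
lemma re_homE (z : Cn n) (t : ℝ) (x : Cn n) : (D.homE h φ z t x).re =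
    (-(D.wt (x - (t : ℂ) • z) + φ (x - (t : ℂ) • z)) / h) + (-(D.wt x + φ x) / h) +
      (φ (x - (t : ℂ) • z) - φ x) / h := by
  have h1 := D.wt_sub x ((t : ℂ) • z)
  have e1 : D.B ((t : ℂ) • z) x = t * D.B z x := by
    simp only [B, map_smul, LinearMap.smul_apply, smul_eq_mul]; ring
  have e2 : D.B ((t : ℂ) • z) ((t : ℂ) • z) = t ^ 2 * D.B z z := by
    simp only [B, map_smulₛₗ, map_smul, LinearMap.smul_apply, smul_eq_mul, RingHom.id_apply,
      conj_ofReal]; ring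
  rw [e1, e2] at h1
  have e3 : (2 * t * D.B z x - t ^ 2 * D.B z z - 2 * (D.wt x + φ x) : ℂ) =
      (2 * (t * D.B z x) - t ^ 2 * D.B z z) - ((2 * (D.wt x + φ x) : ℝ) : ℂ) := by push_cast; ring
  rw [homE, div_ofReal_re, e3, sub_re, ← h1, ofReal_re]
  ring

lemma norm_homJ_le (hh : 0 < h) (z : Cn n) {t m : ℝ} (x : Cn n)
    (hm : φ (x - (t : ℂ) • z) - φ x ≤ m) :
    ‖D.homJ h φ u v z t x‖ ≤ Real.exp (m / h) *
      ((‖u (x - (t : ℂ) • z)‖ * Real.exp (-(D.wt (x - (t : ℂ) • z) + φ (x - (t : ℂ) • z)) / h)) *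
        (‖v x‖ * Real.exp (-(D.wt x + φ x) / h))) := by
  rw [homJ, norm_mul, norm_mul, norm_exp, re_homE, Real.exp_add, Real.exp_add, RCLike.norm_conj]
  have h2 : Real.exp ((φ (x - (t : ℂ) • z) - φ x) / h) ≤ Real.exp (m / h) :=
    Real.exp_le_exp.2 (by gcongr)
  calc _ = Real.exp ((φ (x - (t : ℂ) • z) - φ x) / h) *
      ((‖u (x - (t : ℂ) • z)‖ * Real.exp (-(D.wt (x - (t : ℂ) • z) + φ (x - (t : ℂ) • z)) / h)) *
        (‖v x‖ * Real.exp (-(D.wt x + φ x) / h))) := by ring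
    _ ≤ _ := by gcongr

lemma _root_.SmallPert.sub_smul_sub_le (P : SmallPert φ ε) (z : Cn n) {t : ℝ} (ht : |t| ≤ 1)
    (x : Cn n) : φ (x - (t : ℂ) • z) - φ x ≤ ε * ‖z‖ := by
  refine (le_abs_self _).trans ((P.abs_sub_le _ _).trans ?_)
  rw [sub_sub_cancel_left, norm_neg, norm_smul, norm_real, Real.norm_eq_abs]
  exact mul_le_mul_of_nonneg_left (mul_le_of_le_one_left (norm_nonneg _) ht) P.nonneg

lemma norm_homJ_zero_le (z : Cn n) (x : Cn n) : ‖D.homJ h φ u v z 0 x‖ =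
      (‖u x‖ * Real.exp (-(D.wt x + φ x) / h)) * (‖v x‖ * Real.exp (-(D.wt x + φ x) / h)) := by
  rw [homJ, norm_mul, norm_mul, norm_exp, re_homE, RCLike.norm_conj]
  simp only [ofReal_zero, zero_smul, sub_zero, sub_self, zero_div, add_zero, Real.exp_add]
  ring

lemma integrable_mul_weights {Φ : Cn n → ℝ} (hΦ : Continuous Φ) (hu : Continuous u)
    (hv : Continuous v) (hu2 : SqInt Φ h u) (hv2 : SqInt Φ h v) (y : Cn n) :
    Integrable (fun x => (‖u (x - y)‖ * Real.exp (-Φ (x - y) / h)) *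
        (‖v x‖ * Real.exp (-Φ x / h))) ∧
      ∫ x, (‖u (x - y)‖ * Real.exp (-Φ (x - y) / h)) * (‖v x‖ * Real.exp (-Φ x / h)) ≤
        weightedNorm Φ h u * weightedNorm Φ h v := by
  have hsq : ∀ {w : Cn n → ℂ} (x : Cn n), (‖w x‖ * Real.exp (-Φ x / h)) ^ 2 =
      ‖w x‖ ^ 2 * Real.exp (-2 * Φ x / h) := fun x => by rw [mul_pow, ← exp_sq]
  have h1 := integral_mul_le_sqrt (μ := (volume : Measure (Cn n)))
    (f := fun x => ‖u (x - y)‖ * Real.exp (-Φ (x - y) / h))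
    (g := fun x => ‖v x‖ * Real.exp (-Φ x / h))
    (Continuous.aestronglyMeasurable (by fun_prop)) (Continuous.aestronglyMeasurable (by fun_prop))
    (fun x => by positivity) (fun x => by positivity)
    (by
      simp only [hsq]
      exact hu2.comp_sub_right y)
    (by simp only [hsq]; exact hv2)
  simp only [hsq] at h1
  rw [integral_sub_right_eq_self (fun x => ‖u x‖ ^ 2 * Real.exp (-2 * Φ x / h)) y] at h1
  exact h1

lemma integral_norm_homJ_le (P : SmallPert φ ε) (hh : 0 < h) (hu : Differentiable ℂ u)
    (hv : Differentiable ℂ v) (hu2 : SqInt (fun x => D.wt x + φ x) h u)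
    (hv2 : SqInt (fun x => D.wt x + φ x) h v) (z : Cn n) {t m : ℝ}
    (hm : ∀ x, φ (x - (t : ℂ) • z) - φ x ≤ m) :
    Integrable (D.homJ h φ u v z t) ∧ ∫ x, ‖D.homJ h φ u v z t x‖ ≤ Real.exp (m / h) *
      (weightedNorm (fun x => D.wt x + φ x) h u * weightedNorm (fun x => D.wt x + φ x) h v) := by
  have hφ := P.contDiff.continuous
  obtain ⟨h1, h2⟩ := integrable_mul_weights (h := h) (Φ := fun x => D.wt x + φ x) (by fun_prop)
    hu.continuous hv.continuous hu2 hv2 ((t : ℂ) • z)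
  have hi : Integrable (D.homJ h φ u v z t) := (h1.const_mul (Real.exp (m / h))).mono'
    (D.contDiff_homJ P.contDiff hu hv z t).continuous.aestronglyMeasurable
    (Eventually.of_forall fun x => D.norm_homJ_le hh z x (hm x))
  refine ⟨hi, (integral_mono hi.norm (h1.const_mul (Real.exp (m / h)))
    fun x => D.norm_homJ_le hh z x (hm x)).trans ?_⟩
  rw [integral_const_mul]
  exact mul_le_mul_of_nonneg_left h2 (Real.exp_pos _).le

/-- For 0 ≤ t ≤ 1 the N(z) term has a favourable sign, so only ∂φ contributes. -/
lemma re_homK_exponent_le (P : SmallPert φ ε) (hh : 0 < h) (z : Cn n) {t : ℝ} (h0 : 0 ≤ t)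
    (h1 : t ≤ 1) (x : Cn n) : (-((1 - t) * 2 / h * del φ x z) - (1 - t ^ 2) * D.N z / h : ℂ).re ≤
      2 * ε * ‖z‖ / h := by
  have e1 : (-((1 - t) * 2 / h * del φ x z) - (1 - t ^ 2) * D.N z / h : ℂ) =
      ((-((1 - t) * 2 / h) : ℝ) : ℂ) * del φ x z - (((1 - t ^ 2) * D.N z / h : ℝ) : ℂ) := by
    push_cast; ring
  rw [e1, sub_re, ofReal_re, re_ofReal_mul]
  have h2 := (abs_re_le_norm (del φ x z)).trans (P.norm_del_le x z)
  have h3 : 0 ≤ (1 - t ^ 2) * D.N z / h :=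
    div_nonneg (mul_nonneg (by nlinarith) (D.N_nonneg z)) hh.le
  have h4 : -((1 - t) * 2 / h) * (del φ x z).re ≤ 2 / h * (ε * ‖z‖) := by
    have h5 : (1 - t) * 2 / h ≤ 2 / h := by gcongr; linarith
    have h6 : 0 ≤ (1 - t) * 2 / h := div_nonneg (by linarith) hh.le
    have h7 := neg_abs_le (del φ x z).re
    calc -((1 - t) * 2 / h) * (del φ x z).re = (1 - t) * 2 / h * (-(del φ x z).re) := by ring
      _ ≤ (1 - t) * 2 / h * |(del φ x z).re| := by gcongr; linarith
      _ ≤ 2 / h * (ε * ‖z‖) := by gcongr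
  have h8 : 2 / h * (ε * ‖z‖) = 2 * ε * ‖z‖ / h := by ring
  linarith

lemma norm_homK_le (P : SmallPert φ ε) (hh : 0 < h) (z : Cn n) {t : ℝ} (h0 : 0 ≤ t)
    (h1 : t ≤ 1) (x : Cn n) : ‖D.homK h φ z t x‖ ≤ Real.exp (2 * ε * ‖z‖ / h) := by
  rw [homK, norm_exp]
  exact Real.exp_le_exp.2 (D.re_homK_exponent_le P hh z h0 h1 x)

lemma norm_homK_sub_le (P : SmallPert φ ε) (hh : 0 < h) (z : Cn n) {t : ℝ} (h0 : 0 ≤ t)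
    (h1 : t ≤ 1) (x y : Cn n) : ‖D.homK h φ z t x - D.homK h φ z t y‖ ≤
      Real.exp (2 * ε * ‖z‖ / h) * (2 * ε * ‖z‖ / h) * ‖x - y‖ := by
  refine (norm_cexp_sub_cexp_le (D.re_homK_exponent_le P hh z h0 h1 x)
    (D.re_homK_exponent_le P hh z h0 h1 y)).trans ?_
  rw [mul_assoc (Real.exp _)]
  refine mul_le_mul_of_nonneg_left ?_ (Real.exp_pos _).le
  have e1 : (-((1 - t) * 2 / h * del φ x z) - (1 - t ^ 2) * D.N z / h -
      (-((1 - t) * 2 / h * del φ y z) - (1 - t ^ 2) * D.N z / h) : ℂ) =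
      ((-((1 - t) * 2 / h) : ℝ) : ℂ) * (del φ x z - del φ y z) := by push_cast; ring
  rw [e1, norm_mul, norm_real, norm_neg, Real.norm_eq_abs,
    abs_of_nonneg (div_nonneg (by linarith) hh.le)]
  have h5 : (1 - t) * 2 / h ≤ 2 / h := by gcongr; linarith
  have h6 : 0 ≤ (1 - t) * 2 / h := div_nonneg (by linarith) hh.le
  calc _ ≤ 2 / h * (ε * ‖x - y‖ * ‖z‖) := by
        gcongr
        exact P.norm_del_sub_le x y z
    _ = _ := by ring

lemma continuous_homE (hφ : Continuous φ) (z : Cn n) :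
    Continuous fun r : ℝ × Cn n => D.homE h φ z r.1 r.2 := by
  unfold homE; fun_prop

lemma continuous_homJ (hφ : Continuous φ) (hu : Continuous u) (hv : Continuous v) (z : Cn n) :
    Continuous fun r : ℝ × Cn n => D.homJ h φ u v z r.1 r.2 := by
  have := D.continuous_homE (h := h) hφ z
  unfold homJ; fun_prop

lemma continuous_homK (P : SmallPert φ ε) (z : Cn n) :
    Continuous fun r : ℝ × Cn n => D.homK h φ z r.1 r.2 := by
  have := P.continuous_del (f := fun r : ℝ × Cn n => r.2) (g := fun _ => z) (by fun_prop)
    (by fun_prop)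
  unfold homK; fun_prop

lemma continuous_homK_right (P : SmallPert φ ε) (z : Cn n) (t : ℝ) :
    Continuous fun x => D.homK h φ z t x := by
  have := P.continuous_del (f := fun x : Cn n => x) (g := fun _ => z) (by fun_prop) (by fun_prop)
  unfold homK; fun_prop

lemma continuous_fderiv_homJ (hφ : ContDiff ℝ 1 φ) (hu : Differentiable ℂ u)
    (hv : Differentiable ℂ v) (z y : Cn n) :
    Continuous fun r : ℝ × Cn n => fderiv ℝ (D.homJ h φ u v z r.1) r.2 y := by
  have huc := hu.continuous
  have hvc := hv.continuous
  have hφc := hφ.continuous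
  have h1 : Continuous fun r : ℝ × Cn n => fderiv ℂ u (r.2 - (r.1 : ℂ) • z) y :=
    (((contDiff_of_differentiable hu).continuous_fderiv one_ne_zero).comp
      (by fun_prop : Continuous fun r : ℝ × Cn n => r.2 - (r.1 : ℂ) • z)).clm_apply continuous_const
  have h2 : Continuous fun r : ℝ × Cn n => fderiv ℂ v r.2 y :=
    (((contDiff_of_differentiable hv).continuous_fderiv one_ne_zero).comp
      continuous_snd).clm_apply continuous_const
  have h3 : Continuous fun r : ℝ × Cn n => fderiv ℝ φ r.2 y :=
    ((hφ.continuous_fderiv one_ne_zero).comp continuous_snd).clm_apply continuous_const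
  have h4 := D.continuous_homE (h := h) hφc z
  have h5 := D.continuous_homJ (h := h) hφc huc hvc z
  simp only [D.fderiv_homJ hφ hu hv]
  fun_prop

lemma norm_mul_homK_sub_le (P : SmallPert φ ε) (hh : 0 < h) (z : Cn n) {t : ℝ} (h0 : 0 ≤ t)
    (h1 : t ≤ 1) {β : Cn n → ℂ} {d : ℝ} (hβd : ∀ x, ‖β x‖ ≤ d)
    (hβL : ∀ x y, ‖β x - β y‖ ≤ 2 * d * ‖x - y‖) (x y : Cn n) :
    ‖β x * D.homK h φ z t x - β y * D.homK h φ z t y‖ ≤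
      d * (2 + 2 * ε * ‖z‖ / h) * Real.exp (2 * ε * ‖z‖ / h) * ‖x - y‖ := by
  have hd : 0 ≤ d := (norm_nonneg _).trans (hβd 0)
  have e : β x * D.homK h φ z t x - β y * D.homK h φ z t y = (β x - β y) * D.homK h φ z t x +
      β y * (D.homK h φ z t x - D.homK h φ z t y) := by ring
  rw [e]
  refine (norm_add_le _ _).trans ?_
  simp only [norm_mul]
  have k1 := D.norm_homK_le P hh z h0 h1 x
  have k2 := D.norm_homK_sub_le P hh z h0 h1 x y
  calc _ ≤ (2 * d * ‖x - y‖) * Real.exp (2 * ε * ‖z‖ / h) +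
        d * (Real.exp (2 * ε * ‖z‖ / h) * (2 * ε * ‖z‖ / h) * ‖x - y‖) :=
        add_le_add (mul_le_mul (hβL x y) k1 (norm_nonneg _) (by positivity))
          (mul_le_mul (hβd y) k2 (norm_nonneg _) hd)
    _ = _ := by ring

lemma hasDerivAt_integral_homJ (P : SmallPert φ ε) (hu : Differentiable ℂ u)
    (hv : Differentiable ℂ v) (z : Cn n) {β : Cn n → ℂ} (hβ : Continuous β)
    (hβs : HasCompactSupport β) (t : ℝ) :
    HasDerivAt (fun t => ∫ x, β x * (D.homK h φ z t x * D.homJ h φ u v z t x))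
      (∫ x, β x * -(D.homK h φ z t x * ((1 / 2 : ℂ) * (fderiv ℝ (D.homJ h φ u v z t) x z -
        I * fderiv ℝ (D.homJ h φ u v z t) x (I • z))))) t := by
  have hKc := D.continuous_homK (h := h) P z
  have hJc := D.continuous_homJ (h := h) P.contDiff.continuous hu.continuous hv.continuous z
  have hJ1 := D.continuous_fderiv_homJ (h := h) P.contDiff hu hv z z
  have hJ2 := D.continuous_fderiv_homJ (h := h) P.contDiff hu hv z (I • z)
  have hβ0 : ∀ x ∉ tsupport β, β x = 0 := fun x hx => image_eq_zero_of_notMem_tsupport hx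
  have hβ2 : Continuous fun r : ℝ × Cn n => β r.2 := hβ.comp continuous_snd
  refine hasDerivAt_integral_of_compact (G := fun t x => β x *
      (D.homK h φ z t x * D.homJ h φ u v z t x))
    (G' := fun t x => β x * -(D.homK h φ z t x * ((1 / 2 : ℂ) *
      (fderiv ℝ (D.homJ h φ u v z t) x z - I * fderiv ℝ (D.homJ h φ u v z t) x (I • z)))))
    hβs.isCompact (hβ2.mul (hKc.mul hJc))
    (hβ2.mul (hKc.mul (continuous_const.mul (hJ1.sub (continuous_const.mul hJ2)))).neg)
    (fun t x hx => by rw [hβ0 x hx, zero_mul]) (fun t x hx => by rw [hβ0 x hx, zero_mul])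
    (fun t x => (D.hasDerivAt_homK_mul_homJ (h := h) P.contDiff hu hv z t x).const_mul (β x)) t

/-- The holomorphic derivative of J is integrated by parts onto βK. This needs only that βK is
Lipschitz, hence only that ∂φ is Lipschitz; a C^{1,1} perturbation is enough. -/
lemma norm_integral_deriv_le (P : SmallPert φ ε) (hh : 0 < h) (hu : Differentiable ℂ u)
    (hv : Differentiable ℂ v) (hu2 : SqInt (fun x => D.wt x + φ x) h u)
    (hv2 : SqInt (fun x => D.wt x + φ x) h v) (z : Cn n) {β : Cn n → ℂ} {d : ℝ}
    (hβ : Continuous β) (hβs : HasCompactSupport β) (hβd : ∀ x, ‖β x‖ ≤ d)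
    (hβL : ∀ x y, ‖β x - β y‖ ≤ 2 * d * ‖x - y‖) {t : ℝ} (h0 : 0 ≤ t) (h1 : t ≤ 1) :
    ‖∫ x, β x * -(D.homK h φ z t x * ((1 / 2 : ℂ) * (fderiv ℝ (D.homJ h φ u v z t) x z -
        I * fderiv ℝ (D.homJ h φ u v z t) x (I • z))))‖ ≤
      d * (2 + 2 * ε * ‖z‖ / h) * Real.exp (2 * ε * ‖z‖ / h) * ‖z‖ * (Real.exp (ε * ‖z‖ / h) *
        (weightedNorm (fun x => D.wt x + φ x) h u * weightedNorm (fun x => D.wt x + φ x) h v)) := by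
  obtain ⟨i1, i2⟩ := D.integral_norm_homJ_le P hh hu hv hu2 hv2 z (t := t)
    (P.sub_smul_sub_le z (abs_le.2 ⟨by linarith, h1⟩))
  have hd : 0 ≤ d := (norm_nonneg _).trans (hβd 0)
  have hKc := D.continuous_homK_right (h := h) P z t
  have key := norm_integral_mul_del_le (D.norm_mul_homK_sub_le P hh z h0 h1 hβd hβL)
    (hβ.mul hKc) hβs.mul_right (D.contDiff_homJ (h := h) P.contDiff hu hv z t) i1 z
  have hε := P.nonneg
  have hc0 : 0 ≤ d * (2 + 2 * ε * ‖z‖ / h) * Real.exp (2 * ε * ‖z‖ / h) * ‖z‖ := by positivity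
  refine le_trans (le_of_eq ?_) (key.trans (mul_le_mul_of_nonneg_left i2 hc0))
  rw [← norm_neg, ← integral_neg]
  congr 1
  refine integral_congr_ae (Eventually.of_forall fun x => ?_)
  show -(_ * -(_ * _)) = _ * _ * _
  ring

/-- The main estimate: the translation by `z` can be replaced by a multiplication. -/
lemma norm_integral_homJ_sub_le (P : SmallPert φ ε) (hh : 0 < h) (hu : Differentiable ℂ u)
    (hv : Differentiable ℂ v) (hu2 : SqInt (fun x => D.wt x + φ x) h u)
    (hv2 : SqInt (fun x => D.wt x + φ x) h v) (z : Cn n) {β : Cn n → ℂ} {d : ℝ}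
    (hβ : Continuous β) (hβs : HasCompactSupport β) (hβd : ∀ x, ‖β x‖ ≤ d)
    (hβL : ∀ x y, ‖β x - β y‖ ≤ 2 * d * ‖x - y‖) :
    ‖(∫ x, β x * D.homJ h φ u v z 1 x) -
        ∫ x, β x * (D.homK h φ z 0 x * D.homJ h φ u v z 0 x)‖ ≤
      d * ‖z‖ * (2 + 2 * ε * ‖z‖ / h) * Real.exp (3 * ε * ‖z‖ / h) *
      (weightedNorm (fun x => D.wt x + φ x) h u * weightedNorm (fun x => D.wt x + φ x) h v) := by
  have := norm_image_sub_le_of_norm_deriv_le_segment_01'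
    (fun t _ => (D.hasDerivAt_integral_homJ (h := h) P hu hv z hβ hβs t).hasDerivWithinAt)
    (fun t ht => D.norm_integral_deriv_le P hh hu hv hu2 hv2 z hβ hβs hβd hβL ht.1 ht.2.le)
  -- K is normalised at t = 1, so this endpoint is the translation itself, and the whole correction
  -- appears at t = 0.
  have hK1 : ∀ x, D.homK h φ z 1 x = 1 := fun x => by simp [homK]
  simp only [hK1, one_mul] at this
  refine this.trans (le_of_eq ?_)
  have e3 : Real.exp (3 * ε * ‖z‖ / h) =
      Real.exp (2 * ε * ‖z‖ / h) * Real.exp (ε * ‖z‖ / h) := by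
    rw [← Real.exp_add]; congr 1; ring
  rw [e3]; ring

end QData

/-! ### Gevrey decay against exponential losses, and the pairing of a single wave packet. -/

lemma integrable_pow_mul_exp_neg_rpow {n m : ℕ} {c r : ℝ} (hc : 0 < c) (hr : 0 < r) :
    Integrable fun x : Cn n => (1 + ‖x‖) ^ m * Real.exp (-(c * ‖x‖ ^ r)) := by
  obtain ⟨M, hM⟩ := exists_exp_neg_rpow_le (d := m) (half_pos hc) hr (Nat.cast_nonneg m)
  have hcr : Continuous fun x : Cn n => ‖x‖ ^ r := continuous_norm.rpow_const fun x => Or.inr hr.le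
  refine ((integrable_exp_neg_rpow (μ := (volume : Measure (Cn n))) (half_pos hc) hr).const_mul
    M).mono' (Continuous.aestronglyMeasurable (by fun_prop)) (Eventually.of_forall fun x => ?_)
  rw [Real.norm_eq_abs, abs_of_nonneg (by positivity)]
  have h1 := hM ‖x‖ (norm_nonneg _)
  rw [Real.rpow_neg (by positivity), Real.rpow_natCast, ← div_eq_mul_inv,
    le_div_iff₀ (by positivity)] at h1
  have h2 : Real.exp (-(c * ‖x‖ ^ r)) =
      Real.exp (-(c / 2 * ‖x‖ ^ r)) * Real.exp (-(c / 2 * ‖x‖ ^ r)) := by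
    rw [← Real.exp_add]; congr 1; ring
  calc _ = (Real.exp (-(c / 2 * ‖x‖ ^ r)) * (1 + ‖x‖) ^ m) * Real.exp (-(c / 2 * ‖x‖ ^ r)) := by
        rw [h2]; ring
    _ ≤ _ := by gcongr

namespace QData

variable {n : ℕ} (D : QData n) {s c h ε : ℝ}

/-- A majorant of the damping factor times polynomials and small exponentials. -/
def maj (s c : ℝ) (m : ℕ) (w : Cn n × Cn n) : ℝ :=
  ((1 + ‖w.1‖) ^ m * Real.exp (-D.N w.1 + c * ‖w.1‖)) *
    ((1 + ‖w.2‖) ^ m * Real.exp (-(c / 2 * ‖w.2‖ ^ (1 / s))))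

lemma maj_nonneg (m : ℕ) (w : Cn n × Cn n) : 0 ≤ D.maj s c m w := by unfold maj; positivity

lemma integrable_maj (hs : 1 < s) (hc : 0 < c) (m : ℕ) : Integrable (D.maj s c m) := by
  have h1 : Integrable fun p : Cn n => (1 + ‖p‖) ^ m * Real.exp (-D.N p + c * ‖p‖) := by
    have hlo := D.lo_pos
    set E := Real.exp (c ^ 2 / (2 * D.lo))
    refine ((integrable_pow_mul_exp_neg_rpow (n := n) (m := m) (half_pos hlo) two_pos).const_mul
      E).mono' (Continuous.aestronglyMeasurable (by fun_prop)) (Eventually.of_forall fun p => ?_)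
    rw [Real.norm_eq_abs, abs_of_nonneg (by positivity), mul_left_comm, ← Real.exp_add]
    refine mul_le_mul_of_nonneg_left (Real.exp_le_exp.2 ?_) (by positivity)
    rw [Real.rpow_two]
    have h2 := D.lo_le p
    have h3 : c * ‖p‖ ≤ c ^ 2 / (2 * D.lo) + D.lo / 2 * ‖p‖ ^ 2 := by
      have h4 : c ^ 2 / (2 * D.lo) + D.lo / 2 * ‖p‖ ^ 2 - c * ‖p‖ =
          (c - D.lo * ‖p‖) ^ 2 / (2 * D.lo) := by field_simp; ring
      have h5 : 0 ≤ (c - D.lo * ‖p‖) ^ 2 / (2 * D.lo) := by positivity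
      linarith
    linarith
  exact h1.mul_prod (integrable_pow_mul_exp_neg_rpow (half_pos hc) (by positivity))

lemma maj_mono {m k : ℕ} (hmk : m ≤ k) (w : Cn n × Cn n) : D.maj s c m w ≤ D.maj s c k w := by
  unfold maj
  gcongr <;> simp

/-- For |ζ| ≤ 1/h one has (h|ζ|)^{1-1/s} ≤ 1, that is, h^{1-1/s}|ζ| ≤ |ζ|^{1/s}. This is where the
size h^{1-1/s} of the perturbation matches the Gevrey decay; half of the decay is spent. -/
lemma growth_le (hs : 1 < s) (hc : 0 < c) (hh : 0 < h) (hh1 : h ≤ 1)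
    (hε : ε ≤ c / 4 * h ^ (1 - 1 / s)) {w : Cn n × Cn n} (hw : ‖w.2‖ ≤ 1 / h) :
    2 * ε * (‖w.1‖ + ‖w.2‖) ≤ c / 2 * ‖w.1‖ + c / 2 * ‖w.2‖ ^ (1 / s) := by
  have hs1 : 0 < 1 - 1 / s := by
    have : 1 / s < 1 := by rw [div_lt_one (by linarith)]; exact hs
    linarith
  have h1 : h ^ (1 - 1 / s) ≤ 1 := Real.rpow_le_one hh.le hh1 hs1.le
  have h2 : h ^ (1 - 1 / s) * ‖w.2‖ ≤ ‖w.2‖ ^ (1 / s) := by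
    rcases eq_or_lt_of_le (norm_nonneg w.2) with h0 | h0
    · rw [← h0, mul_zero]; positivity
    have e : ‖w.2‖ = ‖w.2‖ ^ (1 - 1 / s) * ‖w.2‖ ^ (1 / s) := by
      rw [← Real.rpow_add h0]; simp
    have h3 : (h * ‖w.2‖) ^ (1 - 1 / s) ≤ 1 :=
      Real.rpow_le_one (by positivity) (by rwa [le_div_iff₀ hh, mul_comm] at hw) hs1.le
    rw [Real.mul_rpow hh.le h0.le] at h3
    calc h ^ (1 - 1 / s) * ‖w.2‖ = (h ^ (1 - 1 / s) * ‖w.2‖ ^ (1 - 1 / s)) * ‖w.2‖ ^ (1 / s) := by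
          conv_lhs => rw [e]
          ring
      _ ≤ 1 * ‖w.2‖ ^ (1 / s) := by gcongr
      _ = _ := one_mul _
  have h4 : ε * ‖w.1‖ ≤ c / 4 * ‖w.1‖ := by
    gcongr
    exact hε.trans (mul_le_of_le_one_right (by positivity) h1)
  have h5 : ε * ‖w.2‖ ≤ c / 4 * ‖w.2‖ ^ (1 / s) := by
    calc ε * ‖w.2‖ ≤ c / 4 * h ^ (1 - 1 / s) * ‖w.2‖ := by gcongr
      _ = c / 4 * (h ^ (1 - 1 / s) * ‖w.2‖) := by ring
      _ ≤ _ := by gcongr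
  linarith

lemma pow_mul_damp_mul_exp_le (hs : 1 < s) (hc : 0 < c) (hh : 0 < h) (hh1 : h ≤ 1)
    (hε : ε ≤ c / 4 * h ^ (1 - 1 / s)) (m : ℕ) {w : Cn n × Cn n} (hw : ‖w.2‖ ≤ 1 / h) :
    (1 + ‖w.1‖ + ‖w.2‖) ^ m * (D.damp s c w * Real.exp (2 * ε * (‖w.1‖ + ‖w.2‖))) ≤
      D.maj s c m w := by
  have h1 := growth_le hs hc hh hh1 hε hw
  have h2 : D.damp s c w * Real.exp (2 * ε * (‖w.1‖ + ‖w.2‖)) ≤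
      Real.exp (-D.N w.1 + c * ‖w.1‖) * Real.exp (-(c / 2 * ‖w.2‖ ^ (1 / s))) := by
    rw [damp, ← Real.exp_add, ← Real.exp_add, ← Real.exp_add]
    refine Real.exp_le_exp.2 ?_
    have : 0 ≤ c / 2 * ‖w.1‖ := by positivity
    linarith
  have h3 : 1 + ‖w.1‖ + ‖w.2‖ ≤ (1 + ‖w.1‖) * (1 + ‖w.2‖) := by
    nlinarith [mul_nonneg (norm_nonneg w.1) (norm_nonneg w.2)]
  have h4 := D.damp_nonneg s c w
  calc _ ≤ ((1 + ‖w.1‖) * (1 + ‖w.2‖)) ^ m *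
        (Real.exp (-D.N w.1 + c * ‖w.1‖) * Real.exp (-(c / 2 * ‖w.2‖ ^ (1 / s)))) := by gcongr
    _ = _ := by rw [maj, mul_pow]; ring

/-- Here h^{1-1/s}/h = (1/h)^{1/s} < |ζ|^{1/s}, so half of the decay pays for the crude loss
e^{2ε/h}. The factor h comes from 1 ≤ h|ζ|, at the price of one power of |ζ|. -/
lemma damp_mul_exp_le (hs : 1 < s) (hc : 0 < c) (hh : 0 < h)
    (hε : ε ≤ c / 4 * h ^ (1 - 1 / s)) {w : Cn n × Cn n} (hw : 1 / h < ‖w.2‖) :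
    D.damp s c w * Real.exp (2 * ε / h) ≤ h * D.maj s c 1 w := by
  have h1 : 2 * ε / h ≤ c / 2 * ‖w.2‖ ^ (1 / s) := by
    have e1 : h ^ (1 - 1 / s) / h = (1 / h) ^ (1 / s) := by
      rw [Real.rpow_sub hh, Real.rpow_one, Real.div_rpow zero_le_one hh.le, Real.one_rpow]
      field_simp
    have h2 : (1 / h) ^ (1 / s) ≤ ‖w.2‖ ^ (1 / s) :=
      Real.rpow_le_rpow (by positivity) hw.le (by positivity)
    calc 2 * ε / h ≤ 2 * (c / 4 * h ^ (1 - 1 / s)) / h := by gcongr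
      _ = c / 2 * (h ^ (1 - 1 / s) / h) := by ring
      _ ≤ _ := by rw [e1]; gcongr
  have h2 : D.damp s c w * Real.exp (2 * ε / h) ≤
      Real.exp (-D.N w.1 + c * ‖w.1‖) * Real.exp (-(c / 2 * ‖w.2‖ ^ (1 / s))) := by
    rw [damp, ← Real.exp_add, ← Real.exp_add, ← Real.exp_add]
    refine Real.exp_le_exp.2 ?_
    have : 0 ≤ c * ‖w.1‖ := by positivity
    linarith
  have h3 : 1 ≤ h * ((1 + ‖w.1‖) * (1 + ‖w.2‖)) := by
    have h4 : 1 ≤ h * ‖w.2‖ := by rw [div_lt_iff₀ hh, mul_comm] at hw; exact hw.le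
    have : ‖w.2‖ ≤ (1 + ‖w.1‖) * (1 + ‖w.2‖) := by
      nlinarith [mul_nonneg (norm_nonneg w.1) (norm_nonneg w.2), norm_nonneg w.1]
    exact h4.trans (by gcongr)
  have h5 : 0 ≤ Real.exp (-D.N w.1 + c * ‖w.1‖) * Real.exp (-(c / 2 * ‖w.2‖ ^ (1 / s))) := by
    positivity
  calc _ ≤ _ := h2
    _ ≤ h * ((1 + ‖w.1‖) * (1 + ‖w.2‖)) *
        (Real.exp (-D.N w.1 + c * ‖w.1‖) * Real.exp (-(c / 2 * ‖w.2‖ ^ (1 / s)))) :=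
        le_mul_of_one_le_left h5 h3
    _ = _ := by rw [maj]; ring

lemma norm_sub_I_smul_le (w : Cn n × Cn n) : ‖w.1 - I • w.2‖ ≤ ‖w.1‖ + ‖w.2‖ := by
  refine (norm_sub_le _ _).trans (le_of_eq ?_)
  rw [norm_smul, norm_I, one_mul]

lemma norm_zsh_le (hh : 0 < h) (w : Cn n × Cn n) : ‖zsh h w‖ ≤ h / 2 * (‖w.1‖ + ‖w.2‖) := by
  rw [zsh, norm_smul, norm_real, Real.norm_eq_abs, abs_of_pos (by positivity)]
  gcongr
  exact norm_sub_I_smul_le w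

variable {K M W : ℝ} {φ : Cn n → ℝ} {α u v ψ : Cn n → ℂ}

/-- The pairing of one wave packet, before the interpolation. -/
def pairing (α : Cn n → ℂ) (h : ℝ) (φ : Cn n → ℝ) (ψ u v : Cn n → ℂ) (w : Cn n × Cn n) : ℂ :=
  ∫ x, ψ x * D.amp α (x - (1 / 2 : ℂ) • zsh h w) w * D.homJ h φ u v (zsh h w) 1 x

/-- The pairing of one wave packet, after the interpolation. -/
def pairing₀ (α : Cn n → ℂ) (h : ℝ) (φ : Cn n → ℝ) (ψ u v : Cn n → ℂ) (w : Cn n × Cn n) : ℂ :=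
  ∫ x, ψ x * D.amp α (x - (1 / 2 : ℂ) • zsh h w) w *
    (D.homK h φ (zsh h w) 0 x * D.homJ h φ u v (zsh h w) 0 x)

/-- The interpolation estimate with β = ψ · amp, whose Lipschitz constant is at most twice its
bound. The shift has size (h/2)(|p| + |ζ|), which provides the factor h, and the losses are those of
`growth_le`. -/
lemma norm_pairing_sub_le (hα : Continuous α) (hM : ∀ x, ‖α x‖ ≤ M) (hs : 1 < s) (hc : 0 < c)
    (hK : ∀ y w, ‖D.amp α y w‖ ≤ K * D.damp s c w)
    (hKL : ∀ y y' w, ‖D.amp α y w - D.amp α y' w‖ ≤ K * D.damp s c w * ‖y - y'‖)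
    (P : SmallPert φ ε) (hh : 0 < h) (hh1 : h ≤ 1) (hε : ε ≤ c / 4 * h ^ (1 - 1 / s))
    (hε1 : ε ≤ 1) (hu : Differentiable ℂ u)
    (hv : Differentiable ℂ v) (hu2 : SqInt (fun x => D.wt x + φ x) h u)
    (hv2 : SqInt (fun x => D.wt x + φ x) h v)
    (hψ : Continuous ψ) (hψs : HasCompactSupport ψ) (hψW : ∀ x, ‖ψ x‖ ≤ W)
    (hψL : ∀ x y, ‖ψ x - ψ y‖ ≤ W * ‖x - y‖) (hK0 : 0 ≤ K) {w : Cn n × Cn n}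
    (hw : ‖w.2‖ ≤ 1 / h) :
    ‖D.pairing α h φ ψ u v w - D.pairing₀ α h φ ψ u v w‖ ≤ h * (W * K * D.maj s c 2 w) *
      (weightedNorm (fun x => D.wt x + φ x) h u * weightedNorm (fun x => D.wt x + φ x) h v) := by
  have hW : 0 ≤ W := (norm_nonneg _).trans (hψW 0)
  have hd := D.damp_nonneg s c w
  have hε0 := P.nonneg
  set β : Cn n → ℂ := fun x => ψ x * D.amp α (x - (1 / 2 : ℂ) • zsh h w) w
  have hβc : Continuous β := hψ.mul (D.continuous_amp hα hM
    (f := fun x => x - (1 / 2 : ℂ) • zsh h w) (g := fun _ => w) (by fun_prop) continuous_const)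
  have hβd : ∀ x, ‖β x‖ ≤ W * (K * D.damp s c w) := fun x => by
    rw [norm_mul]; exact mul_le_mul (hψW x) (hK _ _) (norm_nonneg _) hW
  have hβL : ∀ x y, ‖β x - β y‖ ≤ 2 * (W * (K * D.damp s c w)) * ‖x - y‖ := fun x y => by
    have e : β x - β y = (ψ x - ψ y) * D.amp α (x - (1 / 2 : ℂ) • zsh h w) w +
        ψ y * (D.amp α (x - (1 / 2 : ℂ) • zsh h w) w - D.amp α (y - (1 / 2 : ℂ) • zsh h w) w) := by
      simp only [β]; ring
    have h1 := hKL (x - (1 / 2 : ℂ) • zsh h w) (y - (1 / 2 : ℂ) • zsh h w) w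
    rw [sub_sub_sub_cancel_right] at h1
    rw [e]
    refine (norm_add_le _ _).trans ?_
    rw [norm_mul, norm_mul]
    calc _ ≤ (W * ‖x - y‖) * (K * D.damp s c w) + W * (K * D.damp s c w * ‖x - y‖) :=
          add_le_add (mul_le_mul (hψL x y) (hK _ _) (norm_nonneg _) (by positivity))
            (mul_le_mul (hψW y) h1 (norm_nonneg _) hW)
      _ = _ := by ring
  refine (D.norm_integral_homJ_sub_le P hh hu hv hu2 hv2 (zsh h w) hβc hψs.mul_right hβd
    hβL).trans ?_
  refine mul_le_mul_of_nonneg_right ?_ (mul_nonneg (Real.sqrt_nonneg _) (Real.sqrt_nonneg _))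
  have hz := norm_zsh_le hh w
  set r := ‖w.1‖ + ‖w.2‖
  have hr : 0 ≤ r := by positivity
  have h1 : 2 * ε * ‖zsh h w‖ / h ≤ r := by
    rw [div_le_iff₀ hh]
    calc 2 * ε * ‖zsh h w‖ ≤ 2 * 1 * (h / 2 * r) := by gcongr
      _ = r * h := by ring
  have h2 : 3 * ε * ‖zsh h w‖ / h ≤ 2 * ε * r := by
    rw [div_le_iff₀ hh]
    calc 3 * ε * ‖zsh h w‖ ≤ 3 * ε * (h / 2 * r) := by gcongr
      _ ≤ 2 * ε * r * h := by nlinarith [mul_nonneg (mul_nonneg hε0 hr) hh.le]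
  have h3 := D.pow_mul_damp_mul_exp_le hs hc hh hh1 hε 2 hw
  have h4 : 1 + ‖w.1‖ + ‖w.2‖ = 1 + r := by simp only [r]; ring
  rw [h4] at h3
  calc W * (K * D.damp s c w) * ‖zsh h w‖ * (2 + 2 * ε * ‖zsh h w‖ / h) *
        Real.exp (3 * ε * ‖zsh h w‖ / h)
      ≤ W * (K * D.damp s c w) * (h / 2 * r) * (2 + r) * Real.exp (2 * ε * r) := by
        gcongr
    _ = h * (W * K * ((r * (2 + r) / 2) * (D.damp s c w * Real.exp (2 * ε * r)))) := by ring
    _ ≤ h * (W * K * ((1 + r) ^ 2 * (D.damp s c w * Real.exp (2 * ε * r)))) := by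
        gcongr
        nlinarith
    _ ≤ _ := by gcongr

/-- At high frequency no interpolation is made: the bound |φ| ≤ ε alone limits the loss to e^{2ε/h},
independently of the length of the shift. -/
lemma norm_pairing_le (hs : 1 < s) (hc : 0 < c)
    (hK : ∀ y w, ‖D.amp α y w‖ ≤ K * D.damp s c w)
    (P : SmallPert φ ε) (hh : 0 < h) (hε : ε ≤ c / 4 * h ^ (1 - 1 / s))
    (hu : Differentiable ℂ u)
    (hv : Differentiable ℂ v) (hu2 : SqInt (fun x => D.wt x + φ x) h u)
    (hv2 : SqInt (fun x => D.wt x + φ x) h v) (hψW : ∀ x, ‖ψ x‖ ≤ W) (hK0 : 0 ≤ K)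
    {w : Cn n × Cn n} (hw : 1 / h < ‖w.2‖) :
    ‖D.pairing α h φ ψ u v w‖ ≤ h * (W * K * D.maj s c 2 w) *
      (weightedNorm (fun x => D.wt x + φ x) h u * weightedNorm (fun x => D.wt x + φ x) h v) := by
  have hW : 0 ≤ W := (norm_nonneg _).trans (hψW 0)
  have hd := D.damp_nonneg s c w
  have hU : 0 ≤ weightedNorm (fun x => D.wt x + φ x) h u *
    weightedNorm (fun x => D.wt x + φ x) h v := mul_nonneg (Real.sqrt_nonneg _) (Real.sqrt_nonneg _)
  obtain ⟨i1, i2⟩ := D.integral_norm_homJ_le P hh hu hv hu2 hv2 (zsh h w) (t := 1) (m := 2 * ε)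
    (fun x => by
      have h1 := P.bound_zero (x - ((1 : ℝ) : ℂ) • zsh h w)
      have h2 := P.bound_zero x
      rw [abs_le] at h1 h2
      linarith)
  refine (norm_integral_le_of_norm_le (i1.norm.const_mul (W * (K * D.damp s c w)))
    (Eventually.of_forall fun x => ?_)).trans ?_
  · rw [norm_mul, norm_mul]
    exact mul_le_mul_of_nonneg_right (mul_le_mul (hψW x) (hK _ _) (norm_nonneg _) hW)
      (norm_nonneg _)
  · rw [integral_const_mul]
    have h1 := D.damp_mul_exp_le hs hc hh hε hw
    have h2 := D.maj_mono (s := s) (c := c) (show 1 ≤ 2 by norm_num) w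
    calc _ ≤ W * (K * D.damp s c w) * (Real.exp (2 * ε / h) *
          (weightedNorm (fun x => D.wt x + φ x) h u * weightedNorm (fun x => D.wt x + φ x) h v)) := by
          gcongr
      _ = W * K * (D.damp s c w * Real.exp (2 * ε / h)) *
          (weightedNorm (fun x => D.wt x + φ x) h u * weightedNorm (fun x => D.wt x + φ x) h v) := by
          ring
      _ ≤ W * K * (h * D.maj s c 2 w) *
          (weightedNorm (fun x => D.wt x + φ x) h u * weightedNorm (fun x => D.wt x + φ x) h v) := by
          refine mul_le_mul_of_nonneg_right (mul_le_mul_of_nonneg_left ?_ (by positivity)) hU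
          exact h1.trans (mul_le_mul_of_nonneg_left h2 hh.le)
      _ = _ := by ring

end QData

/-! ### Superposition of the wave packets and the effective symbol. -/

lemma integrable_of_le_mul {n : ℕ} {Ω : Type*} [MeasurableSpace Ω] [TopologicalSpace Ω]
    [OpensMeasurableSpace Ω] [SecondCountableTopology Ω] {μ : Measure Ω} [SFinite μ]
    {F : Cn n × Ω → ℂ} (hF : Continuous F) {g : Cn n → ℝ} {k : Ω → ℝ} (hg : Integrable g)
    (hk : Integrable k μ) (hle : ∀ x w, ‖F (x, w)‖ ≤ g x * k w) :
    Integrable F ((volume : Measure (Cn n)).prod μ) :=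
  (hg.mul_prod hk).mono' hF.aestronglyMeasurable (Eventually.of_forall fun r => hle r.1 r.2)

lemma one_add_pow_sub_one_le {h : ℝ} (hh : 0 ≤ h) (hh1 : h ≤ 1) (n : ℕ) :
    (1 + h) ^ n - 1 ≤ h * 3 ^ n := by
  induction n with
  | zero => simpa using hh
  | succ k ih =>
    have h3 : (1 : ℝ) ≤ 3 ^ k := one_le_pow₀ (by norm_num)
    have : (1 + h) ^ (k + 1) ≤ (1 + h * 3 ^ k) * (1 + h) := by
      rw [pow_succ]; gcongr; linarith
    rw [pow_succ (3 : ℝ)]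
    nlinarith [mul_nonneg hh (by linarith : (0 : ℝ) ≤ 3 ^ k - 1),
      mul_nonneg (mul_nonneg hh (by linarith : (0 : ℝ) ≤ 3 ^ k)) (by linarith : 0 ≤ 1 - h)]

namespace QData

variable {n : ℕ} (D : QData n) {s c h ε K M W : ℝ} {φ : Cn n → ℝ} {α u v ψ : Cn n → ℂ}

lemma continuous_damp (hs : 1 < s) : Continuous (D.damp s c) := by
  unfold damp
  have : Continuous fun w : Cn n × Cn n => ‖w.2‖ ^ (1 / s) :=
    (continuous_norm.comp continuous_snd).rpow_const fun w => Or.inr (by positivity)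
  fun_prop

/-- The region of the moderate frequencies. -/
def lowFreq (n : ℕ) (h : ℝ) : Set (Cn n × Cn n) := {w | ‖w.2‖ ≤ 1 / h}

lemma measurableSet_lowFreq : MeasurableSet (lowFreq n h) :=
  (isClosed_le (by fun_prop) continuous_const).measurableSet

lemma mem_lowFreq {w : Cn n × Cn n} : w ∈ lowFreq n h ↔ ‖w.2‖ ≤ 1 / h := Iff.rfl

/-- The symbol of the operator on the deformed manifold, from the moderate frequencies. -/
def sym (α : Cn n → ℂ) (h : ℝ) (φ : Cn n → ℝ) (x : Cn n) : ℂ :=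
  D.c₂ * ∫ w in lowFreq n h, D.amp α x w * cexp (-del φ x (w.1 - I • w.2))

lemma homJ_one (z x : Cn n) : D.homJ h φ u v z 1 x =
    D.tr h z u x * (conj (v x) * (Real.exp (-2 * (D.wt x + φ x) / h) : ℂ)) := by
  rw [homJ, tr, ofReal_one, one_smul]
  have : D.homE h φ z 1 x = (2 * D.B z x - D.B z z) / h + ((-2 * (D.wt x + φ x) / h : ℝ) : ℂ) := by
    rw [homE]; push_cast; ring
  rw [this, Complex.exp_add, ofReal_exp]
  ring

lemma homJ_zero (z x : Cn n) : D.homJ h φ u v z 0 x =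
    u x * (conj (v x) * (Real.exp (-2 * (D.wt x + φ x) / h) : ℂ)) := by
  rw [homJ, ofReal_zero, zero_smul, sub_zero]
  have : D.homE h φ z 0 x = ((-2 * (D.wt x + φ x) / h : ℝ) : ℂ) := by
    rw [homE]; push_cast; ring
  rw [this, ofReal_exp]
  ring

lemma continuous_homJ_prod (hφ : Continuous φ) (hu : Continuous u) (hv : Continuous v) (t : ℝ) :
    Continuous fun r : Cn n × (Cn n × Cn n) => D.homJ h φ u v (zsh h r.2) t r.1 := by
  unfold homJ homE; fun_prop

lemma continuous_homK_prod (P : SmallPert φ ε) (t : ℝ) :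
    Continuous fun r : Cn n × (Cn n × Cn n) => D.homK h φ (zsh h r.2) t r.1 := by
  have := P.continuous_del (f := fun r : Cn n × (Cn n × Cn n) => r.1)
    (g := fun r => zsh h r.2) (by fun_prop) (by fun_prop)
  unfold homK; fun_prop

lemma continuous_amp_prod (hα : Continuous α) (hM : ∀ x, ‖α x‖ ≤ M) :
    Continuous fun r : Cn n × (Cn n × Cn n) =>
      D.amp α (r.1 - (1 / 2 : ℂ) • zsh h r.2) r.2 :=
  D.continuous_amp hα hM (f := fun r : Cn n × (Cn n × Cn n) => r.1 - (1 / 2 : ℂ) • zsh h r.2)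
    (g := fun r => r.2) (by fun_prop) (by fun_prop)

lemma integrable_pairing_integrand (hα : Continuous α) (hM : ∀ x, ‖α x‖ ≤ M) (hs : 1 < s)
    (hc : 0 < c) (hK : ∀ y w, ‖D.amp α y w‖ ≤ K * D.damp s c w)
    (P : SmallPert φ ε) (hh : 0 < h) (hu : Continuous u) (hv : Continuous v) {Cu Cv : ℝ}
    (hub : ∀ x, ‖u x‖ * Real.exp (-(D.wt x + φ x) / h) ≤ Cu)
    (hvb : ∀ x, ‖v x‖ * Real.exp (-(D.wt x + φ x) / h) ≤ Cv)
    (hψ : Continuous ψ) (hψs : HasCompactSupport ψ) :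
    Integrable (fun r : Cn n × (Cn n × Cn n) => ψ r.1 *
      D.amp α (r.1 - (1 / 2 : ℂ) • zsh h r.2) r.2 * D.homJ h φ u v (zsh h r.2) 1 r.1)
      ((volume : Measure (Cn n)).prod volume) := by
  have h1 := D.continuous_amp_prod (h := h) hα hM
  have h2 := D.continuous_homJ_prod (h := h) P.contDiff.continuous hu hv 1
  have hCu : 0 ≤ Cu := le_trans (by positivity) (hub 0)
  have hCv : 0 ≤ Cv := le_trans (by positivity) (hvb 0)
  refine integrable_of_le_mul (((hψ.comp continuous_fst).mul h1).mul h2)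
    (g := fun x => ‖ψ x‖ * (Real.exp (2 * ε / h) * (Cu * Cv))) (k := fun w => K * D.damp s c w)
    ((hψ.norm.integrable_of_hasCompactSupport hψs.norm).mul_const _)
    ((D.integrable_damp hs hc).const_mul K) fun x w => ?_
  have h3 := D.norm_homJ_le (u := u) (v := v) hh (zsh h w) (t := 1) (m := 2 * ε) x (by
    have h1 := P.bound_zero (x - ((1 : ℝ) : ℂ) • zsh h w)
    have h2 := P.bound_zero x
    rw [abs_le] at h1 h2
    linarith)
  have h4 := h3.trans (mul_le_mul_of_nonneg_left (mul_le_mul (hub (x - ((1 : ℝ) : ℂ) • zsh h w))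
    (hvb x) (by positivity) hCu) (Real.exp_pos _).le)
  show ‖ψ x * D.amp α (x - (1 / 2 : ℂ) • zsh h w) w * D.homJ h φ u v (zsh h w) 1 x‖ ≤ _
  rw [norm_mul, norm_mul]
  calc _ ≤ ‖ψ x‖ * (K * D.damp s c w) * (Real.exp (2 * ε / h) * (Cu * Cv)) :=
        mul_le_mul (mul_le_mul_of_nonneg_left (hK _ _) (norm_nonneg _)) h4 (norm_nonneg _)
          (mul_nonneg (norm_nonneg _) ((norm_nonneg _).trans (hK 0 w)))
    _ = _ := by ring

lemma integral_op_eq (hα : Continuous α) (hM : ∀ x, ‖α x‖ ≤ M) (hs : 1 < s)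
    (hc : 0 < c) (hK : ∀ y w, ‖D.amp α y w‖ ≤ K * D.damp s c w)
    (P : SmallPert φ ε) (hh : 0 < h) (hu : Continuous u) (hv : Continuous v) {Cu Cv : ℝ}
    (hub : ∀ x, ‖u x‖ * Real.exp (-(D.wt x + φ x) / h) ≤ Cu)
    (hvb : ∀ x, ‖v x‖ * Real.exp (-(D.wt x + φ x) / h) ≤ Cv)
    (hψ : Continuous ψ) (hψs : HasCompactSupport ψ) :
    Integrable (D.pairing α h φ ψ u v) ∧
    ∫ x, ψ x * D.op α h u x * (conj (v x) * (Real.exp (-2 * (D.wt x + φ x) / h) : ℂ)) =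
      ((D.c₂ * (1 + h / 4) ^ n : ℝ) : ℂ) * ∫ w, D.pairing α h φ ψ u v w := by
  have hi := D.integrable_pairing_integrand hα hM hs hc hK P hh hu hv hub hvb hψ hψs
  refine ⟨hi.integral_prod_right, ?_⟩
  have h1 : ∫ w, D.pairing α h φ ψ u v w = ∫ x, ∫ w, ψ x *
      D.amp α (x - (1 / 2 : ℂ) • zsh h w) w * D.homJ h φ u v (zsh h w) 1 x :=
    (integral_integral_swap hi).symm
  rw [h1, ← integral_const_mul]
  congr 1; ext x
  have h2 : ∀ w, ψ x * D.amp α (x - (1 / 2 : ℂ) • zsh h w) w * D.homJ h φ u v (zsh h w) 1 x =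
      (ψ x * (conj (v x) * (Real.exp (-2 * (D.wt x + φ x) / h) : ℂ))) * D.opInt α h u x w := by
    intro w; rw [homJ_one, opInt]; ring
  simp only [h2]
  rw [integral_const_mul, op]
  ring

lemma norm_homK_zero_le (P : SmallPert φ ε) (hh : 0 < h) (w : Cn n × Cn n) (x : Cn n) :
    ‖D.homK h φ (zsh h w) 0 x‖ ≤ Real.exp (2 * ε * (‖w.1‖ + ‖w.2‖)) := by
  refine (D.norm_homK_le P hh (zsh h w) le_rfl zero_le_one x).trans (Real.exp_le_exp.2 ?_)
  have hz := norm_zsh_le hh w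
  have hε := P.nonneg
  rw [div_le_iff₀ hh]
  calc 2 * ε * ‖zsh h w‖ ≤ 2 * ε * (h / 2 * (‖w.1‖ + ‖w.2‖)) := by gcongr
    _ ≤ 2 * ε * (‖w.1‖ + ‖w.2‖) * h := by
        have : 0 ≤ ε * (‖w.1‖ + ‖w.2‖) * h := by positivity
        nlinarith

lemma integrableOn_damp_mul_exp (hs : 1 < s) (hc : 0 < c) (hh : 0 < h) (hh1 : h ≤ 1)
    (hε : ε ≤ c / 4 * h ^ (1 - 1 / s)) (m : ℕ) :
    Integrable (fun w => (1 + ‖w.1‖ + ‖w.2‖) ^ m *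
      (D.damp s c w * Real.exp (2 * ε * (‖w.1‖ + ‖w.2‖)))) (volume.restrict (lowFreq n h)) := by
  have hd := D.continuous_damp (c := c) hs
  refine ((D.integrable_maj hs hc m).restrict).mono'
    (Continuous.aestronglyMeasurable (by fun_prop))
    ((ae_restrict_iff' measurableSet_lowFreq).2 (Eventually.of_forall fun w hw => ?_))
  have := D.damp_nonneg s c w
  rw [Real.norm_eq_abs, abs_of_nonneg (by positivity)]
  exact D.pow_mul_damp_mul_exp_le hs hc hh hh1 hε m hw

/-- At t = 0 the integrand J no longer depends on the packet, so by Fubini the packets add up to a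
multiplier in x. The restriction to low frequencies is what makes the bound e^{2ε(|p|+|ζ|)} of the
integrating factor summable. -/
lemma integral_pairing₀_eq (hα : Continuous α) (hM : ∀ x, ‖α x‖ ≤ M) (hs : 1 < s)
    (hc : 0 < c) (hK : ∀ y w, ‖D.amp α y w‖ ≤ K * D.damp s c w)
    (P : SmallPert φ ε) (hh : 0 < h) (hh1 : h ≤ 1) (hε : ε ≤ c / 4 * h ^ (1 - 1 / s))
    (hu : Continuous u) (hv : Continuous v)
    (hψ : Continuous ψ) (hψs : HasCompactSupport ψ) :
    Integrable (D.pairing₀ α h φ ψ u v) (volume.restrict (lowFreq n h)) ∧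
    (Integrable fun x => ψ x * (u x * (conj (v x) * (Real.exp (-2 * (D.wt x + φ x) / h) : ℂ))) *
        ∫ w in lowFreq n h, D.amp α (x - (1 / 2 : ℂ) • zsh h w) w * D.homK h φ (zsh h w) 0 x) ∧
    ∫ w in lowFreq n h, D.pairing₀ α h φ ψ u v w =
      ∫ x, ψ x * (u x * (conj (v x) * (Real.exp (-2 * (D.wt x + φ x) / h) : ℂ))) *
        ∫ w in lowFreq n h, D.amp α (x - (1 / 2 : ℂ) • zsh h w) w * D.homK h φ (zsh h w) 0 x := by
  have hφc := P.contDiff.continuous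
  have h1 := D.continuous_amp_prod (h := h) hα hM
  have h2 := D.continuous_homJ_prod (h := h) hφc hu hv 0
  have h3 := D.continuous_homK_prod (h := h) P 0
  set j : Cn n → ℂ := fun x => u x * (conj (v x) * (Real.exp (-2 * (D.wt x + φ x) / h) : ℂ))
  have hj : Continuous j := by fun_prop
  have hg : Integrable fun x => ‖ψ x * j x‖ * K :=
    ((hψ.mul hj).norm.integrable_of_hasCompactSupport (hψs.mul_right.norm)).mul_const _
  have hi : Integrable (fun r : Cn n × (Cn n × Cn n) => ψ r.1 *
      D.amp α (r.1 - (1 / 2 : ℂ) • zsh h r.2) r.2 *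
        (D.homK h φ (zsh h r.2) 0 r.1 * D.homJ h φ u v (zsh h r.2) 0 r.1))
      ((volume : Measure (Cn n)).prod (volume.restrict (lowFreq n h))) := by
    refine integrable_of_le_mul (((hψ.comp continuous_fst).mul h1).mul (h3.mul h2)) hg
      (D.integrableOn_damp_mul_exp hs hc hh hh1 hε 0) fun x w => ?_
    show ‖ψ x * D.amp α (x - (1 / 2 : ℂ) • zsh h w) w *
      (D.homK h φ (zsh h w) 0 x * D.homJ h φ u v (zsh h w) 0 x)‖ ≤ _
    have k1 := hK (x - (1 / 2 : ℂ) • zsh h w) w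
    have k2 := D.norm_homK_zero_le P hh w x
    have hj0 : D.homJ h φ u v (zsh h w) 0 x = j x := D.homJ_zero _ _
    rw [hj0, norm_mul, norm_mul, norm_mul]
    calc _ ≤ ‖ψ x‖ * (K * D.damp s c w) * (Real.exp (2 * ε * (‖w.1‖ + ‖w.2‖)) * ‖j x‖) :=
          mul_le_mul (mul_le_mul_of_nonneg_left k1 (norm_nonneg _))
            (mul_le_mul_of_nonneg_right k2 (norm_nonneg _)) (by positivity)
            (mul_nonneg (norm_nonneg _) ((norm_nonneg _).trans k1))
      _ = _ := by rw [norm_mul (ψ x) (j x)]; ring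
  have hx : ∀ x, (∫ w in lowFreq n h, ψ x * D.amp α (x - (1 / 2 : ℂ) • zsh h w) w *
        (D.homK h φ (zsh h w) 0 x * D.homJ h φ u v (zsh h w) 0 x)) = ψ x * j x *
        ∫ w in lowFreq n h, D.amp α (x - (1 / 2 : ℂ) • zsh h w) w * D.homK h φ (zsh h w) 0 x := by
    intro x
    rw [← integral_const_mul]
    congr 1; ext w
    rw [homJ_zero]
    ring
  refine ⟨hi.integral_prod_right, hi.integral_prod_left.congr (Eventually.of_forall hx), ?_⟩
  have e1 : ∫ w in lowFreq n h, D.pairing₀ α h φ ψ u v w = ∫ x, ∫ w in lowFreq n h, ψ x *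
      D.amp α (x - (1 / 2 : ℂ) • zsh h w) w *
        (D.homK h φ (zsh h w) 0 x * D.homJ h φ u v (zsh h w) 0 x) :=
    (integral_integral_swap hi).symm
  rw [e1]
  exact integral_congr_ae (Eventually.of_forall hx)

/-- The shift (h/2)(p - iζ) cancels the factor 2/h in front of ∂φ, so the effective multiplier is of
order one, while the N(z) term retains a factor h. -/
lemma homK_zero_eq (hh : 0 < h) (w : Cn n × Cn n) (x : Cn n) : D.homK h φ (zsh h w) 0 x =
    cexp (-del φ x (w.1 - I • w.2) - ((h / 4 * D.N (w.1 - I • w.2) : ℝ) : ℂ)) := by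
  have hhc : (h : ℂ) ≠ 0 := by exact_mod_cast hh.ne'
  rw [homK, zsh, del_real_smul, N_smul, norm_real, Real.norm_eq_abs, sq_abs]
  congr 1
  push_cast
  field_simp
  ring

lemma norm_del_le_growth (P : SmallPert φ ε) (w : Cn n × Cn n) (x : Cn n) :
    ‖del φ x (w.1 - I • w.2)‖ ≤ ε * (‖w.1‖ + ‖w.2‖) :=
  (P.norm_del_le x _).trans (mul_le_mul_of_nonneg_left (norm_sub_I_smul_le w) P.nonneg)

/-- Three discrepancies of size O(h) are collected: the normalisation (1 + h/4)^n, the evaluation of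
the amplitude at the midpoint instead of x, and the Gaussian factor e^{-(h/4) N(p - iζ)}. -/
lemma norm_symbol_integrand_sub_le
    (hK : ∀ y w, ‖D.amp α y w‖ ≤ K * D.damp s c w)
    (hKL : ∀ y y' w, ‖D.amp α y w - D.amp α y' w‖ ≤ K * D.damp s c w * ‖y - y'‖)
    (P : SmallPert φ ε) (hh : 0 < h) (hh1 : h ≤ 1) (hK0 : 0 ≤ K) (w : Cn n × Cn n) (x : Cn n) :
    ‖(((1 + h / 4) ^ n : ℝ) : ℂ) *
        (D.amp α (x - (1 / 2 : ℂ) • zsh h w) w * D.homK h φ (zsh h w) 0 x) -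
      D.amp α x w * cexp (-del φ x (w.1 - I • w.2))‖ ≤ h * (K * (3 ^ n + 1 + D.up)) *
        ((1 + ‖w.1‖ + ‖w.2‖) ^ 2 * (D.damp s c w * Real.exp (2 * ε * (‖w.1‖ + ‖w.2‖)))) := by
  have hd := D.damp_nonneg s c w
  have hup := D.up_pos
  have hε := P.nonneg
  set r := ‖w.1‖ + ‖w.2‖
  have hr : 0 ≤ r := by positivity
  set A := D.amp α (x - (1 / 2 : ℂ) • zsh h w) w
  set E := Real.exp (2 * ε * r)
  have hK1 : ‖D.homK h φ (zsh h w) 0 x‖ ≤ E := D.norm_homK_zero_le P hh w x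
  have hA : ‖A‖ ≤ K * D.damp s c w := hK _ _
  have e : (((1 + h / 4) ^ n : ℝ) : ℂ) * (A * D.homK h φ (zsh h w) 0 x) -
      D.amp α x w * cexp (-del φ x (w.1 - I • w.2)) =
      (((1 + h / 4) ^ n - 1 : ℝ) : ℂ) * (A * D.homK h φ (zsh h w) 0 x) +
      (A - D.amp α x w) * D.homK h φ (zsh h w) 0 x +
      D.amp α x w * (D.homK h φ (zsh h w) 0 x - cexp (-del φ x (w.1 - I • w.2))) := by
    push_cast; ring
  have b1 : ‖(((1 + h / 4) ^ n - 1 : ℝ) : ℂ)‖ ≤ h * 3 ^ n := by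
    have h1 : 1 ≤ (1 + h / 4) ^ n := one_le_pow₀ (by linarith)
    rw [norm_real, Real.norm_eq_abs, abs_of_nonneg (by linarith)]
    refine (one_add_pow_sub_one_le (by positivity) (by linarith) n).trans ?_
    gcongr; linarith
  have b2 : ‖A - D.amp α x w‖ ≤ K * D.damp s c w * (h * (1 + r)) := by
    refine (hKL _ _ w).trans ?_
    gcongr
    rw [sub_sub_cancel_left, norm_neg, norm_smul]
    have h5 : ‖(1 / 2 : ℂ)‖ = 1 / 2 := by norm_num
    have := norm_zsh_le hh w
    rw [h5]
    nlinarith [mul_nonneg hh.le hr]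
  have b3 : ‖D.homK h φ (zsh h w) 0 x - cexp (-del φ x (w.1 - I • w.2))‖ ≤
      E * (h * D.up * (1 + r) ^ 2) := by
    rw [D.homK_zero_eq hh]
    have hN := D.N_nonneg (w.1 - I • w.2)
    have h1 := norm_del_le_growth P w x
    have h2 := neg_le_of_abs_le ((abs_re_le_norm _).trans h1)
    have h3 : ε * r ≤ 2 * ε * r := by nlinarith [mul_nonneg hε hr]
    refine (norm_cexp_sub_cexp_le (m := 2 * ε * r) ?_ ?_).trans ?_
    · rw [sub_re, neg_re, ofReal_re]
      have : 0 ≤ h / 4 * D.N (w.1 - I • w.2) := by positivity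
      linarith
    · rw [neg_re]; linarith
    · refine mul_le_mul_of_nonneg_left ?_ (Real.exp_pos _).le
      rw [sub_sub_cancel_left, norm_neg, norm_real, Real.norm_eq_abs, abs_of_nonneg (by positivity)]
      have h4 := D.N_le (w.1 - I • w.2)
      have h5 := norm_sub_I_smul_le w
      have h6 : D.N (w.1 - I • w.2) ≤ D.up * (1 + r) ^ 2 := h4.trans (by gcongr; linarith)
      have h7 : 0 ≤ h * (D.up * (1 + r) ^ 2) := by positivity
      calc h / 4 * D.N (w.1 - I • w.2) ≤ h / 4 * (D.up * (1 + r) ^ 2) := by gcongr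
        _ ≤ _ := by linarith
  rw [e]
  refine (norm_add₃_le).trans ?_
  rw [norm_mul, norm_mul, norm_mul, norm_mul]
  have hr1 : 1 ≤ (1 + r) ^ 2 := one_le_pow₀ (by linarith)
  have hr2 : 1 + r ≤ (1 + r) ^ 2 := by nlinarith
  have hE : 0 < E := Real.exp_pos _
  have hh4 : 1 + ‖w.1‖ + ‖w.2‖ = 1 + r := by simp only [r]; ring
  rw [hh4]
  calc _ ≤ h * 3 ^ n * (K * D.damp s c w * E) + K * D.damp s c w * (h * (1 + r)) * E +
        K * D.damp s c w * (E * (h * D.up * (1 + r) ^ 2)) := by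
        gcongr
        exact hK _ _
    _ = h * K * (D.damp s c w * E) * (3 ^ n * 1 + (1 + r) + D.up * (1 + r) ^ 2) := by ring
    _ ≤ h * K * (D.damp s c w * E) * (3 ^ n * (1 + r) ^ 2 + (1 + r) ^ 2 + D.up * (1 + r) ^ 2) := by
        gcongr
    _ = _ := by ring

/-- The multiplier after the interpolation is close to the symbol. -/
lemma norm_multiplier_sub_sym_le (hα : Continuous α) (hM : ∀ x, ‖α x‖ ≤ M) (hs : 1 < s)
    (hc : 0 < c) (hK : ∀ y w, ‖D.amp α y w‖ ≤ K * D.damp s c w)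
    (hKL : ∀ y y' w, ‖D.amp α y w - D.amp α y' w‖ ≤ K * D.damp s c w * ‖y - y'‖)
    (P : SmallPert φ ε) (hh : 0 < h) (hh1 : h ≤ 1) (hε : ε ≤ c / 4 * h ^ (1 - 1 / s))
    (hK0 : 0 ≤ K) (x : Cn n) :
    ‖((D.c₂ * (1 + h / 4) ^ n : ℝ) : ℂ) * (∫ w in lowFreq n h,
        D.amp α (x - (1 / 2 : ℂ) • zsh h w) w * D.homK h φ (zsh h w) 0 x) - D.sym α h φ x‖ ≤
      h * (D.c₂ * (K * (3 ^ n + 1 + D.up)) * ∫ w, D.maj s c 2 w) := by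
  have hc2 := D.c₂_pos
  have hup := D.up_pos
  have hmaj := D.integrableOn_damp_mul_exp hs hc hh hh1 hε 0
  simp only [pow_zero, one_mul] at hmaj
  have hdc := P.continuous_del (f := fun _ : Cn n × Cn n => x) (g := fun w => w.1 - I • w.2)
    continuous_const (by fun_prop)
  have i1 : Integrable (fun w => D.amp α (x - (1 / 2 : ℂ) • zsh h w) w *
      D.homK h φ (zsh h w) 0 x) (volume.restrict (lowFreq n h)) := by
    have c1 := D.continuous_amp hα hM (f := fun w : Cn n × Cn n => x - (1 / 2 : ℂ) • zsh h w)
      (g := fun w => w) (by fun_prop) continuous_id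
    have c2 : Continuous fun w => D.homK h φ (zsh h w) 0 x := by
      simp only [D.homK_zero_eq hh]; fun_prop
    refine (hmaj.const_mul K).mono' (c1.mul c2).aestronglyMeasurable
      (Eventually.of_forall fun w => ?_)
    rw [norm_mul, ← mul_assoc]
    exact mul_le_mul (hK _ _) (D.norm_homK_zero_le P hh w x) (norm_nonneg _)
      ((norm_nonneg _).trans (hK 0 w))
  have i2 : Integrable (fun w => D.amp α x w * cexp (-del φ x (w.1 - I • w.2)))
      (volume.restrict (lowFreq n h)) := by
    have c1 := D.continuous_amp hα hM (f := fun w : Cn n × Cn n => x)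
      (g := fun w => w) continuous_const continuous_id
    refine (hmaj.const_mul K).mono' (c1.mul hdc.neg.cexp).aestronglyMeasurable
      (Eventually.of_forall fun w => ?_)
    rw [norm_mul, ← mul_assoc]
    refine mul_le_mul (hK _ _) ?_ (norm_nonneg _) ((norm_nonneg _).trans (hK 0 w))
    rw [norm_exp, neg_re]
    refine Real.exp_le_exp.2 ?_
    have h2 := neg_le_of_abs_le ((abs_re_le_norm _).trans (norm_del_le_growth P w x))
    have h3 : 0 ≤ ε * (‖w.1‖ + ‖w.2‖) := mul_nonneg P.nonneg (by positivity)
    linarith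
  have e : ((D.c₂ * (1 + h / 4) ^ n : ℝ) : ℂ) * (∫ w in lowFreq n h,
        D.amp α (x - (1 / 2 : ℂ) • zsh h w) w * D.homK h φ (zsh h w) 0 x) - D.sym α h φ x =
      (D.c₂ : ℂ) * ∫ w in lowFreq n h, ((((1 + h / 4) ^ n : ℝ) : ℂ) *
        (D.amp α (x - (1 / 2 : ℂ) • zsh h w) w * D.homK h φ (zsh h w) 0 x) -
      D.amp α x w * cexp (-del φ x (w.1 - I • w.2))) := by
    rw [integral_sub (i1.const_mul _) i2, integral_const_mul, sym]
    push_cast; ring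
  rw [e, norm_mul, norm_real, Real.norm_eq_abs, abs_of_pos hc2]
  have i3 := D.integrable_maj hs hc 2
  have key : ‖∫ w in lowFreq n h, ((((1 + h / 4) ^ n : ℝ) : ℂ) *
        (D.amp α (x - (1 / 2 : ℂ) • zsh h w) w * D.homK h φ (zsh h w) 0 x) -
      D.amp α x w * cexp (-del φ x (w.1 - I • w.2)))‖ ≤
      ∫ w in lowFreq n h, h * (K * (3 ^ n + 1 + D.up)) * D.maj s c 2 w := by
    refine norm_integral_le_of_norm_le (i3.restrict.const_mul _)
      ((ae_restrict_iff' measurableSet_lowFreq).2 (Eventually.of_forall fun w hw => ?_))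
    refine (D.norm_symbol_integrand_sub_le hK hKL P hh hh1 hK0 w x).trans ?_
    exact mul_le_mul_of_nonneg_left (D.pow_mul_damp_mul_exp_le hs hc hh hh1 hε 2 hw)
      (by positivity)
  have h4 : ∫ w in lowFreq n h, D.maj s c 2 w ≤ ∫ w, D.maj s c 2 w :=
    setIntegral_le_integral i3 (Eventually.of_forall fun w => D.maj_nonneg 2 w)
  rw [integral_const_mul] at key
  calc _ ≤ D.c₂ * (h * (K * (3 ^ n + 1 + D.up)) * ∫ w, D.maj s c 2 w) := by
        refine mul_le_mul_of_nonneg_left (key.trans ?_) hc2.le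
        exact mul_le_mul_of_nonneg_left h4 (by positivity)
    _ = _ := by ring

/-- The scalar products with the operator are, up to `O(h)`, given by the symbol. -/
lemma norm_integral_op_sub_le (hα : Continuous α) (hM : ∀ x, ‖α x‖ ≤ M) (hs : 1 < s)
    (hc : 0 < c) (hK : ∀ y w, ‖D.amp α y w‖ ≤ K * D.damp s c w)
    (hKL : ∀ y y' w, ‖D.amp α y w - D.amp α y' w‖ ≤ K * D.damp s c w * ‖y - y'‖)
    (P : SmallPert φ ε) (hh : 0 < h) (hh1 : h ≤ 1) (hε : ε ≤ c / 4 * h ^ (1 - 1 / s))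
    (hε1 : ε ≤ 1) (hK0 : 0 ≤ K) (hu : Differentiable ℂ u) (hv : Differentiable ℂ v)
    (hu2 : SqInt (fun x => D.wt x + φ x) h u) (hv2 : SqInt (fun x => D.wt x + φ x) h v)
    {Cu Cv : ℝ} (hub : ∀ x, ‖u x‖ * Real.exp (-(D.wt x + φ x) / h) ≤ Cu)
    (hvb : ∀ x, ‖v x‖ * Real.exp (-(D.wt x + φ x) / h) ≤ Cv)
    (hψ : Continuous ψ) (hψs : HasCompactSupport ψ) (hψW : ∀ x, ‖ψ x‖ ≤ W)
    (hψL : ∀ x y, ‖ψ x - ψ y‖ ≤ W * ‖x - y‖) {S : Cn n → ℂ} {Ks : ℝ} (hSc : Continuous S)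
    (hS : ∀ x, ‖D.sym α h φ x - S x‖ ≤ Ks * h) :
    ‖(∫ x, ψ x * D.op α h u x * (conj (v x) * (Real.exp (-2 * (D.wt x + φ x) / h) : ℂ))) -
      ∫ x, ψ x * S x * (u x * (conj (v x) * (Real.exp (-2 * (D.wt x + φ x) / h) : ℂ)))‖ ≤
      (D.c₂ * 2 ^ n * K * (∫ w, D.maj s c 2 w) +
        D.c₂ * (K * (3 ^ n + 1 + D.up)) * (∫ w, D.maj s c 2 w) + Ks) * h * W *
      (weightedNorm (fun x => D.wt x + φ x) h u * weightedNorm (fun x => D.wt x + φ x) h v) := by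
  have hW : 0 ≤ W := (norm_nonneg _).trans (hψW 0)
  have hc2 := D.c₂_pos
  have hφc := P.contDiff.continuous
  set U := weightedNorm (fun x => D.wt x + φ x) h u * weightedNorm (fun x => D.wt x + φ x) h v
  have hU : 0 ≤ U := mul_nonneg (Real.sqrt_nonneg _) (Real.sqrt_nonneg _)
  set m := ∫ w, D.maj s c 2 w
  have hm : 0 ≤ m := integral_nonneg fun w => D.maj_nonneg 2 w
  set κ := D.c₂ * (1 + h / 4) ^ n
  have hκ : 0 ≤ κ := by positivity
  have hκ2 : κ ≤ D.c₂ * 2 ^ n := by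
    simp only [κ]; gcongr; linarith
  obtain ⟨i1, e1⟩ := D.integral_op_eq hα hM hs hc hK P hh hu.continuous hv.continuous hub hvb hψ hψs
  obtain ⟨i0, iR, e0⟩ := D.integral_pairing₀_eq hα hM hs hc hK P hh hh1 hε hu.continuous
    hv.continuous hψ hψs
  have i3 := D.integrable_maj hs hc 2
  set R := ∫ w in lowFreq n h, D.pairing₀ α h φ ψ u v w
  have s1 : ‖(∫ w, D.pairing α h φ ψ u v w) - R‖ ≤ h * (W * K * m) * U := by
    have e : (∫ w, D.pairing α h φ ψ u v w) - R = ∫ w, (D.pairing α h φ ψ u v w -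
        (lowFreq n h).indicator (D.pairing₀ α h φ ψ u v) w) := by
      rw [integral_sub i1 ((integrable_indicator_iff measurableSet_lowFreq).2 i0),
        integral_indicator measurableSet_lowFreq]
    -- Low frequencies are interpolated; at high frequencies the pairing itself is already O(h) and
    -- is compared with 0.
    have hle : ∀ w, ‖D.pairing α h φ ψ u v w -
        (lowFreq n h).indicator (D.pairing₀ α h φ ψ u v) w‖ ≤
        h * (W * K * D.maj s c 2 w) * U := fun w => by
      by_cases hw : w ∈ lowFreq n h
      · rw [Set.indicator_of_mem hw]
        exact D.norm_pairing_sub_le hα hM hs hc hK hKL P hh hh1 hε hε1 hu hv hu2 hv2 hψ hψs hψW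
          hψL hK0 hw
      · rw [Set.indicator_of_notMem hw, sub_zero]
        exact D.norm_pairing_le hs hc hK P hh hε hu hv hu2 hv2 hψW hK0 (not_le.1 hw)
    rw [e]
    refine (norm_integral_le_of_norm_le (((i3.const_mul (W * K)).const_mul h).mul_const U)
      (Eventually.of_forall hle)).trans (le_of_eq ?_)
    rw [integral_mul_const, integral_const_mul, integral_const_mul]
  set j : Cn n → ℂ := fun x => u x * (conj (v x) * (Real.exp (-2 * (D.wt x + φ x) / h) : ℂ))
  have huc := hu.continuous
  have hvc := hv.continuous
  have hjc : Continuous j := by fun_prop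
  have hjn : ∀ x, ‖j x‖ = (‖u x‖ * Real.exp (-(D.wt x + φ x) / h)) *
      (‖v x‖ * Real.exp (-(D.wt x + φ x) / h)) := fun x => by
    have h1 : j x = D.homJ h φ u v 0 0 x := (D.homJ_zero 0 x).symm
    rw [h1, norm_homJ_zero_le]
  obtain ⟨j1, j2⟩ := integrable_mul_weights (h := h) (Φ := fun x => D.wt x + φ x) (by fun_prop)
    huc hvc hu2 hv2 0
  simp only [sub_zero, ← hjn] at j1 j2
  set Sx : Cn n → ℂ := fun x => ∫ w in lowFreq n h,
    D.amp α (x - (1 / 2 : ℂ) • zsh h w) w * D.homK h φ (zsh h w) 0 x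
  have s2 : ‖(κ : ℂ) * R - ∫ x, ψ x * S x * j x‖ ≤
      W * (h * (D.c₂ * (K * (3 ^ n + 1 + D.up)) * m) + Ks * h) * U := by
    have hpt : ∀ x, ‖(κ : ℂ) * Sx x - S x‖ ≤
        h * (D.c₂ * (K * (3 ^ n + 1 + D.up)) * m) + Ks * h := fun x => by
      have h1 := D.norm_multiplier_sub_sym_le hα hM hs hc hK hKL P hh hh1 hε hK0 x
      have h2 := norm_sub_le_norm_sub_add_norm_sub ((κ : ℂ) * Sx x) (D.sym α h φ x) (S x)
      exact h2.trans (add_le_add h1 (hS x))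
    have iS : Integrable fun x => ψ x * S x * j x :=
      ((hψ.mul hSc).mul hjc).integrable_of_hasCompactSupport (hψs.mul_right.mul_right)
    have e : (κ : ℂ) * R - ∫ x, ψ x * S x * j x = ∫ x, ψ x * j x * ((κ : ℂ) * Sx x - S x) := by
      rw [e0, ← integral_const_mul, ← integral_sub (iR.const_mul _) iS]
      congr 1; ext x; ring
    rw [e]
    refine (norm_integral_le_of_norm_le (j1.const_mul (W * (h * (D.c₂ * (K * (3 ^ n + 1 + D.up)) * m)
      + Ks * h))) (Eventually.of_forall fun x => ?_)).trans ?_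
    · rw [norm_mul, norm_mul]
      calc _ ≤ W * ‖j x‖ * (h * (D.c₂ * (K * (3 ^ n + 1 + D.up)) * m) + Ks * h) :=
            mul_le_mul (mul_le_mul_of_nonneg_right (hψW x) (norm_nonneg _)) (hpt x)
              (norm_nonneg _) (mul_nonneg hW (norm_nonneg _))
        _ = _ := by ring
    · rw [integral_const_mul]
      exact mul_le_mul_of_nonneg_left j2 (mul_nonneg hW ((norm_nonneg _).trans (hpt 0)))
  have e2 : (∫ x, ψ x * D.op α h u x * (conj (v x) * (Real.exp (-2 * (D.wt x + φ x) / h) : ℂ))) -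
      (∫ x, ψ x * S x * j x) = (κ : ℂ) * ((∫ w, D.pairing α h φ ψ u v w) - R) +
        ((κ : ℂ) * R - ∫ x, ψ x * S x * j x) := by
    rw [e1]; ring
  rw [e2]
  refine (norm_add_le _ _).trans ?_
  rw [norm_mul, norm_real, Real.norm_eq_abs, abs_of_nonneg hκ]
  calc _ ≤ D.c₂ * 2 ^ n * (h * (W * K * m) * U) +
        W * (h * (D.c₂ * (K * (3 ^ n + 1 + D.up)) * m) + Ks * h) * U := by gcongr
    _ = _ := by ring

end QData

/-! ### Flatness and the Cauchy–Riemann equations to all orders on Λ. -/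

/-- The derivatives of a smooth function vanish at a point at which it is flat. -/
lemma iteratedDeriv_eq_zero_of_flat {β : ℝ → ℂ} (hβ : ContDiff ℝ ∞ β)
    (hflat : ∀ N : ℕ, ∃ C : ℝ, ∀ r, ‖β r‖ ≤ C * |r| ^ N) (k : ℕ) : iteratedDeriv k β 0 = 0 := by
  have hO : ∀ k : ℕ, β =o[𝓝 0] fun x : ℝ => (x - 0) ^ k := by
    intro k
    obtain ⟨C, hC⟩ := hflat (k + 1)
    have h1 : β =O[𝓝 0] fun x : ℝ => x ^ (k + 1) :=
      Asymptotics.IsBigO.of_bound C (Eventually.of_forall fun r => by simpa using hC r)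
    simp only [sub_zero]
    exact h1.trans_isLittleO (Asymptotics.isLittleO_pow_pow (Nat.lt_succ_self k))
  have key : ∀ k : ℕ, (∀ x, taylorWithinEval β k Set.univ 0 x = 0) ∧ iteratedDeriv k β 0 = 0 := by
    intro k
    induction k with
    | zero =>
      obtain ⟨C, hC⟩ := hflat 1
      have h0 : β 0 = 0 := by simpa using hC 0
      simp [taylor_within_zero_eval, h0]
    | succ k ih =>
      -- All lower Taylor coefficients vanish by induction, and β itself is o(x^{k+1}); hence the
      -- next Taylor term is o(x^{k+1}) as well, which forces its coefficient to be 0.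
      have h1 := taylor_isLittleO_univ (x₀ := 0) (n := k + 1) (hβ.of_le (by exact_mod_cast le_top))
      have h2 := (hO (k + 1)).sub h1
      simp only [sub_sub_cancel, taylorWithinEval_succ, ih.1, zero_add, iteratedDerivWithin_univ]
        at h2
      set d := iteratedDeriv (k + 1) β 0
      have hd : d = 0 := by
        have h3 : (fun x : ℝ => ‖((((k + 1 : ℝ) * k.factorial)⁻¹ : ℝ) : ℂ) * d‖) =o[𝓝[≠] 0]
            fun _ : ℝ => (1 : ℝ) := by
          rw [Asymptotics.isLittleO_iff]
          intro c hc
          filter_upwards [(h2.mono nhdsWithin_le_nhds).def hc, self_mem_nhdsWithin] with x hx hx0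
          have hx1 : 0 < |x| ^ (k + 1) := pow_pos (abs_pos.2 hx0) _
          simp only [sub_zero, norm_smul, norm_mul, norm_pow, Real.norm_eq_abs] at hx
          simp only [norm_mul, norm_real, Real.norm_eq_abs, abs_one, mul_one, abs_abs, abs_norm] at hx ⊢
          refine le_of_mul_le_mul_right ?_ hx1
          linarith
        rw [Asymptotics.isLittleO_one_iff] at h3
        have h4 := tendsto_nhds_unique h3 tendsto_const_nhds
        have h5 : ((((k + 1 : ℝ) * k.factorial)⁻¹ : ℝ) : ℂ) ≠ 0 := by
          have : (0 : ℝ) < ((k + 1 : ℝ) * k.factorial)⁻¹ := by positivity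
          exact_mod_cast this.ne'
        have h6 := norm_eq_zero.1 h4.symm
        exact (mul_eq_zero.1 h6).resolve_left h5
      refine ⟨fun x => ?_, hd⟩
      rw [taylorWithinEval_succ, ih.1, zero_add, iteratedDerivWithin_univ]
      rw [show iteratedDeriv (k + 1) β 0 = 0 from hd, smul_zero]
  exact (key k).2

section DirectionalDerivative

variable {E : Type*} [NormedAddCommGroup E] [NormedSpace ℝ E]

lemma contDiff_fderiv_apply {f : E → ℂ} (hf : ContDiff ℝ ∞ f) (w : E) :
    ContDiff ℝ ∞ fun x => fderiv ℝ f x w :=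
  (hf.fderiv_right (m := ∞) (by simp)).clm_apply contDiff_const

lemma fderiv_fderiv_comm {f : E → ℂ} (hf : ContDiff ℝ ∞ f) (v w x : E) :
    fderiv ℝ (fun y => fderiv ℝ f y v) x w = fderiv ℝ (fun y => fderiv ℝ f y w) x v := by
  have hd : DifferentiableAt ℝ (fderiv ℝ f) x :=
    ((hf.fderiv_right (m := ∞) (by simp)).differentiable (by simp)) x
  have hs : IsSymmSndFDerivAt ℝ f x := hf.contDiffAt.isSymmSndFDerivAt
    (by rw [minSmoothness_of_isRCLikeNormedField]; exact WithTop.coe_le_coe.2 (le_top (a := (2 : ℕ∞))))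
  have h : ∀ v, fderiv ℝ (fun y => fderiv ℝ f y v) x w = fderiv ℝ (fderiv ℝ f) x w v := fun v => by
    have := (hd.hasFDerivAt.clm_apply (hasFDerivAt_const v x)).fderiv
    rw [this]; simp
  have h' : fderiv ℝ (fun y => fderiv ℝ f y w) x v = fderiv ℝ (fderiv ℝ f) x v w := by
    have := (hd.hasFDerivAt.clm_apply (hasFDerivAt_const w x)).fderiv
    rw [this]; simp
  rw [h v, h', hs v w]

lemma dirD_fderiv {f : E → ℂ} (hf : ContDiff ℝ ∞ f) (e w : E) (k : ℕ) :
    dirD e k (fun x => fderiv ℝ f x w) = fun x => fderiv ℝ (dirD e k f) x w := by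
  induction k with
  | zero => rfl
  | succ k ih =>
    funext x
    simp only [dirD]
    rw [ih]
    exact fderiv_fderiv_comm (contDiff_dirD hf e k) w e x

lemma dirD_add_const_mul {f g : E → ℂ} (hf : ContDiff ℝ ∞ f) (hg : ContDiff ℝ ∞ g) (a b : ℂ) (e : E)
    (k : ℕ) : dirD e k (fun x => a * f x + b * g x) =
      fun x => a * dirD e k f x + b * dirD e k g x := by
  induction k with
  | zero => rfl
  | succ k ih =>
    funext x
    have h1 := ((contDiff_dirD hf e k).differentiable (by simp) x).hasFDerivAt
    have h2 := ((contDiff_dirD hg e k).differentiable (by simp) x).hasFDerivAt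
    simp only [dirD]
    have h3 : HasFDerivAt (fun x => a * dirD e k f x + b * dirD e k g x) _ x :=
      (h1.const_mul a).add (h2.const_mul b)
    rw [ih, h3.fderiv]
    simp

end DirectionalDerivative

/-- All the derivatives of an almost holomorphic function satisfy the Cauchy–Riemann equations on
the manifold. -/
lemma dbar_dirD_eq_zero {V : Type*} [NormedAddCommGroup V] [NormedSpace ℂ V] {f : V → ℂ}
    (hf : ContDiff ℝ ∞ f) {Λ : Set V}
    (hflat : ∀ N : ℕ, ∃ C : ℝ, ∀ ρ w : V, ‖dbar f ρ w‖ ≤ C * Metric.infDist ρ Λ ^ N * ‖w‖)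
    {ρ : V} (hρ : ρ ∈ Λ) (e w : V) (k : ℕ) : dbar (dirD e k f) ρ w = 0 := by
  set g : V → ℂ := fun x => 1 / 2 * fderiv ℝ f x w + I / 2 * fderiv ℝ f x (I • w)
  have hg : ContDiff ℝ ∞ g := (contDiff_const.mul (contDiff_fderiv_apply hf w)).add
    (contDiff_const.mul (contDiff_fderiv_apply hf (I • w)))
  have hgd : ∀ x, g x = dbar f x w := fun x => by simp only [g, dbar]; ring
  -- Directional derivatives commute, so the antilinear part of the k-th derivative of f is the k-th
  -- derivative of ∂̄f.
  have h1 : dbar (dirD e k f) ρ w = dirD e k g ρ := by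
    rw [dirD_add_const_mul (contDiff_fderiv_apply hf w) (contDiff_fderiv_apply hf (I • w)),
      dirD_fderiv hf, dirD_fderiv hf, dbar]
    ring
  have h2 := iteratedDeriv_line hg e k ρ 0
  rw [zero_smul, add_zero] at h2
  rw [h1, ← h2]
  refine iteratedDeriv_eq_zero_of_flat (hg.comp (by fun_prop)) (fun N => ?_) k
  obtain ⟨C, hC⟩ := hflat N
  refine ⟨|C| * ‖e‖ ^ N * ‖w‖, fun r => ?_⟩
  rw [Function.comp_apply, hgd]
  refine (hC _ w).trans ?_
  -- On the line through ρ the distance to Λ is at most the distance to ρ, so flatness on Λ gives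
  -- flatness in r.
  have h3 : Metric.infDist (ρ + r • e) Λ ≤ |r| * ‖e‖ := by
    refine (Metric.infDist_le_dist_of_mem hρ).trans (le_of_eq ?_)
    rw [dist_eq_norm, add_sub_cancel_left, norm_smul, Real.norm_eq_abs]
  have h4 : Metric.infDist (ρ + r • e) Λ ^ N ≤ (|r| * ‖e‖) ^ N :=
    pow_le_pow_left₀ Metric.infDist_nonneg h3 N
  have h5 : C * Metric.infDist (ρ + r • e) Λ ^ N ≤ |C| * (|r| * ‖e‖) ^ N :=
    mul_le_mul (le_abs_self C) h4 (pow_nonneg Metric.infDist_nonneg N) (abs_nonneg C)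
  calc _ ≤ |C| * (|r| * ‖e‖) ^ N * ‖w‖ := by gcongr
    _ = _ := by rw [mul_pow]; ring

/-! ### Moments of the wave packet decomposition. -/

namespace QData

variable {n : ℕ} (D : QData n) {s c K M : ℝ} {α : Cn n → ℂ}

/-- The moments of the wave packet decomposition. -/
def mom (α : Cn n → ℂ) (δ : Cn n) (k : ℕ) (y : Cn n) : ℂ :=
  ∫ w, D.amp α y w * (-D.H (w.1 - I • w.2) δ) ^ k

/-- The wave packets, parametrized by their centres. -/
def pk (α : Cn n → ℂ) (y : Cn n) (q : Cn n × Cn n) : ℂ :=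
  D.stft α q.1 q.2 * cexp (2 * (D.H y q.2).re * I - D.N (y - q.1))

/-- The factor by which an antiholomorphic derivative acts on the wave packets. -/
def pkX (δ y : Cn n) (q : Cn n × Cn n) : ℂ := -D.H (y - q.1 - I • q.2) δ

/-- The derivative of the moments' integrand in the direction `v`. -/
def pkD (α : Cn n → ℂ) (δ v : Cn n) (k : ℕ) (y : Cn n) (q : Cn n × Cn n) : ℂ :=
  D.pk α y q * ((2 * (D.H v q.2).re * I - 2 * (D.H v (y - q.1)).re) * D.pkX δ y q ^ k +
    k * D.pkX δ y q ^ (k - 1) * -D.H v δ)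

lemma amp_reflect (y : Cn n) (q : Cn n × Cn n) :
    D.amp α y (y - q.1, q.2) = D.pk α y q := by
  rw [amp, pk, sub_sub_cancel, mul_assoc, ofReal_exp, ← Complex.exp_add]
  push_cast
  rw [← sub_eq_add_neg]

/-- With packets indexed by their centres, y enters only through explicit exponentials and
polynomials; differentiating in y never touches α. -/
lemma mom_eq (δ : Cn n) (k : ℕ) (y : Cn n) :
    D.mom α δ k y = ∫ q, D.pk α y q * D.pkX δ y q ^ k := by
  rw [mom, ← integral_reflect_fst _ y]
  simp only [amp_reflect, pkX]

lemma hasDerivAt_pk_line (δ v y : Cn n) (k : ℕ) (q : Cn n × Cn n) (t : ℝ) :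
    HasDerivAt (fun t : ℝ => D.pk α (y + (t : ℂ) • v) q * D.pkX δ (y + (t : ℂ) • v) q ^ k)
      (D.pkD α δ v k (y + (t : ℂ) • v) q) t := by
  have h0 : HasDerivAt (fun t : ℝ => (t : ℂ)) 1 t := (hasDerivAt_id t).ofReal_comp
  have e1 : ∀ t : ℝ, (2 * (D.H (y + (t : ℂ) • v) q.2).re * I - D.N (y + (t : ℂ) • v - q.1) : ℂ) =
      (2 * (D.H y q.2).re * I - D.N (y - q.1)) +
        t * (2 * (D.H v q.2).re * I - 2 * (D.H v (y - q.1)).re) - (t : ℂ) ^ 2 * D.N v := by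
    intro t
    have h1 : y + (t : ℂ) • v - q.1 = (y - q.1) + (t : ℂ) • v := by abel
    have h2 := D.H_re_comm v (y - q.1)
    rw [h1, N_add, N_smul]
    simp only [map_add, LinearMap.add_apply, map_smul, LinearMap.smul_apply, smul_eq_mul, add_re,
      re_ofReal_mul, map_smulₛₗ, conj_ofReal, norm_real, Real.norm_eq_abs, sq_abs, h2]
    push_cast; ring
  have e2 : ∀ t : ℝ, D.pkX δ (y + (t : ℂ) • v) q = D.pkX δ y q + t * -D.H v δ := by
    intro t
    simp only [pkX, map_sub, map_add, map_smul, LinearMap.sub_apply, LinearMap.add_apply,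
      LinearMap.smul_apply, smul_eq_mul]
    ring
  have d1 : HasDerivAt (fun t : ℝ => (2 * (D.H (y + (t : ℂ) • v) q.2).re * I -
      D.N (y + (t : ℂ) • v - q.1) : ℂ)) ((2 * (D.H v q.2).re * I - 2 * (D.H v (y - q.1)).re) -
        2 * t * D.N v) t := by
    rw [funext e1]
    have := ((h0.mul_const (2 * (D.H v q.2).re * I - 2 * (D.H v (y - q.1)).re : ℂ)).const_add
      (2 * (D.H y q.2).re * I - D.N (y - q.1) : ℂ)).sub ((h0.pow 2).mul_const (D.N v : ℂ))
    exact this.congr_deriv (by simp)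
  have d2 : HasDerivAt (fun t : ℝ => D.pkX δ (y + (t : ℂ) • v) q) (-D.H v δ) t := by
    rw [funext e2]
    exact ((h0.mul_const (-D.H v δ)).const_add _).congr_deriv (by simp)
  refine ((d1.cexp.const_mul (D.stft α q.1 q.2)).mul (d2.pow k)).congr_deriv ?_
  have e3 : ((D.H v (y + (t : ℂ) • v - q.1)).re : ℂ) = (D.H v (y - q.1)).re + t * D.N v := by
    have h1 : y + (t : ℂ) • v - q.1 = (y - q.1) + (t : ℂ) • v := by abel
    rw [h1]
    simp only [map_add, add_re, map_smulₛₗ, smul_eq_mul, conj_ofReal, re_ofReal_mul, N]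
    push_cast; ring
  rw [pkD, pk, e3]
  simp only [Pi.pow_apply]
  ring

lemma norm_pk_le (hst : ∀ k ζ, ‖D.stft α k ζ‖ ≤ K * Real.exp (-(c * ‖ζ‖ ^ (1 / s))))
    (y : Cn n) (q : Cn n × Cn n) :
    ‖D.pk α y q‖ ≤ K * Real.exp (-(c * ‖q.2‖ ^ (1 / s))) * Real.exp (-(D.lo * ‖y - q.1‖ ^ 2)) := by
  rw [pk, norm_mul, norm_exp]
  have h1 : (2 * (D.H y q.2).re * I - D.N (y - q.1) : ℂ).re = -D.N (y - q.1) := by simp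
  rw [h1]
  refine mul_le_mul (hst _ _) (Real.exp_le_exp.2 ?_) (Real.exp_pos _).le
    ((norm_nonneg _).trans (hst 0 _))
  have := D.lo_le (y - q.1)
  linarith

lemma norm_pkX_le (δ y : Cn n) (q : Cn n × Cn n) :
    ‖D.pkX δ y q‖ ≤ D.up * ‖δ‖ * (‖y - q.1‖ + ‖q.2‖) := by
  have hup := D.up_pos
  rw [pkX, norm_neg]
  refine (D.norm_H_le _ _).trans ?_
  have h1 : ‖y - q.1 - I • q.2‖ ≤ ‖y - q.1‖ + ‖q.2‖ := norm_sub_I_smul_le (y - q.1, q.2)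
  calc _ ≤ D.up * (‖y - q.1‖ + ‖q.2‖) * ‖δ‖ := by gcongr
    _ = _ := by ring

/-- The constant in the bound of the derivatives of the wave packets. -/
def pkA (δ v : Cn n) : ℝ := 1 + 2 * D.up * (1 + ‖δ‖) * (1 + ‖v‖)

lemma norm_pkD_factor_le (δ v : Cn n) (k : ℕ) (y : Cn n) (q : Cn n × Cn n) :
    ‖(2 * (D.H v q.2).re * I - 2 * (D.H v (y - q.1)).re) * D.pkX δ y q ^ k +
      k * D.pkX δ y q ^ (k - 1) * -D.H v δ‖ ≤
      (k + 1) * D.pkA δ v ^ (k + 1) * ((1 + ‖y - q.1‖) * (1 + ‖q.2‖)) ^ (k + 1) := by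
  have hup := D.up_pos
  set A := D.pkA δ v
  set ρ := ‖y - q.1‖
  set σ := ‖q.2‖
  set T := (1 + ρ) * (1 + σ)
  have hρ : 0 ≤ ρ := norm_nonneg _
  have hσ : 0 ≤ σ := norm_nonneg _
  have hδ := norm_nonneg δ
  have hv := norm_nonneg v
  have hT : ρ + σ ≤ T := by simp only [T]; nlinarith [mul_nonneg hρ hσ]
  have hT1 : 1 ≤ T := by simp only [T]; nlinarith [mul_nonneg hρ hσ]
  have hδv := mul_nonneg hδ hv
  have hA1 : 1 ≤ A := by simp only [A, pkA]; have : 0 ≤ 2 * D.up * (1 + ‖δ‖) * (1 + ‖v‖) := by positivity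
                         linarith
  have a1 : D.up * ‖δ‖ ≤ A := by
    simp only [A, pkA]; nlinarith [mul_nonneg hup.le hδv, mul_nonneg hup.le hδ, mul_nonneg hup.le hv]
  have a2 : 2 * D.up * ‖v‖ ≤ A := by
    simp only [A, pkA]; nlinarith [mul_nonneg hup.le hδv, mul_nonneg hup.le hδ, mul_nonneg hup.le hv]
  have a3 : D.up * ‖v‖ * ‖δ‖ ≤ A := by
    simp only [A, pkA]; nlinarith [mul_nonneg hup.le hδv, mul_nonneg hup.le hδ, mul_nonneg hup.le hv]
  have hX : ‖D.pkX δ y q‖ ≤ A * T := (D.norm_pkX_le δ y q).trans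
    (mul_le_mul a1 hT (by positivity) (by positivity))
  have b1 : ‖(2 * (D.H v q.2).re * I - 2 * (D.H v (y - q.1)).re : ℂ)‖ ≤ A * T := by
    have h1 := (abs_re_le_norm _).trans (D.norm_H_le v q.2)
    have h2 := (abs_re_le_norm _).trans (D.norm_H_le v (y - q.1))
    refine (norm_sub_le _ _).trans ?_
    simp only [norm_mul, norm_I, mul_one, norm_real, RCLike.norm_ofNat, Real.norm_eq_abs]
    calc _ ≤ 2 * (D.up * ‖v‖ * σ) + 2 * (D.up * ‖v‖ * ρ) := by gcongr
      _ = 2 * D.up * ‖v‖ * (ρ + σ) := by ring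
      _ ≤ A * T := mul_le_mul a2 hT (by positivity) (by positivity)
  have hAT : 1 ≤ A * T := one_le_mul_of_one_le_of_one_le hA1 hT1
  refine (norm_add_le _ _).trans ?_
  simp only [norm_mul, norm_pow, norm_neg, norm_natCast]
  have c1 : ‖D.pkX δ y q‖ ^ (k - 1) ≤ (A * T) ^ k :=
    (pow_le_pow_left₀ (norm_nonneg _) hX _).trans (pow_le_pow_right₀ hAT (Nat.sub_le k 1))
  have c2 : ‖D.H v δ‖ ≤ A * T := ((D.norm_H_le v δ).trans a3).trans
    (le_mul_of_one_le_right (by positivity) hT1)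
  have c3 : ‖(2 * (D.H v q.2).re * I - 2 * (D.H v (y - q.1)).re : ℂ)‖ * ‖D.pkX δ y q‖ ^ k ≤
      (A * T) * (A * T) ^ k :=
    mul_le_mul b1 (pow_le_pow_left₀ (norm_nonneg _) hX k) (by positivity) (by positivity)
  have c4 : (k : ℝ) * ‖D.pkX δ y q‖ ^ (k - 1) * ‖D.H v δ‖ ≤ k * (A * T) ^ k * (A * T) := by gcongr
  calc _ ≤ (A * T) * (A * T) ^ k + k * (A * T) ^ k * (A * T) := add_le_add c3 c4
    _ = (k + 1) * (A * T) ^ (k + 1) := by ring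
    _ = _ := by rw [mul_pow]; ring

/-- An integrable bound of the wave packets, uniform along a segment. -/
lemma exists_pk_dominated (hs : 1 < s) (hc : 0 < c) (m : ℕ) (y v : Cn n) :
    ∃ b : Cn n × Cn n → ℝ, Integrable b ∧ ∀ t : ℝ, |t| ≤ 1 → ∀ q : Cn n × Cn n,
      Real.exp (-(c * ‖q.2‖ ^ (1 / s))) * Real.exp (-(D.lo * ‖y + (t : ℂ) • v - q.1‖ ^ 2)) *
        ((1 + ‖y + (t : ℂ) • v - q.1‖) * (1 + ‖q.2‖)) ^ m ≤ b q := by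
  have hlo := D.lo_pos
  obtain ⟨C, hC⟩ := exists_exp_neg_rpow_le (d := m) (half_pos hlo) two_pos (Nat.cast_nonneg m)
  have hC0 : 0 ≤ C := by
    have := (Real.exp_pos _).le.trans (hC 0 le_rfl)
    simpa using this
  have g1 : Integrable fun p : Cn n => Real.exp (-(D.lo / 4 * ‖y - p‖ ^ (2 : ℝ))) :=
    (integrable_exp_neg_rpow (μ := (volume : Measure (Cn n))) (c := D.lo / 4) (by positivity)
      two_pos).comp_sub_left y
  have g2 := integrable_pow_mul_exp_neg_rpow (n := n) (m := m) hc (r := 1 / s) (by positivity)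
  refine ⟨fun q => (C * Real.exp (D.lo / 2 * ‖v‖ ^ 2)) * (Real.exp (-(D.lo / 4 * ‖y - q.1‖ ^ (2 : ℝ))) *
    ((1 + ‖q.2‖) ^ m * Real.exp (-(c * ‖q.2‖ ^ (1 / s))))), (g1.mul_prod g2).const_mul _,
    fun t ht q => ?_⟩
  set ρ := ‖y + (t : ℂ) • v - q.1‖
  have hρ : 0 ≤ ρ := norm_nonneg _
  have h1 := hC ρ hρ
  rw [Real.rpow_neg (by positivity), Real.rpow_natCast, ← div_eq_mul_inv,
    le_div_iff₀ (by positivity), Real.rpow_two] at h1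
  -- Half of the Gaussian absorbs the polynomial. The other half is compared with a Gaussian centred
  -- at y, which is independent of t.
  have h2 : ‖y - q.1‖ ^ 2 ≤ 2 * ρ ^ 2 + 2 * ‖v‖ ^ 2 := by
    have e : y - q.1 = (y + (t : ℂ) • v - q.1) - (t : ℂ) • v := by abel
    have h3 : ‖y - q.1‖ ≤ ρ + ‖v‖ := by
      rw [e]
      refine (norm_sub_le _ _).trans (add_le_add le_rfl ?_)
      rw [norm_smul, norm_real, Real.norm_eq_abs]
      exact mul_le_of_le_one_left (norm_nonneg _) ht
    have h4 := pow_le_pow_left₀ (norm_nonneg _) h3 2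
    nlinarith [sq_nonneg (ρ - ‖v‖)]
  have h5 : Real.exp (-(D.lo * ρ ^ 2)) = Real.exp (-(D.lo / 2 * ρ ^ 2)) *
      Real.exp (-(D.lo / 2 * ρ ^ 2)) := by rw [← Real.exp_add]; congr 1; ring
  have h6 : Real.exp (-(D.lo / 2 * ρ ^ 2)) ≤ Real.exp (D.lo / 2 * ‖v‖ ^ 2) *
      Real.exp (-(D.lo / 4 * ‖y - q.1‖ ^ (2 : ℝ))) := by
    rw [← Real.exp_add, Real.rpow_two]
    refine Real.exp_le_exp.2 ?_
    nlinarith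
  calc _ = ((1 + ‖q.2‖) ^ m * Real.exp (-(c * ‖q.2‖ ^ (1 / s)))) *
        (Real.exp (-(D.lo / 2 * ρ ^ 2)) * (1 + ρ) ^ m) * Real.exp (-(D.lo / 2 * ρ ^ 2)) := by
        rw [h5, mul_pow]; ring
    _ ≤ ((1 + ‖q.2‖) ^ m * Real.exp (-(c * ‖q.2‖ ^ (1 / s)))) * C *
        (Real.exp (D.lo / 2 * ‖v‖ ^ 2) * Real.exp (-(D.lo / 4 * ‖y - q.1‖ ^ (2 : ℝ)))) := by
        gcongr
    _ = _ := by ring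

lemma continuous_pk (hα : Continuous α) (hM : ∀ x, ‖α x‖ ≤ M) (y : Cn n) :
    Continuous (D.pk α y) := by
  have h1 := D.continuous_stft hα hM (f := fun q : Cn n × Cn n => q.1) (g := fun q => q.2)
    continuous_fst continuous_snd
  unfold pk; fun_prop

lemma continuous_pkX (δ y : Cn n) : Continuous (D.pkX δ y) := by
  unfold pkX; fun_prop

lemma continuous_pkD (hα : Continuous α) (hM : ∀ x, ‖α x‖ ≤ M) (δ v : Cn n) (k : ℕ) (y : Cn n) :
    Continuous (D.pkD α δ v k y) := by
  have h1 := D.continuous_pk hα hM y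
  have h2 := D.continuous_pkX δ y
  unfold pkD; fun_prop

/-- Differentiation under the integral, with the majorant of `exists_pk_dominated`. One more power
of the variables is needed for the derivative, whence k + 1 there. -/
lemma hasDerivAt_mom (hα : Continuous α) (hM : ∀ x, ‖α x‖ ≤ M) (hs : 1 < s) (hc : 0 < c)
    (hst : ∀ k ζ, ‖D.stft α k ζ‖ ≤ K * Real.exp (-(c * ‖ζ‖ ^ (1 / s))))
    (δ v : Cn n) (k : ℕ) (y : Cn n) :
    Integrable (D.pkD α δ v k y) ∧
    HasDerivAt (fun t : ℝ => D.mom α δ k (y + (t : ℂ) • v)) (∫ q, D.pkD α δ v k y q) 0 := by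
  have hup := D.up_pos
  have hA0 : 0 ≤ D.pkA δ v := by unfold pkA; positivity
  obtain ⟨b, hb, hbl⟩ := D.exists_pk_dominated hs hc (k + 1) y v
  obtain ⟨b', hb', hbl'⟩ := D.exists_pk_dominated hs hc k y v
  have hK0 : 0 ≤ K := by
    have := (norm_nonneg _).trans (hst 0 0)
    exact nonneg_of_mul_nonneg_left this (Real.exp_pos _)
  have hint : Integrable (fun q => D.pk α (y + ((0 : ℝ) : ℂ) • v) q *
      D.pkX δ (y + ((0 : ℝ) : ℂ) • v) q ^ k) := by
    refine (hb'.const_mul (K * (D.up * ‖δ‖) ^ k)).mono'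
      ((D.continuous_pk hα hM _).mul ((D.continuous_pkX δ _).pow k)).aestronglyMeasurable
      (Eventually.of_forall fun q => ?_)
    rw [norm_mul, norm_pow]
    have h1 := D.norm_pk_le hst (y + ((0 : ℝ) : ℂ) • v) q
    have h2 := D.norm_pkX_le δ (y + ((0 : ℝ) : ℂ) • v) q
    have h3 := hbl' 0 (by simp) q
    have h4 : ‖y + ((0 : ℝ) : ℂ) • v - q.1‖ + ‖q.2‖ ≤
        (1 + ‖y + ((0 : ℝ) : ℂ) • v - q.1‖) * (1 + ‖q.2‖) := by
      nlinarith [norm_nonneg (y + ((0 : ℝ) : ℂ) • v - q.1), norm_nonneg q.2,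
        mul_nonneg (norm_nonneg (y + ((0 : ℝ) : ℂ) • v - q.1)) (norm_nonneg q.2)]
    have h5 : ‖D.pkX δ (y + ((0 : ℝ) : ℂ) • v) q‖ ^ k ≤ (D.up * ‖δ‖) ^ k *
        ((1 + ‖y + ((0 : ℝ) : ℂ) • v - q.1‖) * (1 + ‖q.2‖)) ^ k := by
      rw [← mul_pow]
      exact pow_le_pow_left₀ (norm_nonneg _) (h2.trans (by gcongr)) k
    calc _ ≤ _ := mul_le_mul h1 h5 (by positivity) (by positivity)
      _ = (K * (D.up * ‖δ‖) ^ k) * (Real.exp (-(c * ‖q.2‖ ^ (1 / s))) *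
          Real.exp (-(D.lo * ‖y + ((0 : ℝ) : ℂ) • v - q.1‖ ^ 2)) *
          ((1 + ‖y + ((0 : ℝ) : ℂ) • v - q.1‖) * (1 + ‖q.2‖)) ^ k) := by ring
      _ ≤ _ := by gcongr
  have hbound : ∀ q, ∀ t ∈ Metric.ball (0 : ℝ) 1, ‖D.pkD α δ v k (y + (t : ℂ) • v) q‖ ≤
      (K * ((k + 1) * D.pkA δ v ^ (k + 1))) * b q := by
    intro q t ht
    have ht1 : |t| ≤ 1 := by
      rw [Metric.mem_ball, Real.dist_eq, sub_zero] at ht; exact ht.le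
    have h1 := D.norm_pk_le hst (y + (t : ℂ) • v) q
    have h2 := D.norm_pkD_factor_le δ v k (y + (t : ℂ) • v) q
    have h3 := hbl t ht1 q
    rw [pkD, norm_mul]
    calc _ ≤ _ := mul_le_mul h1 h2 (norm_nonneg _) (by positivity)
      _ = (K * ((k + 1) * D.pkA δ v ^ (k + 1))) * (Real.exp (-(c * ‖q.2‖ ^ (1 / s))) *
          Real.exp (-(D.lo * ‖y + (t : ℂ) • v - q.1‖ ^ 2)) *
          ((1 + ‖y + (t : ℂ) • v - q.1‖) * (1 + ‖q.2‖)) ^ (k + 1)) := by ring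
      _ ≤ _ := mul_le_mul_of_nonneg_left h3 (by positivity)
  have main := hasDerivAt_integral_of_dominated_loc_of_deriv_le
    (F := fun (t : ℝ) q => D.pk α (y + (t : ℂ) • v) q * D.pkX δ (y + (t : ℂ) • v) q ^ k)
    (F' := fun (t : ℝ) q => D.pkD α δ v k (y + (t : ℂ) • v) q)
    (bound := fun q => (K * ((k + 1) * D.pkA δ v ^ (k + 1))) * b q) (x₀ := (0 : ℝ))
    (Metric.ball_mem_nhds (0 : ℝ) one_pos)
    (Eventually.of_forall fun t => ((D.continuous_pk hα hM _).mul
      ((D.continuous_pkX δ _).pow k)).aestronglyMeasurable) hint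
    (D.continuous_pkD hα hM δ v k _).aestronglyMeasurable (Eventually.of_forall hbound)
    (hb.const_mul _) (Eventually.of_forall fun q t _ => D.hasDerivAt_pk_line δ v y k q t)
  simp only [← D.mom_eq, ofReal_zero, zero_smul, add_zero] at main
  exact main

/-- An antiholomorphic derivative raises the order of the moments. -/
lemma mom_succ (hα : Continuous α) (hM : ∀ x, ‖α x‖ ≤ M) (hs : 1 < s) (hc : 0 < c)
    (hst : ∀ k ζ, ‖D.stft α k ζ‖ ≤ K * Real.exp (-(c * ‖ζ‖ ^ (1 / s))))
    (δ : Cn n) (k : ℕ) (y : Cn n) :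
    D.mom α δ (k + 1) y = (1 / 2) * ((∫ q, D.pkD α δ δ k y q) +
      I * ∫ q, D.pkD α δ (I • δ) k y q) := by
  have i1 := (D.hasDerivAt_mom hα hM hs hc hst δ δ k y).1
  have i2 := (D.hasDerivAt_mom hα hM hs hc hst δ (I • δ) k y).1
  rw [mom_eq, ← integral_const_mul, ← integral_add i1 (i2.const_mul I), ← integral_const_mul]
  congr 1; ext q
  have e1 : (((D.H δ q.2).re : ℂ) + I * ((I * D.H δ q.2).re : ℂ)) = D.H q.2 δ := by
    rw [D.herm δ q.2, I_mul_re]; apply Complex.ext <;> simp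
  have e2 : (((D.H δ (y - q.1)).re : ℂ) + I * ((I * D.H δ (y - q.1)).re : ℂ)) =
      D.H (y - q.1) δ := by
    rw [D.herm δ (y - q.1), I_mul_re]; apply Complex.ext <;> (simp; try ring)
  have e3 : D.pkX δ y q = -D.H (y - q.1) δ + I * D.H q.2 δ := by
    rw [pkX, map_sub, LinearMap.sub_apply, map_smul, LinearMap.smul_apply, smul_eq_mul]; ring
  -- The combination of the directions δ and iδ is twice the antiholomorphic derivative. On the
  -- exponent of the packet it gives 2X with X = `D.pkX δ y q`: each differentiation brings down one
  -- more factor X.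
  have e4 : (2 * (D.H δ q.2).re * I - 2 * (D.H δ (y - q.1)).re : ℂ) +
      I * (2 * (D.H (I • δ) q.2).re * I - 2 * (D.H (I • δ) (y - q.1)).re) = 2 * D.pkX δ y q := by
    rw [e3, ← e1, ← e2]
    simp only [map_smul, LinearMap.smul_apply, smul_eq_mul]
    ring
  have e5 : D.H (I • δ) δ = I * D.H δ δ := by
    simp only [map_smul, LinearMap.smul_apply, smul_eq_mul]
  simp only [pkD, e5]
  -- The terms from differentiating X^k cancel because X is holomorphic in y.
  linear_combination (-(1 / 2) * D.pk α y q * D.pkX δ y q ^ k) * e4 +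
    (1 / 2 * D.pk α y q * k * D.pkX δ y q ^ (k - 1) * D.H δ δ) * I_sq

end QData

/-! ### Comparison of the effective symbol with the almost holomorphic extension. -/

lemma del_add {n : ℕ} (φ : Cn n → ℝ) (x z w : Cn n) : del φ x (z + w) = del φ x z + del φ x w := by
  simp only [del, smul_add, map_add]; push_cast; ring

lemma del_I_smul {n : ℕ} (φ : Cn n → ℝ) (x z : Cn n) : del φ x (I • z) = I * del φ x z := by
  have : I • I • z = -z := by rw [smul_smul, I_mul_I, neg_one_smul]
  simp only [del, this, map_neg]; push_cast
  linear_combination (1 / 2 * fderiv ℝ φ x (I • z) : ℂ) * I_sq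

lemma del_smul {n : ℕ} (φ : Cn n → ℝ) (x z : Cn n) (a : ℂ) : del φ x (a • z) = a * del φ x z := by
  have e : a • z = ((a.re : ℂ) • z) + (a.im : ℂ) • (I • z) := by
    conv_lhs => rw [← re_add_im a]
    rw [add_smul, mul_smul]
  rw [e, del_add, del_real_smul, del_real_smul, del_I_smul]
  conv_rhs => rw [← re_add_im a]
  ring

/-- The derivative `z ↦ ∑ z_j ∂φ/∂x_j` as a linear form. -/
def delₗ {n : ℕ} (φ : Cn n → ℝ) (x : Cn n) : Cn n →ₗ[ℂ] ℂ where
  toFun := del φ x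
  map_add' := del_add φ x
  map_smul' a z := del_smul φ x z a

/-- The covector `(2/i) ∂φ`. -/
def delXi {n : ℕ} (φ : Cn n → ℝ) (x : Cn n) : Cn n := fun j => 2 / I * del φ x (Pi.single j 1)

lemma norm_delXi_le {n : ℕ} {φ : Cn n → ℝ} {ε : ℝ} (P : SmallPert φ ε) (x : Cn n) :
    ‖delXi φ x‖ ≤ 2 * ε := by
  have := P.nonneg
  refine (pi_norm_le_iff_of_nonneg (by positivity)).2 fun j => ?_
  rw [delXi, norm_mul, norm_div, norm_I, RCLike.norm_ofNat, div_one]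
  have h1 := P.norm_del_le x (Pi.single j 1)
  rw [Pi.norm_single, norm_one, mul_one] at h1
  linarith

/-- A chain of derivatives that starts small and whose last term is small remains small. -/
lemma norm_le_of_hasDerivAt_chain {g : ℕ → ℝ → ℂ} {N : ℕ} {A : ℝ}
    (hg : ∀ k, ∀ q ∈ Set.Icc (0 : ℝ) 1, HasDerivAt (g k) (g (k + 1) q) q)
    (h0 : ∀ k < N, ‖g k 0‖ ≤ A) (hN : ∀ q ∈ Set.Icc (0 : ℝ) 1, ‖g N q‖ ≤ A) :
    ‖g 0 1‖ ≤ (N + 1) * A := by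
  have key : ∀ j ≤ N, ∀ q ∈ Set.Icc (0 : ℝ) 1, ‖g (N - j) q‖ ≤ (j + 1) * A := by
    intro j
    induction j with
    | zero => intro _ q hq; simpa using hN q hq
    | succ j ih =>
      intro hj q hq
      have e : N - j = N - (j + 1) + 1 := by omega
      have h1 := (convex_Icc (0 : ℝ) 1).norm_image_sub_le_of_norm_hasDerivWithin_le
        (f := g (N - (j + 1))) (f' := g (N - j)) (C := (j + 1) * A)
        (fun q hq => by rw [e]; exact (hg _ q hq).hasDerivWithinAt) (ih (by omega))
        (Set.left_mem_Icc.2 zero_le_one) hq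
      have h2 := h0 (N - (j + 1)) (by omega)
      have hA : 0 ≤ (j + 1) * A := (norm_nonneg _).trans (ih (by omega) q hq)
      have h3 : ‖q - 0‖ ≤ 1 := by
        rw [sub_zero, Real.norm_eq_abs, abs_of_nonneg hq.1]; exact hq.2
      have h4 : ‖g (N - (j + 1)) q‖ ≤ ‖g (N - (j + 1)) q - g (N - (j + 1)) 0‖ +
          ‖g (N - (j + 1)) 0‖ := by
        simpa using norm_add_le (g (N - (j + 1)) q - g (N - (j + 1)) 0) (g (N - (j + 1)) 0)
      push_cast
      nlinarith [mul_le_mul_of_nonneg_left h3 hA]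
  have := key N le_rfl 1 (Set.right_mem_Icc.2 zero_le_one)
  simpa using this

namespace QData

variable {n : ℕ} (D : QData n) {s c h ε K M : ℝ} {φ : Cn n → ℝ} {α : Cn n → ℂ}
  {aT : Cn n × Cn n → ℂ}

/-- The covector `(2/i) ∂Φ₀` of the weight. -/
def xi0 (x : Cn n) : Cn n := fun j => 2 / I * D.B (Pi.single j 1) x

/-- The covector `(2/i) H(·, δ)`. -/
def etaH (δ : Cn n) : Cn n := fun j => 2 / I * D.H (Pi.single j 1) δ

/-- The hermitian form represents all the linear forms. -/
lemma exists_H_eq (L : Cn n →ₗ[ℂ] ℂ) : ∃ δ, ∀ w, D.H w δ = L w := by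
  let T : Cn n →ₗ[ℂ] Cn n := LinearMap.pi fun j => D.H.flip (Pi.single j 1)
  have hT : ∀ δ j, T δ j = D.H δ (Pi.single j 1) := fun δ j => rfl
  have hsum : ∀ δ w : Cn n, D.H δ w = ∑ j, conj (w j) * D.H δ (Pi.single j 1) := by
    intro δ w
    have hw : w = ∑ j, w j • (Pi.single j (1 : ℂ) : Cn n) := by
      ext i; simp [Finset.sum_apply, Pi.single_apply]
    conv_lhs => rw [hw]
    simp only [map_sum, map_smulₛₗ, smul_eq_mul]
  have hinj : Function.Injective T := by
    rw [← LinearMap.ker_eq_bot, LinearMap.ker_eq_bot']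
    intro δ hδ
    by_contra hne
    have h1 := D.pos δ hne
    rw [hsum] at h1
    simp [← hT, hδ] at h1
  obtain ⟨δ, hδ⟩ := (LinearMap.injective_iff_surjective.1 hinj) fun j => conj (L (Pi.single j 1))
  refine ⟨δ, fun w => ?_⟩
  have hw : w = ∑ j, w j • (Pi.single j (1 : ℂ) : Cn n) := by
    ext i; simp [Finset.sum_apply, Pi.single_apply]
  rw [D.herm δ w, hsum, map_sum]
  conv_rhs => rw [hw]
  simp only [map_sum, map_smul, smul_eq_mul, map_mul, conj_conj, ← hT, hδ]

lemma xi0_add (x y : Cn n) : D.xi0 (x + y) = D.xi0 x + D.xi0 y := by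
  ext j; simp only [xi0, B, map_add, Pi.add_apply]; ring

lemma xi0_real_smul (t : ℝ) (x : Cn n) : D.xi0 ((t : ℂ) • x) = t • D.xi0 x := by
  ext j
  simp only [xi0, B, map_smulₛₗ, smul_eq_mul, conj_ofReal, RingHom.id_apply, Pi.smul_apply, real_smul]; ring

/-- The antiholomorphic derivative of the section y ↦ (y, ξ₀(y)) in the direction δ is vertical: the
base components δ and i·iδ cancel, and so do the Q parts, while the H parts add up. This is how base
derivatives of α determine fibre derivatives of its extension. -/
lemma xi0_add_I (δ : Cn n) : D.xi0 δ + I • D.xi0 (I • δ) = (2 : ℂ) • D.etaH δ := by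
  ext j
  simp only [xi0, B, etaH, map_smulₛₗ, smul_eq_mul, RingHom.id_apply, Pi.smul_apply, Pi.add_apply, conj_I]
  linear_combination (2 / I * (-D.H (Pi.single j 1) δ + D.Q (Pi.single j 1) δ)) * I_sq

/-- The fibre derivatives of the almost holomorphic extension are given by the moments. -/
lemma dirD_eq_mom (hα : Continuous α) (hM : ∀ x, ‖α x‖ ≤ M) (hs : 1 < s) (hαG : GevreyBounded s α)
    (hc : 0 < c) (hst : ∀ k ζ, ‖D.stft α k ζ‖ ≤ K * Real.exp (-(c * ‖ζ‖ ^ (1 / s))))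
    {Λ : Set (Cn n × Cn n)} (hΛ : ∀ y, (y, D.xi0 y) ∈ Λ) (haT : ContDiff ℝ ∞ aT)
    (hflat : ∀ N : ℕ, ∃ C : ℝ, ∀ ρ w, ‖dbar aT ρ w‖ ≤ C * Metric.infDist ρ Λ ^ N * ‖w‖)
    (hext : ∀ y, aT (y, D.xi0 y) = α y) (δ : Cn n) (k : ℕ) (y : Cn n) :
    dirD ((0 : Cn n), D.etaH δ) k aT (y, D.xi0 y) = D.c₂ * D.mom α δ k y := by
  induction k generalizing y with
  | zero =>
    rw [dirD, hext, D.amp_inversion hs hαG y, mom]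
    simp
  | succ k ih =>
    set F := dirD ((0 : Cn n), D.etaH δ) k aT
    have hF : DifferentiableAt ℝ F (y, D.xi0 y) :=
      (contDiff_dirD haT _ k).differentiable (by simp) _
    have hd : ∀ v, fderiv ℝ F (y, D.xi0 y) (v, D.xi0 v) = D.c₂ * ∫ q, D.pkD α δ v k y q := by
      intro v
      have h1 := ((D.hasDerivAt_mom hα hM hs hc hst δ v k y).2).const_mul (D.c₂ : ℂ)
      have h2 : (fun t : ℝ => (D.c₂ : ℂ) * D.mom α δ k (y + (t : ℂ) • v)) =
          fun t : ℝ => F ((y, D.xi0 y) + t • (v, D.xi0 v)) := by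
        funext t
        rw [← ih, xi0_add, xi0_real_smul]
        congr 1
      rw [h2] at h1
      have h3 : HasDerivAt (fun t : ℝ => (y, D.xi0 y) + t • (v, D.xi0 v)) (v, D.xi0 v) 0 := by
        simpa using ((hasDerivAt_id (0 : ℝ)).smul_const (v, D.xi0 v)).const_add (y, D.xi0 y)
      have h4 : HasFDerivAt F (fderiv ℝ F (y, D.xi0 y)) ((y, D.xi0 y) + (0 : ℝ) • (v, D.xi0 v)) := by
        rw [zero_smul, add_zero]; exact hF.hasFDerivAt
      exact (h4.comp_hasDerivAt (0 : ℝ) h3).unique h1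
    -- On Λ the derivative of the k-th fibre derivative is complex linear.
    have hCR : ∀ w, I * fderiv ℝ F (y, D.xi0 y) w = fderiv ℝ F (y, D.xi0 y) (I • w) := by
      intro w
      have h1 := dbar_dirD_eq_zero haT hflat (hΛ y) ((0 : Cn n), D.etaH δ) w k
      rw [dbar] at h1
      linear_combination (2 * I) * h1 - fderiv ℝ F (y, D.xi0 y) (I • w) * I_sq
    rw [D.mom_succ hα hM hs hc hst]
    have e1 := hd δ
    have e2 := hd (I • δ)
    -- By complex linearity the two tangential derivatives combine into the vertical one, and on the
    -- side of the moments the same combination raises the order by `mom_succ`.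
    have e3 : fderiv ℝ F (y, D.xi0 y) (δ, D.xi0 δ) +
        I * fderiv ℝ F (y, D.xi0 y) (I • δ, D.xi0 (I • δ)) =
        2 * fderiv ℝ F (y, D.xi0 y) ((0 : Cn n), D.etaH δ) := by
      rw [hCR, ← map_add]
      have : (δ, D.xi0 δ) + I • (I • δ, D.xi0 (I • δ)) = (2 : ℝ) • ((0 : Cn n), D.etaH δ) := by
        rw [Prod.smul_mk, Prod.mk_add_mk, xi0_add_I, smul_smul, I_mul_I, neg_one_smul, add_neg_cancel,
          Prod.smul_mk, smul_zero]
        congr 1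
      rw [this, map_smul]; simp
    show fderiv ℝ F (y, D.xi0 y) ((0 : Cn n), D.etaH δ) = _
    linear_combination (-1 / 2) * e3 + (1 / 2) * e1 + (I / 2) * e2

lemma pow_mul_damp_le (hc : 0 < c) (m : ℕ) (w : Cn n × Cn n) :
    (1 + ‖w.1‖ + ‖w.2‖) ^ m * D.damp s c w ≤ D.maj s c m w := by
  have h1 : 1 + ‖w.1‖ + ‖w.2‖ ≤ (1 + ‖w.1‖) * (1 + ‖w.2‖) := by
    nlinarith [mul_nonneg (norm_nonneg w.1) (norm_nonneg w.2)]
  have h2 : Real.exp (-D.N w.1) ≤ Real.exp (-D.N w.1 + c * ‖w.1‖) :=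
    Real.exp_le_exp.2 (by have : 0 ≤ c * ‖w.1‖ := by positivity
                          linarith)
  have h3 : Real.exp (-(c * ‖w.2‖ ^ (1 / s))) ≤ Real.exp (-(c / 2 * ‖w.2‖ ^ (1 / s))) :=
    Real.exp_le_exp.2 (by have : 0 ≤ c / 2 * ‖w.2‖ ^ (1 / s) := by positivity
                          linarith)
  calc _ ≤ ((1 + ‖w.1‖) * (1 + ‖w.2‖)) ^ m *
        (Real.exp (-D.N w.1 + c * ‖w.1‖) * Real.exp (-(c / 2 * ‖w.2‖ ^ (1 / s)))) := by
        rw [damp]; gcongr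
    _ = _ := by rw [maj, mul_pow]; ring

/-- The `k`-th derivative along the fibre of the symbol of the operator. -/
def symD (α : Cn n → ℂ) (h : ℝ) (φ : Cn n → ℝ) (x : Cn n) (k : ℕ) (q : ℝ) : ℂ :=
  D.c₂ * ∫ w in lowFreq n h, D.amp α x w * ((-del φ x (w.1 - I • w.2)) ^ k *
    cexp (q * -del φ x (w.1 - I • w.2)))

/-- Each derivative in q brings down ∂φ(p - iζ), hence a factor ε. The range |q| ≤ 2 contains a unit
neighbourhood of [0,1], for differentiation under the integral; on it the loss is still the one that
`growth_le` controls. -/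
lemma norm_symD_integrand_le (hs : 1 < s) (hc : 0 < c) (hK : ∀ y w, ‖D.amp α y w‖ ≤ K * D.damp s c w)
    (P : SmallPert φ ε) (hh : 0 < h) (hh1 : h ≤ 1) (hε : ε ≤ c / 4 * h ^ (1 - 1 / s)) (hK0 : 0 ≤ K)
    (x : Cn n) (k : ℕ) {q : ℝ} (hq : |q| ≤ 2) {w : Cn n × Cn n} (hw : w ∈ lowFreq n h) :
    ‖D.amp α x w * ((-del φ x (w.1 - I • w.2)) ^ k * cexp (q * -del φ x (w.1 - I • w.2)))‖ ≤
      K * ε ^ k * D.maj s c k w := by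
  have hε0 := P.nonneg
  have hd := D.damp_nonneg s c w
  have h1 := norm_del_le_growth P w x
  set ℓ := del φ x (w.1 - I • w.2)
  have h2 : ‖ℓ‖ ≤ ε * (1 + ‖w.1‖ + ‖w.2‖) := h1.trans (by gcongr; linarith)
  have h3 : (q * -ℓ : ℂ).re ≤ 2 * ε * (‖w.1‖ + ‖w.2‖) := by
    refine (re_le_norm _).trans ?_
    rw [norm_mul, norm_neg, norm_real, Real.norm_eq_abs]
    calc |q| * ‖ℓ‖ ≤ 2 * (ε * (‖w.1‖ + ‖w.2‖)) := mul_le_mul hq h1 (norm_nonneg _) (by norm_num)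
      _ = _ := by ring
  rw [norm_mul, norm_mul, norm_pow, norm_neg, norm_exp]
  calc _ ≤ (K * D.damp s c w) * ((ε * (1 + ‖w.1‖ + ‖w.2‖)) ^ k *
        Real.exp (2 * ε * (‖w.1‖ + ‖w.2‖))) := by
        gcongr
        exact hK _ _
    _ = K * ε ^ k * ((1 + ‖w.1‖ + ‖w.2‖) ^ k * (D.damp s c w *
        Real.exp (2 * ε * (‖w.1‖ + ‖w.2‖)))) := by rw [mul_pow]; ring
    _ ≤ _ := mul_le_mul_of_nonneg_left (D.pow_mul_damp_mul_exp_le hs hc hh hh1 hε k hw)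
        (by positivity)

lemma continuous_symD_integrand (hα : Continuous α) (hM : ∀ x, ‖α x‖ ≤ M) (P : SmallPert φ ε)
    (x : Cn n) (k : ℕ) (q : ℝ) : Continuous fun w : Cn n × Cn n =>
      D.amp α x w * ((-del φ x (w.1 - I • w.2)) ^ k * cexp (q * -del φ x (w.1 - I • w.2))) := by
  have h1 := D.continuous_amp hα hM (f := fun _ : Cn n × Cn n => x) (g := fun w => w)
    continuous_const continuous_id
  have h2 := P.continuous_del (f := fun _ : Cn n × Cn n => x) (g := fun w => w.1 - I • w.2)
    continuous_const (by fun_prop)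
  fun_prop

lemma norm_symD_le (hs : 1 < s) (hc : 0 < c) (hK : ∀ y w, ‖D.amp α y w‖ ≤ K * D.damp s c w)
    (P : SmallPert φ ε) (hh : 0 < h) (hh1 : h ≤ 1) (hε : ε ≤ c / 4 * h ^ (1 - 1 / s)) (hK0 : 0 ≤ K)
    (x : Cn n) (k : ℕ) {q : ℝ} (hq : |q| ≤ 2) :
    ‖D.symD α h φ x k q‖ ≤ D.c₂ * (K * ε ^ k * ∫ w, D.maj s c k w) := by
  have hc2 := D.c₂_pos
  have hε0 := P.nonneg
  rw [symD, norm_mul, norm_real, Real.norm_of_nonneg hc2.le]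
  refine mul_le_mul_of_nonneg_left ?_ hc2.le
  have hi : Integrable fun w => K * ε ^ k * D.maj s c k w := (D.integrable_maj hs hc k).const_mul _
  refine (norm_integral_le_of_norm_le hi.restrict ((ae_restrict_iff' measurableSet_lowFreq).2
    (Eventually.of_forall fun w hw => D.norm_symD_integrand_le hs hc hK P hh hh1 hε hK0 x k hq hw))).trans ?_
  rw [← integral_const_mul]
  exact setIntegral_le_integral hi (Eventually.of_forall fun w => by
    have := D.maj_nonneg (s := s) (c := c) k w; positivity)

lemma hasDerivAt_symD (hα : Continuous α) (hM : ∀ x, ‖α x‖ ≤ M) (hs : 1 < s) (hc : 0 < c)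
    (hK : ∀ y w, ‖D.amp α y w‖ ≤ K * D.damp s c w)
    (P : SmallPert φ ε) (hh : 0 < h) (hh1 : h ≤ 1) (hε : ε ≤ c / 4 * h ^ (1 - 1 / s)) (hK0 : 0 ≤ K)
    (x : Cn n) (k : ℕ) {q : ℝ} (hq : q ∈ Set.Icc (0 : ℝ) 1) :
    HasDerivAt (D.symD α h φ x k) (D.symD α h φ x (k + 1) q) q := by
  have hi : ∀ k, Integrable (fun w => K * ε ^ k * D.maj s c k w) (volume.restrict (lowFreq n h)) :=
    fun k => ((D.integrable_maj hs hc k).const_mul _).restrict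
  have hball : ∀ t ∈ Metric.ball q 1, |t| ≤ 2 := fun t ht => by
    rw [Metric.mem_ball, Real.dist_eq, abs_lt] at ht
    rw [abs_le]; constructor <;> linarith [hq.1, hq.2]
  have hqb : |q| ≤ 2 := hball q (Metric.mem_ball_self one_pos)
  have main := hasDerivAt_integral_of_dominated_loc_of_deriv_le
    (μ := volume.restrict (lowFreq n h))
    (F := fun (t : ℝ) (w : Cn n × Cn n) =>
      D.amp α x w * ((-del φ x (w.1 - I • w.2)) ^ k * cexp (t * -del φ x (w.1 - I • w.2))))
    (F' := fun (t : ℝ) (w : Cn n × Cn n) =>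
      D.amp α x w * ((-del φ x (w.1 - I • w.2)) ^ (k + 1) * cexp (t * -del φ x (w.1 - I • w.2))))
    (bound := fun w => K * ε ^ (k + 1) * D.maj s c (k + 1) w) (x₀ := q)
    (Metric.ball_mem_nhds q one_pos)
    (Eventually.of_forall fun t => (D.continuous_symD_integrand hα hM P x k t).aestronglyMeasurable)
    ((hi k).mono' (D.continuous_symD_integrand hα hM P x k q).aestronglyMeasurable
      ((ae_restrict_iff' measurableSet_lowFreq).2 (Eventually.of_forall fun w hw =>
        D.norm_symD_integrand_le hs hc hK P hh hh1 hε hK0 x k hqb hw)))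
    (D.continuous_symD_integrand hα hM P x (k + 1) q).aestronglyMeasurable
    ((ae_restrict_iff' measurableSet_lowFreq).2 (Eventually.of_forall fun w hw t ht =>
      D.norm_symD_integrand_le hs hc hK P hh hh1 hε hK0 x (k + 1) (hball t ht) hw))
    (hi (k + 1))
    (Eventually.of_forall fun w t _ => by
      have h0 : HasDerivAt (fun t : ℝ => (t : ℂ) * -del φ x (w.1 - I • w.2))
          (-del φ x (w.1 - I • w.2)) t := by
        simpa using ((hasDerivAt_id t).ofReal_comp).mul_const (-del φ x (w.1 - I • w.2))
      refine ((h0.cexp.const_mul _).const_mul _).congr_deriv ?_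
      rw [pow_succ]; ring)
  exact main.2.const_mul _

/-- The symbol of the operator on the deformed manifold is the almost holomorphic extension, up to
`O(h)`. -/
lemma exists_norm_sym_sub_le (hα : Continuous α) (hM : ∀ x, ‖α x‖ ≤ M) (hs : 1 < s)
    (hαG : GevreyBounded s α)
    (hc : 0 < c) (hK : ∀ y w, ‖D.amp α y w‖ ≤ K * D.damp s c w) (hK0 : 0 ≤ K)
    (hst : ∀ k ζ, ‖D.stft α k ζ‖ ≤ K * Real.exp (-(c * ‖ζ‖ ^ (1 / s))))
    {Λ : Set (Cn n × Cn n)} (hΛ : ∀ y, (y, D.xi0 y) ∈ Λ) (haT : GevreyBounded s aT)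
    (hflat : ∀ N : ℕ, ∃ C : ℝ, ∀ ρ w, ‖dbar aT ρ w‖ ≤ C * Metric.infDist ρ Λ ^ N * ‖w‖)
    (hext : ∀ y, aT (y, D.xi0 y) = α y) :
    ∃ Ks : ℝ, 0 ≤ Ks ∧ ∀ (h ε : ℝ) (φ : Cn n → ℝ), SmallPert φ ε → 0 < h → h ≤ 1 →
      ε ≤ c / 4 * h ^ (1 - 1 / s) → ε ≤ 1 → ∀ x,
        ‖D.sym α h φ x - aT (x, D.xi0 x + delXi φ x)‖ ≤ Ks * h := by
  have hc2 := D.c₂_pos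
  obtain ⟨hsm, Ca, hCa, hab⟩ := haT
  have hs1 : 0 < 1 - 1 / s := by
    have : 1 / s < 1 := by rw [div_lt_one (by linarith)]; exact hs
    linarith
  -- The Taylor order: (1 - 1/s) N ≥ 1 makes ε^N = O(h).
  obtain ⟨N, hN⟩ := exists_nat_ge (1 / (1 - 1 / s))
  have hN1 : 1 ≤ (1 - 1 / s) * N := by
    rwa [div_le_iff₀ hs1, mul_comm] at hN
  set MN := Ca ^ (1 + N) * (N.factorial : ℝ) ^ s
  have hMN : 0 ≤ MN := by positivity
  have hmaj : ∀ m, 0 ≤ ∫ w, D.maj s c m w := fun m => integral_nonneg fun w => D.maj_nonneg m w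
  set A₁ := MN * 2 ^ N * (c / 4) ^ N + D.c₂ * (K * (c / 4) ^ N * ∫ w, D.maj s c N w)
  set A₂ := D.c₂ * (K * ∫ w, D.maj s c (N + 1) w)
  have hA₁ : 0 ≤ A₁ := add_nonneg (by positivity)
    (mul_nonneg hc2.le (mul_nonneg (by positivity) (hmaj N)))
  have hA₂ : 0 ≤ A₂ := mul_nonneg hc2.le (mul_nonneg hK0 (hmaj _))
  refine ⟨(N + 1) * (A₁ + A₂), by positivity, fun h ε φ P hh hh1 hε hε1 x => ?_⟩
  have hε0 := P.nonneg
  -- δ represents ∂φ(x) through H, so the vertical vector η = (2/i)H(·,δ) is (2/i)∂φ(x), and q ↦ (x,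
  -- ξ₀(x) + qη) runs from Λ_{Φ₀} at q = 0 to the perturbed manifold at q = 1.
  obtain ⟨δ, hδ⟩ := D.exists_H_eq (delₗ φ x)
  have hδ' : ∀ w, D.H w δ = del φ x w := hδ
  have hη : D.etaH δ = delXi φ x := by ext j; simp only [etaH, delXi, hδ']
  have hpow : ε ^ N ≤ (c / 4) ^ N * h := by
    refine (pow_le_pow_left₀ hε0 hε N).trans ?_
    rw [mul_pow, ← Real.rpow_natCast (h ^ (1 - 1 / s)), ← Real.rpow_mul hh.le]
    gcongr
    calc h ^ ((1 - 1 / s) * (N : ℝ)) ≤ h ^ (1 : ℝ) := Real.rpow_le_rpow_of_exponent_ge hh hh1 hN1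
      _ = h := Real.rpow_one h
  -- The successive q-derivatives of the difference between the extension and the symbol along the
  -- segment. The lower ones are small at q = 0 and the N-th is small throughout.
  let g : ℕ → ℝ → ℂ := fun k q =>
    dirD ((0 : Cn n), D.etaH δ) k aT ((x, D.xi0 x) + q • ((0 : Cn n), D.etaH δ)) -
      D.symD α h φ x k q
  have hg : ∀ k, ∀ q ∈ Set.Icc (0 : ℝ) 1, HasDerivAt (g k) (g (k + 1) q) q := fun k q hq =>
    (hasDerivAt_dirD hsm _ k _ q).sub (D.hasDerivAt_symD hα hM hs hc hK P hh hh1 hε hK0 x k hq)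
  have hgN : ∀ q ∈ Set.Icc (0 : ℝ) 1, ‖g N q‖ ≤ (A₁ + A₂) * h := by
    intro q hq
    have h1 : ‖dirD ((0 : Cn n), D.etaH δ) N aT ((x, D.xi0 x) + q • ((0 : Cn n), D.etaH δ))‖ ≤
        MN * (2 * ε) ^ N := by
      refine (norm_dirD_le hsm _ N _).trans ?_
      have : ‖((0 : Cn n), D.etaH δ)‖ ≤ 2 * ε := by
        rw [Prod.norm_mk, norm_zero, hη, max_eq_right (norm_nonneg _)]; exact norm_delXi_le P x
      gcongr
      exact hab N _
    have h2 := D.norm_symD_le hs hc hK P hh hh1 hε hK0 x N (q := q)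
      (by rw [abs_of_nonneg hq.1]; linarith [hq.2])
    refine (norm_sub_le _ _).trans ((add_le_add h1 h2).trans ?_)
    have h3 : D.c₂ * (K * ε ^ N * ∫ w, D.maj s c N w) ≤
        D.c₂ * (K * ((c / 4) ^ N * h) * ∫ w, D.maj s c N w) := by
      have := hmaj N
      gcongr
    have h4 : MN * (2 * ε) ^ N ≤ MN * (2 ^ N * ((c / 4) ^ N * h)) := by
      rw [mul_pow]; gcongr
    calc _ ≤ MN * (2 ^ N * ((c / 4) ^ N * h)) +
          D.c₂ * (K * ((c / 4) ^ N * h) * ∫ w, D.maj s c N w) := add_le_add h4 h3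
      _ = A₁ * h := by simp only [A₁]; ring
      _ ≤ _ := by nlinarith [mul_nonneg hA₂ hh.le]
  have hg0 : ∀ k < N, ‖g k 0‖ ≤ (A₁ + A₂) * h := by
    intro k hk
    have hcont := D.continuous_symD_integrand hα hM P x k 0
    simp only [ofReal_zero, zero_mul, Complex.exp_zero, mul_one] at hcont
    have hb : ∀ w : Cn n × Cn n, ‖D.amp α x w * (-del φ x (w.1 - I • w.2)) ^ k‖ ≤
        K * ((1 + ‖w.1‖ + ‖w.2‖) ^ k * D.damp s c w) := by
      intro w
      have h1 := norm_del_le_growth P w x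
      have h2 : ‖del φ x (w.1 - I • w.2)‖ ≤ 1 + ‖w.1‖ + ‖w.2‖ := h1.trans (by
        nlinarith [mul_nonneg (by linarith : 0 ≤ 1 - ε) (add_nonneg (norm_nonneg w.1) (norm_nonneg w.2))])
      have hd := D.damp_nonneg s c w
      rw [norm_mul, norm_pow, norm_neg]
      calc _ ≤ (K * D.damp s c w) * (1 + ‖w.1‖ + ‖w.2‖) ^ k := by gcongr; exact hK _ _
        _ = _ := by ring
    have hint : Integrable fun w : Cn n × Cn n => D.amp α x w * (-del φ x (w.1 - I • w.2)) ^ k :=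
      ((D.integrable_maj hs hc k).const_mul K).mono' hcont.aestronglyMeasurable
        (Eventually.of_forall fun w => (hb w).trans
          (mul_le_mul_of_nonneg_left (D.pow_mul_damp_le hc k w) hK0))
    -- At q = 0 the fibre derivatives are the full moments, so only the discarded high frequencies
    -- remain; there 1 ≤ h|ζ| gains the factor h.
    have e1 : g k 0 = D.c₂ * ∫ w in (lowFreq n h)ᶜ,
        D.amp α x w * (-del φ x (w.1 - I • w.2)) ^ k := by
      have h1 := D.dirD_eq_mom hα hM hs hαG hc hst hΛ hsm hflat hext δ k x
      have h2 := integral_add_compl (measurableSet_lowFreq (n := n) (h := h)) hint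
      simp only [g, zero_smul, add_zero, h1, mom, hδ', symD, ofReal_zero, zero_mul,
        Complex.exp_zero, mul_one]
      rw [← h2]; ring
    have hbig : ∀ w ∈ (lowFreq n h)ᶜ, ‖D.amp α x w * (-del φ x (w.1 - I • w.2)) ^ k‖ ≤
        h * K * D.maj s c (N + 1) w := by
      intro w hw
      have h1 : 1 ≤ h * ‖w.2‖ := by
        rw [Set.mem_compl_iff, mem_lowFreq, not_le, div_lt_iff₀ hh] at hw; linarith
      have hd := D.damp_nonneg s c w
      have h2 : 1 ≤ h * (1 + ‖w.1‖ + ‖w.2‖) := by nlinarith [norm_nonneg w.1]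
      calc _ ≤ _ := hb w
        _ ≤ K * ((1 + ‖w.1‖ + ‖w.2‖) ^ k * D.damp s c w) * (h * (1 + ‖w.1‖ + ‖w.2‖)) :=
          le_mul_of_one_le_right (by positivity) h2
        _ = h * K * ((1 + ‖w.1‖ + ‖w.2‖) ^ (k + 1) * D.damp s c w) := by ring
        _ ≤ h * K * D.maj s c (N + 1) w := by
          gcongr
          exact (D.pow_mul_damp_le hc (k + 1) w).trans (D.maj_mono (by omega) w)
    have hi : Integrable fun w => h * K * D.maj s c (N + 1) w :=
      (D.integrable_maj hs hc (N + 1)).const_mul _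
    rw [e1, norm_mul, norm_real, Real.norm_of_nonneg hc2.le]
    have h3 := norm_integral_le_of_norm_le hi.restrict
      ((ae_restrict_iff' (measurableSet_lowFreq (n := n) (h := h)).compl).2 (Eventually.of_forall hbig))
    have h4 : ∫ w in (lowFreq n h)ᶜ, h * K * D.maj s c (N + 1) w ≤
        h * K * ∫ w, D.maj s c (N + 1) w := by
      rw [← integral_const_mul]
      exact setIntegral_le_integral hi (Eventually.of_forall fun w => by
        have := D.maj_nonneg (s := s) (c := c) (N + 1) w; positivity)
    calc _ ≤ D.c₂ * (h * K * ∫ w, D.maj s c (N + 1) w) :=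
          mul_le_mul_of_nonneg_left (h3.trans h4) hc2.le
      _ = A₂ * h := by simp only [A₂]; ring
      _ ≤ _ := by nlinarith [mul_nonneg hA₁ hh.le]
  have key := norm_le_of_hasDerivAt_chain hg hg0 hgN
  have e0 : g 0 1 = aT (x, D.xi0 x + delXi φ x) - D.sym α h φ x := by
    simp only [g, dirD, one_smul, Prod.mk_add_mk, add_zero, hη, symD, sym, pow_zero, one_mul,
      ofReal_one]
  rw [e0, norm_sub_rev] at key
  linarith

end QData

/-! ### From a quadratic form on ℂⁿ to the forms H and Q. -/

/-- The Gaussian integral of `‖Lz‖²`. -/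
lemma integral_exp_neg_sum_normSq {n : ℕ} {S : Matrix (Fin n) (Fin n) ℂ} (hS : S.det ≠ 0) {t : ℝ}
    (ht : 0 < t) : ∫ z : Cn n, Real.exp (-(t * ∑ i, ‖Matrix.mulVec S z i‖ ^ 2)) =
      Real.pi ^ n / (t ^ n * ‖S.det‖ ^ 2) := by
  have h0 : ∫ z : ℂ, Real.exp (-t * ‖z‖ ^ (2 : ℝ)) = Real.pi / t := by
    rw [Complex.integral_exp_neg_mul_rpow one_le_two ht]
    have : (-2 / 2 : ℝ) = -1 := by norm_num
    rw [this, Real.rpow_neg_one, div_self (two_ne_zero)]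
    norm_num
    rw [div_eq_mul_inv]
  have h1 : ∫ z : Cn n, Real.exp (-(t * ∑ i, ‖z i‖ ^ 2)) = (Real.pi / t) ^ n := by
    have h := integral_fintype_prod_volume_eq_pow (ι := Fin n)
      (fun z : ℂ => Real.exp (-t * ‖z‖ ^ (2 : ℝ)))
    rw [Fintype.card_fin, h0] at h
    rw [← h]
    congr 1; ext z
    rw [← Real.exp_sum, ← Finset.mul_sum]
    simp only [Real.rpow_two, neg_mul]
  set L : Cn n →ₗ[ℝ] Cn n := (Matrix.toLin' S).restrictScalars ℝ
  -- The real determinant of a complex linear map is the squared modulus of its complex determinant.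
  have hL : LinearMap.det L = ‖S.det‖ ^ 2 := by
    rw [LinearMap.det_restrictScalars, LinearMap.det_toLin', Algebra.norm_complex_apply,
      Complex.normSq_eq_norm_sq]
  have hL0 : LinearMap.det L ≠ 0 := by
    rw [hL]; exact pow_ne_zero 2 (norm_ne_zero_iff.2 hS)
  have h2 := Measure.map_linearMap_addHaar_eq_smul_addHaar (volume : Measure (Cn n)) hL0
  have hLc : Continuous L := L.continuous_of_finiteDimensional
  have h3 : ∫ z : Cn n, Real.exp (-(t * ∑ i, ‖L z i‖ ^ 2)) =
      ∫ z, Real.exp (-(t * ∑ i, ‖z i‖ ^ 2)) ∂(Measure.map L volume) := by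
    rw [integral_map hLc.aemeasurable (Continuous.aestronglyMeasurable (by fun_prop))]
  rw [h2, integral_smul_measure, h1, hL, ENNReal.toReal_ofReal (abs_nonneg _), abs_of_nonneg (by positivity)] at h3
  have h4 : ∀ z, L z = Matrix.mulVec S z := fun z => Matrix.toLin'_apply S z
  simp only [h4] at h3
  rw [h3, smul_eq_mul, div_pow]
  have := norm_ne_zero_iff.2 hS
  field_simp

section Form

variable {n : ℕ} (Φ : QuadraticForm ℝ (Cn n))

/-- The real bilinear form of a quadratic form. -/
def polb : Cn n →ₗ[ℝ] Cn n →ₗ[ℝ] ℝ := QuadraticMap.associated Φ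

lemma polb_comm (x y : Cn n) : polb Φ x y = polb Φ y x := by
  exact QuadraticMap.associated_isSymm ℝ Φ x y

lemma polb_self (x : Cn n) : polb Φ x x = Φ x := QuadraticMap.associated_eq_self_apply ℝ Φ x

lemma hasFDerivAt_form (x : Cn n) :
    HasFDerivAt Φ ((2 : ℝ) • LinearMap.toContinuousLinearMap (polb Φ x)) x := by
  have h : (Φ : Cn n → ℝ) = fun x => LinearMap.toContinuousLinearMap (polb Φ x) x := by
    funext x; exact (polb_self Φ x).symm
  let T : Cn n →L[ℝ] Cn n →L[ℝ] ℝ := LinearMap.toContinuousLinearMap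
    ((LinearMap.toContinuousLinearMap (𝕜 := ℝ) (E := Cn n) (F' := ℝ)).toLinearMap ∘ₗ polb Φ)
  rw [h]
  have h2 := (T.hasFDerivAt (x := x)).clm_apply (hasFDerivAt_id x)
  refine h2.congr_fderiv ?_
  ext y
  have e1 : ∀ a b, T a b = polb Φ a b := fun a b => rfl
  simp only [_root_.add_apply, ContinuousLinearMap.comp_apply,
    ContinuousLinearMap.flip_apply, _root_.smul_apply, e1,
    LinearMap.coe_toContinuousLinearMap', smul_eq_mul, id]
  have : polb Φ y x = polb Φ x y := polb_comm Φ y x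
  simp only [ContinuousLinearMap.coe_id', id, this]
  ring

/-- The hermitian part of the complex polar form. -/
def hermH : Cn n →ₗ[ℂ] Cn n →ₗ⋆[ℂ] ℂ :=
  LinearMap.mk₂'ₛₗ (RingHom.id ℂ) (starRingEnd ℂ)
    (fun z x => (1 / 2) * (polb Φ z x - I * polb Φ (I • z) x + I * polb Φ z (I • x) +
      polb Φ (I • z) (I • x)))
    (fun z w x => by simp only [smul_add, map_add, LinearMap.add_apply]; push_cast; ring)
    (fun a z x => by
      have e : a • z = a.re • z + a.im • (I • z) := by
        ext i; simp only [Pi.smul_apply, Pi.add_apply, smul_eq_mul, real_smul]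
        conv_lhs => rw [← re_add_im a]
        ring
      have e' : I • (a • z) = a.re • (I • z) - a.im • z := by
        ext i; simp only [Pi.smul_apply, Pi.sub_apply, smul_eq_mul, real_smul]
        conv_lhs => rw [← re_add_im a]
        linear_combination (a.im * z i : ℂ) * I_sq
      rw [e', e]
      simp only [map_add, map_sub, LinearMap.add_apply, LinearMap.sub_apply, map_smul,
        LinearMap.smul_apply, smul_eq_mul]
      apply Complex.ext <;> simp <;> ring)
    (fun z w x => by simp only [smul_add, map_add]; push_cast; ring)
    (fun a z x => by
      have e : a • x = a.re • x + a.im • (I • x) := by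
        ext i; simp only [Pi.smul_apply, Pi.add_apply, smul_eq_mul, real_smul]
        conv_lhs => rw [← re_add_im a]
        ring
      have e' : I • (a • x) = a.re • (I • x) - a.im • x := by
        ext i; simp only [Pi.smul_apply, Pi.sub_apply, smul_eq_mul, real_smul]
        conv_lhs => rw [← re_add_im a]
        linear_combination (a.im * x i : ℂ) * I_sq
      rw [e', e]
      simp only [map_add, map_sub, map_smul, smul_eq_mul]
      apply Complex.ext <;> simp <;> ring)

/-- The bilinear part of the complex polar form. -/
def bilQ : Cn n →ₗ[ℂ] Cn n →ₗ[ℂ] ℂ :=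
  LinearMap.mk₂ ℂ
    (fun z x => (1 / 2) * (polb Φ z x - I * polb Φ (I • z) x - I * polb Φ z (I • x) -
      polb Φ (I • z) (I • x)))
    (fun z w x => by simp only [smul_add, map_add, LinearMap.add_apply]; push_cast; ring)
    (fun a z x => by
      have e : a • z = a.re • z + a.im • (I • z) := by
        ext i; simp only [Pi.smul_apply, Pi.add_apply, smul_eq_mul, real_smul]
        conv_lhs => rw [← re_add_im a]
        ring
      have e' : I • (a • z) = a.re • (I • z) - a.im • z := by
        ext i; simp only [Pi.smul_apply, Pi.sub_apply, smul_eq_mul, real_smul]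
        conv_lhs => rw [← re_add_im a]
        linear_combination (a.im * z i : ℂ) * I_sq
      rw [e', e]
      simp only [map_add, map_sub, LinearMap.add_apply, LinearMap.sub_apply, map_smul,
        LinearMap.smul_apply, smul_eq_mul]
      apply Complex.ext <;> simp <;> ring)
    (fun z w x => by simp only [smul_add, map_add]; push_cast; ring)
    (fun a z x => by
      have e : a • x = a.re • x + a.im • (I • x) := by
        ext i; simp only [Pi.smul_apply, Pi.add_apply, smul_eq_mul, real_smul]
        conv_lhs => rw [← re_add_im a]
        ring
      have e' : I • (a • x) = a.re • (I • x) - a.im • x := by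
        ext i; simp only [Pi.smul_apply, Pi.sub_apply, smul_eq_mul, real_smul]
        conv_lhs => rw [← re_add_im a]
        linear_combination (a.im * x i : ℂ) * I_sq
      rw [e', e]
      simp only [map_add, map_sub, map_smul, smul_eq_mul]
      apply Complex.ext <;> simp <;> ring)

lemma hermH_apply (z x : Cn n) : hermH Φ z x = (1 / 2) * (polb Φ z x - I * polb Φ (I • z) x +
    I * polb Φ z (I • x) + polb Φ (I • z) (I • x)) := rfl

lemma bilQ_apply (z x : Cn n) : bilQ Φ z x = (1 / 2) * (polb Φ z x - I * polb Φ (I • z) x -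
    I * polb Φ z (I • x) - polb Φ (I • z) (I • x)) := rfl

lemma hermH_conj (x y : Cn n) : hermH Φ y x = conj (hermH Φ x y) := by
  rw [hermH_apply, hermH_apply, polb_comm Φ y x, polb_comm Φ (I • y) x, polb_comm Φ y (I • x),
    polb_comm Φ (I • y) (I • x)]
  apply Complex.ext <;> simp
  ring

lemma bilQ_symm (x y : Cn n) : bilQ Φ y x = bilQ Φ x y := by
  rw [bilQ_apply, bilQ_apply, polb_comm Φ y x, polb_comm Φ (I • y) x, polb_comm Φ y (I • x),
    polb_comm Φ (I • y) (I • x)]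
  ring

/-- The first derivatives of a quadratic form are real linear, so the Levi matrix does not depend on
x and is the matrix of the hermitian part of the polar form. -/
lemma leviMatrix_eq (x : Cn n) (j k : Fin n) :
    leviMatrix Φ x j k = hermH Φ (Pi.single j 1) (Pi.single k 1) := by
  have hs : ∀ j : Fin n, (Pi.single j I : Cn n) = I • Pi.single j 1 := fun j => by
    rw [← Pi.single_smul, smul_eq_mul, mul_one]
  have hf : ∀ x, HasFDerivAt (fun z => (Φ z : ℂ))
      (ofRealCLM.comp ((2 : ℝ) • LinearMap.toContinuousLinearMap (polb Φ x))) x := fun x =>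
    ofRealCLM.hasFDerivAt.comp x (hasFDerivAt_form Φ x)
  have h1 : (wirtingerBar k fun z => (Φ z : ℂ)) = fun x =>
      ((polb Φ (Pi.single k 1) x : ℂ) + I * (polb Φ (I • Pi.single k 1) x : ℂ)) := by
    funext x
    rw [wirtingerBar, (hf x).fderiv, hs]
    simp only [ContinuousLinearMap.comp_apply, _root_.smul_apply,
      LinearMap.coe_toContinuousLinearMap', ofRealCLM_apply, smul_eq_mul]
    rw [polb_comm Φ x, polb_comm Φ x]
    push_cast; ring
  have hl : ∀ z : Cn n, HasFDerivAt (fun x => (polb Φ z x : ℂ))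
      (ofRealCLM.comp (LinearMap.toContinuousLinearMap (polb Φ z))) x := fun z =>
    ofRealCLM.hasFDerivAt.comp x (LinearMap.toContinuousLinearMap (polb Φ z)).hasFDerivAt
  have h2 : HasFDerivAt (fun x => ((polb Φ (Pi.single k 1) x : ℂ) +
      I * (polb Φ (I • Pi.single k 1) x : ℂ))) _ x := (hl _).add ((hl _).const_mul I)
  rw [leviMatrix, Matrix.of_apply, h1, wirtinger, h2.fderiv, hs]
  simp only [ContinuousLinearMap.comp_apply, _root_.smul_apply,
    _root_.add_apply, LinearMap.coe_toContinuousLinearMap', ofRealCLM_apply, smul_eq_mul]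
  rw [hermH_apply, polb_comm Φ (Pi.single k 1) (Pi.single j 1),
    polb_comm Φ (I • Pi.single k 1) (Pi.single j 1), polb_comm Φ (Pi.single k 1) (I • Pi.single j 1),
    polb_comm Φ (I • Pi.single k 1) (I • Pi.single j 1)]
  linear_combination (-1 / 2 * polb Φ (I • Pi.single j 1) (I • Pi.single k 1) : ℂ) * I_sq

/-- H is linear in its first variable, while positivity of matrices conjugates the left vector;
hence the evaluation at the conjugate of x. -/
lemma hermH_eq_dotProduct (x : Cn n) :
    hermH Φ x x = dotProduct (star (star x)) ((leviMatrix Φ 0).mulVec (star x)) := by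
  have hx : x = ∑ j, x j • (Pi.single j (1 : ℂ) : Cn n) := by
    ext i; simp [Finset.sum_apply, Pi.single_apply]
  conv_lhs => rw [hx]
  simp only [map_sum, LinearMap.sum_apply, map_smulₛₗ, LinearMap.smul_apply, smul_eq_mul,
    RingHom.id_apply, dotProduct, Matrix.mulVec, leviMatrix_eq, Finset.mul_sum, Pi.star_apply,
    RCLike.star_def]
  rw [Finset.sum_comm]
  exact Finset.sum_congr rfl fun j _ => Finset.sum_congr rfl fun k _ => by
    rw [Complex.conj_conj]; ring

variable (hΦ : StrictlyPlurisubharmonic Φ)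

open scoped ComplexOrder in
lemma det_levi_pos (hΦ : StrictlyPlurisubharmonic Φ) : 0 < (leviMatrix Φ 0).det := (hΦ 0).det_pos

open scoped ComplexOrder MatrixOrder in
lemma exists_levi_eq (hΦ : StrictlyPlurisubharmonic Φ) :
    ∃ S : Matrix (Fin n) (Fin n) ℂ, leviMatrix Φ 0 = S.conjTranspose * S := by
  obtain ⟨S, hS⟩ := CStarAlgebra.nonneg_iff_eq_star_mul_self.1 (hΦ 0).posSemidef.nonneg
  exact ⟨S, hS⟩

open scoped ComplexOrder in
/-- The data of a strictly plurisubharmonic quadratic form. -/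
def formData (hΦ : StrictlyPlurisubharmonic Φ) : QData n where
  H := hermH Φ
  Q := bilQ Φ
  herm := hermH_conj Φ
  symm := bilQ_symm Φ
  pos x hx := by
    rw [hermH_eq_dotProduct]
    exact (Complex.pos_iff.1 ((hΦ 0).dotProduct_mulVec_pos (star_ne_zero.2 hx))).1
  vol := (leviMatrix Φ 0).det.re
  vol_pos := (Complex.pos_iff.1 (det_levi_pos Φ hΦ)).1
  integral_gauss t ht := by
    obtain ⟨S, hS⟩ := exists_levi_eq Φ hΦ
    have hdet : (leviMatrix Φ 0).det = (‖S.det‖ ^ 2 : ℝ) := by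
      rw [hS, Matrix.det_mul, Matrix.det_conjTranspose, RCLike.star_def, Complex.conj_mul']
      push_cast; rfl
    have hne : S.det ≠ 0 := fun h => by
      have := det_levi_pos Φ hΦ
      rw [hdet, h] at this; simp at this
    have hdc : (S.map conj).det = conj S.det := by
      rw [← RingHom.mapMatrix_apply, ← RingHom.map_det]
    -- The factorisation S*S of the Levi matrix makes H(z,z) the squared Euclidean norm of S̄z,
    -- which reduces the Gaussian integral to a product of one-dimensional ones.
    have hH : ∀ z, (hermH Φ z z).re = ∑ i, ‖Matrix.mulVec (S.map conj) z i‖ ^ 2 := by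
      intro z
      have h1 : ∀ i, Matrix.mulVec (S.map conj) z i = conj (Matrix.mulVec S (star z) i) := by
        intro i
        simp [Matrix.mulVec, dotProduct, map_sum]
      rw [hermH_eq_dotProduct, hS, ← Matrix.mulVec_mulVec, Matrix.dotProduct_mulVec,
        ← Matrix.star_mulVec, dotProduct, Complex.re_sum]
      refine Finset.sum_congr rfl fun i _ => ?_
      rw [h1, RCLike.norm_conj, Pi.star_apply, RCLike.star_def, Complex.conj_mul', ← ofReal_pow, ofReal_re]
    simp only [hH]
    rw [integral_exp_neg_sum_normSq (by rw [hdc]; simpa using hne) ht, hdc, RCLike.norm_conj, hdet, ofReal_re]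

lemma wt_formData : (formData Φ hΦ).wt = Φ := by
  funext x
  show (hermH Φ x x).re + (bilQ Φ x x).re = Φ x
  rw [← add_re, hermH_apply, bilQ_apply, ← polb_self]
  simp
  ring

end Form

lemma wirtinger_ofReal {n : ℕ} {Φ : Cn n → ℝ} {x : Cn n} (hΦ : DifferentiableAt ℝ Φ x) (j : Fin n) :
    wirtinger j (fun z => (Φ z : ℂ)) x = del Φ x (Pi.single j 1) := by
  have h : HasFDerivAt (fun z => (Φ z : ℂ)) (ofRealCLM.comp (fderiv ℝ Φ x)) x :=
    ofRealCLM.hasFDerivAt.comp x hΦ.hasFDerivAt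
  have hs : (Pi.single j I : Cn n) = I • Pi.single j 1 := by
    rw [← Pi.single_smul, smul_eq_mul, mul_one]
  rw [wirtinger, h.fderiv, hs, del]
  rfl

lemma xi_eq_delXi {n : ℕ} {Φ : Cn n → ℝ} {x : Cn n} (hΦ : DifferentiableAt ℝ Φ x) :
    xi Φ x = delXi Φ x := by
  funext j
  rw [xi, wirtinger_ofReal hΦ, delXi]

namespace QData

variable {n : ℕ} (D : QData n)

lemma xi_wt (x : Cn n) : xi D.wt x = D.xi0 x := by
  rw [xi_eq_delXi (D.contDiff_wt.differentiable (by simp) x)]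
  funext j
  rw [delXi, del_wt, xi0]

lemma xi_perturbed {φ : Cn n → ℝ} {ε : ℝ} (P : SmallPert φ ε) (x : Cn n) :
    xi (fun x => D.wt x + φ x) x = D.xi0 x + delXi φ x := by
  have h1 := D.contDiff_wt.differentiable (by simp) x
  have h2 := P.contDiff.differentiable one_ne_zero x
  rw [xi_eq_delXi (h1.fun_add h2)]
  have h3 : ∀ z, fderiv ℝ (fun x => D.wt x + φ x) x z = fderiv ℝ D.wt x z + fderiv ℝ φ x z := by
    intro z
    have : HasFDerivAt (fun x => D.wt x + φ x) _ x := h1.hasFDerivAt.add h2.hasFDerivAt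
    rw [this.fderiv]; rfl
  funext j
  rw [Pi.add_apply, xi0, ← del_wt, delXi, delXi]
  simp only [del, h3]
  push_cast; ring

lemma B_eq_sum_xi0 (z x : Cn n) : ∑ j, z j * D.xi0 x j = 2 / I * D.B z x := by
  have hz : z = ∑ j, z j • (Pi.single j (1 : ℂ) : Cn n) := by
    ext i; simp [Finset.sum_apply, Pi.single_apply]
  have : D.B z x = ∑ j, z j * D.B (Pi.single j 1) x := by
    conv_lhs => rw [hz]
    simp only [B, map_sum, LinearMap.sum_apply, map_smul, LinearMap.smul_apply, smul_eq_mul,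
      ← Finset.sum_add_distrib, mul_add]
  rw [this, Finset.mul_sum]
  exact Finset.sum_congr rfl fun j _ => by rw [xi0]; ring

end QData

/-- The substitution y = x - z. The phase at the midpoint becomes (2B(z,x) - B(z,z))/h, since ξ₀ is
(2/i)∂Φ₀ and B is real linear in its second variable. The Levi determinant is constant, and the
factors 2^n cancel. -/
lemma weylIntegral_eq_weyl {n : ℕ} (Φ : QuadraticForm ℝ (Cn n)) (hΦ : StrictlyPlurisubharmonic Φ)
    (a : Lambda Φ → ℂ) (h : ℝ) (u : Cn n → ℂ) (x : Cn n) :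
    weylIntegral Φ a h u x = (formData Φ hΦ).weyl (fun y => a (toLambda Φ y)) h u x := by
  set D := formData Φ hΦ
  have hwt : D.wt = Φ := wt_formData Φ hΦ
  have hxi : ∀ y, xi Φ y = D.xi0 y := fun y => by
    have := D.xi_wt y
    rwa [hwt] at this
  have hdet : ∀ y, (leviMatrix Φ y).det = (D.vol : ℂ) := by
    intro y
    have e : leviMatrix Φ y = leviMatrix Φ 0 := by
      ext j k; rw [leviMatrix_eq, leviMatrix_eq]
    rw [e]
    have h1 := (Complex.pos_iff.1 (det_levi_pos Φ hΦ)).2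
    exact Complex.ext rfl (by rw [← h1, ofReal_im])
  rw [weylIntegral, QData.weyl, ← integral_sub_left_eq_self _ volume x, ← integral_const_mul,
    ← integral_const_mul]
  congr 1; ext z
  have e1 : (1 / 2 : ℂ) • (x + (x - z)) = x - (1 / 2 : ℂ) • z := by
    ext i; simp only [Pi.smul_apply, Pi.add_apply, Pi.sub_apply, smul_eq_mul]; ring
  have e2 : I / h * ∑ j, (x j - (x - z) j) * xi Φ (x - (1 / 2 : ℂ) • z) j =
      (2 * D.B z x - D.B z z) / h := by
    have h1 : ∀ j, x j - (x - z) j = z j := fun j => by simp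
    simp only [h1, hxi, D.B_eq_sum_xi0]
    have h2 : D.B z (x - (1 / 2 : ℂ) • z) = D.B z x - 1 / 2 * D.B z z := by
      have h3 : (1 / 2 : ℂ) = ((1 / 2 : ℝ) : ℂ) := by norm_num
      simp only [QData.B, map_sub, h3, map_smulₛₗ, conj_ofReal, smul_eq_mul, RingHom.id_apply]
      ring
    rw [h2]
    have := I_ne_zero
    field_simp
  simp only [e1, e2, hdet, QData.tr]
  generalize cexp ((2 * D.B z x - D.B z z) / h) = E
  generalize a (toLambda Φ (x - (1 / 2 : ℂ) • z)) = A
  push_cast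
  rw [show (2 * (Real.pi : ℂ) * h) ^ n = 2 ^ n * (Real.pi * h) ^ n by rw [← mul_pow]; ring]
  have h2n : (2 : ℂ) ^ n ≠ 0 := pow_ne_zero n two_ne_zero
  rw [one_div, mul_inv, div_eq_mul_inv]
  linear_combination (((Real.pi : ℂ) * h) ^ n)⁻¹ * E *
    A * u (x - z) * D.vol * (inv_mul_cancel₀ h2n)

/-! ### Density of the rapidly decaying functions; existence and uniqueness of the operator. -/

namespace QData

variable {n : ℕ} (D : QData n) {s h : ℝ} {α u : Cn n → ℂ}

/-- The dilations `e^{Q(x, x)/h} f(rx)` of `u = e^{Q(x, x)/h} f`. -/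
def dil (h r : ℝ) (u : Cn n → ℂ) (x : Cn n) : ℂ :=
  cexp (((1 - r ^ 2 : ℝ) : ℂ) * D.Q x x / h) * u (r • x)

lemma differentiable_dil (hu : Differentiable ℂ u) (r : ℝ) : Differentiable ℂ (D.dil h r u) := by
  have h1 := D.differentiable_Q_diag
  have h2 : Differentiable ℂ fun x : Cn n => u (r • x) := by
    have : ∀ x : Cn n, r • x = (r : ℂ) • x := re_smul_eq r
    simp only [this]
    exact hu.comp (differentiable_id.const_smul (r : ℂ))
  unfold dil
  simp only [div_eq_mul_inv]
  exact (((h1.const_mul _).mul_const _).cexp).mul h2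

/-- The holomorphic factor e^{(1 - r²)Q(x,x)/h} restores the pluriharmonic part of the weight.
Dilation thus costs nothing there, and for r < 1 it gains a Gaussian e^{-(1 - r²)N(x)/h}. -/
lemma norm_dil (r : ℝ) (x : Cn n) : ‖D.dil h r u x‖ * Real.exp (-D.wt x / h) =
    ‖u (r • x)‖ * Real.exp (-D.wt (r • x) / h) * Real.exp (-((1 - r ^ 2) * D.N x / h)) := by
  have e1 : D.wt (r • x) = r ^ 2 * D.N x + r ^ 2 * (D.Q x x).re := by
    rw [wt, re_smul_eq, N_smul]
    simp only [map_smul, LinearMap.smul_apply, smul_eq_mul, re_ofReal_mul, norm_real,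
      Real.norm_eq_abs, sq_abs]
    ring
  have e2 : (((1 - r ^ 2 : ℝ) : ℂ) * D.Q x x / h).re = (1 - r ^ 2) * (D.Q x x).re / h := by
    rw [div_ofReal_re, re_ofReal_mul]
  rw [dil, norm_mul, norm_exp, e1, e2]
  have e3 : Real.exp ((1 - r ^ 2) * (D.Q x x).re / h) * Real.exp (-D.wt x / h) =
      Real.exp (-(r ^ 2 * D.N x + r ^ 2 * (D.Q x x).re) / h) *
        Real.exp (-((1 - r ^ 2) * D.N x / h)) := by
    rw [← Real.exp_add, ← Real.exp_add, wt]; congr 1; ring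
  linear_combination ‖u (r • x)‖ * e3

lemma rapidlyDecaying_dil (hh : 0 < h) (hu : Differentiable ℂ u) (hu2 : SqInt D.wt h u) {r : ℝ}
    (hr0 : 0 ≤ r) (hr : r < 1) : RapidlyDecaying D.wt h (D.dil h r u) := by
  intro N
  obtain ⟨C, hC0, hC⟩ := D.exists_bound_normalised hh hu hu2
  have hr2 : 0 < 1 - r ^ 2 := by nlinarith
  have hlo := D.lo_pos
  obtain ⟨M, hM⟩ := exists_exp_neg_rpow_le (c := (1 - r ^ 2) * D.lo / h) (d := N) (by positivity)
    two_pos (Nat.cast_nonneg N)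
  refine ⟨C * M, fun x => ?_⟩
  have h1 := D.norm_dil (h := h) (u := u) r x
  have h2 := hM ‖x‖ (norm_nonneg x)
  rw [Real.rpow_neg (by positivity), Real.rpow_natCast, ← div_eq_mul_inv,
    le_div_iff₀ (by positivity), Real.rpow_two] at h2
  have h3 : Real.exp (-((1 - r ^ 2) * D.N x / h)) ≤ Real.exp (-((1 - r ^ 2) * D.lo / h * ‖x‖ ^ 2)) := by
    refine Real.exp_le_exp.2 (neg_le_neg ?_)
    have := D.lo_le x
    calc _ = (1 - r ^ 2) * (D.lo * ‖x‖ ^ 2) / h := by ring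
      _ ≤ _ := by gcongr
  rw [← div_le_iff₀ (Real.exp_pos _), div_eq_mul_inv, ← Real.exp_neg, ← neg_div, mul_assoc, h1]
  calc _ ≤ (1 + ‖x‖) ^ N * (C * Real.exp (-((1 - r ^ 2) * D.lo / h * ‖x‖ ^ 2))) := by
        gcongr
        exact hC _
    _ = C * (Real.exp (-((1 - r ^ 2) * D.lo / h * ‖x‖ ^ 2)) * (1 + ‖x‖) ^ N) := by ring
    _ ≤ C * M := by gcongr

lemma sqInt_dil (hh : 0 < h) (hu : Differentiable ℂ u) (hu2 : SqInt D.wt h u) {r : ℝ}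
    (hr0 : 0 < r) (hr : r < 1) : SqInt D.wt h (D.dil h r u) ∧
      ∫ x, ‖D.dil h r u x‖ ^ 2 * Real.exp (-2 * D.wt x / h) ≤
        (r ^ (2 * n))⁻¹ * ∫ x, ‖u x‖ ^ 2 * Real.exp (-2 * D.wt x / h) := by
  have hle : ∀ x, ‖D.dil h r u x‖ ^ 2 * Real.exp (-2 * D.wt x / h) ≤
      (fun y => ‖u y‖ ^ 2 * Real.exp (-2 * D.wt y / h)) (r • x) := by
    intro x
    have h1 := D.norm_dil (h := h) (u := u) r x
    have h2 : Real.exp (-((1 - r ^ 2) * D.N x / h)) ≤ 1 := by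
      rw [Real.exp_le_one_iff, neg_nonpos]
      have := D.N_nonneg x
      have : 0 ≤ 1 - r ^ 2 := by nlinarith
      positivity
    simp only [exp_sq, ← mul_pow, h1]
    exact pow_le_pow_left₀ (by positivity) (mul_le_of_le_one_right (by positivity) h2) 2
  have hi : Integrable fun x : Cn n => (fun y => ‖u y‖ ^ 2 * Real.exp (-2 * D.wt y / h)) (r • x) :=
    Integrable.comp_smul hu2 hr0.ne'
  have hc := (D.differentiable_dil (h := h) hu r).continuous
  have hS : SqInt D.wt h (D.dil h r u) := hi.mono' (Continuous.aestronglyMeasurable (by fun_prop))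
    (Eventually.of_forall fun x => by
      rw [Real.norm_eq_abs, abs_of_nonneg (by positivity)]; exact hle x)
  refine ⟨hS, (integral_mono hS hi hle).trans (le_of_eq ?_)⟩
  rw [Measure.integral_comp_smul (volume : Measure (Cn n))
    (fun y => ‖u y‖ ^ 2 * Real.exp (-2 * D.wt y / h)) r, finrank_real_Cn, smul_eq_mul,
    abs_of_nonneg (by positivity)]

/-- Scheffé's lemma in `L²`: pointwise convergence without loss of mass. -/
lemma _root_.exists_integral_sub_sq_lt {X : Type*} [MeasurableSpace X] {μ : Measure X} {f : ℕ → X → ℂ}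
    {g : X → ℂ} {w : X → ℝ} (hw : ∀ x, 0 ≤ w x) (hfm : ∀ k, AEStronglyMeasurable (f k) μ)
    (hgm : AEStronglyMeasurable g μ) (hwm : AEStronglyMeasurable w μ)
    (hf : ∀ k, Integrable (fun x => ‖f k x‖ ^ 2 * w x) μ)
    (hg : Integrable (fun x => ‖g x‖ ^ 2 * w x) μ)
    (hfg : ∀ x, Tendsto (fun k => f k x) atTop (𝓝 (g x))) {b : ℕ → ℝ}
    (hb : ∀ k, ∫ x, ‖f k x‖ ^ 2 * w x ∂μ ≤ b k * ∫ x, ‖g x‖ ^ 2 * w x ∂μ)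
    (hb1 : Tendsto b atTop (𝓝 1)) {ε : ℝ} (hε : 0 < ε) :
    ∃ k, ∫ x, ‖f k x - g x‖ ^ 2 * w x ∂μ < ε := by
  by_contra! hcon
  set J := ∫ x, ‖g x‖ ^ 2 * w x ∂μ
  have hJ : 0 ≤ J := integral_nonneg fun x => mul_nonneg (sq_nonneg _) (hw x)
  have hpar : ∀ a b : ℂ, ‖a - b‖ ^ 2 ≤ 2 * ‖a‖ ^ 2 + 2 * ‖b‖ ^ 2 := fun a b => by
    have h1 := pow_le_pow_left₀ (norm_nonneg _) (norm_sub_le a b) 2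
    nlinarith [sq_nonneg (‖a‖ - ‖b‖)]
  have hd : ∀ k, Integrable (fun x => ‖f k x - g x‖ ^ 2 * w x) μ := fun k => by
    refine (((hf k).const_mul 2).add (hg.const_mul 2)).mono'
      ((((hfm k).sub hgm).norm.pow 2).mul hwm) (Eventually.of_forall fun x => ?_)
    have h1 := mul_le_mul_of_nonneg_right (hpar (f k x) (g x)) (hw x)
    rw [Real.norm_eq_abs, abs_of_nonneg (mul_nonneg (sq_nonneg _) (hw x))]
    simp only [Pi.add_apply]
    linarith
  -- G is nonnegative by the parallelogram inequality and tends pointwise to 4|g|²w. Fatou's lemma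
  -- together with the mass bound leaves no room for a persistent gap ε.
  let G : ℕ → X → ℝ := fun k x => 2 * (‖f k x‖ ^ 2 * w x) + 2 * (‖g x‖ ^ 2 * w x) -
    ‖f k x - g x‖ ^ 2 * w x
  have hG0 : ∀ k x, 0 ≤ G k x := fun k x => by
    have h1 := mul_le_mul_of_nonneg_right (hpar (f k x) (g x)) (hw x)
    simp only [G]; linarith
  have hGi : ∀ k, Integrable (G k) μ := fun k => (((hf k).const_mul 2).add (hg.const_mul 2)).sub (hd k)
  have hGint : ∀ k, ∫ x, G k x ∂μ ≤ 2 * (b k * J) + 2 * J - ε := by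
    intro k
    have h1 : ∫ x, G k x ∂μ = 2 * ∫ x, ‖f k x‖ ^ 2 * w x ∂μ + 2 * J -
        ∫ x, ‖f k x - g x‖ ^ 2 * w x ∂μ := by
      have h2 : Integrable (fun x => 2 * (‖f k x‖ ^ 2 * w x) + 2 * (‖g x‖ ^ 2 * w x)) μ :=
        ((hf k).const_mul 2).add (hg.const_mul 2)
      simp only [G]
      rw [integral_sub h2 (hd k),
        integral_add ((hf k).const_mul 2) (hg.const_mul 2), integral_const_mul, integral_const_mul]
    linarith [hcon k, hb k]
  have hlim : ∀ x, Tendsto (fun k => ENNReal.ofReal (G k x)) atTop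
      (𝓝 (ENNReal.ofReal (4 * (‖g x‖ ^ 2 * w x)))) := by
    intro x
    refine (ENNReal.continuous_ofReal.tendsto _).comp ?_
    have h1 : Tendsto (fun k => ‖f k x‖) atTop (𝓝 ‖g x‖) := (hfg x).norm
    have h2 : Tendsto (fun k => ‖f k x - g x‖) atTop (𝓝 0) := by
      simpa using ((hfg x).sub_const (g x)).norm
    have h3 := (((((h1.pow 2).mul_const (w x)).const_mul 2).add_const (2 * (‖g x‖ ^ 2 * w x))).sub
      ((h2.pow 2).mul_const (w x)))
    refine h3.congr' (Eventually.of_forall fun k => rfl) |>.trans (le_of_eq ?_)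
    congr 1; ring
  have hfatou := lintegral_liminf_le' (μ := μ) (u := (atTop : Filter ℕ))
    (f := fun k x => ENNReal.ofReal (G k x))
    (fun k => (hGi k).aemeasurable.ennreal_ofReal)
  rw [lintegral_congr fun x => (hlim x).liminf_eq] at hfatou
  rw [← ofReal_integral_eq_lintegral_ofReal (hg.const_mul 4)
    (Eventually.of_forall fun x => by have := hw x; positivity), integral_const_mul] at hfatou
  have h5 : liminf (fun k => ∫⁻ x, ENNReal.ofReal (G k x) ∂μ) atTop ≤
      ENNReal.ofReal (2 * (1 * J) + 2 * J - ε) := by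
    have h6 : Tendsto (fun k => ENNReal.ofReal (2 * (b k * J) + 2 * J - ε)) atTop
        (𝓝 (ENNReal.ofReal (2 * (1 * J) + 2 * J - ε))) :=
      (ENNReal.continuous_ofReal.tendsto _).comp
        ((((hb1.mul_const J).const_mul 2).add_const (2 * J)).sub_const ε)
    rw [← h6.liminf_eq]
    refine liminf_le_liminf (Eventually.of_forall fun k => ?_)
    rw [← ofReal_integral_eq_lintegral_ofReal (hGi k) (Eventually.of_forall (hG0 k))]
    exact ENNReal.ofReal_le_ofReal (hGint k)
  have h7 := hfatou.trans h5
  have h8 : 0 ≤ 2 * (1 * J) + 2 * J - ε := by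
    have h9 : Tendsto (fun k => 2 * (b k * J) + 2 * J - ε) atTop (𝓝 (2 * (1 * J) + 2 * J - ε)) :=
      (((hb1.mul_const J).const_mul 2).add_const (2 * J)).sub_const ε
    exact ge_of_tendsto' h9 fun k => (integral_nonneg (hG0 k)).trans (hGint k)
  rw [ENNReal.ofReal_le_ofReal_iff h8] at h7
  linarith

/-- The rapidly decaying functions are dense in the Bargmann space. -/
lemma exists_rapidlyDecaying_approx (hh : 0 < h) (hu : Differentiable ℂ u) (hu2 : SqInt D.wt h u)
    {ε : ℝ} (hε : 0 < ε) : ∃ v : Cn n → ℂ, Differentiable ℂ v ∧ SqInt D.wt h v ∧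
      RapidlyDecaying D.wt h v ∧ weightedNorm D.wt h (fun x => v x - u x) < ε := by
  let r : ℕ → ℝ := fun k => 1 - 1 / ((k : ℝ) + 2)
  have hr0 : ∀ k, 0 < r k := fun k => by
    have : 1 / ((k : ℝ) + 2) < 1 := by
      rw [div_lt_one (by positivity)]; linarith [(Nat.cast_nonneg k : (0 : ℝ) ≤ k)]
    simp only [r]; linarith
  have hr1 : ∀ k, r k < 1 := fun k => by
    have : 0 < 1 / ((k : ℝ) + 2) := by positivity
    simp only [r]; linarith
  have hrt : Tendsto r atTop (𝓝 1) := by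
    have h1 : Tendsto (fun k : ℕ => 1 / ((k : ℝ) + 2)) atTop (𝓝 0) := by
      simp only [one_div]
      exact tendsto_inv_atTop_zero.comp (tendsto_natCast_atTop_atTop.atTop_add tendsto_const_nhds)
    simpa [r] using h1.const_sub 1
  have hc := hu.continuous
  have hconv : ∀ x, Tendsto (fun k => D.dil h (r k) u x) atTop (𝓝 (u x)) := by
    intro x
    have h1 : Continuous fun t : ℝ => D.dil h t u x := by unfold dil; fun_prop
    have h2 := (h1.tendsto 1).comp hrt
    simpa [dil, Function.comp_def] using h2
  have hb1 : Tendsto (fun k => (r k ^ (2 * n))⁻¹) atTop (𝓝 1) := by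
    simpa using (hrt.pow (2 * n)).inv₀ (by simp)
  obtain ⟨k, hk⟩ := exists_integral_sub_sq_lt (μ := volume) (f := fun k => D.dil h (r k) u) (g := u)
    (w := fun x => Real.exp (-2 * D.wt x / h)) (fun x => (Real.exp_pos _).le)
    (fun k => (D.differentiable_dil hu (r k)).continuous.aestronglyMeasurable)
    hc.aestronglyMeasurable (Continuous.aestronglyMeasurable (by fun_prop))
    (fun k => (D.sqInt_dil hh hu hu2 (hr0 k) (hr1 k)).1) hu2 hconv
    (fun k => (D.sqInt_dil hh hu hu2 (hr0 k) (hr1 k)).2) hb1 (sq_pos_of_pos hε)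
  refine ⟨D.dil h (r k) u, D.differentiable_dil hu _, (D.sqInt_dil hh hu hu2 (hr0 k) (hr1 k)).1,
    D.rapidlyDecaying_dil hh hu hu2 (hr0 k).le (hr1 k), ?_⟩
  rw [weightedNorm]
  exact (Real.sqrt_lt_sqrt (integral_nonneg fun x => by positivity) hk).trans_eq (Real.sqrt_sq hε.le)

lemma _root_.mem_bargmannSpace_iff {Φ : Cn n → ℝ} (hΦ : Continuous Φ) :
    u ∈ bargmannSpace Φ h ↔ Differentiable ℂ u ∧ SqInt Φ h u := by
  refine and_congr_right fun hu => ?_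
  have hc := hu.continuous
  rw [memLp_two_iff_integrable_sq_norm (Continuous.aestronglyMeasurable (by fun_prop)), SqInt]
  refine iff_of_eq (congrArg (fun F => Integrable F volume) ?_)
  ext x
  rw [norm_mul, mul_pow, norm_real, Real.norm_eq_abs, Real.abs_exp, ← exp_sq, mul_comm]

lemma tr_add (z : Cn n) (u v : Cn n → ℂ) (x : Cn n) :
    D.tr h z (u + v) x = D.tr h z u x + D.tr h z v x := by
  simp only [tr, Pi.add_apply]; ring

/-- The operator on the Bargmann space. -/
def opₗ (hα : GevreyBounded s α) (hs : 1 < s) (hh : 0 < h) :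
    bargmannSpace D.wt h →ₗ[ℂ] bargmannSpace D.wt h where
  toFun u := ⟨D.op α h u, by
    obtain ⟨c, K, hc, hK0, hK, -, -⟩ := D.exists_amp_bound hs hα
    obtain ⟨M, hM⟩ : ∃ M, ∀ x, ‖α x‖ ≤ M := by
      obtain ⟨-, C, -, hb⟩ := hα
      exact ⟨_, fun x => by simpa using hb 0 x⟩
    have hw := (D.contDiff_wt).continuous
    obtain ⟨hu, hu2⟩ := (mem_bargmannSpace_iff hw).1 u.2
    obtain ⟨L, hL⟩ := D.exists_op_bound hα.1.continuous hM hs hc hK0.le hK hh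
    exact (mem_bargmannSpace_iff hw).2
      ⟨D.differentiable_op hα.1.continuous hM hs hc hK0.le hK hh hu hu2, (hL _ hu hu2).1⟩⟩
  map_add' u v := by
    obtain ⟨c, K, hc, hK0, hK, -, -⟩ := D.exists_amp_bound hs hα
    obtain ⟨M, hM⟩ : ∃ M, ∀ x, ‖α x‖ ≤ M := by
      obtain ⟨-, C, -, hb⟩ := hα
      exact ⟨_, fun x => by simpa using hb 0 x⟩
    have hw := (D.contDiff_wt).continuous
    obtain ⟨hu, hu2⟩ := (mem_bargmannSpace_iff hw).1 u.2
    obtain ⟨hv, hv2⟩ := (mem_bargmannSpace_iff hw).1 v.2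
    ext x
    have i1 := D.integrable_opInt hα.1.continuous hM hs hc hK0.le hK hh hu hu2 x
    have i2 := D.integrable_opInt hα.1.continuous hM hs hc hK0.le hK hh hv hv2 x
    show D.op α h ((u : Cn n → ℂ) + v) x = D.op α h u x + D.op α h v x
    rw [op, op, op, ← mul_add, ← integral_add i1 i2]
    simp only [opInt, tr_add, mul_add]
  map_smul' a u := by
    ext x
    show D.op α h (a • (u : Cn n → ℂ)) x = a * D.op α h u x
    rw [op, op, mul_left_comm a]
    have e : ∀ w, D.opInt α h (a • (u : Cn n → ℂ)) x w = a * D.opInt α h u x w := fun w => by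
      simp only [opInt, tr, Pi.smul_apply, smul_eq_mul]; ring
    simp only [e, integral_const_mul]

/-- `A` is the bounded operator that is given by the Weyl quantization on the rapidly decaying
functions. -/
def IsWeyl (α : Cn n → ℂ) (h : ℝ) (A : bargmannSpace D.wt h →ₗ[ℂ] bargmannSpace D.wt h) : Prop :=
  (∃ M : ℝ, ∀ u, weightedNorm D.wt h (A u) ≤ M * weightedNorm D.wt h u) ∧
    ∀ u : bargmannSpace D.wt h, RapidlyDecaying D.wt h u → ∀ x, (A u : Cn n → ℂ) x = D.weyl α h u x

lemma isWeyl_opₗ (hα : GevreyBounded s α) (hs : 1 < s) (hh : 0 < h) :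
    D.IsWeyl α h (D.opₗ hα hs hh) := by
  obtain ⟨c, K, hc, hK0, hK, -, -⟩ := D.exists_amp_bound hs hα
  obtain ⟨M, hM⟩ : ∃ M, ∀ x, ‖α x‖ ≤ M := by
    obtain ⟨-, C, -, hb⟩ := hα
    exact ⟨_, fun x => by simpa using hb 0 x⟩
  have hw := (D.contDiff_wt).continuous
  obtain ⟨L, hL⟩ := D.exists_op_bound hα.1.continuous hM hs hc hK0.le hK hh
  refine ⟨⟨L, fun u => ?_⟩, fun u hr x => ?_⟩ <;>
    obtain ⟨hu, hu2⟩ := (mem_bargmannSpace_iff hw).1 u.2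
  · exact (hL _ hu hu2).2
  · exact D.op_eq_weyl hα hs hh hu hu2 hr x

/-- Point evaluations are continuous on the Bargmann space, so two bounded operators that agree on
the dense set of rapidly decaying functions have the same values at every point. -/
lemma IsWeyl.unique {A A' : bargmannSpace D.wt h →ₗ[ℂ] bargmannSpace D.wt h} (hh : 0 < h)
    (hA : D.IsWeyl α h A) (hA' : D.IsWeyl α h A') : A = A' := by
  obtain ⟨⟨M, hM⟩, hr⟩ := hA
  obtain ⟨⟨M', hM'⟩, hr'⟩ := hA'
  have hw := (D.contDiff_wt).continuous
  obtain ⟨C, hC, hb⟩ := D.exists_pointwise_bound hh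
  ext u x
  obtain ⟨hu, hu2⟩ := (mem_bargmannSpace_iff hw).1 u.2
  set E := C * Real.exp (D.wt x / h)
  have hE : 0 < E := by positivity
  have hpt : ∀ (T : bargmannSpace D.wt h →ₗ[ℂ] bargmannSpace D.wt h) (M : ℝ),
      (∀ u, weightedNorm D.wt h (T u) ≤ M * weightedNorm D.wt h u) →
      ∀ v : bargmannSpace D.wt h, ‖(T v : Cn n → ℂ) x‖ ≤ E * |M| * weightedNorm D.wt h v := by
    intro T M hM v
    obtain ⟨h1, h2⟩ := (mem_bargmannSpace_iff hw).1 (T v).2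
    have hv0 : 0 ≤ weightedNorm D.wt h (v : Cn n → ℂ) := Real.sqrt_nonneg _
    have h3 : weightedNorm D.wt h (T v) ≤ |M| * weightedNorm D.wt h v :=
      (hM v).trans (by gcongr; exact le_abs_self M)
    calc _ ≤ C * weightedNorm D.wt h (T v) * Real.exp (D.wt x / h) := hb _ h1 h2 x
      _ ≤ C * (|M| * weightedNorm D.wt h v) * Real.exp (D.wt x / h) := by gcongr
      _ = _ := by simp only [E]; ring
  refine eq_of_forall_dist_le fun ε hε => ?_
  have hden : 0 < E * |M| + E * |M'| + 1 := by positivity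
  obtain ⟨v, hv, hv2, hvr, hvu⟩ := D.exists_rapidlyDecaying_approx hh hu hu2 (div_pos hε hden)
  let v' : bargmannSpace D.wt h := ⟨v, (mem_bargmannSpace_iff hw).2 ⟨hv, hv2⟩⟩
  have e1 : (A v' : Cn n → ℂ) x = (A' v' : Cn n → ℂ) x := by rw [hr v' hvr, hr' v' hvr]
  have e2 : ∀ T : bargmannSpace D.wt h →ₗ[ℂ] bargmannSpace D.wt h,
      (T (v' - u) : Cn n → ℂ) x = (T v' : Cn n → ℂ) x - (T u : Cn n → ℂ) x := fun T => by
    rw [map_sub]; rfl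
  have h1 := hpt A M hM (v' - u)
  have h2 := hpt A' M' hM' (v' - u)
  have h3 : weightedNorm D.wt h ((v' - u : bargmannSpace D.wt h) : Cn n → ℂ) ≤
      ε / (E * |M| + E * |M'| + 1) := hvu.le
  have h0 : 0 ≤ weightedNorm D.wt h ((v' - u : bargmannSpace D.wt h) : Cn n → ℂ) := Real.sqrt_nonneg _
  rw [dist_eq_norm]
  have e3 : (A u : Cn n → ℂ) x - (A' u : Cn n → ℂ) x =
      (A' (v' - u) : Cn n → ℂ) x - (A (v' - u) : Cn n → ℂ) x := by
    rw [e2, e2, e1]; ring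
  rw [e3]
  refine (norm_sub_le _ _).trans ?_
  rw [le_div_iff₀ hden] at h3
  nlinarith

end QData

/-! ### Approximation of W^{1,∞} functions by compactly supported Lipschitz functions. -/

open scoped Convolution

lemma ae_norm_le_toReal_eLpNorm_top {X E : Type*} [MeasurableSpace X] {μ : Measure X}
    [NormedAddCommGroup E] {f : X → E} (hf : MemLp f ⊤ μ) :
    ∀ᵐ x ∂μ, ‖f x‖ ≤ (eLpNorm f ⊤ μ).toReal := by
  have hfin : eLpNorm f ⊤ μ ≠ ⊤ := hf.2.ne
  rw [eLpNorm_exponent_top] at hfin ⊢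
  filter_upwards [ae_le_eLpNormEssSup (f := f) (μ := μ)] with x hx
  rw [← toReal_enorm]
  exact ENNReal.toReal_mono hfin hx

section Mollification

variable {n : ℕ}

lemma norm_integral_bump_smul_le (b : ContDiffBump (0 : Cn n)) {g : Cn n → ℂ} {W : ℝ}
    (hg : ∀ᵐ t, ‖g t‖ ≤ W) (x : Cn n) :
    ‖∫ t, b.normed volume (x - t) • g t‖ ≤ W := by
  have hi : Integrable fun t => b.normed volume (x - t) * W :=
    ((b.integrable_normed (μ := volume)).comp_sub_left x).mul_const W
  refine (norm_integral_le_of_norm_le hi ?_).trans (le_of_eq ?_)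
  · filter_upwards [hg] with t ht
    rw [norm_smul, Real.norm_of_nonneg (b.nonneg_normed _)]
    exact mul_le_mul_of_nonneg_left ht (b.nonneg_normed _)
  · rw [integral_mul_const, integral_sub_left_eq_self (fun t => b.normed volume t) volume x,
      b.integral_normed, one_mul]

/-- The mollification of a function. -/
def moll (b : ContDiffBump (0 : Cn n)) (ψ : Cn n → ℂ) : Cn n → ℂ :=
  b.normed volume ⋆[ContinuousLinearMap.lsmul ℝ ℝ, volume] ψ

lemma moll_apply (b : ContDiffBump (0 : Cn n)) (ψ : Cn n → ℂ) (x : Cn n) :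
    moll b ψ x = ∫ t, b.normed volume (x - t) • ψ t := convolution_lsmul_swap

lemma hasFDerivAt_moll (b : ContDiffBump (0 : Cn n)) {ψ : Cn n → ℂ} {G : Cn n → Cn n →L[ℝ] ℂ}
    (hψ : MemW1Infty ψ G) (x : Cn n) :
    ∃ L : Cn n →L[ℝ] ℂ, HasFDerivAt (moll b ψ) L x ∧
      ∀ w, L w = ∫ t, b.normed volume (x - t) • G t w := by
  have hloc : LocallyIntegrable ψ := hψ.bounded.locallyIntegrable le_top
  have hcs := b.hasCompactSupport_normed (μ := volume)
  have hsm : ∀ m : ℕ∞, ContDiff ℝ m (b.normed volume) := fun m => b.contDiff_normed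
  have h1 := hcs.hasFDerivAt_convolution_right (ContinuousLinearMap.lsmul ℝ ℝ (E := ℂ)).flip hloc
    (hsm 1) x
  rw [convolution_flip] at h1
  refine ⟨_, h1, fun w => ?_⟩
  rw [convolution_precompR_apply _ hloc (hcs.fderiv ℝ) ((hsm 1).continuous_fderiv one_ne_zero)]
  have hf : ContDiff ℝ ∞ fun t => b.normed volume (x - t) :=
    (hsm ⊤).comp (contDiff_const.sub contDiff_id)
  have hfs : HasCompactSupport fun t => b.normed volume (x - t) :=
    hcs.comp_homeomorph (Homeomorph.subLeft x)
  -- The weak gradient is tested on t ↦ b(x - t); the sign of the reflection cancels the sign of the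
  -- integration by parts.
  have h2 := hψ.weak_gradient _ hf hfs w
  have h3 : ∀ t, fderiv ℝ (fun t => b.normed volume (x - t)) t w =
      -fderiv ℝ (b.normed volume) (x - t) w := by
    intro t
    have h4 := ((hsm 1).differentiable one_ne_zero (x - t)).hasFDerivAt.comp t
      ((hasFDerivAt_id t).const_sub x)
    have h5 : HasFDerivAt (fun t => b.normed volume (x - t)) _ t := h4
    rw [h5.fderiv]
    simp
  simp only [h3] at h2
  rw [convolution_def]
  have e1 : ∫ t, (ContinuousLinearMap.lsmul ℝ ℝ (E := ℂ)).flip (ψ t)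
      (fderiv ℝ (b.normed volume) (x - t) w) =
      -∫ t, ψ t * ((-fderiv ℝ (b.normed volume) (x - t) w : ℝ) : ℂ) := by
    rw [← integral_neg]
    congr 1; ext t
    simp [mul_comm]
  rw [e1, h2, neg_neg]
  simp only [real_smul]

/-- The gradient of the mollification is an average of the weak gradient, so its sup norm does not
exceed that of G. -/
lemma norm_moll_sub_le (b : ContDiffBump (0 : Cn n)) {ψ : Cn n → ℂ} {G : Cn n → Cn n →L[ℝ] ℂ}
    (hψ : MemW1Infty ψ G) (x y : Cn n) :
    ‖moll b ψ x - moll b ψ y‖ ≤ (eLpNorm G ⊤ volume).toReal * ‖x - y‖ := by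
  choose L hL hLw using hasFDerivAt_moll b hψ
  refine convex_univ.norm_image_sub_le_of_norm_hasFDerivWithin_le (𝕜 := ℝ) (f' := L)
    (fun z _ => (hL z).hasFDerivWithinAt) (fun z _ => ?_) (Set.mem_univ y) (Set.mem_univ x)
  refine ContinuousLinearMap.opNorm_le_bound _ ENNReal.toReal_nonneg fun w => ?_
  rw [hLw]
  refine norm_integral_bump_smul_le b ?_ z
  filter_upwards [ae_norm_le_toReal_eLpNorm_top hψ.bounded_gradient] with t ht
  exact ((G t).le_opNorm w).trans (mul_le_mul_of_nonneg_right ht (norm_nonneg w))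

/-- A Lipschitz cutoff function of the ball of radius `R`. -/
def cut (R : ℝ) (x : Cn n) : ℝ := max 0 (min 1 (2 - ‖x‖ / R))

lemma cut_nonneg (R : ℝ) (x : Cn n) : 0 ≤ cut R x := le_max_left _ _

lemma cut_le_one (R : ℝ) (x : Cn n) : cut R x ≤ 1 := max_le zero_le_one (min_le_left _ _)

lemma continuous_cut (R : ℝ) : Continuous (cut (n := n) R) := by
  unfold cut
  simp only [div_eq_mul_inv]
  fun_prop

lemma abs_cut_sub_le {R : ℝ} (hR : 1 ≤ R) (x y : Cn n) : |cut R x - cut R y| ≤ ‖x - y‖ := by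
  have h0 : 0 < R := by linarith
  unfold cut
  refine (abs_max_sub_max_le_max _ _ _ _).trans ?_
  rw [sub_self, abs_zero, max_eq_right (abs_nonneg _)]
  refine (abs_min_sub_min_le_max _ _ _ _).trans ?_
  rw [sub_self, abs_zero, max_eq_right (abs_nonneg _)]
  have e : 2 - ‖x‖ / R - (2 - ‖y‖ / R) = (‖y‖ - ‖x‖) / R := by ring
  rw [e, abs_div, abs_of_pos h0, div_le_iff₀ h0]
  have h1 := abs_norm_sub_norm_le y x
  rw [norm_sub_rev] at h1
  nlinarith [norm_nonneg (x - y)]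

lemma hasCompactSupport_cut {R : ℝ} (hR : 1 ≤ R) : HasCompactSupport (cut (n := n) R) := by
  have h0 : 0 < R := by linarith
  refine HasCompactSupport.intro (isCompact_closedBall (0 : Cn n) (2 * R)) fun x hx => ?_
  rw [Metric.mem_closedBall, dist_zero_right, not_le] at hx
  have : 2 - ‖x‖ / R ≤ 0 := by
    rw [sub_nonpos, le_div_iff₀ h0]; exact hx.le
  rw [cut]
  exact max_eq_left ((min_le_right _ _).trans this)

lemma cut_eq_one {R : ℝ} (hR : 0 < R) {x : Cn n} (hx : ‖x‖ ≤ R) : cut R x = 1 := by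
  have : 1 ≤ 2 - ‖x‖ / R := by
    have : ‖x‖ / R ≤ 1 := by rwa [div_le_one hR]
    linarith
  rw [cut, min_eq_left this, max_eq_right zero_le_one]

/-- The approximation of bounded functions with bounded weak gradient by compactly supported
Lipschitz functions. -/
lemma exists_lipschitz_approx {ψ : Cn n → ℂ} {G : Cn n → Cn n →L[ℝ] ℂ} (hψ : MemW1Infty ψ G) :
    ∃ f : ℕ → Cn n → ℂ, (∀ k, Continuous (f k)) ∧ (∀ k, HasCompactSupport (f k)) ∧
      (∀ k x, ‖f k x‖ ≤ w1InftyNorm ψ G) ∧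
      (∀ k x y, ‖f k x - f k y‖ ≤ w1InftyNorm ψ G * ‖x - y‖) ∧
      ∀ᵐ x, Tendsto (fun k => f k x) atTop (𝓝 (ψ x)) := by
  let b : ℕ → ContDiffBump (0 : Cn n) := fun k =>
    ⟨1 / ((k : ℝ) + 1) / 2, 1 / ((k : ℝ) + 1), by positivity, half_lt_self (by positivity)⟩
  have hloc : LocallyIntegrable ψ := hψ.bounded.locallyIntegrable le_top
  have hb0 : Tendsto (fun k => (b k).rOut) atTop (𝓝 0) := tendsto_one_div_add_atTop_nhds_zero_nat
  have hconv := ContDiffBump.ae_convolution_tendsto_right_of_locallyIntegrable (μ := volume)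
    (φ := b) (K := 2) hb0 (Eventually.of_forall fun k => le_of_eq (by simp only [b]; ring)) hloc
  set W₀ := (eLpNorm ψ ⊤ volume).toReal
  set W₁ := (eLpNorm G ⊤ volume).toReal
  have hW₀ : 0 ≤ W₀ := ENNReal.toReal_nonneg
  have hW₁ : 0 ≤ W₁ := ENNReal.toReal_nonneg
  have hW : w1InftyNorm ψ G = W₀ + W₁ := rfl
  have hm0 : ∀ k x, ‖moll (b k) ψ x‖ ≤ W₀ := fun k x => by
    rw [moll_apply]
    exact norm_integral_bump_smul_le _ (ae_norm_le_toReal_eLpNorm_top hψ.bounded) x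
  have hR : ∀ k : ℕ, (1 : ℝ) ≤ (k : ℝ) + 1 := fun k => by
    linarith [(Nat.cast_nonneg k : (0 : ℝ) ≤ k)]
  have hmc : ∀ k, Continuous (moll (b k) ψ) := fun k => by
    refine continuous_iff_continuousAt.2 fun x => ?_
    obtain ⟨L, hL, -⟩ := hasFDerivAt_moll (b k) hψ x
    exact hL.continuousAt
  -- The cutoff is at most 1 and, for radius at least 1, 1-Lipschitz. By the product rule the
  -- Lipschitz constant is at most the sum of the two sup norms, uniformly in k.
  refine ⟨fun k x => (cut ((k : ℝ) + 1) x : ℂ) * moll (b k) ψ x, fun k => ?_, fun k => ?_,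
    fun k x => ?_, fun k x y => ?_, ?_⟩
  · exact (continuous_ofReal.comp (continuous_cut _)).mul (hmc k)
  · exact ((hasCompactSupport_cut (hR k)).comp_left (g := fun r : ℝ => (r : ℂ)) ofReal_zero).mul_right
  · rw [norm_mul, norm_real, Real.norm_of_nonneg (cut_nonneg _ _), hW]
    have h1 := cut_le_one ((k : ℝ) + 1) x
    have h2 := cut_nonneg ((k : ℝ) + 1) x
    nlinarith [hm0 k x, norm_nonneg (moll (b k) ψ x)]
  · have e : (cut ((k : ℝ) + 1) x : ℂ) * moll (b k) ψ x - cut ((k : ℝ) + 1) y * moll (b k) ψ y =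
        cut ((k : ℝ) + 1) x * (moll (b k) ψ x - moll (b k) ψ y) +
          ((cut ((k : ℝ) + 1) x - cut ((k : ℝ) + 1) y : ℝ) : ℂ) * moll (b k) ψ y := by
      push_cast; ring
    rw [e, hW]
    refine (norm_add_le _ _).trans ?_
    rw [norm_mul, norm_mul, norm_real, norm_real, Real.norm_of_nonneg (cut_nonneg _ _),
      Real.norm_eq_abs]
    have h1 := mul_le_mul (cut_le_one ((k : ℝ) + 1) x) (norm_moll_sub_le (b k) hψ x y)
      (norm_nonneg _) zero_le_one
    have h2 := mul_le_mul (abs_cut_sub_le (hR k) x y) (hm0 k y) (norm_nonneg _) (norm_nonneg _)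
    linarith
  · filter_upwards [hconv] with x hx
    refine hx.congr' ?_
    obtain ⟨k₀, hk₀⟩ := exists_nat_ge ‖x‖
    filter_upwards [eventually_ge_atTop k₀] with k hk
    have : ‖x‖ ≤ (k : ℝ) + 1 := by
      have : (k₀ : ℝ) ≤ k := by exact_mod_cast hk
      linarith
    rw [cut_eq_one (by linarith [hR k]) this, ofReal_one, one_mul]
    rfl

/-- An estimate of integrals that holds for the compactly supported Lipschitz functions extends to
the bounded functions with bounded weak gradient. -/
lemma norm_integral_sub_le_of_lipschitz {ψ : Cn n → ℂ} {G : Cn n → Cn n →L[ℝ] ℂ}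
    (hψ : MemW1Infty ψ G) {F₁ F₂ : Cn n → ℂ} (h₁ : Integrable F₁) (h₂ : Integrable F₂) {B : ℝ}
    (hB : ∀ f : Cn n → ℂ, Continuous f → HasCompactSupport f → (∀ x, ‖f x‖ ≤ w1InftyNorm ψ G) →
      (∀ x y, ‖f x - f y‖ ≤ w1InftyNorm ψ G * ‖x - y‖) →
      ‖(∫ x, f x * F₁ x) - ∫ x, f x * F₂ x‖ ≤ B) :
    ‖(∫ x, ψ x * F₁ x) - ∫ x, ψ x * F₂ x‖ ≤ B := by
  obtain ⟨f, hfc, hfs, hfW, hfL, hft⟩ := exists_lipschitz_approx hψ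
  have key : ∀ {F : Cn n → ℂ}, Integrable F →
      Tendsto (fun k => ∫ x, f k x * F x) atTop (𝓝 (∫ x, ψ x * F x)) := by
    intro F hF
    refine tendsto_integral_of_dominated_convergence (fun x => w1InftyNorm ψ G * ‖F x‖)
      (fun k => (hfc k).aestronglyMeasurable.mul hF.1) (hF.norm.const_mul _)
      (fun k => Eventually.of_forall fun x => ?_) ?_
    · rw [norm_mul]
      exact mul_le_mul_of_nonneg_right (hfW k x) (norm_nonneg _)
    · filter_upwards [hft] with x hx
      exact hx.mul_const _
  exact le_of_tendsto ((key h₁).sub (key h₂)).norm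
    (Eventually.of_forall fun k => hB _ (hfc k) (hfs k) (hfW k) (hfL k))

end Mollification

/-! ### Assembly of the estimate in the deformed Bargmann space. -/

namespace QData

lemma SqInt.of_abs_sub_le {n : ℕ} {Φ Φ' : Cn n → ℝ} {h ε : ℝ} {u : Cn n → ℂ} (hu : SqInt Φ h u)
    (hh : 0 < h) (huc : Continuous u) (hΦ' : Continuous Φ') (hle : ∀ x, |Φ' x - Φ x| ≤ ε) :
    SqInt Φ' h u := by
  refine (Integrable.const_mul hu (Real.exp (2 * ε / h))).mono'
    (Continuous.aestronglyMeasurable (by fun_prop)) (Eventually.of_forall fun x => ?_)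
  rw [Real.norm_eq_abs, abs_of_nonneg (by positivity), mul_left_comm, ← Real.exp_add]
  refine mul_le_mul_of_nonneg_left (Real.exp_le_exp.2 ?_) (by positivity)
  have := (abs_le.1 (hle x)).1
  rw [← add_div]
  gcongr
  linarith

lemma _root_.bargmannSpace_eq_of_abs_sub_le {n : ℕ} {Φ Φ' : Cn n → ℝ} {h ε : ℝ} (hh : 0 < h)
    (hΦ : Continuous Φ) (hΦ' : Continuous Φ') (hle : ∀ x, |Φ' x - Φ x| ≤ ε) :
    bargmannSpace Φ' h = bargmannSpace Φ h := by
  ext u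
  rw [mem_bargmannSpace_iff hΦ, mem_bargmannSpace_iff hΦ']
  refine and_congr_right fun hu => ⟨fun h1 => ?_, fun h1 => ?_⟩
  · exact h1.of_abs_sub_le hh hu.continuous hΦ fun x => by rw [abs_sub_comm]; exact hle x
  · exact h1.of_abs_sub_le hh hu.continuous hΦ' hle

lemma integrable_mul_weight {n : ℕ} {Φ : Cn n → ℝ} {h : ℝ} {u v : Cn n → ℂ} (hΦ : Continuous Φ)
    (huc : Continuous u) (hvc : Continuous v) (hu : SqInt Φ h u) (hv : SqInt Φ h v) :
    Integrable fun x => u x * (conj (v x) * (Real.exp (-2 * Φ x / h) : ℂ)) := by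
  refine (Integrable.add hu hv).mono' (Continuous.aestronglyMeasurable (by fun_prop))
    (Eventually.of_forall fun x => ?_)
  rw [norm_mul, norm_mul, RCLike.norm_conj, norm_real, Real.norm_eq_abs, Real.abs_exp]
  have h1 := two_mul_le_add_sq ‖u x‖ ‖v x‖
  have h2 := Real.exp_pos (-2 * Φ x / h)
  have h3 : ‖u x‖ * ‖v x‖ ≤ ‖u x‖ ^ 2 + ‖v x‖ ^ 2 := by
    nlinarith [mul_nonneg (norm_nonneg (u x)) (norm_nonneg (v x))]
  simp only [Pi.add_apply]
  calc _ = ‖u x‖ * ‖v x‖ * Real.exp (-2 * Φ x / h) := by ring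
    _ ≤ (‖u x‖ ^ 2 + ‖v x‖ ^ 2) * Real.exp (-2 * Φ x / h) := by gcongr
    _ = _ := by ring

variable {n : ℕ} (D : QData n) {s : ℝ} {α : Cn n → ℂ}

lemma continuous_xi0 : Continuous D.xi0 := by
  refine continuous_pi fun j => ?_
  unfold xi0; fun_prop

lemma _root_.SmallPert.continuous_delXi {φ : Cn n → ℝ} {ε : ℝ} (P : SmallPert φ ε) :
    Continuous (delXi φ) := by
  refine continuous_pi fun j => ?_
  have := P.continuous_del (f := fun x => x) (g := fun _ => Pi.single j 1) continuous_id
    continuous_const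
  unfold delXi; fun_prop

/-- The scalar products of the Weyl quantization in the deformed Bargmann space are given by the
almost holomorphic extension of the symbol, up to `O(h)`. -/
theorem exists_pairing_estimate (hs : 1 < s) (hα : GevreyBounded s α) :
    ∃ C : ℝ, 0 < C ∧ ∀ aT : Cn n × Cn n → ℂ, GevreyBounded s aT →
      ∀ Λ : Set (Cn n × Cn n), (∀ y, (y, D.xi0 y) ∈ Λ) →
      (∀ N : ℕ, ∃ C : ℝ, ∀ ρ w, ‖dbar aT ρ w‖ ≤ C * Metric.infDist ρ Λ ^ N * ‖w‖) →
      (∀ y, aT (y, D.xi0 y) = α y) →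
      ∃ K : ℝ, 0 < K ∧ ∀ (h : ℝ), 0 < h → h ≤ 1 → ∀ φ : Cn n → ℝ,
        SmallPert φ (C⁻¹ * h ^ (1 - 1 / s)) → ∀ (ψ : Cn n → ℂ) (G : Cn n → Cn n →L[ℝ] ℂ),
        MemW1Infty ψ G → ∀ u v : Cn n → ℂ, Differentiable ℂ u → Differentiable ℂ v →
        SqInt D.wt h u → SqInt D.wt h v →
        ‖(∫ x, ψ x * (D.op α h u x * (conj (v x) * (Real.exp (-2 * (D.wt x + φ x) / h) : ℂ)))) -
          ∫ x, ψ x * (aT (x, D.xi0 x + delXi φ x) *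
            (u x * (conj (v x) * (Real.exp (-2 * (D.wt x + φ x) / h) : ℂ))))‖ ≤
          K * h * w1InftyNorm ψ G * weightedNorm (fun x => D.wt x + φ x) h u *
            weightedNorm (fun x => D.wt x + φ x) h v := by
  obtain ⟨c, K, hc, hK0, hK, hKL, hst⟩ := D.exists_amp_bound hs hα
  obtain ⟨M, hM⟩ : ∃ M, ∀ x, ‖α x‖ ≤ M := by
    obtain ⟨-, C, -, hb⟩ := hα
    exact ⟨_, fun x => by simpa using hb 0 x⟩
  have hαc := hα.1.continuous
  have hC0 : 0 < max 1 (4 / c) := lt_max_of_lt_left one_pos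
  -- 4/c gives ε ≤ (c/4) h^{1-1/s}, with c the decay rate of the amplitudes of α, and 1 gives ε ≤ 1.
  -- Both are fixed before the extension is chosen.
  refine ⟨max 1 (4 / c), hC0, fun aT haT Λ hΛ hflat hext => ?_⟩
  obtain ⟨Ks, hKs, hsym⟩ := D.exists_norm_sym_sub_le hαc hM hs hα hc hK hK0.le hst hΛ haT hflat hext
  have hc2 := D.c₂_pos
  have hup := D.up_pos
  set m := ∫ w, D.maj s c 2 w
  have hm : 0 ≤ m := integral_nonneg fun w => D.maj_nonneg 2 w
  set K₁ := D.c₂ * 2 ^ n * K * m + D.c₂ * (K * (3 ^ n + 1 + D.up)) * m + Ks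
  have hK₁ : 0 ≤ K₁ := by positivity
  -- K₁ is only known to be nonnegative; the summand 1 makes the constant positive.
  refine ⟨K₁ + 1, by positivity, fun h hh hh1 φ P ψ G hψ u v hu hv hu2 hv2 => ?_⟩
  set ε := (max 1 (4 / c))⁻¹ * h ^ (1 - 1 / s)
  have hs1 : 0 ≤ 1 - 1 / s := by
    have : 1 / s ≤ 1 := by rw [div_le_one (by linarith)]; exact hs.le
    linarith
  have hh2 : h ^ (1 - 1 / s) ≤ 1 := Real.rpow_le_one hh.le hh1 hs1
  have hε : ε ≤ c / 4 * h ^ (1 - 1 / s) := by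
    simp only [ε]
    gcongr
    rw [inv_le_comm₀ hC0 (by positivity), inv_div]
    exact le_max_right _ _
  have hε1 : ε ≤ 1 := by
    have : (max 1 (4 / c))⁻¹ ≤ 1 := inv_le_one_of_one_le₀ (le_max_left _ _)
    calc ε ≤ 1 * 1 := mul_le_mul this hh2 (by positivity) zero_le_one
      _ = 1 := one_mul 1
  have hwc : Continuous D.wt := D.contDiff_wt.continuous
  have hφc := P.contDiff.continuous
  have hΦc : Continuous fun x => D.wt x + φ x := hwc.add hφc
  have hclose : ∀ x, |D.wt x + φ x - D.wt x| ≤ ε := fun x => by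
    rw [add_sub_cancel_left]; exact P.bound_zero x
  have hop := D.differentiable_op hαc hM hs hc hK0.le hK hh hu hu2
  obtain ⟨L, hL⟩ := D.exists_op_bound hαc hM hs hc hK0.le hK hh
  have hop2 := (hL u hu hu2).1.of_abs_sub_le hh hop.continuous hΦc hclose
  have hu2' := hu2.of_abs_sub_le hh hu.continuous hΦc hclose
  have hv2' := hv2.of_abs_sub_le hh hv.continuous hΦc hclose
  have hbound : ∀ f : Cn n → ℂ, Differentiable ℂ f → SqInt D.wt h f →
      ∃ C, ∀ x, ‖f x‖ * Real.exp (-(D.wt x + φ x) / h) ≤ C := by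
    intro f hf hf2
    obtain ⟨C, hC0, hC⟩ := D.exists_bound_normalised hh hf hf2
    refine ⟨C * Real.exp (ε / h), fun x => ?_⟩
    have e : Real.exp (-(D.wt x + φ x) / h) = Real.exp (-D.wt x / h) * Real.exp (-φ x / h) := by
      rw [← Real.exp_add]; congr 1; ring
    rw [e, ← mul_assoc]
    have h1 : Real.exp (-φ x / h) ≤ Real.exp (ε / h) := by
      refine Real.exp_le_exp.2 ?_
      gcongr
      have := (abs_le.1 (P.bound_zero x)).1
      linarith
    exact mul_le_mul (hC x) h1 (Real.exp_pos _).le hC0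
  obtain ⟨Cu, hub⟩ := hbound u hu hu2
  obtain ⟨Cv, hvb⟩ := hbound v hv hv2
  have hSc : Continuous fun x => aT (x, D.xi0 x + delXi φ x) :=
    haT.1.continuous.comp (continuous_id.prodMk (D.continuous_xi0.add P.continuous_delXi))
  have i1 := integrable_mul_weight hΦc hop.continuous hv.continuous hop2 hv2'
  have i2 : Integrable fun x => aT (x, D.xi0 x + delXi φ x) *
      (u x * (conj (v x) * (Real.exp (-2 * (D.wt x + φ x) / h) : ℂ))) := by
    obtain ⟨-, Ca, -, hab⟩ := haT
    exact (integrable_mul_weight hΦc hu.continuous hv.continuous hu2' hv2').bdd_mul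
      hSc.aestronglyMeasurable (Eventually.of_forall fun x => by simpa using hab 0 _)
  have hU : 0 ≤ weightedNorm (fun x => D.wt x + φ x) h u := Real.sqrt_nonneg _
  have hV : 0 ≤ weightedNorm (fun x => D.wt x + φ x) h v := Real.sqrt_nonneg _
  have hW : 0 ≤ w1InftyNorm ψ G := add_nonneg ENNReal.toReal_nonneg ENNReal.toReal_nonneg
  refine (norm_integral_sub_le_of_lipschitz hψ i1 i2 (B := K₁ * h * w1InftyNorm ψ G *
    (weightedNorm (fun x => D.wt x + φ x) h u * weightedNorm (fun x => D.wt x + φ x) h v))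
    fun f hfc hfs hfW hfL => ?_).trans ?_
  · have key := D.norm_integral_op_sub_le hαc hM hs hc hK hKL P hh hh1 hε hε1 hK0.le hu hv hu2' hv2'
      hub hvb hfc hfs hfW hfL hSc (hsym h ε φ P hh hh1 hε hε1)
    change _ ≤ K₁ * h * w1InftyNorm ψ G * _ at key
    simp only [← mul_assoc] at key ⊢
    exact key
  · rw [← mul_assoc]
    gcongr
    linarith

/-- The existence and the uniqueness of the Weyl quantization. -/
lemma exists_unique_isWeyl {Φ : Cn n → ℝ} (hΦ : D.wt = Φ) {h : ℝ} (hs : 1 < s)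
    (hα : GevreyBounded s α) (hh : 0 < h) :
    ∃ T : bargmannSpace Φ h →ₗ[ℂ] bargmannSpace Φ h,
      ((∃ M : ℝ, ∀ u, weightedNorm Φ h (T u) ≤ M * weightedNorm Φ h u) ∧
        ∀ u : bargmannSpace Φ h, RapidlyDecaying Φ h u → ∀ x,
          (T u : Cn n → ℂ) x = D.weyl α h u x) ∧
      (∀ A : bargmannSpace Φ h →ₗ[ℂ] bargmannSpace Φ h,
        ((∃ M : ℝ, ∀ u, weightedNorm Φ h (A u) ≤ M * weightedNorm Φ h u) ∧
          ∀ u : bargmannSpace Φ h, RapidlyDecaying Φ h u → ∀ x,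
            (A u : Cn n → ℂ) x = D.weyl α h u x) → A = T) ∧
      ∀ u, (T u : Cn n → ℂ) = D.op α h u := by
  subst hΦ
  exact ⟨D.opₗ hα hs hh, D.isWeyl_opₗ hα hs hh,
    fun A hA => IsWeyl.unique (α := α) D hh hA (D.isWeyl_opₗ hα hs hh), fun u => rfl⟩

end QData

end

/-! ### The proposition. -/

theorem proposition2p1 (n : ℕ) (Φ₀ : QuadraticForm ℝ (Cn n)) (hΦ₀ : StrictlyPlurisubharmonic Φ₀)
    (s : ℝ) (hs : 1 < s) (a : Lambda Φ₀ → ℂ) (ha : GevreyBoundedOnLambda s a) :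
    (∀ h : ℝ, 0 < h → h ≤ 1 →
      ∃! A : bargmannSpace Φ₀ h →ₗ[ℂ] bargmannSpace Φ₀ h, IsWeylQuantization Φ₀ a h A) ∧
    ∃ C : ℝ, 0 < C ∧
      ∀ aT : Cn n × Cn n → ℂ, IsAlmostHolomorphicExtension s a aT →
        ∃ K : ℝ, 0 < K ∧
          ∀ (h : ℝ), 0 < h → h ≤ 1 →
          ∀ Φ₁ : Cn n → ℝ, IsC11Perturbation Φ₀ Φ₁ (C⁻¹ * h ^ (1 - 1 / s)) →
            bargmannSpace Φ₁ h = bargmannSpace Φ₀ h ∧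
            ∀ A : bargmannSpace Φ₀ h →ₗ[ℂ] bargmannSpace Φ₀ h, IsWeylQuantization Φ₀ a h A →
            ∀ (ψ : Cn n → ℂ) (G : Cn n → Cn n →L[ℝ] ℂ), MemW1Infty ψ G →
            ∀ u v : bargmannSpace Φ₀ h,
              ‖weightedInner Φ₁ h (fun x => ψ x * (A u : Cn n → ℂ) x) v
                  - ∫ x, ψ x * aT (x, xi Φ₁ x) * (u : Cn n → ℂ) x *
                      starRingEnd ℂ ((v : Cn n → ℂ) x) * (Real.exp (-2 * Φ₁ x / h) : ℂ)‖
                ≤ K * h * w1InftyNorm ψ G * weightedNorm Φ₁ h u * weightedNorm Φ₁ h v := by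
  set D := formData Φ₀ hΦ₀ with hD
  have hwt : D.wt = Φ₀ := wt_formData Φ₀ hΦ₀
  have hwt' : ∀ x, D.wt x = Φ₀ x := fun x => congrFun hwt x
  have hxi : ∀ y, xi Φ₀ y = D.xi0 y := fun y => by
    have := D.xi_wt y
    rwa [hwt] at this
  have hΦc : Continuous Φ₀ := hwt ▸ D.contDiff_wt.continuous
  have hT : ∀ h : ℝ, 0 < h → ∃ T : bargmannSpace Φ₀ h →ₗ[ℂ] bargmannSpace Φ₀ h,
      IsWeylQuantization Φ₀ a h T ∧ (∀ A, IsWeylQuantization Φ₀ a h A → A = T) ∧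
      ∀ u, (T u : Cn n → ℂ) = D.op (fun y => a (toLambda Φ₀ y)) h u := by
    intro h hh
    simp only [IsWeylQuantization, weylIntegral_eq_weyl Φ₀ hΦ₀]
    exact D.exists_unique_isWeyl hwt hs ha hh
  refine ⟨fun h hh _ => ?_, ?_⟩
  · obtain ⟨T, h1, h2, -⟩ := hT h hh
    exact ⟨T, h1, h2⟩
  obtain ⟨C, hC, hest⟩ := D.exists_pairing_estimate hs ha
  refine ⟨C, hC, fun aT haT => ?_⟩
  obtain ⟨K, hK, hest⟩ := hest aT haT.gevrey (Lambda Φ₀) (fun y => ⟨y, by simp only [hxi]⟩) haT.dbar_flat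
    (fun y => by rw [← hxi]; exact haT.extends_symbol (toLambda Φ₀ y))
  refine ⟨K, hK, fun h hh hh1 Φ₁ hΦ₁ => ?_⟩
  have P : SmallPert (fun x => Φ₁ x - Φ₀ x) (C⁻¹ * h ^ (1 - 1 / s)) :=
    ⟨hΦ₁.contDiff.sub (by rw [← hwt]; exact D.contDiff_wt.of_le (by simp)), hΦ₁.bound_zero,
      hΦ₁.bound_one, hΦ₁.bound_two⟩
  have hsum : (fun x => D.wt x + (Φ₁ x - Φ₀ x)) = Φ₁ := by
    funext x; rw [hwt']; ring
  have hsum' : ∀ x, D.wt x + (Φ₁ x - Φ₀ x) = Φ₁ x := fun x => congrFun hsum x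
  refine ⟨bargmannSpace_eq_of_abs_sub_le hh hΦc hΦ₁.contDiff.continuous hΦ₁.bound_zero,
    fun A hA ψ G hψ u v => ?_⟩
  obtain ⟨T, -, h2, h3⟩ := hT h hh
  obtain ⟨hu, hu2⟩ := (mem_bargmannSpace_iff hΦc).1 u.2
  obtain ⟨hv, hv2⟩ := (mem_bargmannSpace_iff hΦc).1 v.2
  have key := hest h hh hh1 _ P ψ G hψ u v hu hv (by rwa [hwt]) (by rwa [hwt])
  have hxi1 : ∀ x, D.xi0 x + delXi (fun x => Φ₁ x - Φ₀ x) x = xi Φ₁ x := fun x => by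
    rw [← D.xi_perturbed P, hsum]
  rw [hsum] at key
  -- By uniqueness any quantization A is the superposition of magnetic translations, for which the
  -- estimate was proved.
  simp only [hsum', hxi1, ← h3, ← h2 A hA] at key
  rw [weightedInner]
  simp only [← mul_assoc] at key ⊢
  exact key
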